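/- Let $\tilde A$ be an abelian group, $A_0\subset A\subset\tilde A$ subgroups, $V=\coprod_{n\in\mathbb Z}V_{(n)}=\coprod_{\alpha\in A}V^{(\alpha)}$ a strongly $A$-graded conformal vertex algebra, and $V_0\subset V$ a vertex subalgebra (with the same vacuum and conformal vector) that is strongly graded with respect to $A_0$. Let $W_0,W_1,W_2,W_3,W_4$ be strongly $\tilde A$-graded generalized $V$-modules, $W_i=\coprod_{\beta\in\tilde A}W_i^{(\beta)}$, with generalized weight spaces $(W_i)_{[n]}$, $n\in\mathbb C$. Let $W_0'$ be the contragredient module of $W_0$, with $(W_0')^{(\beta)}_{[n]}=\big((W_0)^{(-\beta)}_{[n]}\big)^*$. Assume that for $i=0,1,2,3$: * all generalized weights of $W_i$ are real, and for each $\beta\in\tilde A$ the weights of $W_i^{(\beta)}$ are bounded below; * $W_i$ is $C_1$-cofinite as a $V_0$-module: for every $\beta\in\tilde A$ the space $W_i^{(\beta)}/(C_1(W_i)\cap W_i^{(\beta)})$ is finite-dimensional, where $C_1(W_i)$ is the span of all $u_{-1}w$ with $u\in\coprod_{n>0}(V_0)_{(n)}$ and $w\in W_i$. For generalized modules $M_1,M_2,M_3$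 and $\beta_1,\beta_2\in\tilde A$, let $N_{M_1^{(\beta_1)}M_2^{(\beta_2)}}^{M_3^{(\beta_1+\beta_2)}}$ be the fusion rule, that is, the dimension of the space of logarithmic intertwining operators of type ${M_3^{(\beta_1+\beta_2)}\choose M_1^{(\beta_1)}\,M_2^{(\beta_2)}}$ among modules for $V^{(0)}$. Assume that for $(M_1,M_2,M_3)=(W_1,W_4,W_0')$ and for $(M_1,M_2,M_3)=(W_2,W_3,W_4)$, and for any two elements $\beta_1,\beta_2\in\tilde A$, this number is nonzero for only finitely many pairs in $(\beta_1+A_0)\times(\beta_2+A_0)$. (In particular, all these assumptions hold if every strongly $\tilde A$-graded generalized $V$-module is graded by real weights, lower bounded and $C_1$-cofinite as a $V_0$-module, and the finiteness of fusion rules holds for every triple of such modules.) Let $\mathcal Y_1$ and $\mathcal Y_2$ be grading-compatible logarithmic intertwining operators of types ${W_0'\choose W_1\,W_4}$ and ${W_4\choose W_2\,W_3}$, and let $w_i\in W_i$, $i=0,1,2,3$, be $\tilde A$-homogeneous. Put $R=\mathbb C[z_1^{\pm1},z_2^{\pm1},(z_1-z_2)^{-1}]$. Then for each one of the seven possible singular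 points $$z_1=0,\quad z_2=0,\quad z_1=\infty,\quad z_2=\infty,\quad z_1=z_2,\quad z_1^{-1}(z_1-z_2)=0,\quad z_2^{-1}(z_1-z_2)=0$$ there exist $m,n\ge1$ and $a_1,\dots,a_m,b_1,\dots,b_n\in R$ such that the formal series $\langle w_0,\mathcal Y_1(w_1,z_1)\mathcal Y_2(w_2,z_2)w_3\rangle$ in complex powers of $z_1,z_2$ and nonnegative integral powers of $\log z_1,\log z_2$ satisfies the expansion in the region $|z_1|>|z_2|>0$ of the system $$\frac{\partial^m\varphi}{\partial z_1^m}+a_1\frac{\partial^{m-1}\varphi}{\partial z_1^{m-1}}+\cdots+a_m\varphi=0,\qquad \frac{\partial^n\varphi}{\partial z_2^n}+b_1\frac{\partial^{n-1}\varphi}{\partial z_2^{n-1}}+\cdots+b_n\varphi=0,$$ and such that the chosen singular point of this system is regular. Here regularity means the following. Let $x$ be, in the respective cases, $z_1$, $z_2$, $1/z_1$, $1/z_2$, $z_1-z_2$, $z_1^{-1}(z_1-z_2)$, $z_2^{-1}(z_1-z_2)$, so that the singular point is the locus $x=0$; let the second coordinate be $z_2,z_1,z_2,z_1,z_2,z_1,z_2$,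 respectively. Consider any point $c\in\mathbb C\cup\{\infty\}$ and let $y$ be the second coordinate minus $c$ if $c\ne\infty$, and the inverse of the second coordinate if $c=\infty$. Whenever $z_1$, $z_2$ and $z_1-z_2$ are finite and nonzero on some punctured polydisc $0<|x|<\rho$, $0<|y|<\rho$, then for all sufficiently small radii $r_1,r_2>0$ every multivalued holomorphic solution $\varphi$ of the system on $0<|x|<r_1$, $0<|y|<r_2$ is a finite sum $$\varphi=\sum_{i}\sum_{0\le j,k<M}x^{s_i}y^{t_i}(\log x)^j(\log y)^k f_{i,j,k}(x,y)$$ with $s_i,t_i\in\mathbb C$ and each $f_{i,j,k}$ holomorphic on the polydisc $|x|<r_1$, $|y|<r_2$. -/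

import Mathlib

open scoped Topology

universe u v

noncomputable section

namespace SGVA

/-! ### Component form of the Jacobi identity -/

/-- The Jacobi identity in components. The coefficients of `x₀^(-l-1) x₁^(-m-1) x₂^(-n-1)` in
`x₀⁻¹ δ((x₁-x₂)/x₀) Y₃(u,x₁) I(x,x₂) w - x₀⁻¹ δ((x₂-x₁)/(-x₀)) I(x,x₂) Y₂(u,x₁) w
  = x₂⁻¹ δ((x₁-x₀)/x₂) I(Y₁(u,x₀)x,x₂) w`,
where `Yⱼ(u,x) = ∑ n, yⱼ u n x^(-n-1)` with `n` an integer, and `I(x,x₂) = ∑ n, I n x x₂^(-n-1)`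
with `n` in `K` (the integers for vertex operators, the complex numbers for intertwining operators).
All sums over `i` are finite whenever the lower truncation conditions hold. -/
def JacobiIdentity {K U X W₂ W₃ : Type*} [Ring K] [AddCommGroup X] [Module ℂ X]
    [AddCommGroup W₂] [Module ℂ W₂] [AddCommGroup W₃] [Module ℂ W₃]
    (y₁ : U → ℤ → Module.End ℂ X) (y₂ : U → ℤ → Module.End ℂ W₂) (y₃ : U → ℤ → Module.End ℂ W₃)
    (I : K → X → W₂ → W₃) : Prop :=
  ∀ (u : U) (x : X) (w : W₂) (l m : ℤ) (n : K),
    ∑ᶠ i : ℕ, (((-1 : ℂ) ^ i * (Ring.choose l i : ℤ)) •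
        (y₃ u (m + l - i) (I (n + (i : K)) x w)
          - ((-1 : ℂ) ^ l) • I (n + (l : K) - (i : K)) x (y₂ u (m + i) w)))
      = ∑ᶠ i : ℕ, ((Ring.choose m i : ℤ) : ℂ) • I ((m : K) + n - (i : K)) (y₁ u (l + i) x) w

/-- Lower truncation of a system of modes. -/
def Truncated {U W : Type*} [AddCommGroup W] [Module ℂ W] (y : U → ℤ → Module.End ℂ W) : Prop :=
  ∀ (u : U) (w : W), ∃ N : ℤ, ∀ n ≥ N, y u n w = 0

/-- Direct sum decomposition `W = ∐ F i`. -/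
def IsGrading {ι W : Type*} [AddCommGroup W] [Module ℂ W] (F : ι → Submodule ℂ W) : Prop :=
  iSupIndep F ∧ iSup F = ⊤

/-- The Virasoro relations with central charge `c`. -/
def VirasoroRelations {W : Type*} [AddCommGroup W] [Module ℂ W] (L : ℤ → Module.End ℂ W) (c : ℂ) :
    Prop :=
  ∀ m n : ℤ, L m * L n - L n * L m = ((m : ℂ) - n) • L (m + n)
    + (if m + n = 0 then ((m : ℂ) ^ 3 - m) / 12 * c else 0) • (1 : Module.End ℂ W)

/-! ### Conformal vertex algebras and generalized modules -/

/-- Conformal vertex algebras. `Y v n` is the mode `v_n` of `Y(v,x) = ∑ n, v_n x^(-n-1)`. -/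
structure ConformalVertexAlgebra (V : Type v) [AddCommGroup V] [Module ℂ V] where
  Y : V →ₗ[ℂ] (ℤ → Module.End ℂ V)
  vac : V
  ω : V
  c : ℂ
  /-- the weight spaces `V_(n)` -/
  wt : ℤ → Submodule ℂ V
  isInternal : DirectSum.IsInternal wt
  vac_mem : vac ∈ wt 0
  ω_mem : ω ∈ wt 2
  truncated : Truncated (fun u n => Y u n)
  vacuum : ∀ n : ℤ, Y vac n = if n = -1 then 1 else 0
  creation : ∀ (v : V) (n : ℤ), 0 ≤ n → Y v n vac = 0
  creation_limit : ∀ v : V, Y v (-1) vac = v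
  jacobi : JacobiIdentity (fun u n => Y u n) (fun u n => Y u n) (fun u n => Y u n)
    (fun (n : ℤ) x w => Y x n w)
  virasoro : VirasoroRelations (fun n => Y ω (n + 1)) c
  derivative : ∀ (v : V) (n : ℤ), Y (Y ω 0 v) n = (-(n : ℂ)) • Y v (n - 1)
  weight : ∀ (n : ℤ), ∀ v ∈ wt n, Y ω 1 v = (n : ℂ) • v

namespace ConformalVertexAlgebra

variable {V : Type v} [AddCommGroup V] [Module ℂ V] (𝒱 : ConformalVertexAlgebra V)

/-- `L(n) = ω_{n+1}`. -/
def L (n : ℤ) : Module.End ℂ V := 𝒱.Y 𝒱.ω (n + 1)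

/-- The component of `v` in `V_(h)`. -/
def component (h : ℤ) (v : V) : V :=
  ((LinearEquiv.ofBijective (DirectSum.coeLinearMap 𝒱.wt) 𝒱.isInternal).symm v h : 𝒱.wt h)

end ConformalVertexAlgebra

/-- Conformal vertex algebras strongly graded with respect to `A`. The group `A` is given as a
subgroup of the abelian group `B` (written `Ã` in the literature) by which modules are graded. -/
structure StronglyGradedCVA {B : Type*} [AddCommGroup B] (A : AddSubgroup B)
    (V : Type v) [AddCommGroup V] [Module ℂ V] extends ConformalVertexAlgebra V where
  /-- the subspaces `V^(α)` -/
  gr : A → Submodule ℂ V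
  gr_isGrading : IsGrading gr
  compatible : ∀ α, gr α = ⨆ n, wt n ⊓ gr α
  gr_lower : ∀ α, ∃ N : ℤ, ∀ n < N, wt n ⊓ gr α = ⊥
  gr_finite : ∀ α n, Module.Finite ℂ (wt n ⊓ gr α : Submodule ℂ V)
  vac_gr : vac ∈ gr 0
  ω_gr : ω ∈ gr 0
  mode_gr : ∀ (α β : A), ∀ v ∈ gr α, ∀ w ∈ gr β, ∀ l : ℤ, Y v l w ∈ gr (α + β)

/-- Generalized modules: as modules, but `wt n` is `W_[n]`, consisting of generalized eigenvectors
of `L(0)`. -/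
structure GeneralizedModule {V : Type v} [AddCommGroup V] [Module ℂ V]
    (𝒱 : ConformalVertexAlgebra V) (W : Type u) [AddCommGroup W] [Module ℂ W] where
  Y : V →ₗ[ℂ] (ℤ → Module.End ℂ W)
  /-- the generalized weight spaces `W_[n]` -/
  wt : ℂ → Submodule ℂ W
  isGrading : IsGrading wt
  truncated : Truncated (fun u n => Y u n)
  vacuum : ∀ n : ℤ, Y 𝒱.vac n = if n = -1 then 1 else 0
  jacobi : JacobiIdentity (fun u n => 𝒱.Y u n) (fun u n => Y u n) (fun u n => Y u n)
    (fun (n : ℤ) x w => Y x n w)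
  virasoro : VirasoroRelations (fun n => Y 𝒱.ω (n + 1)) 𝒱.c
  derivative : ∀ (v : V) (n : ℤ), Y (𝒱.Y 𝒱.ω 0 v) n = (-(n : ℂ)) • Y v (n - 1)
  weight : ∀ (n : ℂ), ∀ w ∈ wt n, ∃ k : ℕ, ((Y 𝒱.ω 1 - n • (1 : Module.End ℂ W)) ^ k) w = 0

/-- Generalized modules strongly graded with respect to `B`. -/
structure StronglyGradedModule {B : Type*} [AddCommGroup B] {A : AddSubgroup B}
    {V : Type v} [AddCommGroup V] [Module ℂ V] (𝒱 : StronglyGradedCVA A V)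
    (W : Type u) [AddCommGroup W] [Module ℂ W]
    extends GeneralizedModule 𝒱.toConformalVertexAlgebra W where
  /-- the subspaces `W^(β)` -/
  gr : B → Submodule ℂ W
  gr_isGrading : IsGrading gr
  compatible : ∀ β, gr β = ⨆ n, wt n ⊓ gr β
  gr_lower : ∀ (β : B) (n : ℂ), ∃ N : ℤ, ∀ k : ℤ, k < N → wt (n + k) ⊓ gr β = ⊥
  gr_finite : ∀ β n, Module.Finite ℂ (wt n ⊓ gr β : Submodule ℂ W)
  mode_gr : ∀ (α : A) (β : B), ∀ v ∈ 𝒱.gr α, ∀ w ∈ gr β, ∀ l : ℤ, Y v l w ∈ gr ((α : B) + β)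

/-- `V₀` is a conformal vertex subalgebra (same vacuum and conformal vector) of `V` that is strongly
graded with respect to `A₀ ⊆ A`, i.e. `V₀` is the sum of its doubly homogeneous subspaces
`V₀ ∩ V_(n)^(α)` with `α ∈ A₀`. The finiteness conditions are inherited from `V`. -/
structure IsStronglyGradedSubalgebra {B : Type*} [AddCommGroup B] {A : AddSubgroup B}
    {V : Type v} [AddCommGroup V] [Module ℂ V] (𝒱 : StronglyGradedCVA A V)
    (A₀ : AddSubgroup A) (V₀ : Submodule ℂ V) : Prop where
  vac_mem : 𝒱.vac ∈ V₀
  ω_mem : 𝒱.ω ∈ V₀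
  mode_mem : ∀ u ∈ V₀, ∀ w ∈ V₀, ∀ n : ℤ, 𝒱.Y u n w ∈ V₀
  graded : V₀ = ⨆ (n : ℤ) (α : A₀), V₀ ⊓ (𝒱.wt n ⊓ 𝒱.gr α)

namespace StronglyGradedModule

variable {B : Type*} [AddCommGroup B] {A : AddSubgroup B}
  {V : Type v} [AddCommGroup V] [Module ℂ V] {𝒱 : StronglyGradedCVA A V}
  {W : Type u} [AddCommGroup W] [Module ℂ W] (M : StronglyGradedModule 𝒱 W)

/-- All weights are real. -/
def IsRealGraded : Prop := ∀ n : ℂ, n.im ≠ 0 → M.wt n = ⊥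

/-- Every `W^(β)` has weights with real part bounded below. -/
def IsLowerBounded : Prop := ∀ β : B, ∃ N : ℝ, ∀ n : ℂ, n.re < N → M.wt n ⊓ M.gr β = ⊥

/-- `C₁(W)` for `W` as a `V₀`-module: the span of the `u_{-1} w` with
`u ∈ (V₀)₊ = ∐_{n > 0} (V₀)_(n)` and `w ∈ W`. -/
def C₁ (V₀ : Submodule ℂ V) : Submodule ℂ W :=
  Submodule.span ℂ {x | ∃ u ∈ ⨆ (n : ℤ) (_ : 0 < n), V₀ ⊓ 𝒱.wt n, ∃ w : W, M.Y u (-1) w = x}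

/-- `C₁`-cofiniteness as a `V₀`-module: `dim W^(β) / (C₁(W) ∩ W^(β)) < ∞` for all `β`. -/
def IsC₁Cofinite (V₀ : Submodule ℂ V) : Prop :=
  ∀ β : B, Module.Finite ℂ (M.gr β ⧸ (M.C₁ V₀).submoduleOf (M.gr β))

/-- The operator on `W` whose transpose is the mode `v_n` of the contragredient module, i.e. the
coefficient of `x^(-n-1)` in `Y(e^{x L(1)} (-x⁻²)^{L(0)} v, x⁻¹)`. The sum runs over the weights `h`
of the components of `v` and the powers `i` of `L(1)`; it is finite because `L(1)` is locally
nilpotent on `V`. -/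
def adjointMode (v : V) (n : ℤ) : Module.End ℂ W :=
  ∑ᶠ hi : ℤ × ℕ, ((-1 : ℂ) ^ hi.1 * ((Nat.factorial hi.2 : ℕ) : ℂ)⁻¹) •
    M.Y (((𝒱.L 1) ^ hi.2) (𝒱.component hi.1 v)) (2 * hi.1 - hi.2 - n - 2)

/-- The modes of the adjoint vertex operators, acting on the full dual space of `W`. -/
def contragredientY (v : V) (n : ℤ) : Module.End ℂ (Module.Dual ℂ W) := (M.adjointMode v n).dualMap

/-- `(W')_[n]^(β) = (W_[n]^(-β))^*`: the functionals that vanish on all other doubly homogeneous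
subspaces. -/
def contragredientWtGr (n : ℂ) (β : B) : Submodule ℂ (Module.Dual ℂ W) :=
  ⨅ (m : ℂ) (γ : B) (_ : ¬ (m = n ∧ γ = -β)), (M.wt m ⊓ M.gr γ).dualAnnihilator

/-- `(W')^(β)`, the homogeneous subspaces of the contragredient module `W' = ∐_β (W')^(β)`, inside
the full dual space. -/
def contragredientGr (β : B) : Submodule ℂ (Module.Dual ℂ W) := ⨆ n, M.contragredientWtGr n β

end StronglyGradedModule

/-! ### Logarithmic intertwining operators -/

/-- Logarithmic intertwining operators. `I n k w₁ w₂` is the coefficient of `x^(-n-1) (log x)^k` in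
`𝒴(w₁,x) w₂`. The algebra enters only through its modes on the three spaces and the conformal
vector `ω`. -/
structure IsLogIntertwining {U W₁ W₂ W₃ : Type*} [AddCommGroup W₁] [Module ℂ W₁]
    [AddCommGroup W₂] [Module ℂ W₂] [AddCommGroup W₃] [Module ℂ W₃] (ω : U)
    (y₁ : U → ℤ → Module.End ℂ W₁) (y₂ : U → ℤ → Module.End ℂ W₂) (y₃ : U → ℤ → Module.End ℂ W₃)
    (I : ℂ → ℕ → W₁ →ₗ[ℂ] W₂ →ₗ[ℂ] W₃) : Prop where
  /-- the coefficient of each power of `x` is a polynomial in `log x` -/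
  log_finite : ∀ w₁ w₂ n, ∃ K : ℕ, ∀ k ≥ K, I n k w₁ w₂ = 0
  truncated : ∀ w₁ w₂ n, ∃ N : ℕ, ∀ m : ℕ, N ≤ m → ∀ k, I (n + m) k w₁ w₂ = 0
  jacobi : ∀ k, JacobiIdentity y₁ y₂ y₃ (fun n x w => I n k x w)
  derivative : ∀ w₁ n k,
    I n k (y₁ ω 0 w₁) = (-n) • I (n - 1) k w₁ + ((k : ℂ) + 1) • I (n - 1) (k + 1) w₁

section Space

variable {U W₁ W₂ W₃ : Type*} [AddCommGroup W₁] [Module ℂ W₁]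
    [AddCommGroup W₂] [Module ℂ W₂] [AddCommGroup W₃] [Module ℂ W₃] (ω : U)
    (y₁ : U → ℤ → Module.End ℂ W₁) (y₂ : U → ℤ → Module.End ℂ W₂) (y₃ : U → ℤ → Module.End ℂ W₃)

theorem finite_support_of_eventually {X : Type*} [Zero X] (f : ℕ → X)
    (h : ∃ N : ℕ, ∀ i ≥ N, f i = 0) : (Function.support f).Finite := by
  obtain ⟨N, hN⟩ := h
  refine (Set.finite_lt_nat N).subset fun i hi => ?_
  by_contra hlt
  exact hi (hN i (not_lt.mp hlt))

variable {ω y₁ y₂ y₃} in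
theorem IsLogIntertwining.support_left {I : ℂ → ℕ → W₁ →ₗ[ℂ] W₂ →ₗ[ℂ] W₃}
    (hI : IsLogIntertwining ω y₁ y₂ y₃ I) (h₂ : Truncated y₂) (k : ℕ) (u : U) (x : W₁) (w : W₂)
    (l m : ℤ) (n : ℂ) :
    (Function.support fun i : ℕ => (((-1 : ℂ) ^ i * (Ring.choose l i : ℤ)) •
        (y₃ u (m + l - i) (I (n + (i : ℂ)) k x w)
          - ((-1 : ℂ) ^ l) • I (n + (l : ℂ) - (i : ℂ)) k x (y₂ u (m + i) w)))).Finite := by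
  apply finite_support_of_eventually
  obtain ⟨N, hN⟩ := hI.truncated x w n
  obtain ⟨N', hN'⟩ := h₂ u w
  refine ⟨max N (N' - m).toNat, fun i hi => ?_⟩
  have e : N' ≤ m + i := by
    have : (N' - m).toNat ≤ i := le_trans (le_max_right _ _) hi
    omega
  rw [hN i (le_trans (le_max_left _ _) hi) k, hN' _ e]
  simp

variable {y₁} in
theorem support_right (I : ℂ → ℕ → W₁ →ₗ[ℂ] W₂ →ₗ[ℂ] W₃)
    (h₁ : Truncated y₁) (k : ℕ) (u : U) (x : W₁) (w : W₂) (l m : ℤ) (n : ℂ) :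
    (Function.support fun i : ℕ =>
      ((Ring.choose m i : ℤ) : ℂ) • I ((m : ℂ) + n - (i : ℂ)) k (y₁ u (l + i) x) w).Finite := by
  apply finite_support_of_eventually
  obtain ⟨N', hN'⟩ := h₁ u x
  refine ⟨(N' - l).toNat, fun i hi => ?_⟩
  rw [hN' _ (by omega)]
  simp

/-- The vector space of logarithmic intertwining operators of a given type. -/
def logIntertwiningSpace (h₁ : Truncated y₁) (h₂ : Truncated y₂) :
    Submodule ℂ (ℂ → ℕ → W₁ →ₗ[ℂ] W₂ →ₗ[ℂ] W₃) where
  carrier := {I | IsLogIntertwining ω y₁ y₂ y₃ I}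
  zero_mem' := by
    refine ⟨fun _ _ _ => ⟨0, fun _ _ => rfl⟩, fun _ _ _ => ⟨0, fun _ _ _ => rfl⟩, ?_, ?_⟩
    · intro k u x w l m n
      simp
    · intro w n k
      simp
  add_mem' := by
    intro I J hI hJ
    refine ⟨?_, ?_, ?_, ?_⟩
    · intro w₁ w₂ n
      obtain ⟨K, hK⟩ := hI.log_finite w₁ w₂ n
      obtain ⟨K', hK'⟩ := hJ.log_finite w₁ w₂ n
      refine ⟨max K K', fun k hk => ?_⟩
      simp [hK k (le_trans (le_max_left _ _) hk), hK' k (le_trans (le_max_right _ _) hk)]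
    · intro w₁ w₂ n
      obtain ⟨K, hK⟩ := hI.truncated w₁ w₂ n
      obtain ⟨K', hK'⟩ := hJ.truncated w₁ w₂ n
      refine ⟨max K K', fun m hm k => ?_⟩
      simp [hK m (le_trans (le_max_left _ _) hm) k, hK' m (le_trans (le_max_right _ _) hm) k]
    · intro k u x w l m n
      have a := hI.jacobi k u x w l m n
      have b := hJ.jacobi k u x w l m n
      have e := congrArg₂ (· + ·) a b
      simp only at e
      rw [← finsum_add_distrib (hI.support_left h₂ k u x w l m n)
        (hJ.support_left h₂ k u x w l m n),
        ← finsum_add_distrib (support_right I h₁ k u x w l m n)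
        (support_right J h₁ k u x w l m n)] at e
      refine Eq.trans (finsum_congr fun i => ?_) (e.trans (finsum_congr fun i => ?_))
      · simp only [Pi.add_apply, LinearMap.add_apply, map_add, ← smul_add]
        congr 1
        rw [smul_add]
        abel
      · simp only [Pi.add_apply, LinearMap.add_apply, smul_add]
    · intro w n k
      simp only [Pi.add_apply, hI.derivative, hJ.derivative, LinearMap.add_apply, smul_add]
      abel
  smul_mem' := by
    intro c I hI
    refine ⟨?_, ?_, ?_, ?_⟩
    · intro w₁ w₂ n
      obtain ⟨K, hK⟩ := hI.log_finite w₁ w₂ n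
      exact ⟨K, fun k hk => by simp [hK k hk]⟩
    · intro w₁ w₂ n
      obtain ⟨K, hK⟩ := hI.truncated w₁ w₂ n
      exact ⟨K, fun m hm k => by simp [hK m hm k]⟩
    · intro k u x w l m n
      have e := congrArg (c • ·) (hI.jacobi k u x w l m n)
      simp only [smul_finsum] at e
      refine Eq.trans (finsum_congr fun i => ?_) (e.trans (finsum_congr fun i => ?_))
      · simp only [Pi.smul_apply, LinearMap.smul_apply, map_smul, smul_sub]
        module
      · simp only [Pi.smul_apply, LinearMap.smul_apply]
        module
    · intro w n k
      simp only [Pi.smul_apply, hI.derivative, LinearMap.smul_apply]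
      module

end Space

/-- A family of coefficients is grading-compatible if
`(w₁)_{n;k} w₂ ∈ W₃^(β+γ)` for `w₁ ∈ W₁^(β)` and `w₂ ∈ W₂^(γ)`. -/
def IsGradingCompatible {B W₁ W₂ W₃ : Type*} [AddCommGroup B] [AddCommGroup W₁] [Module ℂ W₁]
    [AddCommGroup W₂] [Module ℂ W₂] [AddCommGroup W₃] [Module ℂ W₃]
    (gr₁ : B → Submodule ℂ W₁) (gr₂ : B → Submodule ℂ W₂) (gr₃ : B → Submodule ℂ W₃)
    (I : ℂ → ℕ → W₁ →ₗ[ℂ] W₂ →ₗ[ℂ] W₃) : Prop :=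
  ∀ β γ, ∀ w₁ ∈ gr₁ β, ∀ w₂ ∈ gr₂ γ, ∀ n k, I n k w₁ w₂ ∈ gr₃ (β + γ)

section Types

variable {B : Type*} [AddCommGroup B] {A : AddSubgroup B}
  {V : Type v} [AddCommGroup V] [Module ℂ V] {𝒱 : StronglyGradedCVA A V}
  {W₀ W₁ W₂ W₃ : Type u} [AddCommGroup W₀] [Module ℂ W₀] [AddCommGroup W₁] [Module ℂ W₁]
  [AddCommGroup W₂] [Module ℂ W₂] [AddCommGroup W₃] [Module ℂ W₃]

/-- Grading-compatible logarithmic intertwining operators of type `W₃` over `W₁ W₂`. -/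
def IsIntertwiningOfType (M₁ : StronglyGradedModule 𝒱 W₁) (M₂ : StronglyGradedModule 𝒱 W₂)
    (M₃ : StronglyGradedModule 𝒱 W₃) (I : ℂ → ℕ → W₁ →ₗ[ℂ] W₂ →ₗ[ℂ] W₃) : Prop :=
  IsLogIntertwining 𝒱.ω (fun v n => M₁.Y v n) (fun v n => M₂.Y v n) (fun v n => M₃.Y v n) I ∧
    IsGradingCompatible M₁.gr M₂.gr M₃.gr I

/-- Grading-compatible logarithmic intertwining operators of type `W₀'` over `W₁ W₂`, where `W₀'` is
the contragredient module of `W₀`. The coefficients are functionals on `W₀`; grading-compatibility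
forces them to lie in `W₀'`, and the modes of `V` on the full dual space extend those on `W₀'`. -/
def IsIntertwiningOfContragredientType (M₁ : StronglyGradedModule 𝒱 W₁)
    (M₂ : StronglyGradedModule 𝒱 W₂) (M₀ : StronglyGradedModule 𝒱 W₀)
    (I : ℂ → ℕ → W₁ →ₗ[ℂ] W₂ →ₗ[ℂ] Module.Dual ℂ W₀) : Prop :=
  IsLogIntertwining 𝒱.ω (fun v n => M₁.Y v n) (fun v n => M₂.Y v n) M₀.contragredientY I ∧
    IsGradingCompatible M₁.gr M₂.gr M₀.contragredientGr I

/-- The action of `V^(0)` on `W^(β)`. -/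
def StronglyGradedModule.zeroAction (M : StronglyGradedModule 𝒱 W₁) (β : B) (v : 𝒱.gr 0) (n : ℤ) :
    Module.End ℂ (M.gr β) :=
  (M.Y (v : V) n).restrict fun w hw => by
    simpa using M.mode_gr 0 β v v.2 w hw n

theorem StronglyGradedModule.zeroAction_truncated (M : StronglyGradedModule 𝒱 W₁) (β : B) :
    Truncated (M.zeroAction β) := by
  intro v w
  obtain ⟨N, hN⟩ := M.truncated (v : V) (w : W₁)
  exact ⟨N, fun n hn => Subtype.ext (hN n hn)⟩

/-- The fusion rule for `M₁^(β₁)`, `M₂^(β₂)`, `M₃^(β₁+β₂)` as modules for `V^(0)`: the dimension of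
the space of logarithmic intertwining operators among them. -/
def fusionRule (M₁ : StronglyGradedModule 𝒱 W₁) (M₂ : StronglyGradedModule 𝒱 W₂)
    (M₃ : StronglyGradedModule 𝒱 W₃) (β₁ β₂ : B) : Cardinal :=
  Module.rank ℂ (logIntertwiningSpace (⟨𝒱.ω, 𝒱.ω_gr⟩ : 𝒱.gr 0)
    (M₁.zeroAction β₁) (M₂.zeroAction β₂) (M₃.zeroAction (β₁ + β₂))
    (M₁.zeroAction_truncated β₁) (M₂.zeroAction_truncated β₂))

/-- The operators all of whose coefficients take values in the subspace `T`. -/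
def valuedIn {X₁ X₂ X₃ : Type*} [AddCommGroup X₁] [Module ℂ X₁] [AddCommGroup X₂] [Module ℂ X₂]
    [AddCommGroup X₃] [Module ℂ X₃] (T : Submodule ℂ X₃) :
    Submodule ℂ (ℂ → ℕ → X₁ →ₗ[ℂ] X₂ →ₗ[ℂ] X₃) where
  carrier := {I | ∀ n k x₁ x₂, I n k x₁ x₂ ∈ T}
  zero_mem' := fun _ _ _ _ => T.zero_mem
  add_mem' := fun hI hJ n k x₁ x₂ => T.add_mem (hI n k x₁ x₂) (hJ n k x₁ x₂)
  smul_mem' := fun c _ hI n k x₁ x₂ => T.smul_mem c (hI n k x₁ x₂)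

/-- The fusion rule for `M₁^(β₁)`, `M₂^(β₂)`, `(M₀')^(β₁+β₂)` as modules for `V^(0)`, where `M₀'` is
the contragredient module of `M₀`. -/
def contragredientFusionRule (M₁ : StronglyGradedModule 𝒱 W₁) (M₂ : StronglyGradedModule 𝒱 W₂)
    (M₀ : StronglyGradedModule 𝒱 W₀) (β₁ β₂ : B) : Cardinal :=
  Module.rank ℂ (logIntertwiningSpace (⟨𝒱.ω, 𝒱.ω_gr⟩ : 𝒱.gr 0)
      (M₁.zeroAction β₁) (M₂.zeroAction β₂) (fun v n => M₀.contragredientY (v : V) n)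
      (M₁.zeroAction_truncated β₁) (M₂.zeroAction_truncated β₂)
    ⊓ valuedIn (M₀.contragredientGr (β₁ + β₂)) :
      Submodule ℂ (ℂ → ℕ → M₁.gr β₁ →ₗ[ℂ] M₂.gr β₂ →ₗ[ℂ] Module.Dual ℂ W₀))

end Types

/-! ### Systems of differential equations -/

/-- An element `num / (z₁ z₂ (z₁ - z₂))^exp` of `R = ℂ[z₁^±, z₂^±, (z₁-z₂)⁻¹]`; every element of `R`
has this form. -/
structure RFraction where
  num : MvPolynomial (Fin 2) ℂ
  exp : ℕ

/-- The value of an element of `R` at a point. -/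
def RFraction.eval (a : RFraction) (z : ℂ × ℂ) : ℂ :=
  MvPolynomial.eval ![z.1, z.2] a.num / (z.1 * z.2 * (z.1 - z.2)) ^ a.exp

/-- Formal series in complex powers of `z₁`, `z₂` and natural powers of their logarithms: `F p k q l`
is the coefficient of `z₁^p (log z₁)^k z₂^q (log z₂)^l`. -/
abbrev LogSeries := ℂ → ℕ → ℂ → ℕ → ℂ

/-- Formal derivative with respect to the first variable. -/
def LogSeries.D₁ (F : LogSeries) : LogSeries := fun p k q l =>
  (p + 1) * F (p + 1) k q l + ((k : ℂ) + 1) * F (p + 1) (k + 1) q l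

/-- Formal derivative with respect to the second variable. -/
def LogSeries.D₂ (F : LogSeries) : LogSeries := fun p k q l =>
  (q + 1) * F p k (q + 1) l + ((l : ℂ) + 1) * F p k (q + 1) (l + 1)

/-- Product of a series with the expansion of an element of `R` in the region `|z₁| > |z₂| > 0`:
`(z₁ - z₂)^(-N)` is expanded as `∑ r, (-N choose r) (-1)^r z₁^(-N-r) z₂^r`. -/
def RFraction.mulExpansion (a : RFraction) (F : LogSeries) : LogSeries := fun p k q l =>
  ∑ s ∈ a.num.support, ∑ᶠ r : ℕ, a.num.coeff s * ((-1) ^ r * (Ring.choose (-(a.exp : ℤ)) r : ℤ)) *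
    F (p - ((s 0 : ℂ) - 2 * a.exp - r)) k (q - ((s 1 : ℂ) - a.exp + r)) l

/-- A system
`∂₁^m φ + a₁ ∂₁^(m-1) φ + ⋯ + a_m φ = 0`, `∂₂^n φ + b₁ ∂₂^(n-1) φ + ⋯ + b_n φ = 0`
of positive orders with coefficients in `R`; `a k` stands for `a_{k+1}` and `b l` for `b_{l+1}`. -/
structure DiffSystem where
  m : ℕ
  n : ℕ
  m_pos : 0 < m
  n_pos : 0 < n
  a : Fin m → RFraction
  b : Fin n → RFraction

namespace DiffSystem

variable (S : DiffSystem)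

/-- A formal series satisfies the expansion of the system in the region `|z₁| > |z₂| > 0`. -/
def IsFormalSolution (F : LogSeries) : Prop :=
  LogSeries.D₁^[S.m] F
      + ∑ k : Fin S.m, (S.a k).mulExpansion (LogSeries.D₁^[S.m - 1 - k] F) = 0 ∧
    LogSeries.D₂^[S.n] F
      + ∑ l : Fin S.n, (S.b l).mulExpansion (LogSeries.D₂^[S.n - 1 - l] F) = 0

/-- A function satisfies the system at the point `z`. -/
def HoldsAt (ψ : ℂ × ℂ → ℂ) (z : ℂ × ℂ) : Prop :=
  iteratedDeriv S.m (fun s => ψ (s, z.2)) z.1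
      + ∑ k : Fin S.m, (S.a k).eval z * iteratedDeriv (S.m - 1 - k) (fun s => ψ (s, z.2)) z.1 = 0 ∧
    iteratedDeriv S.n (fun s => ψ (z.1, s)) z.2
      + ∑ l : Fin S.n, (S.b l).eval z * iteratedDeriv (S.n - 1 - l) (fun s => ψ (z.1, s)) z.2 = 0

end DiffSystem

/-! ### Regular singular points -/

/-- The preimage of the punctured polydisc `0 < |x| < r₁`, `0 < |y| < r₂` under its universal
covering `(ξ, η) ↦ (exp ξ, exp η)`. -/
def coverDomain (r₁ r₂ : ℝ) : Set (ℂ × ℂ) :=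
  {q | q.1.re < Real.log r₁ ∧ q.2.re < Real.log r₂}

/-- Let `p` express `(z₁, z₂)` through local coordinates `(x, y)`. A multivalued solution of the
system on the punctured polydisc `0 < |x| < r₁`, `0 < |y| < r₂` is a function `Φ` on its universal
covering which locally is the pull-back of a holomorphic solution in the variables `(z₁, z₂)`. -/
def DiffSystem.IsMultivaluedSolution (S : DiffSystem) (p : ℂ × ℂ → ℂ × ℂ) (r₁ r₂ : ℝ)
    (Φ : ℂ × ℂ → ℂ) : Prop :=
  ∀ q ∈ coverDomain r₁ r₂, ∃ ψ : ℂ × ℂ → ℂ,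
    AnalyticAt ℂ ψ (p (Complex.exp q.1, Complex.exp q.2)) ∧
    (∀ᶠ q' in 𝓝 q, Φ q' = ψ (p (Complex.exp q'.1, Complex.exp q'.2))) ∧
    (∀ᶠ z in 𝓝 (p (Complex.exp q.1, Complex.exp q.2)), S.HoldsAt ψ z)

/-- `Φ = ∑ x^{s_i} y^{t_i} (log x)^j (log y)^k f_{i,j,k}(x, y)`, a finite sum with complex exponents
and with each `f_{i,j,k}` holomorphic on the full polydisc `|x| < r₁`, `|y| < r₂`; on the universal
covering, `log x = ξ` and `log y = η`. -/
def HasRegularForm (r₁ r₂ : ℝ) (Φ : ℂ × ℂ → ℂ) : Prop :=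
  ∃ (r M : ℕ) (s t : Fin r → ℂ) (f : Fin r → Fin M → Fin M → ℂ × ℂ → ℂ),
    (∀ i j k, AnalyticOnNhd ℂ (f i j k) (Metric.ball 0 r₁ ×ˢ Metric.ball 0 r₂)) ∧
    ∀ q ∈ coverDomain r₁ r₂, Φ q = ∑ i : Fin r, ∑ j : Fin M, ∑ k : Fin M,
      Complex.exp (s i * q.1) * Complex.exp (t i * q.2) * q.1 ^ (j : ℕ) * q.2 ^ (k : ℕ)
        * f i j k (Complex.exp q.1, Complex.exp q.2)

/-- The point `x = y = 0` is a regular singular point of the system: every multivalued solution on a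
sufficiently small punctured polydisc has a finite expansion as in `HasRegularForm`. -/
def DiffSystem.IsRegularAt (S : DiffSystem) (p : ℂ × ℂ → ℂ × ℂ) : Prop :=
  ∃ ρ : ℝ, 0 < ρ ∧ ∀ r₁ r₂ : ℝ, 0 < r₁ → r₁ ≤ ρ → 0 < r₂ → r₂ ≤ ρ →
    ∀ Φ : ℂ × ℂ → ℂ, S.IsMultivaluedSolution p r₁ r₂ Φ → HasRegularForm r₁ r₂ Φ

/-- On some punctured polydisc around `x = y = 0`, all elements of `R` are holomorphic. -/
def IsIsolated (p : ℂ × ℂ → ℂ × ℂ) : Prop :=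
  ∃ ρ : ℝ, 0 < ρ ∧ ∀ x y : ℂ, x ≠ 0 → ‖x‖ < ρ → y ≠ 0 → ‖y‖ < ρ →
    (p (x, y)).1 ≠ 0 ∧ (p (x, y)).2 ≠ 0 ∧ (p (x, y)).1 ≠ (p (x, y)).2

/-- The possible singular points `z₁ = 0`, `z₂ = 0`, `z₁ = ∞`, `z₂ = ∞`, `z₁ = z₂`,
`z₁⁻¹(z₁ - z₂) = 0` and `z₂⁻¹(z₁ - z₂) = 0`. -/
inductive SingularLocus
  | z₁Zero | z₂Zero | z₁Infty | z₂Infty | diagonal | diagonalOverZ₁ | diagonalOverZ₂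

/-- `(z₁, z₂)` in terms of the function `x` defining the locus and the remaining coordinate `y`:
`x` is `z₁`, `z₂`, `1/z₁`, `1/z₂`, `z₁ - z₂`, `z₁⁻¹(z₁ - z₂)`, `z₂⁻¹(z₁ - z₂)` and `y` is `z₂`, `z₁`,
`z₂`, `z₁`, `z₂`, `z₁`, `z₂`, respectively. -/
def SingularLocus.coordinates : SingularLocus → ℂ → ℂ → ℂ × ℂ
  | .z₁Zero, x, y => (x, y)
  | .z₂Zero, x, y => (y, x)
  | .z₁Infty, x, y => (x⁻¹, y)
  | .z₂Infty, x, y => (y, x⁻¹)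
  | .diagonal, x, y => (y + x, y)
  | .diagonalOverZ₁, x, y => (y, y * (1 - x))
  | .diagonalOverZ₂, x, y => (y * (1 + x), y)

/-- A local parametrization of the Riemann sphere centred at `c`: the point with local coordinate `t`
is `y = c + t` for finite `c` and `y = 1 / t` for `c = ∞`. -/
def sphereChart : OnePoint ℂ → ℂ → ℂ
  | OnePoint.infty, t => t⁻¹
  | OnePoint.some c, t => c + t

/-- Local coordinates at the point `x = 0`, `y = c` of the locus, where `c` is a point of the Riemann
sphere. -/
def SingularLocus.chart (σ : SingularLocus) (c : OnePoint ℂ) (q : ℂ × ℂ) : ℂ × ℂ :=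
  σ.coordinates q.1 (sphereChart c q.2)

/-- The singular point given by `σ` is regular: the system is regular at every point `x = 0`, `y = c`
of the locus near which the coefficients have no other singularities than `x = 0` and `y = c`. -/
def DiffSystem.IsRegularAlong (S : DiffSystem) (σ : SingularLocus) : Prop :=
  ∀ c : OnePoint ℂ, IsIsolated (σ.chart c) → S.IsRegularAt (σ.chart c)

/-- The series `⟨w₀, 𝒴₁(w₁, z₁) 𝒴₂(w₂, z₂) w₃⟩`. -/
def productSeries {W₀ W₁ W₂ W₃ W₄ : Type*} [AddCommGroup W₀] [Module ℂ W₀]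
    [AddCommGroup W₁] [Module ℂ W₁] [AddCommGroup W₂] [Module ℂ W₂] [AddCommGroup W₃] [Module ℂ W₃]
    [AddCommGroup W₄] [Module ℂ W₄] (I₁ : ℂ → ℕ → W₁ →ₗ[ℂ] W₄ →ₗ[ℂ] Module.Dual ℂ W₀)
    (I₂ : ℂ → ℕ → W₂ →ₗ[ℂ] W₃ →ₗ[ℂ] W₄) (w₀ : W₀) (w₁ : W₁) (w₂ : W₂) (w₃ : W₃) : LogSeries :=
  fun p k q l => I₁ (-p - 1) k w₁ (I₂ (-q - 1) l w₂ w₃) w₀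

end SGVA

end

/-!
The matrix elements `⟨w₀, 𝒴₁(w₁, z₁) 𝒴₂(w₂, z₂) w₃⟩` (`corr`) lie in a space of formal series on
which `R` acts by expansion in `|z₁| > |z₂| > 0` (`Multiplier`). The Jacobi identity expresses a
matrix element in which a mode `u_{-1}` acts on one of the vectors through matrix elements in which
modes of `u` act on the other three, with coefficients in `R` (`corr_mode_one`, `corr_mode_two`,
`corr_adjointMode`). If `u ∈ V₀` is homogeneous of positive weight, the total weight of the four
vectors drops. By `C₁`-cofiniteness and the lower bounds on the weights, induction on the total
weight reduces every matrix element to those of finitely many generators for each quadruple of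
degrees. Only finitely many quadruples of degrees in the relevant `A₀`-cosets contribute, by the
finiteness of the fusion rules (`exists_finite_degrees`).

For regularity the coefficients have to be controlled. Each singular locus has a coordinate `τ`,
homogeneous of degree zero in `(z₁, z₂)`, that vanishes on it. Multiplied by suitable units of `R`
depending on the weights (`scale`), the matrix elements lie in a finitely generated module over a
Noetherian subring `latticeRing` of `R`, whose elements are holomorphic functions of `τ` for
`|τ| < 1` (`exists_lattice`, `holomorphicIn_of_mem_latticeRing`). This module is stable under
differentiation followed by multiplication by `z₁` and `z₂`, respectively by `z₁ - z₂` along the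
diagonal; where that factor does not compensate for the increase of the total weight, the Euler
field, which preserves weights, expresses one derivative through the other. The iterated
derivatives of a matrix element therefore satisfy a monic linear relation over `latticeRing`, which
gives the two equations (`exists_fuchsian_system`).

Conversely, let a system have coefficients of this kind. On the universal cover of the punctured
polydisc, take the coordinates `ζ = log τ` and `ν`, the logarithm of the second coordinate
(`AdaptedCoordinates`), with derivations `D = ∂_ζ` and `E = ∂_ν`. One equation involves `± D` only
and the other `α E + β D` with `α` invertible, and all coefficients depend on `ζ` alone, through
`τ = exp ζ`. Such a system is holonomic: its solutions are determined by finitely many derivatives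
at a point, so they form a finite-dimensional space, and `E` acts on it. Generalized eigenvectors
of `E` are sums of terms `exp (μ ν) ν ^ j g` with `E g = 0` (`solution_mem_span`). The function `g`
depends on `ζ` alone and satisfies an ordinary differential equation with a simple pole at `τ = 0`,
so Fuchs' theorem in one variable (`linear_system_mem_logForms`: growth by Gronwall's inequality,
Jordan form of the monodromy, removable singularities) writes it as a sum of terms
`τ ^ s (log τ) ^ k f(τ)` with `f` holomorphic. Near each point where `x y = 0` contains all the
singular loci, `τ` is `x` times a nonnegative power of `y` times a holomorphic unit, and the terms
take the required form (`DiffSystem.IsFuchsianAlong.isRegularAlong`).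
-/

noncomputable section

namespace SGVA

/-! ### The ring of Laurent multipliers acting on truncated series -/

/-- Series whose exponents of `z₂` are bounded below in each class modulo `ℤ`. On these, the
expansion of every element of `R` in the region `|z₁| > |z₂| > 0` acts by finite sums. -/
def truncatedSeries : Submodule ℂ LogSeries where
  carrier := {F | ∀ q, ∃ N : ℕ, ∀ m ≥ N, ∀ p k l, F p k (q - (m : ℕ)) l = 0}
  zero_mem' := fun _ => ⟨0, fun _ _ _ _ _ => rfl⟩
  add_mem' := by
    intro F G hF hG q
    obtain ⟨N, hN⟩ := hF q
    obtain ⟨N', hN'⟩ := hG q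
    refine ⟨max N N', fun m hm p k l => ?_⟩
    simp [hN m (le_trans (le_max_left _ _) hm), hN' m (le_trans (le_max_right _ _) hm)]
  smul_mem' := by
    intro c F hF q
    obtain ⟨N, hN⟩ := hF q
    exact ⟨N, fun m hm p k l => by simp [hN m hm]⟩

/-- The type of truncated series. -/
def TSeries : Type := truncatedSeries

instance : AddCommGroup TSeries := (inferInstance : AddCommGroup truncatedSeries)

instance : Module ℂ TSeries := (inferInstance : Module ℂ truncatedSeries)

theorem TSeries.ext {F G : TSeries} (h : ∀ p k q l, F.1 p k q l = G.1 p k q l) : F = G :=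
  Subtype.ext (funext fun p => funext fun k => funext fun q => funext fun l => h p k q l)

@[simp] theorem TSeries.add_apply (F G : TSeries) (p : ℂ) (k : ℕ) (q : ℂ) (l : ℕ) :
    (F + G).1 p k q l = F.1 p k q l + G.1 p k q l := rfl

@[simp] theorem TSeries.sub_apply (F G : TSeries) (p : ℂ) (k : ℕ) (q : ℂ) (l : ℕ) :
    (F - G).1 p k q l = F.1 p k q l - G.1 p k q l := rfl

@[simp] theorem TSeries.smul_apply (c : ℂ) (F : TSeries) (p : ℂ) (k : ℕ) (q : ℂ) (l : ℕ) :
    (c • F).1 p k q l = c * F.1 p k q l := rfl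

@[simp] theorem TSeries.zero_apply (p : ℂ) (k : ℕ) (q : ℂ) (l : ℕ) :
    (0 : TSeries).1 p k q l = 0 := rfl

theorem TSeries.sum_apply {ι : Type*} (s : Finset ι) (F : ι → TSeries) (p : ℂ) (k : ℕ) (q : ℂ)
    (l : ℕ) : (∑ i ∈ s, F i).1 p k q l = ∑ i ∈ s, (F i).1 p k q l := by
  classical
  induction s using Finset.induction_on with
  | empty => simp
  | insert a s ha ih => simp [Finset.sum_insert ha, ih]

/-- Multiplication by the monomial `z₁^a z₂^b`. -/
def shift (a b : ℤ) : Module.End ℂ TSeries where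
  toFun F := ⟨fun p k q l => F.1 (p - a) k (q - b) l, fun q => by
    obtain ⟨N, hN⟩ := F.2 (q - b)
    refine ⟨N, fun m hm p k l => ?_⟩
    have := hN m hm (p - a) k l
    rwa [sub_right_comm] at this⟩
  map_add' _ _ := rfl
  map_smul' _ _ := rfl

theorem shift_apply (a b : ℤ) (F : TSeries) (p : ℂ) (k : ℕ) (q : ℂ) (l : ℕ) :
    (shift a b F).1 p k q l = F.1 (p - a) k (q - b) l := rfl

theorem shift_mul (a b a' b' : ℤ) : shift a b * shift a' b' = shift (a + a') (b + b') := by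
  refine LinearMap.ext fun F => TSeries.ext fun p k q l => ?_
  simp only [Module.End.mul_apply, shift_apply, Int.cast_add, sub_sub]

theorem shift_zero : shift 0 0 = 1 :=
  LinearMap.ext fun F => TSeries.ext fun p k q l => by simp [shift_apply]

/-- The `r`-th coefficient of the expansion of `(z₁ - z₂)^(-n)`. -/
def negBinom (n r : ℕ) : ℂ := (-1) ^ r * (Ring.choose (-(n : ℤ)) r : ℤ)

theorem negBinom_zero_right (n : ℕ) : negBinom n 0 = 1 := by simp [negBinom]

theorem negBinom_zero_succ (r : ℕ) : negBinom 0 (r + 1) = 0 := by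
  simp [negBinom, Ring.choose_zero_succ]

theorem negBinom_succ_succ (n r : ℕ) :
    negBinom (n + 1) (r + 1) - negBinom (n + 1) r = negBinom n (r + 1) := by
  have h := Ring.choose_succ_succ (-((n + 1 : ℕ) : ℤ)) r
  have e : (-((n + 1 : ℕ) : ℤ)) + 1 = -(n : ℤ) := by push_cast; ring
  rw [e] at h
  simp only [negBinom, h]
  push_cast
  ring

theorem negBinom_eq_choose (n r : ℕ) : negBinom (n + 1) r = ((n + r).choose n : ℕ) := by
  rw [negBinom, show (-((n + 1 : ℕ) : ℤ)) = -((n : ℤ) + 1) by push_cast; ring, Ring.choose_neg]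
  rw [show ((n : ℤ) + 1 + r - 1) = ((n + r : ℕ) : ℤ) by push_cast; ring,
    Ring.choose_natCast, Units.smul_def, Int.negOnePow_def, ← Nat.choose_symm_add]
  simp only [zpow_natCast, Units.val_pow_eq_pow_val, Units.val_neg, Units.val_one, smul_eq_mul]
  push_cast
  rw [← mul_assoc, ← mul_pow]
  simp

theorem negBinom_support (n : ℕ) (F : TSeries) (p : ℕ → ℂ) (k : ℕ) (q : ℂ) (l : ℕ) :
    (Function.support fun r : ℕ => negBinom n r * F.1 (p r) k (q - r) l).Finite := by
  apply finite_support_of_eventually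
  obtain ⟨N, hN⟩ := F.2 q
  exact ⟨N, fun r hr => by rw [hN r hr, mul_zero]⟩

/-- Multiplication by the expansion of `(z₁ - z₂)^(-n)`. -/
def dInv (n : ℕ) : Module.End ℂ TSeries where
  toFun F := ⟨fun p k q l => ∑ᶠ r : ℕ, negBinom n r * F.1 (p + n + r) k (q - r) l, fun q => by
    obtain ⟨N, hN⟩ := F.2 q
    refine ⟨N, fun m hm p k l => finsum_eq_zero_of_forall_eq_zero fun r => ?_⟩
    rw [sub_sub, ← Nat.cast_add, hN (m + r) (by omega), mul_zero]⟩
  map_add' F G := TSeries.ext fun p k q l => by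
    simp only [TSeries.add_apply, mul_add]
    exact finsum_add_distrib (negBinom_support n F _ k q l) (negBinom_support n G _ k q l)
  map_smul' c F := TSeries.ext fun p k q l => by
    refine Eq.trans (finsum_congr fun r => ?_) (mul_finsum _ c).symm
    rw [TSeries.smul_apply]
    ring

theorem dInv_apply (n : ℕ) (F : TSeries) (p : ℂ) (k : ℕ) (q : ℂ) (l : ℕ) :
    (dInv n F).1 p k q l = ∑ᶠ r : ℕ, negBinom n r * F.1 (p + n + r) k (q - r) l := rfl

theorem dInv_zero : dInv 0 = 1 := by
  refine LinearMap.ext fun F => TSeries.ext fun p k q l => ?_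
  rw [dInv_apply, finsum_eq_single _ 0]
  · simp [negBinom_zero_right]
  · intro r hr
    obtain ⟨r, rfl⟩ := Nat.exists_eq_succ_of_ne_zero hr
    rw [Nat.succ_eq_add_one, negBinom_zero_succ, zero_mul]

theorem dInv_comm_shift (n : ℕ) (a b : ℤ) : dInv n * shift a b = shift a b * dInv n := by
  refine LinearMap.ext fun F => TSeries.ext fun p k q l => ?_
  simp only [Module.End.mul_apply, shift_apply, dInv_apply]
  refine finsum_congr fun r => ?_
  rw [sub_right_comm q, show p + n + r - a = p - a + n + r by ring]

theorem finsum_nat_eq_zero_add {M : Type*} [AddCommMonoid M] (f : ℕ → M)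
    (hf : (Function.support f).Finite) : ∑ᶠ r, f r = f 0 + ∑ᶠ r, f (r + 1) := by
  obtain ⟨N, hN⟩ := hf.bddAbove
  have h0 : Function.support f ⊆ ↑(Finset.range (N + 1)) := fun r hr => by
    simpa using Nat.lt_succ_of_le (hN hr)
  have h1 : Function.support (fun r => f (r + 1)) ⊆ ↑(Finset.range N) := fun r hr => by
    have := hN (show r + 1 ∈ Function.support f from hr)
    simp only [Finset.coe_range, Set.mem_Iio]
    omega
  rw [finsum_eq_sum_of_support_subset _ h0, finsum_eq_sum_of_support_subset _ h1,
    Finset.sum_range_succ', add_comm]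

/-- Multiplication by `z₁ - z₂` lowers the order of the expansion `dInv` of a power of
`(z₁ - z₂)⁻¹`: this is Pascal's rule. -/
theorem sub_mul_dInv (n : ℕ) : (shift 1 0 - shift 0 1) * dInv (n + 1) = dInv n := by
  refine LinearMap.ext fun F => TSeries.ext fun p k q l => ?_
  simp only [Module.End.mul_apply, LinearMap.sub_apply, TSeries.sub_apply, shift_apply]
  simp only [Int.cast_one, Int.cast_zero, sub_zero, dInv_apply]
  rw [finsum_nat_eq_zero_add _ (negBinom_support (n + 1) F _ k q l),
    finsum_nat_eq_zero_add _ (negBinom_support n F _ k q l), add_sub_assoc,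
    ← finsum_sub_distrib]
  · congr 1
    · simp only [negBinom_zero_right]
      congr 2
      push_cast
      ring_nf
    · refine finsum_congr fun r => ?_
      simp only [← negBinom_succ_succ n r, sub_mul]
      push_cast
      rw [show p - 1 + ((n : ℂ) + 1) + (r + 1) = p + n + (r + 1) by ring,
        show p + ((n : ℂ) + 1) + r = p + n + (r + 1) by ring,
        show q - 1 - (r : ℂ) = q - (r + 1) by ring]
  · refine ((negBinom_support (n + 1) F (fun r : ℕ => p - 1 + (n + 1 : ℕ) + r) k q l).preimage
      (f := fun r : ℕ => r + 1) (Function.Injective.injOn (add_left_injective 1))).subset ?_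
    intro r hr
    exact hr
  · exact negBinom_support (n + 1) F _ k (q - 1) l

/-- The operators of multiplication by monomials and by the expansion of `(z₁ - z₂)⁻¹`. -/
def multiplierGens : Set (Module.End ℂ TSeries) :=
  {f | ∃ a b : ℤ, f = shift a b} ∪ {dInv 1}

theorem multiplierGens_comm : ∀ f ∈ multiplierGens, ∀ g ∈ multiplierGens, f * g = g * f := by
  rintro f (⟨a, b, rfl⟩ | rfl) g (⟨a', b', rfl⟩ | rfl)
  · rw [shift_mul, shift_mul, add_comm a, add_comm b]
  · exact (dInv_comm_shift 1 a b).symm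
  · exact dInv_comm_shift 1 a' b'
  · rfl

/-- The commutative ring `R = ℂ[z₁^±, z₂^±, (z₁-z₂)⁻¹]`, realized by its action on truncated
series through expansion in the region `|z₁| > |z₂| > 0`. -/
abbrev Multiplier : Type := Algebra.adjoin ℂ multiplierGens

namespace Multiplier

instance : CommRing Multiplier :=
  { (inferInstance : Ring (Algebra.adjoin ℂ multiplierGens)) with
    mul_comm := fun a b =>
      (Algebra.isMulCommutative_adjoin ℂ multiplierGens_comm).is_comm.comm a b }

/-- The monomial `z₁^a z₂^b`. -/
def mono (a b : ℤ) : Multiplier := ⟨shift a b, Algebra.subset_adjoin (Or.inl ⟨a, b, rfl⟩)⟩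

theorem mono_mul (a b a' b' : ℤ) : mono a b * mono a' b' = mono (a + a') (b + b') :=
  Subtype.ext (shift_mul a b a' b')

theorem mono_zero : mono 0 0 = 1 := Subtype.ext shift_zero

/-- The variable `z₁`. -/
def z₁ : Multiplierˣ where
  val := mono 1 0
  inv := mono (-1) 0
  val_inv := by rw [mono_mul, ← mono_zero]; rfl
  inv_val := by rw [mono_mul, ← mono_zero]; rfl

/-- The variable `z₂`. -/
def z₂ : Multiplierˣ where
  val := mono 0 1
  inv := mono 0 (-1)
  val_inv := by rw [mono_mul, ← mono_zero]; rfl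
  inv_val := by rw [mono_mul, ← mono_zero]; rfl

/-- The difference `z₁ - z₂`. -/
def z₁₂ : Multiplierˣ where
  val := z₁ - z₂
  inv := ⟨dInv 1, Algebra.subset_adjoin (Or.inr rfl)⟩
  val_inv := Subtype.ext ((sub_mul_dInv 0).trans dInv_zero)
  inv_val := (mul_comm _ _).trans (Subtype.ext ((sub_mul_dInv 0).trans dInv_zero))

theorem coe_z₁₂ : (z₁₂ : Multiplier) = z₁ - z₂ := rfl

theorem z₁_zpow (a : ℤ) : ((z₁ ^ a : Multiplierˣ) : Multiplier) = mono a 0 := by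
  induction a using Int.induction_on with
  | zero => simpa using mono_zero.symm
  | succ i ih => rw [zpow_add_one, Units.val_mul, ih, show (z₁ : Multiplier) = mono 1 0 from rfl,
      mono_mul, add_zero]
  | pred i ih => rw [zpow_sub_one, Units.val_mul, ih,
      show ((z₁⁻¹ : Multiplierˣ) : Multiplier) = mono (-1) 0 from rfl, mono_mul, add_zero]; rfl

theorem z₂_zpow (a : ℤ) : ((z₂ ^ a : Multiplierˣ) : Multiplier) = mono 0 a := by
  induction a using Int.induction_on with
  | zero => simpa using mono_zero.symm
  | succ i ih => rw [zpow_add_one, Units.val_mul, ih, show (z₂ : Multiplier) = mono 0 1 from rfl,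
      mono_mul, add_zero]
  | pred i ih => rw [zpow_sub_one, Units.val_mul, ih,
      show ((z₂⁻¹ : Multiplierˣ) : Multiplier) = mono 0 (-1) from rfl, mono_mul, add_zero]; rfl

theorem mono_smul_apply (a b : ℤ) (F : TSeries) (p : ℂ) (k : ℕ) (q : ℂ) (l : ℕ) :
    (mono a b • F).1 p k q l = F.1 (p - a) k (q - b) l := rfl

theorem z₁_zpow_smul_apply (a : ℤ) (F : TSeries) (p : ℂ) (k : ℕ) (q : ℂ) (l : ℕ) :
    ((z₁ ^ a) • F).1 p k q l = F.1 (p - a) k q l := by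
  rw [Units.smul_def, z₁_zpow, mono_smul_apply, Int.cast_zero, sub_zero]

theorem z₂_zpow_smul_apply (a : ℤ) (F : TSeries) (p : ℂ) (k : ℕ) (q : ℂ) (l : ℕ) :
    ((z₂ ^ a) • F).1 p k q l = F.1 p k (q - a) l := by
  rw [Units.smul_def, z₂_zpow, mono_smul_apply, Int.cast_zero, sub_zero]

theorem z₁₂_smul (F : TSeries) : z₁₂ • F = (shift 1 0 - shift 0 1) F := rfl

theorem z₁₂_inv_pow_smul (n : ℕ) (F : TSeries) : ((z₁₂⁻¹) ^ n) • F = dInv n F := by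
  induction n with
  | zero => rw [pow_zero, one_smul, dInv_zero]; rfl
  | succ n ih =>
    rw [pow_succ', mul_smul, ih, inv_smul_eq_iff, z₁₂_smul, ← Module.End.mul_apply, sub_mul_dInv]

theorem z₁₂_zpow_smul_apply (n : ℕ) (F : TSeries) (p : ℂ) (k : ℕ) (q : ℂ) (l : ℕ) :
    ((z₁₂ ^ (-(n : ℤ))) • F).1 p k q l
      = ∑ᶠ r : ℕ, negBinom n r * F.1 (p + n + r) k (q - r) l := by
  rw [zpow_neg, zpow_natCast, ← inv_pow, z₁₂_inv_pow_smul, dInv_apply]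

end Multiplier

open Multiplier

/-- An element of `R` as a multiplier. -/
def RFraction.toMultiplier (a : RFraction) : Multiplier :=
  MvPolynomial.aeval ![(z₁ : Multiplier), (z₂ : Multiplier)] a.num
    * (((z₁ * z₂ * z₁₂) ^ (-(a.exp : ℤ)) : Multiplierˣ) : Multiplier)

/-- The expansion in the region `|z₁| > |z₂|` of multiplication by an element of `R` is the action of
the corresponding multiplier. -/
theorem RFraction.mulExpansion_eq (a : RFraction) (F : TSeries) :
    a.mulExpansion F.1 = (a.toMultiplier • F).1 := by
  have h : a.toMultiplier • F = ∑ s ∈ a.num.support, a.num.coeff s •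
      (mono ((s 0 : ℤ) - a.exp) ((s 1 : ℤ) - a.exp) • (z₁₂ ^ (-(a.exp : ℤ)) • F)) := by
    rw [RFraction.toMultiplier, MvPolynomial.aeval_def, MvPolynomial.eval₂_eq, Finset.sum_mul,
      Finset.sum_smul]
    refine Finset.sum_congr rfl fun s _ => ?_
    rw [Units.smul_def, ← mul_smul, ← smul_assoc, Algebra.smul_def, mul_assoc]
    congr 2
    rw [Finset.prod_subset (Finset.subset_univ s.support)
      (fun i _ hi => by rw [Finsupp.notMem_support_iff.mp hi, pow_zero]), Fin.prod_univ_two]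
    simp only [Matrix.cons_val_zero, Matrix.cons_val_one]
    rw [mul_zpow, mul_zpow, Units.val_mul, Units.val_mul, ← mul_assoc]
    congr 1
    rw [z₁_zpow, z₂_zpow, ← Units.val_pow_eq_pow_val, ← Units.val_pow_eq_pow_val,
      ← zpow_natCast, ← zpow_natCast, z₁_zpow, z₂_zpow, mono_mul, mono_mul, mono_mul]
    simp only [sub_eq_add_neg, add_zero, zero_add]
  rw [h]
  funext p k q l
  rw [TSeries.sum_apply, RFraction.mulExpansion]
  refine Finset.sum_congr rfl fun s _ => ?_
  rw [TSeries.smul_apply, mono_smul_apply, z₁₂_zpow_smul_apply, mul_finsum]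
  refine finsum_congr fun r => ?_
  rw [negBinom, ← mul_assoc, ← mul_assoc, ← mul_assoc]
  push_cast
  rw [show p - ((s 0 : ℂ) - 2 * a.exp - r) = p - (s 0 - a.exp) + a.exp + r by ring,
    show q - ((s 1 : ℂ) - a.exp + r) = q - (s 1 - a.exp) - r by ring]

/-- The locus where all elements of `R` are defined. -/
def IsGood (z : ℂ × ℂ) : Prop := z.1 ≠ 0 ∧ z.2 ≠ 0 ∧ z.1 ≠ z.2

/-- The multiplier `c` is the expansion of an element of `R` with values given by `φ`. -/
def Represents (c : Multiplier) (φ : ℂ × ℂ → ℂ) : Prop :=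
  ∃ a : RFraction, a.toMultiplier = c ∧ ∀ z, IsGood z → a.eval z = φ z

namespace Represents

theorem congr {c : Multiplier} {φ φ' : ℂ × ℂ → ℂ} (h : Represents c φ)
    (hφ : ∀ z, IsGood z → φ z = φ' z) : Represents c φ' := by
  obtain ⟨a, ha, hz⟩ := h
  exact ⟨a, ha, fun z hg => (hz z hg).trans (hφ z hg)⟩

theorem const (c : ℂ) : Represents (algebraMap ℂ Multiplier c) fun _ => c :=
  ⟨⟨MvPolynomial.C c, 0⟩, by simp [RFraction.toMultiplier], fun z _ => by simp [RFraction.eval]⟩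

theorem _root_.SGVA.IsGood.ne {z : ℂ × ℂ} (h : IsGood z) : z.1 * z.2 * (z.1 - z.2) ≠ 0 :=
  mul_ne_zero (mul_ne_zero h.1 h.2.1) (sub_ne_zero.mpr h.2.2)

theorem z₁z₂_eq : ((z₁ * z₂ * z₁₂ : Multiplierˣ) : Multiplier)
    = MvPolynomial.aeval ![(z₁ : Multiplier), (z₂ : Multiplier)]
      (MvPolynomial.X 0 * MvPolynomial.X 1 * (MvPolynomial.X 0 - MvPolynomial.X 1) :
        MvPolynomial (Fin 2) ℂ) := by
  simp [coe_z₁₂]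

theorem z₁z₂_eval (z : ℂ × ℂ) : z.1 * z.2 * (z.1 - z.2) = MvPolynomial.eval ![z.1, z.2]
      (MvPolynomial.X 0 * MvPolynomial.X 1 * (MvPolynomial.X 0 - MvPolynomial.X 1) :
        MvPolynomial (Fin 2) ℂ) := by
  simp

theorem mul {c c' : Multiplier} {φ φ' : ℂ × ℂ → ℂ} (h : Represents c φ)
    (h' : Represents c' φ') : Represents (c * c') fun z => φ z * φ' z := by
  obtain ⟨a, rfl, hz⟩ := h
  obtain ⟨a', rfl, hz'⟩ := h'
  refine ⟨⟨a.num * a'.num, a.exp + a'.exp⟩, ?_, fun z hg => ?_⟩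
  · simp only [RFraction.toMultiplier, map_mul, Nat.cast_add, neg_add, zpow_add, Units.val_mul]
    ring
  · beta_reduce
    rw [← hz z hg, ← hz' z hg]
    simp only [RFraction.eval, map_mul, pow_add]
    rw [div_mul_div_comm]

theorem add {c c' : Multiplier} {φ φ' : ℂ × ℂ → ℂ} (h : Represents c φ)
    (h' : Represents c' φ') : Represents (c + c') fun z => φ z + φ' z := by
  obtain ⟨a, rfl, hz⟩ := h
  obtain ⟨a', rfl, hz'⟩ := h'
  set w : MvPolynomial (Fin 2) ℂ :=
    MvPolynomial.X 0 * MvPolynomial.X 1 * (MvPolynomial.X 0 - MvPolynomial.X 1) with hw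
  have hw₁ := z₁z₂_eq
  have hw₂ := z₁z₂_eval
  rw [← hw] at hw₁
  simp only [← hw] at hw₂
  clear_value w
  generalize hx : Multiplier.z₁ * Multiplier.z₂ * Multiplier.z₁₂ = x at hw₁
  refine ⟨⟨a.num * w ^ a'.exp + a'.num * w ^ a.exp, a.exp + a'.exp⟩, ?_, fun z hg => ?_⟩
  · simp only [RFraction.toMultiplier, map_mul, map_add, map_pow, ← hw₁, hx]
    rw [← Units.val_pow_eq_pow_val, ← Units.val_pow_eq_pow_val, add_mul, mul_assoc, mul_assoc,
      ← Units.val_mul, ← Units.val_mul, ← zpow_natCast, ← zpow_natCast, ← zpow_add, ← zpow_add]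
    congr 4 <;> push_cast <;> ring
  · beta_reduce
    rw [← hz z hg, ← hz' z hg]
    simp only [RFraction.eval, map_mul, map_add, map_pow, ← hw₂]
    have := hg.ne
    rw [div_add_div _ _ (pow_ne_zero _ this) (pow_ne_zero _ this), pow_add]
    ring

theorem of_num (f : MvPolynomial (Fin 2) ℂ) :
    Represents (MvPolynomial.aeval ![(z₁ : Multiplier), (z₂ : Multiplier)] f)
      fun z => MvPolynomial.eval ![z.1, z.2] f :=
  ⟨⟨f, 0⟩, by simp [RFraction.toMultiplier], fun z _ => by simp [RFraction.eval]⟩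

theorem z₁ : Represents Multiplier.z₁ fun z => z.1 := by
  simpa using of_num (MvPolynomial.X 0)

theorem z₂ : Represents Multiplier.z₂ fun z => z.2 := by
  simpa using of_num (MvPolynomial.X 1)

theorem neg {c : Multiplier} {φ : ℂ × ℂ → ℂ} (h : Represents c φ) :
    Represents (-c) fun z => -φ z := by
  simpa using (const (-1)).mul h

theorem z₁₂ : Represents Multiplier.z₁₂ fun z => z.1 - z.2 := by
  rw [coe_z₁₂]
  simpa [sub_eq_add_neg] using z₁.add z₂.neg

/-- The inverse of `z₁ z₂ (z₁ - z₂)`, from which the inverses of its factors are obtained. -/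
theorem inv_prod : Represents (((Multiplier.z₁ * Multiplier.z₂ * Multiplier.z₁₂)⁻¹ : Multiplierˣ) :
    Multiplier) fun z => (z.1 * z.2 * (z.1 - z.2))⁻¹ :=
  ⟨⟨1, 1⟩, by simp [RFraction.toMultiplier], fun z _ => by simp [RFraction.eval]⟩

theorem inv_of_mul {a b : Multiplierˣ} {φ : ℂ × ℂ → ℂ} {c : Multiplierˣ} {χ : ℂ × ℂ → ℂ}
    (h : Represents (c⁻¹ : Multiplierˣ) χ) (hb : Represents b φ) (e : a * b = c) :
    Represents ((a⁻¹ : Multiplierˣ) : Multiplier) fun z => χ z * φ z := by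
  have : a⁻¹ = c⁻¹ * b := by rw [← e, mul_inv, mul_assoc, inv_mul_cancel, mul_one]
  rw [this, Units.val_mul]
  exact h.mul hb

theorem z₁_inv : Represents ((Multiplier.z₁⁻¹ : Multiplierˣ) : Multiplier) fun z => z.1⁻¹ := by
  refine (inv_of_mul inv_prod (z₂.mul z₁₂) (a := Multiplier.z₁)
    (b := Multiplier.z₂ * Multiplier.z₁₂) (by group)).congr fun z hz => ?_
  have := sub_ne_zero.mpr hz.2.2
  have := hz.1
  have := hz.2.1
  field_simp

theorem z₂_inv : Represents ((Multiplier.z₂⁻¹ : Multiplierˣ) : Multiplier) fun z => z.2⁻¹ := by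
  refine (inv_of_mul inv_prod (z₁.mul z₁₂) (a := Multiplier.z₂)
    (b := Multiplier.z₁ * Multiplier.z₁₂)
    (by rw [← mul_assoc, mul_comm Multiplier.z₂])).congr fun z hz => ?_
  have := sub_ne_zero.mpr hz.2.2
  have := hz.1
  have := hz.2.1
  field_simp

theorem z₁₂_inv :
    Represents ((Multiplier.z₁₂⁻¹ : Multiplierˣ) : Multiplier) fun z => (z.1 - z.2)⁻¹ := by
  refine (inv_of_mul inv_prod (z₁.mul z₂) (a := Multiplier.z₁₂)
    (b := Multiplier.z₁ * Multiplier.z₂) (mul_comm _ _)).congr fun z hz => ?_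
  have := sub_ne_zero.mpr hz.2.2
  have := hz.1
  have := hz.2.1
  field_simp

theorem pow {c : Multiplier} {φ : ℂ × ℂ → ℂ} (h : Represents c φ) (n : ℕ) :
    Represents (c ^ n) fun z => φ z ^ n := by
  induction n with
  | zero => simpa using const 1
  | succ n ih => simpa only [pow_succ] using ih.mul h

end Represents

/-! ### Derivatives of truncated series -/

/-- The derivative with respect to `z₁` on truncated series. -/
def TSeries.D₁ (F : TSeries) : TSeries := ⟨LogSeries.D₁ F.1, fun q => by
  obtain ⟨N, hN⟩ := F.2 q
  exact ⟨N, fun m hm p k l => by simp [LogSeries.D₁, hN m hm]⟩⟩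

/-- The derivative with respect to `z₂` on truncated series. -/
def TSeries.D₂ (F : TSeries) : TSeries := ⟨LogSeries.D₂ F.1, fun q => by
  obtain ⟨N, hN⟩ := F.2 (q + 1)
  refine ⟨N, fun m hm p k l => ?_⟩
  simp only [LogSeries.D₂]
  rw [show q - (m : ℂ) + 1 = q + 1 - m by ring, hN m hm, hN m hm]
  simp⟩

namespace TSeries

theorem D₁_apply (F : TSeries) (p : ℂ) (k : ℕ) (q : ℂ) (l : ℕ) : F.D₁.1 p k q l
    = (p + 1) * F.1 (p + 1) k q l + ((k : ℂ) + 1) * F.1 (p + 1) (k + 1) q l := rfl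

theorem D₂_apply (F : TSeries) (p : ℂ) (k : ℕ) (q : ℂ) (l : ℕ) : F.D₂.1 p k q l
    = (q + 1) * F.1 p k (q + 1) l + ((l : ℂ) + 1) * F.1 p k (q + 1) (l + 1) := rfl

theorem D₁_iterate_coe (F : TSeries) (j : ℕ) : (D₁^[j] F).1 = LogSeries.D₁^[j] F.1 := by
  induction j with
  | zero => rfl
  | succ j ih => rw [Function.iterate_succ_apply', Function.iterate_succ_apply', ← ih]; rfl

theorem D₂_iterate_coe (F : TSeries) (j : ℕ) : (D₂^[j] F).1 = LogSeries.D₂^[j] F.1 := by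
  induction j with
  | zero => rfl
  | succ j ih => rw [Function.iterate_succ_apply', Function.iterate_succ_apply', ← ih]; rfl

theorem D₁_add (F G : TSeries) : (F + G).D₁ = F.D₁ + G.D₁ := ext fun p k q l => by
  simp only [D₁_apply, add_apply]; ring

theorem D₂_add (F G : TSeries) : (F + G).D₂ = F.D₂ + G.D₂ := ext fun p k q l => by
  simp only [D₂_apply, add_apply]; ring

theorem D₁_smul (c : ℂ) (F : TSeries) : (c • F).D₁ = c • F.D₁ := ext fun p k q l => by
  simp only [D₁_apply, smul_apply]; ring

theorem D₂_smul (c : ℂ) (F : TSeries) : (c • F).D₂ = c • F.D₂ := ext fun p k q l => by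
  simp only [D₂_apply, smul_apply]; ring

/-- `D₁` as a linear map. -/
def D₁ₗ : Module.End ℂ TSeries := ⟨⟨D₁, D₁_add⟩, D₁_smul⟩

/-- `D₂` as a linear map. -/
def D₂ₗ : Module.End ℂ TSeries := ⟨⟨D₂, D₂_add⟩, D₂_smul⟩

theorem D₁_iterate_eq (j : ℕ) (F : TSeries) : D₁^[j] F = (D₁ₗ ^ j) F := by
  rw [Module.End.pow_apply]; rfl

theorem D₂_iterate_eq (j : ℕ) (F : TSeries) : D₂^[j] F = (D₂ₗ ^ j) F := by
  rw [Module.End.pow_apply]; rfl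

theorem z₁_smul_apply (F : TSeries) (p : ℂ) (k : ℕ) (q : ℂ) (l : ℕ) :
    (z₁ • F).1 p k q l = F.1 (p - 1) k q l := by
  simpa using z₁_zpow_smul_apply 1 F p k q l

theorem z₂_smul_apply (F : TSeries) (p : ℂ) (k : ℕ) (q : ℂ) (l : ℕ) :
    (z₂ • F).1 p k q l = F.1 p k (q - 1) l := by
  simpa using z₂_zpow_smul_apply 1 F p k q l

theorem D₁_z₁_smul (F : TSeries) : (z₁ • F).D₁ = z₁ • F.D₁ + F := ext fun p k q l => by
  simp only [D₁_apply, add_apply, z₁_smul_apply, add_sub_cancel_right, sub_add_cancel]; ring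

theorem D₂_z₂_smul (F : TSeries) : (z₂ • F).D₂ = z₂ • F.D₂ + F := ext fun p k q l => by
  simp only [D₂_apply, add_apply, z₂_smul_apply, add_sub_cancel_right, sub_add_cancel]; ring

theorem D₁_z₂_smul (F : TSeries) : (z₂ • F).D₁ = z₂ • F.D₁ := ext fun p k q l => by
  simp only [D₁_apply, z₂_smul_apply]

theorem D₂_z₁_smul (F : TSeries) : (z₁ • F).D₂ = z₁ • F.D₂ := ext fun p k q l => by
  simp only [D₂_apply, z₁_smul_apply]

theorem D₁_iterate_z₂_smul (j : ℕ) (F : TSeries) : D₁^[j] (z₂ • F) = z₂ • D₁^[j] F :=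
  Function.Semiconj.iterate_right (f := fun G : TSeries => z₂ • G)
    (fun G => (D₁_z₂_smul G).symm) j F |>.symm

theorem D₂_iterate_z₁_smul (j : ℕ) (F : TSeries) : D₂^[j] (z₁ • F) = z₁ • D₂^[j] F :=
  Function.Semiconj.iterate_right (f := fun G : TSeries => z₁ • G)
    (fun G => (D₂_z₁_smul G).symm) j F |>.symm

theorem D₁_iterate_euler (j : ℕ) (F : TSeries) :
    D₁^[j] (z₁ • F.D₁) = z₁ • D₁^[j + 1] F + (j : ℂ) • D₁^[j] F := by
  induction j with
  | zero => simp
  | succ j ih =>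
    rw [Function.iterate_succ_apply', ih, D₁_add, D₁_smul, D₁_z₁_smul,
      ← Function.iterate_succ_apply' D₁, ← Function.iterate_succ_apply' D₁]
    push_cast
    rw [add_smul, one_smul]
    abel

theorem D₂_iterate_euler (j : ℕ) (F : TSeries) :
    D₂^[j] (z₂ • F.D₂) = z₂ • D₂^[j + 1] F + (j : ℂ) • D₂^[j] F := by
  induction j with
  | zero => simp
  | succ j ih =>
    rw [Function.iterate_succ_apply', ih, D₂_add, D₂_smul, D₂_z₂_smul,
      ← Function.iterate_succ_apply' D₂, ← Function.iterate_succ_apply' D₂]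
    push_cast
    rw [add_smul, one_smul]
    abel

end TSeries

/-! ### Gradings and weights -/

section Gradings

variable {ι W : Type*} [AddCommGroup W] [Module ℂ W] {F : ι → Submodule ℂ W}

open scoped Classical in
/-- The projection onto a component of a grading. -/
def IsGrading.proj (h : IsGrading F) (i : ι) : Module.End ℂ W :=
  (F i).subtype ∘ₗ DirectSum.component ℂ ι (fun i => F i) i ∘ₗ
    (LinearEquiv.ofBijective (DirectSum.coeLinearMap F)
      (DirectSum.isInternal_submodule_of_iSupIndep_of_iSup_eq_top h.1 h.2)).symm.toLinearMap

open scoped Classical in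
theorem IsGrading.proj_of_mem_aux (h : IsGrading F) (i j : ι) (w : W) (hw : w ∈ F j) :
    h.proj i w = if i = j then w else 0 := by
  have e : (LinearEquiv.ofBijective (DirectSum.coeLinearMap F)
      (DirectSum.isInternal_submodule_of_iSupIndep_of_iSup_eq_top h.1 h.2)).symm w
      = DirectSum.lof ℂ ι (fun i => F i) j ⟨w, hw⟩ := by
    rw [LinearEquiv.symm_apply_eq]
    exact (DirectSum.coeLinearMap_lof F j ⟨w, hw⟩).symm
  simp only [IsGrading.proj, LinearMap.comp_apply, LinearEquiv.coe_coe, e]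
  split_ifs with hij
  · subst hij
    rw [DirectSum.component.lof_self]; rfl
  · rw [DirectSum.component.of, dif_neg (Ne.symm hij)]; rfl

theorem IsGrading.proj_of_mem (h : IsGrading F) {i : ι} {w : W} (hw : w ∈ F i) :
    h.proj i w = w := by rw [h.proj_of_mem_aux i i w hw, if_pos rfl]

theorem IsGrading.proj_of_mem_ne (h : IsGrading F) {i j : ι} (hij : i ≠ j) {w : W} (hw : w ∈ F j) :
    h.proj i w = 0 := by rw [h.proj_of_mem_aux i j w hw, if_neg hij]

/-- If the components of a spanning family lie in the members of an independent family, the two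
families agree. -/
theorem eq_of_le_of_iSupIndep {G : ι → Submodule ℂ W} (hG : iSupIndep G) (hF : iSup F = ⊤)
    (hle : ∀ i, F i ≤ G i) (i : ι) : F i = G i := by
  refine le_antisymm (hle i) fun w hw => ?_
  have hw' : w ∈ F i ⊔ ⨆ (j) (_ : j ≠ i), F j := by
    have : F i ⊔ ⨆ (j) (_ : j ≠ i), F j = ⊤ := by
      rw [eq_top_iff, ← hF]
      refine iSup_le fun j => ?_
      by_cases hj : j = i
      · exact hj ▸ le_sup_left
      · exact le_trans (le_iSup₂_of_le j hj le_rfl) le_sup_right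
    rw [this]; trivial
  obtain ⟨a, ha, b, hb, rfl⟩ := Submodule.mem_sup.mp hw'
  have hb' : b ∈ ⨆ (j) (_ : j ≠ i), G j := (iSup₂_mono fun j _ => hle j) hb
  have hb'' : b ∈ G i := by
    have := (G i).sub_mem hw (hle i ha)
    rwa [add_sub_cancel_left] at this
  have := Submodule.disjoint_def.mp (hG i) b hb'' hb'
  rw [this, add_zero]
  exact ha

end Gradings

/-! ### Consequences of the Jacobi identity -/

section Jacobi

variable {K U X W₂ W₃ : Type*} [Ring K] [AddCommGroup X] [Module ℂ X]
  [AddCommGroup W₂] [Module ℂ W₂] [AddCommGroup W₃] [Module ℂ W₃]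
  {y₁ : U → ℤ → Module.End ℂ X} {y₂ : U → ℤ → Module.End ℂ W₂} {y₃ : U → ℤ → Module.End ℂ W₃}
  {I : K → X → W₂ → W₃}

/-- The commutator formula. -/
theorem JacobiIdentity.commutator (h : JacobiIdentity y₁ y₂ y₃ I) (u : U) (x : X) (w : W₂) (m : ℤ)
    (n : K) : y₃ u m (I n x w) - I n x (y₂ u m w)
      = ∑ᶠ i : ℕ, ((Ring.choose m i : ℤ) : ℂ) • I ((m : K) + n - (i : K)) (y₁ u i x) w := by
  have e := h u x w 0 m n
  rw [finsum_eq_single _ 0] at e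
  · simpa using e
  · intro i hi
    obtain ⟨i, rfl⟩ := Nat.exists_eq_succ_of_ne_zero hi
    simp [Ring.choose_zero_succ]

theorem JacobiIdentity.commutator_sum (h : JacobiIdentity y₁ y₂ y₃ I) {u : U} {x : X} {N : ℕ}
    (hN : ∀ i : ℕ, N ≤ i → y₁ u i x = 0) (w : W₂) (h0 : ∀ n, I n 0 w = 0) (m : ℤ)
    (n : K) : y₃ u m (I n x w) - I n x (y₂ u m w)
      = ∑ i ∈ Finset.range N, ((Ring.choose m i : ℤ) : ℂ) •
          I ((m : K) + n - (i : K)) (y₁ u i x) w := by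
  rw [h.commutator]
  refine finsum_eq_sum_of_support_subset _ fun i hi => ?_
  by_contra hlt
  simp only [Finset.coe_range, Set.mem_Iio, not_lt] at hlt
  exact hi (by simp [hN i hlt, h0])

theorem ringChoose_neg_one (i : ℕ) : (Ring.choose (-1 : ℤ) i : ℤ) = (-1) ^ i := by
  rw [Ring.choose_neg, show (1 : ℤ) + i - 1 = (i : ℕ) by ring, Ring.choose_natCast,
    Nat.choose_self]
  simp [Units.smul_def, Int.negOnePow_def]

/-- The associator formula for the mode `u_{-1}`. -/
theorem JacobiIdentity.associator_sum (h : JacobiIdentity y₁ y₂ y₃ I) {u : U} {x : X} {w : W₂}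
    {n : K} {N : ℕ} (h0 : ∀ n, I n x 0 = 0)
    (hI : ∀ i : ℕ, N ≤ i → I (n + i) x w = 0) (hN : ∀ i : ℕ, N ≤ i → y₂ u i w = 0) :
    I n (y₁ u (-1) x) w = ∑ i ∈ Finset.range N,
      (y₃ u (-1 - i) (I (n + i) x w) + I (n - 1 - i) x (y₂ u i w)) := by
  have e := h u x w (-1) 0 n
  have e2 : ∑ᶠ i : ℕ, ((Ring.choose (0 : ℤ) i : ℤ) : ℂ) •
      I (((0 : ℤ) : K) + n - (i : K)) (y₁ u (-1 + i) x) w = I n (y₁ u (-1) x) w := by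
    rw [finsum_eq_single _ 0]
    · simp
    · intro i hi
      obtain ⟨i, rfl⟩ := Nat.exists_eq_succ_of_ne_zero hi
      simp [Ring.choose_zero_succ]
  rw [← e2, ← e, finsum_eq_sum_of_support_subset (s := Finset.range N)]
  · refine Finset.sum_congr rfl fun i _ => ?_
    rw [ringChoose_neg_one]
    push_cast
    rw [← mul_pow]
    simp [sub_eq_add_neg, add_comm]
  · intro i hi
    by_contra hlt
    simp only [Finset.coe_range, Set.mem_Iio, not_lt] at hlt
    exact hi (by simp [hN i hlt, h0, hI i hlt])

end Jacobi

/-! ### Weights of modes -/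

section Weights

variable {V : Type v} [AddCommGroup V] [Module ℂ V] (𝒱 : ConformalVertexAlgebra V)
  {W : Type u} [AddCommGroup W] [Module ℂ W]

/-- The commutator of `L(0)` with the modes of a vector of weight `h`, for any operators that satisfy
the Jacobi identity and the `L(-1)`-derivative property. -/
theorem commutator_L0 {y : V → ℤ → Module.End ℂ W} (hs : ∀ (c : ℂ) v n, y (c • v) n = c • y v n)
    (hj : JacobiIdentity (fun u n => 𝒱.Y u n) y y (fun (n : ℤ) x w => y x n w))
    (hd : ∀ (v : V) (n : ℤ), y (𝒱.Y 𝒱.ω 0 v) n = (-(n : ℂ)) • y v (n - 1)) {h : ℤ} {v : V}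
    (hv : v ∈ 𝒱.wt h) (k : ℤ) (w : W) :
    y 𝒱.ω 1 (y v k w) = y v k (y 𝒱.ω 1 w) + ((h : ℂ) - k - 1) • y v k w := by
  have e := hj.commutator 𝒱.ω v w 1 k
  rw [finsum_eq_sum_of_support_subset (s := Finset.range 2)] at e
  · rw [Finset.sum_range_succ, Finset.sum_range_one] at e
    simp only [Nat.cast_zero, Nat.cast_one, Ring.choose_zero_right, Int.cast_one, one_smul,
      Ring.choose_one_right, hd, 𝒱.weight h v hv, hs] at e
    rw [sub_eq_iff_eq_add] at e
    rw [e]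
    simp only [sub_zero, LinearMap.smul_apply, add_sub_cancel_left]
    push_cast
    module
  · intro i hi
    by_contra hlt
    simp only [Finset.coe_range, Set.mem_Iio, not_lt] at hlt
    refine hi ?_
    have : Ring.choose (1 : ℤ) i = 0 := by
      rw [show (1 : ℤ) = ((1 : ℕ) : ℤ) by rfl, Ring.choose_natCast, Nat.choose_eq_zero_of_lt hlt]
      rfl
    simp [this]

theorem ConformalVertexAlgebra.mem_wt_iff (n : ℤ) (v : V) :
    v ∈ 𝒱.wt n ↔ 𝒱.Y 𝒱.ω 1 v = (n : ℂ) • v := by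
  have h1 : iSupIndep fun n : ℤ => Module.End.eigenspace (𝒱.Y 𝒱.ω 1) (n : ℂ) :=
    (Module.End.eigenspaces_iSupIndep (𝒱.Y 𝒱.ω 1)).comp Int.cast_injective
  have := eq_of_le_of_iSupIndep h1 𝒱.isInternal.submodule_iSup_eq_top
    (fun n v hv => Module.End.mem_eigenspace_iff.mpr (𝒱.weight n v hv)) n
  rw [this, Module.End.mem_eigenspace_iff]

theorem ConformalVertexAlgebra.mode_mem_wt {h m : ℤ} {v w : V} (hv : v ∈ 𝒱.wt h)
    (hw : w ∈ 𝒱.wt m) (k : ℤ) : 𝒱.Y v k w ∈ 𝒱.wt (h + m - k - 1) := by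
  rw [𝒱.mem_wt_iff]
  have := commutator_L0 𝒱 (y := fun u n => 𝒱.Y u n) (fun c v n => by simp) 𝒱.jacobi 𝒱.derivative
    hv k w
  rw [this, 𝒱.weight m w hw, map_smul]
  push_cast
  module

theorem ConformalVertexAlgebra.isGrading : IsGrading 𝒱.wt :=
  ⟨𝒱.isInternal.submodule_iSupIndep, 𝒱.isInternal.submodule_iSup_eq_top⟩

theorem ConformalVertexAlgebra.component_of_mem {h : ℤ} {v : V} (hv : v ∈ 𝒱.wt h) :
    𝒱.component h v = v := by
  have e : (LinearEquiv.ofBijective (DirectSum.coeLinearMap 𝒱.wt) 𝒱.isInternal).symm v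
      = DirectSum.lof ℂ ℤ (fun i => 𝒱.wt i) h ⟨v, hv⟩ := by
    rw [LinearEquiv.symm_apply_eq]
    exact (DirectSum.coeLinearMap_lof 𝒱.wt h ⟨v, hv⟩).symm
  rw [ConformalVertexAlgebra.component, e]
  exact congrArg Subtype.val (DirectSum.component.lof_self (R := ℂ) (M := fun i => 𝒱.wt i) h ⟨v, hv⟩)

theorem ConformalVertexAlgebra.component_of_mem_ne {h k : ℤ} (hk : k ≠ h) {v : V}
    (hv : v ∈ 𝒱.wt h) : 𝒱.component k v = 0 := by
  have e : (LinearEquiv.ofBijective (DirectSum.coeLinearMap 𝒱.wt) 𝒱.isInternal).symm v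
      = DirectSum.lof ℂ ℤ (fun i => 𝒱.wt i) h ⟨v, hv⟩ := by
    rw [LinearEquiv.symm_apply_eq]
    exact (DirectSum.coeLinearMap_lof 𝒱.wt h ⟨v, hv⟩).symm
  rw [ConformalVertexAlgebra.component, e]
  exact congrArg Subtype.val
    ((DirectSum.component.of (R := ℂ) (M := fun i => 𝒱.wt i) k h ⟨v, hv⟩).trans (dif_neg hk.symm))

variable {𝒱}

theorem GeneralizedModule.wt_eq (M : GeneralizedModule 𝒱 W) (n : ℂ) :
    M.wt n = (M.Y 𝒱.ω 1).maxGenEigenspace n := by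
  refine eq_of_le_of_iSupIndep (Module.End.independent_maxGenEigenspace _) M.isGrading.2
    (fun n w hw => ?_) n
  obtain ⟨k, hk⟩ := M.weight n w hw
  exact (Module.End.mem_maxGenEigenspace _ _ _).mpr ⟨k, hk⟩

theorem GeneralizedModule.mode_mem_wt (M : GeneralizedModule 𝒱 W) {h : ℤ} {m : ℂ} {v : V} {w : W}
    (hv : v ∈ 𝒱.wt h) (hw : w ∈ M.wt m) (k : ℤ) : M.Y v k w ∈ M.wt (m + (h - k - 1)) := by
  rw [M.wt_eq, Module.End.mem_maxGenEigenspace] at hw ⊢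
  obtain ⟨r, hr⟩ := hw
  refine ⟨r, ?_⟩
  have key : ∀ (r : ℕ) (w : W), ((M.Y 𝒱.ω 1 - (m + (h - k - 1)) • (1 : Module.End ℂ W)) ^ r)
      (M.Y v k w) = M.Y v k (((M.Y 𝒱.ω 1 - m • (1 : Module.End ℂ W)) ^ r) w) := by
    intro r
    induction r with
    | zero => intro w; simp
    | succ r ih =>
      intro w
      rw [pow_succ, pow_succ, Module.End.mul_apply, Module.End.mul_apply, ← ih]
      congr 1
      have := commutator_L0 𝒱 (y := fun u n => M.Y u n) (fun c v n => by simp) M.jacobi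
        M.derivative hv k w
      simp only [LinearMap.sub_apply, LinearMap.smul_apply, Module.End.one_apply, map_sub, map_smul,
        this]
      module
  rw [key, hr, map_zero]

end Weights

/-! ### Adjoint modes -/

section Adjoint

variable {B : Type*} [AddCommGroup B] {A : AddSubgroup B}
  {V : Type v} [AddCommGroup V] [Module ℂ V] {𝒱 : StronglyGradedCVA A V}
  {W : Type u} [AddCommGroup W] [Module ℂ W] (M : StronglyGradedModule 𝒱 W)

theorem StronglyGradedCVA.L1_pow_mem {h : ℤ} {α : A} {v : V} (hv : v ∈ 𝒱.wt h ⊓ 𝒱.gr α) (j : ℕ) :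
    ((𝒱.L 1) ^ j) v ∈ 𝒱.wt (h - j) ⊓ 𝒱.gr α := by
  induction j with
  | zero => simpa using hv
  | succ j ih =>
    rw [pow_succ', Module.End.mul_apply]
    refine ⟨?_, ?_⟩
    · have := 𝒱.mode_mem_wt 𝒱.ω_mem ih.1 (1 + 1)
      rwa [show (2 : ℤ) + (h - j) - (1 + 1) - 1 = h - (j + 1 : ℕ) by push_cast; ring] at this
    · have := 𝒱.mode_gr 0 α 𝒱.ω 𝒱.ω_gr _ ih.2 (1 + 1)
      rwa [zero_add] at this

theorem StronglyGradedCVA.L1_pow_eq_zero {h : ℤ} {α : A} {v : V} (hv : v ∈ 𝒱.wt h ⊓ 𝒱.gr α) :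
    ∃ J : ℕ, ∀ j ≥ J, ((𝒱.L 1) ^ j) v = 0 := by
  obtain ⟨N, hN⟩ := 𝒱.gr_lower α
  refine ⟨(h - N).toNat + 1, fun j hj => ?_⟩
  have := 𝒱.L1_pow_mem hv j
  rw [hN _ (by omega)] at this
  exact (Submodule.mem_bot _).mp this

namespace StronglyGradedModule

/-- The finite sum that expresses the adjoint of a mode of a homogeneous vector. -/
theorem adjointMode_eq {h : ℤ} {v : V} (hv : v ∈ 𝒱.wt h) {J : ℕ}
    (hJ : ∀ j ≥ J, ((𝒱.L 1) ^ j) v = 0) (n : ℤ) :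
    M.adjointMode v n = ∑ i ∈ Finset.range J, ((-1 : ℂ) ^ h * ((Nat.factorial i : ℕ) : ℂ)⁻¹) •
      M.Y (((𝒱.L 1) ^ i) v) (2 * h - i - n - 2) := by
  classical
  rw [StronglyGradedModule.adjointMode, finsum_eq_sum_of_support_subset (s :=
    (Finset.range J).map ⟨fun i : ℕ => ((h, i) : ℤ × ℕ), fun a b hab => (Prod.ext_iff.mp hab).2⟩)]
  · rw [Finset.sum_map]
    refine Finset.sum_congr rfl fun i _ => ?_
    change ((-1 : ℂ) ^ h * ((Nat.factorial i : ℕ) : ℂ)⁻¹) •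
      M.Y (((𝒱.L 1) ^ i) (𝒱.component h v)) (2 * h - i - n - 2) = _
    rw [𝒱.component_of_mem hv]
  · rintro ⟨k, i⟩ hki
    simp only [Finset.coe_map, Set.mem_image, Finset.mem_coe,
      Finset.mem_range]
    by_cases hk : k = h
    · subst hk
      refine ⟨i, ?_, rfl⟩
      by_contra hlt
      refine hki ?_
      simp only
      rw [𝒱.component_of_mem hv, hJ i (not_lt.mp hlt)]
      simp
    · exfalso
      refine hki ?_
      simp only
      rw [𝒱.component_of_mem_ne hk hv]
      simp

theorem mode_mem {h : ℤ} {α : A} {v : V} (hv : v ∈ 𝒱.wt h ⊓ 𝒱.gr α) {m : ℂ} {β : B} {w : W}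
    (hw : w ∈ M.wt m ⊓ M.gr β) (k : ℤ) :
    M.Y v k w ∈ M.wt (m + (h - k - 1)) ⊓ M.gr ((α : B) + β) :=
  ⟨M.mode_mem_wt hv.1 hw.1 k, M.mode_gr α β v hv.2 w hw.2 k⟩

theorem adjointMode_mem {h : ℤ} {α : A} {v : V} (hv : v ∈ 𝒱.wt h ⊓ 𝒱.gr α) {m : ℂ} {β : B} {w : W}
    (hw : w ∈ M.wt m ⊓ M.gr β) (k : ℤ) :
    M.adjointMode v k w ∈ M.wt (m + (k + 1 - h)) ⊓ M.gr ((α : B) + β) := by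
  obtain ⟨J, hJ⟩ := 𝒱.L1_pow_eq_zero hv
  rw [M.adjointMode_eq hv.1 hJ, LinearMap.sum_apply]
  refine Submodule.sum_mem _ fun i _ => ?_
  rw [LinearMap.smul_apply]
  refine Submodule.smul_mem _ _ ?_
  convert M.mode_mem (𝒱.L1_pow_mem hv i) hw (2 * h - i - k - 2) using 3
  push_cast
  ring

/-- Adjoint modes of sufficiently negative index annihilate a given vector. -/
theorem adjointMode_eq_zero {h : ℤ} {α : A} {v : V} (hv : v ∈ 𝒱.wt h ⊓ 𝒱.gr α) {m : ℂ} {β : B}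
    {w : W} (hw : w ∈ M.wt m ⊓ M.gr β) :
    ∃ N : ℕ, ∀ i : ℕ, N ≤ i → M.adjointMode v (-1 - i) w = 0 := by
  obtain ⟨N, hN⟩ := M.gr_lower ((α : B) + β) m
  refine ⟨(-h - N).toNat + 1, fun i hi => ?_⟩
  have h1 := M.adjointMode_mem hv hw (-1 - i)
  have e : m + (((-1 - (i : ℤ) : ℤ) : ℂ) + 1 - h) = m + ((-i - h : ℤ) : ℂ) := by push_cast; ring
  rw [e, hN _ (by omega)] at h1
  exact (Submodule.mem_bot _).mp h1

/-- Taking adjoints is an involution: the mode `v_{-1}` is the adjoint of the contragredient action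
of a combination of modes. -/
theorem mode_eq_sum_adjointMode {h : ℤ} {α : A} {v : V} (hv : v ∈ 𝒱.wt h ⊓ 𝒱.gr α) {J : ℕ}
    (hJ : ∀ j ≥ J, ((𝒱.L 1) ^ j) v = 0) (hJ0 : 0 < J) (w : W) :
    M.Y v (-1) w = ∑ j ∈ Finset.range J, ((-1 : ℂ) ^ h * ((Nat.factorial j : ℕ) : ℂ)⁻¹) •
      M.adjointMode (((𝒱.L 1) ^ j) v) (2 * h - j - 1) w := by
  have e1 : ∀ j ∈ Finset.range J, ((-1 : ℂ) ^ h * ((Nat.factorial j : ℕ) : ℂ)⁻¹) •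
      M.adjointMode (((𝒱.L 1) ^ j) v) (2 * h - j - 1) w
      = ∑ k ∈ Finset.range J, ((((-1 : ℂ) ^ j * (k.choose j : ℕ)) * ((Nat.factorial k : ℕ) : ℂ)⁻¹) •
        M.Y (((𝒱.L 1) ^ k) v) (-1 - k) w) := by
    intro j hj
    have hjJ := Finset.mem_range.mp hj
    rw [M.adjointMode_eq (𝒱.L1_pow_mem hv j).1 (J := J - j) (fun i hi => by
      rw [← Module.End.mul_apply, ← pow_add]; exact hJ _ (by omega))]
    rw [LinearMap.sum_apply, Finset.smul_sum]
    conv_rhs => rw [← Nat.add_sub_cancel' hjJ.le]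
    rw [Finset.sum_range_add]
    rw [Finset.sum_eq_zero (s := Finset.range j) (fun k hk => by
      rw [Nat.choose_eq_zero_of_lt (Finset.mem_range.mp hk)]; simp), zero_add]
    refine Finset.sum_congr rfl fun i _ => ?_
    rw [LinearMap.smul_apply, smul_smul, ← Module.End.mul_apply, ← pow_add, add_comm i j]
    congr 1
    · have hc : ((j + i).choose j : ℂ) * (Nat.factorial j) * (Nat.factorial i)
          = (Nat.factorial (j + i)) := by
        have := Nat.add_choose_mul_factorial_mul_factorial j i
        rw [← Nat.choose_symm_add] at this
        exact_mod_cast this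
      have hi : ((Nat.factorial i : ℕ) : ℂ) ≠ 0 := Nat.cast_ne_zero.mpr (Nat.factorial_ne_zero i)
      have hj : ((Nat.factorial j : ℕ) : ℂ) ≠ 0 := Nat.cast_ne_zero.mpr (Nat.factorial_ne_zero j)
      have hij : ((Nat.factorial (j + i) : ℕ) : ℂ) ≠ 0 :=
        Nat.cast_ne_zero.mpr (Nat.factorial_ne_zero _)
      have hs : (-1 : ℂ) ^ h * (-1 : ℂ) ^ (h - j) = (-1) ^ j := by
        rw [← zpow_add₀ (by norm_num), show h + (h - j) = 2 * (h - j) + j by ring,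
          zpow_add₀ (by norm_num), zpow_mul]
        norm_num
      rw [show (-1 : ℂ) ^ h * ((Nat.factorial j : ℕ) : ℂ)⁻¹ * ((-1) ^ (h - j) *
        ((Nat.factorial i : ℕ) : ℂ)⁻¹) = ((-1 : ℂ) ^ h * (-1) ^ (h - j)) *
        (((Nat.factorial j : ℕ) : ℂ)⁻¹ * ((Nat.factorial i : ℕ) : ℂ)⁻¹) by ring, hs]
      rw [mul_assoc]
      congr 1
      field_simp
      rw [← hc]; ring
    · congr 2
      push_cast
      ring_nf
  rw [Finset.sum_congr rfl e1, Finset.sum_comm, Finset.sum_eq_single 0]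
  · rw [Finset.sum_eq_single 0]
    · simp
    · intro j _ hj
      rw [Nat.choose_eq_zero_of_lt (Nat.pos_of_ne_zero hj)]
      simp
    · intro h0
      exact absurd (Finset.mem_range.mpr hJ0) h0
  · intro k hk hk0
    rw [← Finset.sum_smul, ← Finset.sum_mul]
    have hs : ∑ j ∈ Finset.range J, (-1 : ℂ) ^ j * (k.choose j : ℕ) = 0 := by
      have hkJ := Finset.mem_range.mp hk
      rw [← Finset.sum_subset (Finset.range_mono (show k + 1 ≤ J by omega))]
      · have := Int.alternating_sum_range_choose (n := k)
        rw [if_neg hk0] at this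
        exact_mod_cast this
      · intro j _ hj
        simp only [Finset.mem_range, not_lt] at hj
        rw [Nat.choose_eq_zero_of_lt (by omega)]
        simp
    rw [hs, zero_mul, zero_smul]
  · intro h0
    exact absurd (Finset.mem_range.mpr hJ0) h0

end StronglyGradedModule

end Adjoint

/-! ### Relations among matrix elements -/

open Multiplier

section Correlation

variable {W₀ W₁ W₂ W₃ W₄ : Type*} [AddCommGroup W₀] [Module ℂ W₀]
    [AddCommGroup W₁] [Module ℂ W₁] [AddCommGroup W₂] [Module ℂ W₂] [AddCommGroup W₃] [Module ℂ W₃]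
    [AddCommGroup W₄] [Module ℂ W₄] (I₁ : ℂ → ℕ → W₁ →ₗ[ℂ] W₄ →ₗ[ℂ] Module.Dual ℂ W₀)
    (I₂ : ℂ → ℕ → W₂ →ₗ[ℂ] W₃ →ₗ[ℂ] W₄)
    (hT : ∀ w₂ w₃ n, ∃ N : ℕ, ∀ m : ℕ, N ≤ m → ∀ k, I₂ (n + m) k w₂ w₃ = 0)

/-- The matrix element `⟨w₀, 𝒴₁(w₁, z₁) 𝒴₂(w₂, z₂) w₃⟩` as a truncated series. -/
def corr (w₀ : W₀) (w₁ : W₁) (w₂ : W₂) (w₃ : W₃) : TSeries :=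
  ⟨productSeries I₁ I₂ w₀ w₁ w₂ w₃, fun q => by
    obtain ⟨N, hN⟩ := hT w₂ w₃ (-q - 1)
    refine ⟨N, fun m hm p k l => ?_⟩
    rw [productSeries, show -(q - (m : ℂ)) - 1 = -q - 1 + m by ring, hN m hm]
    simp⟩

theorem corr_apply (w₀ : W₀) (w₁ : W₁) (w₂ : W₂) (w₃ : W₃) (p : ℂ) (k : ℕ) (q : ℂ) (l : ℕ) :
    (corr I₁ I₂ hT w₀ w₁ w₂ w₃).1 p k q l = I₁ (-p - 1) k w₁ (I₂ (-q - 1) l w₂ w₃) w₀ := rfl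

/-- The matrix element as a linear function of `w₀`. -/
def corrₗ₀ (w₁ : W₁) (w₂ : W₂) (w₃ : W₃) : W₀ →ₗ[ℂ] TSeries where
  toFun w₀ := corr I₁ I₂ hT w₀ w₁ w₂ w₃
  map_add' _ _ := TSeries.ext fun p k q l => by simp [corr_apply]
  map_smul' _ _ := TSeries.ext fun p k q l => by simp [corr_apply]

/-- The matrix element as a linear function of `w₁`. -/
def corrₗ₁ (w₀ : W₀) (w₂ : W₂) (w₃ : W₃) : W₁ →ₗ[ℂ] TSeries where
  toFun w₁ := corr I₁ I₂ hT w₀ w₁ w₂ w₃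
  map_add' _ _ := TSeries.ext fun p k q l => by simp [corr_apply]
  map_smul' _ _ := TSeries.ext fun p k q l => by simp [corr_apply]

/-- The matrix element as a linear function of `w₂`. -/
def corrₗ₂ (w₀ : W₀) (w₁ : W₁) (w₃ : W₃) : W₂ →ₗ[ℂ] TSeries where
  toFun w₂ := corr I₁ I₂ hT w₀ w₁ w₂ w₃
  map_add' _ _ := TSeries.ext fun p k q l => by simp [corr_apply]
  map_smul' _ _ := TSeries.ext fun p k q l => by simp [corr_apply]

/-- The matrix element as a linear function of `w₃`. -/
def corrₗ₃ (w₀ : W₀) (w₁ : W₁) (w₂ : W₂) : W₃ →ₗ[ℂ] TSeries where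
  toFun w₃ := corr I₁ I₂ hT w₀ w₁ w₂ w₃
  map_add' _ _ := TSeries.ext fun p k q l => by simp [corr_apply]
  map_smul' _ _ := TSeries.ext fun p k q l => by simp [corr_apply]

end Correlation

/-- Reindexing of a binomial sum as an expansion coefficient of `(z₁ - z₂)^(-j-1)`. -/
theorem sum_choose_eq_finsum (j : ℕ) (f : ℕ → ℂ) {N : ℕ} (hN : ∀ i, N ≤ i → f i = 0) :
    ∑ i ∈ Finset.range N, (i.choose j : ℂ) * f i
      = ∑ᶠ r : ℕ, negBinom (j + 1) r * f (j + r) := by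
  rw [finsum_eq_sum_of_support_subset (s := Finset.range N)]
  · have h1 : ∑ i ∈ Finset.range (j + N), (i.choose j : ℂ) * f i
        = ∑ i ∈ Finset.range N, (i.choose j : ℂ) * f i := by
      symm
      refine Finset.sum_subset (Finset.range_mono (by omega)) fun i _ hi => ?_
      rw [hN i (by simpa using hi), mul_zero]
    rw [← h1, Finset.sum_range_add, Finset.sum_eq_zero (s := Finset.range j), zero_add]
    · exact Finset.sum_congr rfl fun r _ => by rw [negBinom_eq_choose]
    · intro i hi
      rw [Nat.choose_eq_zero_of_lt (Finset.mem_range.mp hi)]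
      simp
  · intro r hr
    by_contra hlt
    simp only [Finset.coe_range, Set.mem_Iio, not_lt] at hlt
    exact hr (by simp [hN (j + r) (by omega)])

theorem sum_range_eq_of_le {M : Type*} [AddCommMonoid M] {f : ℕ → M} {N N' : ℕ} (h : N ≤ N')
    (hN : ∀ i, N ≤ i → f i = 0) : ∑ i ∈ Finset.range N', f i = ∑ i ∈ Finset.range N, f i :=
  (Finset.sum_subset (Finset.range_mono h) fun i _ hi => hN i (by simpa using hi)).symm

theorem ringChoose_neg_sub (i j : ℕ) :
    (Ring.choose (-1 - (i : ℤ)) j : ℤ) = (-1) ^ j * ((i + j).choose j : ℕ) := by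
  rw [show (-1 - (i : ℤ)) = -((i : ℤ) + 1) by ring, Ring.choose_neg,
    show ((i : ℤ) + 1 + j - 1) = ((i + j : ℕ) : ℤ) by push_cast; ring, Ring.choose_natCast]
  simp [Units.smul_def, Int.negOnePow_def]

section Relations

variable {B : Type*} [AddCommGroup B] {A : AddSubgroup B}
  {V : Type v} [AddCommGroup V] [Module ℂ V] {𝒱 : StronglyGradedCVA A V}
  {W₀ W₁ W₂ W₃ W₄ : Type u} [AddCommGroup W₀] [Module ℂ W₀] [AddCommGroup W₁] [Module ℂ W₁]
  [AddCommGroup W₂] [Module ℂ W₂] [AddCommGroup W₃] [Module ℂ W₃] [AddCommGroup W₄] [Module ℂ W₄]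
  {M₀ : StronglyGradedModule 𝒱 W₀} {M₁ : StronglyGradedModule 𝒱 W₁}
  {M₂ : StronglyGradedModule 𝒱 W₂} {M₃ : StronglyGradedModule 𝒱 W₃}
  {M₄ : StronglyGradedModule 𝒱 W₄}
  {I₁ : ℂ → ℕ → W₁ →ₗ[ℂ] W₄ →ₗ[ℂ] Module.Dual ℂ W₀}
  {I₂ : ℂ → ℕ → W₂ →ₗ[ℂ] W₃ →ₗ[ℂ] W₄}

theorem contragredientY_apply (v : V) (n : ℤ) (φ : Module.Dual ℂ W₀) (w : W₀) :
    M₀.contragredientY v n φ w = φ (M₀.adjointMode v n w) := rfl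

theorem GeneralizedModule.exists_mode_eq_zero {𝒱 : ConformalVertexAlgebra V}
    (M : GeneralizedModule 𝒱 W₀) (u : V) (w : W₀) :
    ∃ N : ℕ, ∀ i : ℕ, N ≤ i → M.Y u i w = 0 := by
  obtain ⟨N, hN⟩ := M.truncated u w
  exact ⟨N.toNat, fun i hi => hN i (by omega)⟩

/-- Moving the mode `v_m` through both intertwining operators. -/
theorem corr_adjointMode (hI₁ : IsIntertwiningOfContragredientType M₁ M₄ M₀ I₁)
    (hI₂ : IsIntertwiningOfType M₂ M₃ M₄ I₂) (v : V) (m : ℤ) (w₀ : W₀) {w₁ : W₁} {w₂ : W₂} (w₃ : W₃) {N₁ N₂ : ℕ}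
    (hN₁ : ∀ i : ℕ, N₁ ≤ i → M₁.Y v i w₁ = 0) (hN₂ : ∀ i : ℕ, N₂ ≤ i → M₂.Y v i w₂ = 0) :
    corr I₁ I₂ hI₂.1.truncated (M₀.adjointMode v m w₀) w₁ w₂ w₃
      = corr I₁ I₂ hI₂.1.truncated w₀ w₁ w₂ (M₃.Y v m w₃)
        + ∑ i ∈ Finset.range N₁, ((Ring.choose m i : ℤ) : ℂ) • (z₁ ^ (m - i) •
          corr I₁ I₂ hI₂.1.truncated w₀ (M₁.Y v i w₁) w₂ w₃)
        + ∑ i ∈ Finset.range N₂, ((Ring.choose m i : ℤ) : ℂ) • (z₂ ^ (m - i) •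
          corr I₁ I₂ hI₂.1.truncated w₀ w₁ (M₂.Y v i w₂) w₃) := by
  refine TSeries.ext fun p k q l => ?_
  simp only [TSeries.add_apply, TSeries.sum_apply, TSeries.smul_apply, z₁_zpow_smul_apply,
    z₂_zpow_smul_apply, corr_apply]
  have e₁ := (hI₁.1.jacobi k).commutator_sum hN₁ (I₂ (-q - 1) l w₂ w₃) (by simp) m (-p - 1)
  have e₂ := (hI₂.1.jacobi l).commutator_sum hN₂ w₃ (by simp) m (-q - 1)
  rw [sub_eq_iff_eq_add] at e₁ e₂
  rw [← contragredientY_apply, e₁, e₂]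
  simp only [LinearMap.add_apply, map_add, LinearMap.sum_apply, map_sum, LinearMap.smul_apply,
    map_smul, smul_eq_mul]
  rw [add_comm, add_comm (Finset.sum _ _) (I₁ _ _ _ _ _), add_right_comm]
  congr 1
  · congr 1
    refine Finset.sum_congr rfl fun i _ => ?_
    congr 5
    push_cast
    ring_nf
  · refine Finset.sum_congr rfl fun i _ => ?_
    congr 5
    push_cast
    ring_nf

/-- The relation obtained by expanding the mode `u_{-1}` applied to the second argument. -/
theorem corr_mode_one (hI₁ : IsIntertwiningOfContragredientType M₁ M₄ M₀ I₁)
    (hI₂ : IsIntertwiningOfType M₂ M₃ M₄ I₂) (u : V) {w₀ : W₀} (w₁ : W₁) {w₂ : W₂} {w₃ : W₃} {N₀ N₂ N₃ : ℕ}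
    (hN₀ : ∀ i : ℕ, N₀ ≤ i → M₀.adjointMode u (-1 - i) w₀ = 0)
    (hN₂ : ∀ i : ℕ, N₂ ≤ i → M₂.Y u i w₂ = 0) (hN₃ : ∀ i : ℕ, N₃ ≤ i → M₃.Y u i w₃ = 0) :
    corr I₁ I₂ hI₂.1.truncated w₀ (M₁.Y u (-1) w₁) w₂ w₃
      = ∑ i ∈ Finset.range N₀, z₁ ^ (i : ℤ) •
          corr I₁ I₂ hI₂.1.truncated (M₀.adjointMode u (-1 - i) w₀) w₁ w₂ w₃
        + ∑ i ∈ Finset.range N₃, z₁ ^ (-1 - (i : ℤ)) •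
          corr I₁ I₂ hI₂.1.truncated w₀ w₁ w₂ (M₃.Y u i w₃)
        + ∑ j ∈ Finset.range N₂, z₁₂ ^ (-((j + 1 : ℕ) : ℤ)) •
          corr I₁ I₂ hI₂.1.truncated w₀ w₁ (M₂.Y u j w₂) w₃ := by
  refine TSeries.ext fun p k q l => ?_
  simp only [TSeries.add_apply, TSeries.sum_apply, z₁_zpow_smul_apply,
    z₁₂_zpow_smul_apply, corr_apply]
  set X := I₂ (-q - 1) l w₂ w₃ with hX
  obtain ⟨Na, ha⟩ := hI₁.1.truncated w₁ X (-p - 1)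
  obtain ⟨Nb, hb⟩ := M₄.exists_mode_eq_zero u X
  have hc : ∀ j : ℕ, ∃ N : ℕ, ∀ i, N ≤ i →
      I₂ ((i : ℂ) + (-q - 1) - j) l (M₂.Y u j w₂) w₃ = 0 := by
    intro j
    obtain ⟨N, hN⟩ := hI₂.1.truncated (M₂.Y u j w₂) w₃ (-q - 1 - j)
    exact ⟨N, fun i hi => by rw [← hN i hi l]; congr 3; ring⟩
  choose Nc hc using hc
  obtain ⟨N, hNa, hNb, hN0, hN3, hNc⟩ : ∃ N, Na ≤ N ∧ Nb ≤ N ∧ N₀ ≤ N ∧ N₃ ≤ N ∧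
      ∀ j ∈ Finset.range N₂, Nc j ≤ N :=
    ⟨Na + Nb + N₀ + N₃ + ∑ j ∈ Finset.range N₂, Nc j, by omega, by omega, by omega, by omega,
      fun j hj => (Finset.single_le_sum (f := Nc) (fun _ _ => Nat.zero_le _) hj).trans (by omega)⟩
  have e := (hI₁.1.jacobi k).associator_sum (u := u) (x := w₁) (w := X) (n := -p - 1) (N := N)
    (by simp) (fun i hi => ha i (hNa.trans hi) k) (fun i hi => hb i (hNb.trans hi))
  rw [e, LinearMap.sum_apply]
  simp only [LinearMap.add_apply, contragredientY_apply]
  have e2 : ∀ i : ℕ, M₄.Y u i X = I₂ (-q - 1) l w₂ (M₃.Y u i w₃) + ∑ j ∈ Finset.range N₂,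
      (i.choose j : ℂ) • I₂ ((i : ℂ) + (-q - 1) - j) l (M₂.Y u j w₂) w₃ := by
    intro i
    have e₂ := (hI₂.1.jacobi l).commutator_sum hN₂ w₃ (by simp) i (-q - 1)
    rw [sub_eq_iff_eq_add, add_comm] at e₂
    simp only [Ring.choose_natCast] at e₂
    exact_mod_cast e₂
  simp only [e2, map_add, LinearMap.add_apply, map_sum, LinearMap.sum_apply, map_smul,
    LinearMap.smul_apply, smul_eq_mul, Finset.sum_add_distrib]
  rw [Finset.sum_comm (s := Finset.range N)]
  rw [← add_assoc]
  congr 1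
  · congr 1
    · rw [sum_range_eq_of_le hN0 (fun i hi => by rw [hN₀ i hi]; simp)]
      refine Finset.sum_congr rfl fun i _ => ?_
      congr 4
      push_cast; ring_nf
    · rw [sum_range_eq_of_le hN3 (fun i hi => by rw [hN₃ i hi]; simp)]
      refine Finset.sum_congr rfl fun i _ => ?_
      congr 4
      push_cast; ring_nf
  · refine Finset.sum_congr rfl fun j hj => ?_
    rw [sum_choose_eq_finsum j (fun i => (I₁ (-p - 1 - 1 - i) k w₁
      (I₂ (i + (-q - 1) - j) l (M₂.Y u j w₂) w₃)) w₀)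
      (fun i hi => by rw [hc j i ((hNc j hj).trans hi)]; simp)]
    refine finsum_congr fun r => ?_
    rw [show -p - 1 - 1 - ((j + r : ℕ) : ℂ) = -(p + ((j + 1 : ℕ) : ℂ) + r) - 1 by push_cast; ring,
      show ((j + r : ℕ) : ℂ) + (-q - 1) - j = -(q - (r : ℂ)) - 1 by push_cast; ring]

/-- The relation obtained by expanding the mode `u_{-1}` applied to the third argument. -/
theorem corr_mode_two (hI₁ : IsIntertwiningOfContragredientType M₁ M₄ M₀ I₁)
    (hI₂ : IsIntertwiningOfType M₂ M₃ M₄ I₂) (u : V) {w₀ : W₀} {w₁ : W₁} (w₂ : W₂) {w₃ : W₃} {N₀ N₁ N₃ : ℕ}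
    (hN₀ : ∀ i : ℕ, N₀ ≤ i → M₀.adjointMode u (-1 - i) w₀ = 0)
    (hN₁ : ∀ i : ℕ, N₁ ≤ i → M₁.Y u i w₁ = 0) (hN₃ : ∀ i : ℕ, N₃ ≤ i → M₃.Y u i w₃ = 0) :
    corr I₁ I₂ hI₂.1.truncated w₀ w₁ (M₂.Y u (-1) w₂) w₃
      = ∑ i ∈ Finset.range N₀, z₂ ^ (i : ℤ) •
          corr I₁ I₂ hI₂.1.truncated (M₀.adjointMode u (-1 - i) w₀) w₁ w₂ w₃
        + ∑ i ∈ Finset.range N₃, z₂ ^ (-1 - (i : ℤ)) •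
          corr I₁ I₂ hI₂.1.truncated w₀ w₁ w₂ (M₃.Y u i w₃)
        - ∑ j ∈ Finset.range N₁, ((-1 : ℂ) ^ j) • (z₁₂ ^ (-((j + 1 : ℕ) : ℤ)) •
          corr I₁ I₂ hI₂.1.truncated w₀ (M₁.Y u j w₁) w₂ w₃) := by
  refine TSeries.ext fun p k q l => ?_
  simp only [TSeries.add_apply, TSeries.sub_apply, TSeries.sum_apply, z₂_zpow_smul_apply,
    z₁₂_zpow_smul_apply, TSeries.smul_apply, corr_apply]
  obtain ⟨Na, ha⟩ := hI₂.1.truncated w₂ w₃ (-q - 1)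
  obtain ⟨N, hNa, hN0, hN3⟩ : ∃ N, Na ≤ N ∧ N₀ ≤ N ∧ N₃ ≤ N :=
    ⟨Na + N₀ + N₃, by omega, by omega, by omega⟩
  have e := (hI₂.1.jacobi l).associator_sum (u := u) (x := w₂) (w := w₃) (n := -q - 1) (N := N)
    (by simp) (fun i hi => ha i (hNa.trans hi) l) (fun i hi => hN₃ i (hN3.trans hi))
  rw [e]
  have e2 : ∀ i : ℕ, I₁ (-p - 1) k w₁ (M₄.Y u (-1 - i) (I₂ (-q - 1 + i) l w₂ w₃)) w₀
      = I₁ (-p - 1) k w₁ (I₂ (-q - 1 + i) l w₂ w₃) (M₀.adjointMode u (-1 - i) w₀)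
        - ∑ j ∈ Finset.range N₁, ((-1) ^ j * ((i + j).choose j : ℂ)) *
          I₁ (-1 - i + (-p - 1) - j) k (M₁.Y u j w₁) (I₂ (-q - 1 + i) l w₂ w₃) w₀ := by
    intro i
    have e₁ := (hI₁.1.jacobi k).commutator_sum hN₁ (I₂ (-q - 1 + i) l w₂ w₃) (by simp)
      (-1 - i) (-p - 1)
    have e₁' := congrArg (fun φ : Module.Dual ℂ W₀ => φ w₀) e₁
    simp only [LinearMap.sub_apply, LinearMap.sum_apply, LinearMap.smul_apply, smul_eq_mul,
      contragredientY_apply, ringChoose_neg_sub] at e₁'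
    rw [eq_sub_iff_add_eq', ← eq_sub_iff_add_eq]
    refine Eq.trans ?_ e₁'.symm
    exact Finset.sum_congr rfl fun j _ => by push_cast; ring
  simp only [map_add, LinearMap.add_apply, map_sum, LinearMap.sum_apply, e2,
    Finset.sum_add_distrib, Finset.sum_sub_distrib]
  rw [Finset.sum_comm (s := Finset.range N), sub_add_eq_add_sub]
  congr 1
  · congr 1
    · rw [sum_range_eq_of_le hN0 (fun i hi => by rw [hN₀ i hi]; simp)]
      refine Finset.sum_congr rfl fun i _ => ?_
      congr 4
      push_cast; ring_nf
    · rw [sum_range_eq_of_le hN3 (fun i hi => by rw [hN₃ i hi]; simp)]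
      refine Finset.sum_congr rfl fun i _ => ?_
      congr 4
      push_cast; ring_nf
  · refine Finset.sum_congr rfl fun j hj => ?_
    rw [finsum_eq_sum_of_support_subset (s := Finset.range N), Finset.mul_sum]
    · refine Finset.sum_congr rfl fun i _ => ?_
      rw [negBinom_eq_choose, mul_assoc, add_comm j i,
        show -1 - (i : ℂ) + (-p - 1) - j = -(p + ((j + 1 : ℕ) : ℂ) + i) - 1 by push_cast; ring,
        show -q - 1 + (i : ℂ) = -(q - (i : ℂ)) - 1 by ring]
    · intro r hr
      by_contra hlt
      simp only [Finset.coe_range, Set.mem_Iio, not_lt] at hlt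
      refine hr ?_
      have := ha r (hNa.trans hlt) l
      simp only
      rw [show -(q - (r : ℂ)) - 1 = -q - 1 + r by ring, this]
      simp

theorem corr_D₁ (hI₁ : IsIntertwiningOfContragredientType M₁ M₄ M₀ I₁)
    (hI₂ : IsIntertwiningOfType M₂ M₃ M₄ I₂) (w₀ : W₀) (w₁ : W₁) (w₂ : W₂) (w₃ : W₃) :
    (corr I₁ I₂ hI₂.1.truncated w₀ w₁ w₂ w₃).D₁
      = corr I₁ I₂ hI₂.1.truncated w₀ (M₁.Y 𝒱.ω 0 w₁) w₂ w₃ := by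
  refine TSeries.ext fun p k q l => ?_
  have e := hI₁.1.derivative w₁ (-p - 1) k
  simp only [TSeries.D₁_apply, corr_apply]
  rw [e, show -p - 1 - 1 = -(p + 1) - 1 by ring]
  simp only [LinearMap.add_apply, LinearMap.smul_apply, smul_eq_mul]
  ring

theorem corr_D₂ (hI₂ : IsIntertwiningOfType M₂ M₃ M₄ I₂) (w₀ : W₀) (w₁ : W₁) (w₂ : W₂) (w₃ : W₃) :
    (corr I₁ I₂ hI₂.1.truncated w₀ w₁ w₂ w₃).D₂
      = corr I₁ I₂ hI₂.1.truncated w₀ w₁ (M₂.Y 𝒱.ω 0 w₂) w₃ := by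
  refine TSeries.ext fun p k q l => ?_
  have e := hI₂.1.derivative w₂ (-q - 1) l
  simp only [TSeries.D₂_apply, corr_apply]
  rw [e, show -q - 1 - 1 = -(q + 1) - 1 by ring]
  simp only [LinearMap.add_apply, LinearMap.smul_apply, smul_eq_mul, map_add, map_smul]
  ring

/-- The Euler field acts on matrix elements through weight-preserving operators. -/
theorem corr_euler (hI₁ : IsIntertwiningOfContragredientType M₁ M₄ M₀ I₁)
    (hI₂ : IsIntertwiningOfType M₂ M₃ M₄ I₂) (w₀ : W₀) (w₁ : W₁) (w₂ : W₂) (w₃ : W₃) :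
    z₁ • (corr I₁ I₂ hI₂.1.truncated w₀ w₁ w₂ w₃).D₁
      + z₂ • (corr I₁ I₂ hI₂.1.truncated w₀ w₁ w₂ w₃).D₂
      = corr I₁ I₂ hI₂.1.truncated (M₀.adjointMode 𝒱.ω 1 w₀) w₁ w₂ w₃
        - corr I₁ I₂ hI₂.1.truncated w₀ (M₁.Y 𝒱.ω 1 w₁) w₂ w₃
        - corr I₁ I₂ hI₂.1.truncated w₀ w₁ (M₂.Y 𝒱.ω 1 w₂) w₃
        - corr I₁ I₂ hI₂.1.truncated w₀ w₁ w₂ (M₃.Y 𝒱.ω 1 w₃) := by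
  obtain ⟨N₁, hN₁⟩ := M₁.exists_mode_eq_zero 𝒱.ω w₁
  obtain ⟨N₂, hN₂⟩ := M₂.exists_mode_eq_zero 𝒱.ω w₂
  have h2 : ∀ i : ℕ, 2 ≤ i → ((Ring.choose (1 : ℤ) i : ℤ) : ℂ) = 0 := by
    intro i hi
    rw [show (1 : ℤ) = ((1 : ℕ) : ℤ) by rfl, Ring.choose_natCast, Nat.choose_eq_zero_of_lt hi]
    simp
  rw [corr_adjointMode hI₁ hI₂ 𝒱.ω 1 w₀ w₃
    (fun i hi => hN₁ i (le_trans (Nat.le_add_right N₁ 2) hi))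
    (fun i hi => hN₂ i (le_trans (Nat.le_add_right N₂ 2) hi)),
    sum_range_eq_of_le (Nat.le_add_left 2 N₁) (fun i hi => by rw [h2 i hi, zero_smul]),
    sum_range_eq_of_le (Nat.le_add_left 2 N₂) (fun i hi => by rw [h2 i hi, zero_smul]),
    corr_D₁ hI₁ hI₂, corr_D₂ hI₂]
  simp only [Finset.sum_range_succ, Finset.sum_range_zero, Ring.choose_zero_right,
    Ring.choose_one_right]
  simp
  abel

end Relations

/-! ### Finiteness of degrees and generators modulo `C₁` -/

section Fusion

variable {B : Type*} [AddCommGroup B] {A : AddSubgroup B}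
  {V : Type v} [AddCommGroup V] [Module ℂ V] {𝒱 : StronglyGradedCVA A V}
  {W₀ W₁ W₂ W₃ W₄ : Type u} [AddCommGroup W₀] [Module ℂ W₀] [AddCommGroup W₁] [Module ℂ W₁]
  [AddCommGroup W₂] [Module ℂ W₂] [AddCommGroup W₃] [Module ℂ W₃] [AddCommGroup W₄] [Module ℂ W₄]
  {M₀ : StronglyGradedModule 𝒱 W₀} {M₁ : StronglyGradedModule 𝒱 W₁}
  {M₂ : StronglyGradedModule 𝒱 W₂} {M₃ : StronglyGradedModule 𝒱 W₃}
  {M₄ : StronglyGradedModule 𝒱 W₄}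
  {I₁ : ℂ → ℕ → W₁ →ₗ[ℂ] W₄ →ₗ[ℂ] Module.Dual ℂ W₀}
  {I₂ : ℂ → ℕ → W₂ →ₗ[ℂ] W₃ →ₗ[ℂ] W₄}

theorem contragredientGr_apply_eq_zero {β γ : B} {φ : Module.Dual ℂ W₀}
    (hφ : φ ∈ M₀.contragredientGr β) {w : W₀} (hw : w ∈ M₀.gr γ) (h : γ ≠ -β) : φ w = 0 := by
  rw [StronglyGradedModule.contragredientGr] at hφ
  induction hφ using Submodule.iSup_induction' with
  | zero => simp
  | add x y _ _ hx hy => rw [LinearMap.add_apply, hx, hy, add_zero]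
  | mem n φ hφ =>
    rw [M₀.compatible γ] at hw
    induction hw using Submodule.iSup_induction' with
    | zero => simp
    | add x y _ _ hx hy => rw [map_add, hx, hy, add_zero]
    | mem m w hw =>
      simp only [StronglyGradedModule.contragredientWtGr, Submodule.mem_iInf] at hφ
      exact (Submodule.mem_dualAnnihilator _).mp (hφ m γ fun hc => h hc.2) w hw

theorem corr_eq_zero_of_degree (hI₁ : IsIntertwiningOfContragredientType M₁ M₄ M₀ I₁)
    (hI₂ : IsIntertwiningOfType M₂ M₃ M₄ I₂) {γ₀ γ₁ γ₂ γ₃ : B} {w₀ : W₀} {w₁ : W₁} {w₂ : W₂}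
    {w₃ : W₃} (h₀ : w₀ ∈ M₀.gr γ₀) (h₁ : w₁ ∈ M₁.gr γ₁) (h₂ : w₂ ∈ M₂.gr γ₂) (h₃ : w₃ ∈ M₃.gr γ₃)
    (h : γ₀ ≠ -(γ₁ + (γ₂ + γ₃))) : corr I₁ I₂ hI₂.1.truncated w₀ w₁ w₂ w₃ = 0 :=
  TSeries.ext fun p k q l => contragredientGr_apply_eq_zero
    (hI₁.2 _ _ w₁ h₁ _ (hI₂.2 _ _ w₂ h₂ w₃ h₃ (-q - 1) l) (-p - 1) k) h₀ h

theorem eq_zero_of_rank_eq_zero {X : Type*} [AddCommGroup X] [Module ℂ X] (S : Submodule ℂ X)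
    (h : Module.rank ℂ S = 0) {x : X} (hx : x ∈ S) : x = 0 := by
  have := rank_zero_iff.mp h
  exact congrArg Subtype.val (Subsingleton.elim (⟨x, hx⟩ : S) 0)

/-- If a fusion rule vanishes, so does the corresponding restriction of an intertwining operator. -/
theorem eq_zero_of_fusionRule_eq_zero (hI₂ : IsIntertwiningOfType M₂ M₃ M₄ I₂) {γ₂ γ₃ : B}
    (h : fusionRule M₂ M₃ M₄ γ₂ γ₃ = 0) {w₂ : W₂} {w₃ : W₃} (h₂ : w₂ ∈ M₂.gr γ₂)
    (h₃ : w₃ ∈ M₃.gr γ₃) (n : ℂ) (k : ℕ) : I₂ n k w₂ w₃ = 0 := by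
  let J : ℂ → ℕ → M₂.gr γ₂ →ₗ[ℂ] M₃.gr γ₃ →ₗ[ℂ] M₄.gr (γ₂ + γ₃) := fun n k =>
    LinearMap.mk₂ ℂ (fun x y => ⟨I₂ n k x y, hI₂.2 _ _ _ x.2 _ y.2 n k⟩)
      (fun _ _ _ => Subtype.ext (by simp)) (fun _ _ _ => Subtype.ext (by simp))
      (fun _ _ _ => Subtype.ext (by simp)) (fun _ _ _ => Subtype.ext (by simp))
  have hcoe : ∀ n k x y, (J n k x y : W₄) = I₂ n k x y := fun _ _ _ _ => rfl
  have hJ : J ∈ logIntertwiningSpace (⟨𝒱.ω, 𝒱.ω_gr⟩ : 𝒱.gr 0)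
      (M₂.zeroAction γ₂) (M₃.zeroAction γ₃) (M₄.zeroAction (γ₂ + γ₃))
      (M₂.zeroAction_truncated γ₂) (M₃.zeroAction_truncated γ₃) := by
    refine ⟨fun x y n => ?_, fun x y n => ?_, fun k u x w l m n => ?_, fun x n k => ?_⟩
    · obtain ⟨K, hK⟩ := hI₂.1.log_finite x y n
      exact ⟨K, fun k hk => Subtype.ext (hK k hk)⟩
    · obtain ⟨N, hN⟩ := hI₂.1.truncated x y n
      exact ⟨N, fun m hm k => Subtype.ext (hN m hm k)⟩
    · have e := hI₂.1.jacobi k (u : V) x w l m n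
      have hinj : Function.Injective (M₄.gr (γ₂ + γ₃)).subtype.toAddMonoidHom :=
        Subtype.val_injective
      apply hinj
      rw [AddMonoidHom.map_finsum_of_injective _ hinj, AddMonoidHom.map_finsum_of_injective _ hinj]
      exact e
    · refine LinearMap.ext fun y => Subtype.ext ?_
      have e := congrArg (fun f : W₃ →ₗ[ℂ] W₄ => f y) (hI₂.1.derivative x n k)
      exact e
  have h0 : J = 0 := by
    refine eq_zero_of_rank_eq_zero (X := ℂ → ℕ → M₂.gr γ₂ →ₗ[ℂ] M₃.gr γ₃ →ₗ[ℂ] M₄.gr (γ₂ + γ₃))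
      (logIntertwiningSpace (⟨𝒱.ω, 𝒱.ω_gr⟩ : 𝒱.gr 0) (M₂.zeroAction γ₂) (M₃.zeroAction γ₃)
        (M₄.zeroAction (γ₂ + γ₃)) (M₂.zeroAction_truncated γ₂) (M₃.zeroAction_truncated γ₃)) ?_ hJ
    exact h
  have := hcoe n k ⟨w₂, h₂⟩ ⟨w₃, h₃⟩
  rw [h0] at this
  exact this.symm

/-- The analogue of `eq_zero_of_fusionRule_eq_zero` for operators with values in a contragredient
module. -/
theorem eq_zero_of_contragredientFusionRule_eq_zero
    (hI₁ : IsIntertwiningOfContragredientType M₁ M₄ M₀ I₁) {γ₁ γ₄ : B}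
    (h : contragredientFusionRule M₁ M₄ M₀ γ₁ γ₄ = 0) {w₁ : W₁} {w₄ : W₄} (h₁ : w₁ ∈ M₁.gr γ₁)
    (h₄ : w₄ ∈ M₄.gr γ₄) (n : ℂ) (k : ℕ) : I₁ n k w₁ w₄ = 0 := by
  let J : ℂ → ℕ → M₁.gr γ₁ →ₗ[ℂ] M₄.gr γ₄ →ₗ[ℂ] Module.Dual ℂ W₀ := fun n k =>
    LinearMap.mk₂ ℂ (fun x y => I₁ n k x y)
      (fun _ _ _ => by simp) (fun _ _ _ => by simp)
      (fun _ _ _ => by simp) (fun _ _ _ => by simp)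
  have hcoe : ∀ n k x y, J n k x y = I₁ n k x y := fun _ _ _ _ => rfl
  have hJ : J ∈ logIntertwiningSpace (⟨𝒱.ω, 𝒱.ω_gr⟩ : 𝒱.gr 0)
      (M₁.zeroAction γ₁) (M₄.zeroAction γ₄) (fun v n => M₀.contragredientY (v : V) n)
      (M₁.zeroAction_truncated γ₁) (M₄.zeroAction_truncated γ₄) ⊓
      valuedIn (M₀.contragredientGr (γ₁ + γ₄)) := by
    refine ⟨⟨fun x y n => ?_, fun x y n => ?_, fun k u x w l m n => ?_, fun x n k => ?_⟩,
      fun n k x y => hI₁.2 _ _ _ x.2 _ y.2 n k⟩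
    · obtain ⟨K, hK⟩ := hI₁.1.log_finite x y n
      exact ⟨K, fun k hk => hK k hk⟩
    · obtain ⟨N, hN⟩ := hI₁.1.truncated x y n
      exact ⟨N, fun m hm k => hN m hm k⟩
    · exact hI₁.1.jacobi k (u : V) x w l m n
    · refine LinearMap.ext fun y => ?_
      exact congrArg (fun f : W₄ →ₗ[ℂ] Module.Dual ℂ W₀ => f y) (hI₁.1.derivative x n k)
  have h0 : J = 0 := by
    refine eq_zero_of_rank_eq_zero (X := ℂ → ℕ → M₁.gr γ₁ →ₗ[ℂ] M₄.gr γ₄ →ₗ[ℂ] Module.Dual ℂ W₀)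
      (logIntertwiningSpace (⟨𝒱.ω, 𝒱.ω_gr⟩ : 𝒱.gr 0) (M₁.zeroAction γ₁) (M₄.zeroAction γ₄)
        (fun v n => M₀.contragredientY (v : V) n) (M₁.zeroAction_truncated γ₁)
        (M₄.zeroAction_truncated γ₄) ⊓ valuedIn (M₀.contragredientGr (γ₁ + γ₄))) ?_ hJ
    exact h
  have := hcoe n k ⟨w₁, h₁⟩ ⟨w₄, h₄⟩
  rw [h0] at this
  exact this.symm

/-- By finiteness of the fusion rules, matrix elements of homogeneous vectors with degrees in given
cosets of `A₀` vanish outside a finite set of degrees. -/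
theorem exists_finite_degrees {A₀ : AddSubgroup A} (hI₁ : IsIntertwiningOfContragredientType M₁ M₄ M₀ I₁)
    (hI₂ : IsIntertwiningOfType M₂ M₃ M₄ I₂)
    (hfusion₁ : ∀ γ₁ γ₂ : B, {α : A₀ × A₀ | contragredientFusionRule M₁ M₄ M₀
      (γ₁ + ((α.1 : A) : B)) (γ₂ + ((α.2 : A) : B)) ≠ 0}.Finite)
    (hfusion₂ : ∀ γ₁ γ₂ : B, {α : A₀ × A₀ | fusionRule M₂ M₃ M₄
      (γ₁ + ((α.1 : A) : B)) (γ₂ + ((α.2 : A) : B)) ≠ 0}.Finite) (β₁ β₂ β₃ : B) :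
    ∃ Λ : Set (B × B × B × B), Λ.Finite ∧ ∀ (γ₀ : B) (α₁ α₂ α₃ : A₀),
      (γ₀, β₁ + ((α₁ : A) : B), β₂ + ((α₂ : A) : B), β₃ + ((α₃ : A) : B)) ∉ Λ →
      ∀ w₀ ∈ M₀.gr γ₀, ∀ w₁ ∈ M₁.gr (β₁ + ((α₁ : A) : B)), ∀ w₂ ∈ M₂.gr (β₂ + ((α₂ : A) : B)),
      ∀ w₃ ∈ M₃.gr (β₃ + ((α₃ : A) : B)), corr I₁ I₂ hI₂.1.truncated w₀ w₁ w₂ w₃ = 0 := by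
  refine ⟨(fun s : (A₀ × A₀) × (A₀ × A₀) =>
    (-(β₁ + ((s.1.1 : A) : B) + (β₂ + ((s.2.1 : A) : B) + (β₃ + ((s.2.2 : A) : B)))),
      β₁ + ((s.1.1 : A) : B), β₂ + ((s.2.1 : A) : B), β₃ + ((s.2.2 : A) : B))) ''
      ({α : A₀ × A₀ | contragredientFusionRule M₁ M₄ M₀
      (β₁ + ((α.1 : A) : B)) (β₂ + β₃ + ((α.2 : A) : B)) ≠ 0} ×ˢ {α : A₀ × A₀ | fusionRule M₂ M₃ M₄
      (β₂ + ((α.1 : A) : B)) (β₃ + ((α.2 : A) : B)) ≠ 0}),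
    ((hfusion₁ β₁ (β₂ + β₃)).prod (hfusion₂ β₂ β₃)).image _, ?_⟩
  intro γ₀ α₁ α₂ α₃ hΛ w₀ h₀ w₁ h₁ w₂ h₂ w₃ h₃
  by_cases hd : γ₀ = -(β₁ + ((α₁ : A) : B) + (β₂ + ((α₂ : A) : B) + (β₃ + ((α₃ : A) : B))))
  swap
  · exact corr_eq_zero_of_degree hI₁ hI₂ h₀ h₁ h₂ h₃ hd
  by_cases hf₂ : fusionRule M₂ M₃ M₄ (β₂ + ((α₂ : A) : B)) (β₃ + ((α₃ : A) : B)) = 0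
  · refine TSeries.ext fun p k q l => ?_
    rw [corr_apply, eq_zero_of_fusionRule_eq_zero hI₂ hf₂ h₂ h₃]
    simp
  have e : β₂ + ((α₂ : A) : B) + (β₃ + ((α₃ : A) : B)) = β₂ + β₃ + (((α₂ + α₃ : A₀) : A) : B) := by
    push_cast; abel
  by_cases hf₁ : contragredientFusionRule M₁ M₄ M₀ (β₁ + ((α₁ : A) : B))
      (β₂ + β₃ + (((α₂ + α₃ : A₀) : A) : B)) = 0
  · refine TSeries.ext fun p k q l => ?_
    rw [corr_apply, eq_zero_of_contragredientFusionRule_eq_zero hI₁ hf₁ h₁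
      (e ▸ hI₂.2 _ _ _ h₂ _ h₃ _ _)]
    simp
  exact absurd ⟨((α₁, α₂ + α₃), (α₂, α₃)), ⟨hf₁, hf₂⟩, by simp [hd]⟩ hΛ

end Fusion

section Generators

variable {B : Type*} [AddCommGroup B] {A : AddSubgroup B} {A₀ : AddSubgroup A}
  {V : Type v} [AddCommGroup V] [Module ℂ V] {𝒱 : StronglyGradedCVA A V} {V₀ : Submodule ℂ V}
  {W : Type u} [AddCommGroup W] [Module ℂ W]

/-- The vectors `u_{-1} w'` of weight `n` and degree `γ` with doubly homogeneous `u ∈ V₀` of positive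
weight and doubly homogeneous `w'`. -/
def StronglyGradedModule.C₁Homogeneous (M : StronglyGradedModule 𝒱 W) (A₀ : AddSubgroup A)
    (V₀ : Submodule ℂ V) (n : ℂ) (γ : B) : Set W :=
  {x | ∃ (h : ℕ) (α : A₀) (γ' : B), 0 < h ∧ ((α : A) : B) + γ' = γ ∧
    ∃ u ∈ V₀ ⊓ (𝒱.wt h ⊓ 𝒱.gr α), ∃ w' ∈ M.wt (n - h) ⊓ M.gr γ', M.Y u (-1) w' = x}

theorem IsStronglyGradedSubalgebra.inf_wt_le (hV₀ : IsStronglyGradedSubalgebra 𝒱 A₀ V₀) (h : ℤ) :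
    V₀ ⊓ 𝒱.wt h ≤ ⨆ α : A₀, V₀ ⊓ (𝒱.wt h ⊓ 𝒱.gr α) := by
  rintro v ⟨hv, hvh⟩
  rw [← 𝒱.isGrading.proj_of_mem hvh]
  have hle : V₀ ≤ (⨆ α : A₀, V₀ ⊓ (𝒱.wt h ⊓ 𝒱.gr α)).comap (𝒱.isGrading.proj h) := by
    conv_lhs => rw [hV₀.graded]
    refine iSup_le fun n => iSup_le fun α => fun x hx => ?_
    rw [Submodule.mem_comap]
    by_cases hn : h = n
    · subst hn
      rw [𝒱.isGrading.proj_of_mem hx.2.1]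
      exact Submodule.mem_iSup_of_mem α hx
    · rw [𝒱.isGrading.proj_of_mem_ne hn hx.2.1]
      exact Submodule.zero_mem _
  exact hle hv

theorem StronglyGradedModule.iSup_inf (M : StronglyGradedModule 𝒱 W) :
    ⨆ (n : ℂ) (γ : B), M.wt n ⊓ M.gr γ = ⊤ := by
  rw [eq_top_iff, ← M.gr_isGrading.2, iSup_comm]
  exact iSup_mono fun γ => (M.compatible γ).le

/-- The space `C₁` is spanned by the homogeneous vectors described in `C₁Homogeneous`. -/
theorem StronglyGradedModule.C₁_le (M : StronglyGradedModule 𝒱 W)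
    (hV₀ : IsStronglyGradedSubalgebra 𝒱 A₀ V₀) :
    M.C₁ V₀ ≤ Submodule.span ℂ (⋃ (n : ℂ) (γ : B), M.C₁Homogeneous A₀ V₀ n γ) := by
  rw [StronglyGradedModule.C₁, Submodule.span_le]
  rintro x ⟨u, hu, w, rfl⟩
  rw [SetLike.mem_coe]
  set S := Submodule.span ℂ (⋃ (n : ℂ) (γ : B), M.C₁Homogeneous A₀ V₀ n γ)
  have hw : w ∈ ⨆ (n : ℂ) (γ : B), M.wt n ⊓ M.gr γ := by rw [M.iSup_inf]; trivial
  have h1 : ∀ (h : ℤ) (_ : 0 < h) (α : A₀) (u : V) (_ : u ∈ V₀ ⊓ (𝒱.wt h ⊓ 𝒱.gr α)),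
      M.Y u (-1) w ∈ S := by
    intro h hh α u hu
    suffices hle : (⨆ (n : ℂ) (γ : B), M.wt n ⊓ M.gr γ) ≤ S.comap (M.Y u (-1)) from hle hw
    refine iSup_le fun n => iSup_le fun γ => fun w hw => ?_
    rw [Submodule.mem_comap]
    obtain ⟨k, rfl⟩ := Int.eq_ofNat_of_zero_le hh.le
    refine Submodule.subset_span (Set.mem_iUnion₂.mpr ⟨n + k, ((α : A) : B) + γ, k, α, γ,
      by exact_mod_cast hh, rfl, u, hu, w, ?_, rfl⟩)
    rwa [add_sub_cancel_right]
  have h2 : (⨆ (n : ℤ) (_ : 0 < n), V₀ ⊓ 𝒱.wt n) ≤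
      S.comap ((LinearMap.applyₗ w).comp ((LinearMap.proj (-1 : ℤ)).comp M.Y)) := by
    refine iSup₂_le fun h hh => (hV₀.inf_wt_le h).trans (iSup_le fun α => fun u hu => ?_)
    exact h1 h hh α u hu
  exact h2 hu

/-- For a `C₁`-cofinite module, the doubly homogeneous vectors of a given degree are generated modulo
`C₁` by finitely many doubly homogeneous ones, compatibly with weights. -/
theorem StronglyGradedModule.exists_generators (M : StronglyGradedModule 𝒱 W)
    (hV₀ : IsStronglyGradedSubalgebra 𝒱 A₀ V₀) (hM : M.IsC₁Cofinite V₀) (γ : B) :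
    ∃ t : Set (ℂ × W), t.Finite ∧ (∀ b ∈ t, b.2 ∈ M.wt b.1 ⊓ M.gr γ) ∧
      ∀ n, ∀ w ∈ M.wt n ⊓ M.gr γ, w ∈ Submodule.span ℂ
        ({x | (n, x) ∈ t} ∪ M.C₁Homogeneous A₀ V₀ n γ) := by
  have hfin := hM γ
  set C := (M.C₁ V₀).submoduleOf (M.gr γ)
  set S : Set (M.gr γ) := {x | ∃ n, (x : W) ∈ M.wt n}
  have hS : Submodule.span ℂ S = ⊤ := by
    rw [eq_top_iff]
    rintro ⟨x, hx⟩ -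
    have hx' := hx
    rw [M.compatible γ] at hx'
    have : (⨆ n, M.wt n ⊓ M.gr γ) ≤ (Submodule.span ℂ S).map (M.gr γ).subtype := by
      refine iSup_le fun n y hy => ⟨⟨y, hy.2⟩, Submodule.subset_span ⟨n, hy.1⟩, rfl⟩
    obtain ⟨y, hy, hyx⟩ := this hx'
    have : y = ⟨x, hx⟩ := Subtype.ext hyx
    rwa [← this]
  have hS' : Submodule.span ℂ (C.mkQ '' S) = ⊤ := by
    rw [Submodule.span_image, hS, Submodule.map_top, Submodule.range_mkQ]
  obtain ⟨s', hs'S, hs'f, hs'⟩ : ∃ s' ⊆ C.mkQ '' S, s'.Finite ∧ Submodule.span ℂ s' = ⊤ := by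
    refine ⟨_, Module.Basis.ofSpan_subset (ge_of_eq hS'), ?_,
      (Module.Basis.ofSpan (ge_of_eq hS')).span_eq⟩
    have := Module.Finite.finite_basis (Module.Basis.ofSpan (ge_of_eq hS'))
    exact Set.finite_range _
  obtain ⟨s, hsS, hsf, hs⟩ : ∃ s ⊆ S, s.Finite ∧ C.mkQ '' s = s' := by
    obtain ⟨s, hs, hsf, h⟩ := Set.exists_subset_image_finite_and (p := fun s => s = s').mp
      ⟨s', hs'S, hs'f, rfl⟩
    exact ⟨s, hs, hsf, h⟩
  choose! wtOf hwt using fun x (hx : x ∈ S) => hx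
  refine ⟨(fun x : M.gr γ => (wtOf x, (x : W))) '' s, hsf.image _, ?_, ?_⟩
  · rintro _ ⟨x, hx, rfl⟩
    exact ⟨hwt x (hsS hx), x.2⟩
  intro n w hw
  set T := Submodule.span ℂ ({x | (n, x) ∈ (fun x : M.gr γ => (wtOf x, (x : W))) '' s} ∪
    M.C₁Homogeneous A₀ V₀ n γ)
  set π := M.isGrading.proj n ∘ₗ M.gr_isGrading.proj γ
  have hπw : π w = w := by
    rw [LinearMap.comp_apply, M.gr_isGrading.proj_of_mem hw.2, M.isGrading.proj_of_mem hw.1]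
  have hC : M.C₁ V₀ ≤ T.comap π := by
    refine (M.C₁_le hV₀).trans (Submodule.span_le.mpr ?_)
    intro x hx
    obtain ⟨m, δ, h, α, γ', hh, hδ, u, hu, w', hw', rfl⟩ := Set.mem_iUnion₂.mp hx
    have hmem := M.mode_mem hu.2 hw' (-1)
    rw [hδ, show m - h + (((h : ℕ) : ℤ) - ((-1 : ℤ) : ℂ) - 1) = m by push_cast; ring] at hmem
    rw [SetLike.mem_coe, Submodule.mem_comap, LinearMap.comp_apply]
    by_cases h1 : γ = δ
    · by_cases h2 : n = m
      · subst h1 h2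
        rw [M.gr_isGrading.proj_of_mem hmem.2, M.isGrading.proj_of_mem hmem.1]
        exact Submodule.subset_span (Or.inr ⟨h, α, γ', hh, hδ, u, hu, w', hw', rfl⟩)
      · subst h1
        rw [M.gr_isGrading.proj_of_mem hmem.2, M.isGrading.proj_of_mem_ne h2 hmem.1]
        exact T.zero_mem
    · rw [M.gr_isGrading.proj_of_mem_ne h1 hmem.2, map_zero]
      exact T.zero_mem
  have hs2 : Submodule.span ℂ s ≤ T.comap (π ∘ₗ (M.gr γ).subtype) := by
    refine Submodule.span_le.mpr fun x hx => ?_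
    rw [SetLike.mem_coe, Submodule.mem_comap, LinearMap.comp_apply, LinearMap.comp_apply,
      Submodule.subtype_apply, M.gr_isGrading.proj_of_mem x.2]
    by_cases h2 : n = wtOf x
    · rw [h2, M.isGrading.proj_of_mem (hwt x (hsS hx))]
      exact Submodule.subset_span (Or.inl ⟨x, hx, by rw [h2]⟩)
    · rw [M.isGrading.proj_of_mem_ne h2 (hwt x (hsS hx))]
      exact T.zero_mem
  have hmk : C.mkQ ⟨w, hw.2⟩ ∈ (Submodule.span ℂ s).map C.mkQ := by
    rw [← Submodule.span_image, hs, hs']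
    trivial
  obtain ⟨y, hy, hyw⟩ := hmk
  have hdiff : w - y ∈ M.C₁ V₀ := by
    have := (Submodule.Quotient.eq C).mp hyw.symm
    exact this
  have h1 := hC hdiff
  have h2 := hs2 hy
  rw [Submodule.mem_comap] at h1 h2
  have h3 : π (w - y) + π y ∈ T := T.add_mem h1 h2
  rw [← map_add, sub_add_cancel, hπw] at h3
  exact h3

end Generators

/-! ### Finitely generated lattices of matrix elements -/

open Multiplier

/-- The subring of the multipliers that stay holomorphic at the singular point. For a suitable choice
of `th` and `zh`, the quotient `th / zh` is a coordinate that vanishes at the singular point, and the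
generators are holomorphic functions of it. -/
def latticeRing (th zh : Multiplierˣ) : Subalgebra ℂ Multiplier :=
  Algebra.adjoin ℂ (Units.val '' {th / z₁, th / z₂, th / z₁₂, z₁ / zh, z₂ / zh, th / zh})

instance (th zh : Multiplierˣ) : IsNoetherianRing (latticeRing th zh) := by
  have hfg : (latticeRing th zh).FG :=
    Subalgebra.fg_def.mpr ⟨_, (Set.toFinite _).image _, rfl⟩
  have : Algebra.FiniteType ℂ (latticeRing th zh) := (Subalgebra.fg_iff_finiteType _).mp hfg
  exact Algebra.FiniteType.isNoetherianRing ℂ _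

theorem complex_smul_mem {th zh : Multiplierˣ} {𝓜 : Submodule (latticeRing th zh) TSeries} (c : ℂ)
    {F : TSeries} (hF : F ∈ 𝓜) : c • F ∈ 𝓜 :=
  𝓜.smul_mem (algebraMap ℂ (latticeRing th zh) c) hF

theorem smul_complex_smul_mem {th zh : Multiplierˣ} {𝓜 : Submodule (latticeRing th zh) TSeries}
    (s : Multiplierˣ) (c : ℂ) {F : TSeries} (hF : s • F ∈ 𝓜) : s • (c • F) ∈ 𝓜 := by
  rw [smul_comm]
  exact complex_smul_mem c hF

theorem monomial_mem_latticeRing (th zh : Multiplierˣ) (a b c d e f : ℕ) :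
    (((th / z₁) ^ a * (th / z₂) ^ b * (th / z₁₂) ^ c * (z₁ / zh) ^ d * (z₂ / zh) ^ e *
      (th / zh) ^ f : Multiplierˣ) : Multiplier) ∈ latticeRing th zh := by
  have h : ∀ x ∈ ({th / z₁, th / z₂, th / z₁₂, z₁ / zh, z₂ / zh, th / zh} : Set Multiplierˣ),
      ∀ n : ℕ, ((x ^ n : Multiplierˣ) : Multiplier) ∈ latticeRing th zh := fun x hx n => by
    rw [Units.val_pow_eq_pow_val]
    exact Subalgebra.pow_mem _ (Algebra.subset_adjoin (Set.mem_image_of_mem _ hx)) n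
  simp only [Units.val_mul]
  refine mul_mem (mul_mem (mul_mem (mul_mem (mul_mem ?_ ?_) ?_) ?_) ?_) ?_ <;>
    exact h _ (by simp) _

/-- The factor that makes a matrix element of total weight `N`, whose vector in `W₀` has weight `n₀`,
homogeneous of degree zero up to a bounded error. -/
def scale (th zh : Multiplierˣ) (N n₀ : ℂ) : Multiplierˣ :=
  th ^ ⌊N.re⌋ * zh ^ (-⌊(2 * n₀).re⌋)

theorem scale_mul (th zh r : Multiplierˣ) (N n₀ : ℂ) (a a₀ : ℤ) :
    scale th zh N n₀ * r
      = (r * th ^ a * zh ^ (-(2 * a₀))) * scale th zh (N - a) (n₀ - a₀) := by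
  have h1 : ⌊(N - a).re⌋ = ⌊N.re⌋ - a := by simp [Int.floor_sub_intCast]
  have h2 : ⌊(2 * (n₀ - a₀)).re⌋ = ⌊(2 * n₀).re⌋ - 2 * a₀ := by
    rw [mul_sub, Complex.sub_re, ← Int.floor_sub_intCast]
    simp
  rw [scale, scale, h1, h2]
  have key : ∀ (G : Type) [AddCommGroup G] (x y r : G) (p q a b : ℤ),
      (p • x + (-q) • y) + r
        = (r + a • x + (-(2 * b)) • y) + ((p - a) • x + (-(q - 2 * b)) • y) := by
    intros; module
  exact key (Additive Multiplierˣ) th zh r _ _ a a₀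

section Lattice

variable {B : Type*} [AddCommGroup B] {A : AddSubgroup B} {A₀ : AddSubgroup A}
  {V : Type v} [AddCommGroup V] [Module ℂ V] {𝒱 : StronglyGradedCVA A V} {V₀ : Submodule ℂ V}
  {W₀ W₁ W₂ W₃ W₄ : Type u} [AddCommGroup W₀] [Module ℂ W₀] [AddCommGroup W₁] [Module ℂ W₁]
  [AddCommGroup W₂] [Module ℂ W₂] [AddCommGroup W₃] [Module ℂ W₃] [AddCommGroup W₄] [Module ℂ W₄]
  {M₀ : StronglyGradedModule 𝒱 W₀} {M₁ : StronglyGradedModule 𝒱 W₁}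
  {M₂ : StronglyGradedModule 𝒱 W₂} {M₃ : StronglyGradedModule 𝒱 W₃}
  {M₄ : StronglyGradedModule 𝒱 W₄}
  {I₁ : ℂ → ℕ → W₁ →ₗ[ℂ] W₄ →ₗ[ℂ] Module.Dual ℂ W₀}
  {I₂ : ℂ → ℕ → W₂ →ₗ[ℂ] W₃ →ₗ[ℂ] W₄}
  {th zh : Multiplierˣ} {𝓜 : Submodule (latticeRing th zh) TSeries}
  {A' : AddSubgroup B} {β₁ β₂ β₃ : B} {x : ℝ} {hT : ∀ w₂ w₃ n, ∃ N : ℕ, ∀ m : ℕ, N ≤ m → ∀ k,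
    I₂ (n + m) k w₂ w₃ = 0}

variable (M₀ M₁ M₂ M₃ I₁) (hT) (𝓜) (A') (β₁ β₂ β₃) (x) in
/-- The rescaled matrix elements of doubly homogeneous vectors of total weight at most `x`, with
degrees in the cosets `βᵢ + A'`, belong to `𝓜`. -/
def InLattice : Prop :=
  ∀ ⦃n₀ n₁ n₂ n₃ : ℂ⦄ ⦃γ₀ γ₁ γ₂ γ₃ : B⦄ ⦃w₀ : W₀⦄ ⦃w₁ : W₁⦄ ⦃w₂ : W₂⦄ ⦃w₃ : W₃⦄,
    w₀ ∈ M₀.wt n₀ ⊓ M₀.gr γ₀ → w₁ ∈ M₁.wt n₁ ⊓ M₁.gr γ₁ → w₂ ∈ M₂.wt n₂ ⊓ M₂.gr γ₂ →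
    w₃ ∈ M₃.wt n₃ ⊓ M₃.gr γ₃ → γ₁ - β₁ ∈ A' → γ₂ - β₂ ∈ A' → γ₃ - β₃ ∈ A' →
    (n₀ + n₁ + n₂ + n₃).re ≤ x →
    scale th zh (n₀ + n₁ + n₂ + n₃) n₀ • corr I₁ I₂ hT w₀ w₁ w₂ w₃ ∈ 𝓜

namespace InLattice

variable {n₀ n₁ n₂ n₃ : ℂ} {γ₀ γ₁ γ₂ γ₃ : B} {w₀ : W₀} {w₁ : W₁} {w₂ : W₂} {w₃ : W₃}

/-- The terms that arise from a Jacobi identity relation have total weight smaller by an integer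
`a ≥ 1`, and their coefficient `r`, rescaled, is a monomial in the generators of `latticeRing`. -/
theorem unit_smul_mem (hx : InLattice M₀ M₁ M₂ M₃ I₁ 𝓜 A' β₁ β₂ β₃ x hT) {m₀ m₁ m₂ m₃ : ℂ}
    (h₀ : w₀ ∈ M₀.wt m₀ ⊓ M₀.gr γ₀) (h₁ : w₁ ∈ M₁.wt m₁ ⊓ M₁.gr γ₁)
    (h₂ : w₂ ∈ M₂.wt m₂ ⊓ M₂.gr γ₂) (h₃ : w₃ ∈ M₃.wt m₃ ⊓ M₃.gr γ₃)
    (hγ₁ : γ₁ - β₁ ∈ A') (hγ₂ : γ₂ - β₂ ∈ A') (hγ₃ : γ₃ - β₃ ∈ A')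
    (hn : (n₀ + n₁ + n₂ + n₃).re ≤ x + 1) (r : Multiplierˣ) (a a₀ : ℤ) (ha : 1 ≤ a)
    (e₀ : m₀ = n₀ - a₀) (e : m₀ + m₁ + m₂ + m₃ = n₀ + n₁ + n₂ + n₃ - a)
    (hr : ∃ b c d k l m : ℕ, r * th ^ a * zh ^ (-(2 * a₀)) = (th / z₁) ^ b * (th / z₂) ^ c *
      (th / z₁₂) ^ d * (z₁ / zh) ^ k * (z₂ / zh) ^ l * (th / zh) ^ m) :
    scale th zh (n₀ + n₁ + n₂ + n₃) n₀ • (r • corr I₁ I₂ hT w₀ w₁ w₂ w₃) ∈ 𝓜 := by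
  obtain ⟨b, c, d, k, l, m, hr⟩ := hr
  rw [← mul_smul, scale_mul _ _ _ _ _ a a₀, mul_smul, ← e, ← e₀, hr]
  refine 𝓜.smul_mem (⟨_, monomial_mem_latticeRing th zh b c d k l m⟩ : latticeRing th zh)
    (hx h₀ h₁ h₂ h₃ hγ₁ hγ₂ hγ₃ ?_)
  rw [e, Complex.sub_re, Complex.intCast_re]
  have : (1 : ℝ) ≤ a := by exact_mod_cast ha
  linarith

theorem add_sub_mem {β γ α : B} (hα : α ∈ A') (hγ : γ - β ∈ A') : α + γ - β ∈ A' := by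
  rw [add_sub_assoc]
  exact A'.add_mem hα hγ

set_option maxHeartbeats 400000 in
/-- Matrix elements with `v_{-1}` applied to the second argument reduce to smaller total weight. -/
theorem mode_one_mem {h : ℕ} {α : A} {v : V}
    (hI₁ : IsIntertwiningOfContragredientType M₁ M₄ M₀ I₁)
    (hI₂ : IsIntertwiningOfType M₂ M₃ M₄ I₂)
    (hx : InLattice M₀ M₁ M₂ M₃ I₁ 𝓜 A' β₁ β₂ β₃ x hI₂.1.truncated) (hh : 0 < h)
    (hα : (α : B) ∈ A') (hv : v ∈ 𝒱.wt h ⊓ 𝒱.gr α)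
    (hγ₁ : γ₁ - β₁ ∈ A') (hγ₂ : γ₂ - β₂ ∈ A') (hγ₃ : γ₃ - β₃ ∈ A')
    (hn : (n₀ + n₁ + n₂ + n₃).re ≤ x + 1)
    (h₀ : w₀ ∈ M₀.wt n₀ ⊓ M₀.gr γ₀) (h₁ : w₁ ∈ M₁.wt (n₁ - h) ⊓ M₁.gr γ₁)
    (h₂ : w₂ ∈ M₂.wt n₂ ⊓ M₂.gr γ₂) (h₃ : w₃ ∈ M₃.wt n₃ ⊓ M₃.gr γ₃) :
    scale th zh (n₀ + n₁ + n₂ + n₃) n₀ •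
      corr I₁ I₂ hI₂.1.truncated w₀ (M₁.Y v (-1) w₁) w₂ w₃ ∈ 𝓜 := by
  obtain ⟨N₀, hN₀⟩ := M₀.adjointMode_eq_zero hv h₀
  obtain ⟨N₂, hN₂⟩ := M₂.exists_mode_eq_zero v w₂
  obtain ⟨N₃, hN₃⟩ := M₃.exists_mode_eq_zero v w₃
  rw [corr_mode_one hI₁ hI₂ v w₁ hN₀ hN₂ hN₃]
  simp only [smul_add, Finset.smul_sum]
  refine add_mem (add_mem (sum_mem fun i _ => ?_) (sum_mem fun i _ => ?_)) (sum_mem fun i _ => ?_)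
  · refine hx.unit_smul_mem (M₀.adjointMode_mem hv h₀ _) h₁ h₂ h₃ hγ₁ hγ₂ hγ₃ hn _
      (i + 2 * h) (i + h) (by omega) (by push_cast; ring) (by push_cast; ring)
      ⟨0, 0, 0, i, 0, i + 2 * h, ?_⟩
    have key : ∀ (G : Type) [AddCommGroup G] (s t z₁ z₂ d : G),
        (i : ℤ) • z₁ + (i + 2 * h : ℤ) • s + (-(2 * (i + h : ℤ))) • t
        = 0 • (s - z₁) + 0 • (s - z₂) + 0 • (s - d) + i • (z₁ - t) + 0 • (z₂ - t)
          + (i + 2 * h) • (s - t) := by intros; module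
    exact key (Additive Multiplierˣ) th zh z₁ z₂ z₁₂
  · refine hx.unit_smul_mem h₀ h₁ h₂ (M₃.mode_mem hv h₃ _) hγ₁ hγ₂ (add_sub_mem hα hγ₃) hn _
      (i + 1) 0 (by omega) (by push_cast; ring) (by push_cast; ring) ⟨i + 1, 0, 0, 0, 0, 0, ?_⟩
    have key : ∀ (G : Type) [AddCommGroup G] (s t z₁ z₂ d : G),
        (-1 - i : ℤ) • z₁ + (i + 1 : ℤ) • s + (-(2 * 0 : ℤ)) • t
        = (i + 1) • (s - z₁) + 0 • (s - z₂) + 0 • (s - d) + 0 • (z₁ - t) + 0 • (z₂ - t)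
          + 0 • (s - t) := by intros; module
    exact key (Additive Multiplierˣ) th zh z₁ z₂ z₁₂
  · refine hx.unit_smul_mem h₀ h₁ (M₂.mode_mem hv h₂ _) h₃ hγ₁ (add_sub_mem hα hγ₂) hγ₃ hn _
      (i + 1) 0 (by omega) (by push_cast; ring) (by push_cast; ring) ⟨0, 0, i + 1, 0, 0, 0, ?_⟩
    have key : ∀ (G : Type) [AddCommGroup G] (s t z₁ z₂ d : G),
        (-((i + 1 : ℕ) : ℤ)) • d + (i + 1 : ℤ) • s + (-(2 * 0 : ℤ)) • t
        = 0 • (s - z₁) + 0 • (s - z₂) + (i + 1) • (s - d) + 0 • (z₁ - t) + 0 • (z₂ - t)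
          + 0 • (s - t) := by intros; push_cast; module
    exact key (Additive Multiplierˣ) th zh z₁ z₂ z₁₂

set_option maxHeartbeats 400000 in
/-- Matrix elements with `v_{-1}` applied to the third argument reduce to smaller total weight. -/
theorem mode_two_mem {h : ℕ} {α : A} {v : V}
    (hI₁ : IsIntertwiningOfContragredientType M₁ M₄ M₀ I₁)
    (hI₂ : IsIntertwiningOfType M₂ M₃ M₄ I₂)
    (hx : InLattice M₀ M₁ M₂ M₃ I₁ 𝓜 A' β₁ β₂ β₃ x hI₂.1.truncated) (hh : 0 < h)
    (hα : (α : B) ∈ A') (hv : v ∈ 𝒱.wt h ⊓ 𝒱.gr α)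
    (hγ₁ : γ₁ - β₁ ∈ A') (hγ₂ : γ₂ - β₂ ∈ A') (hγ₃ : γ₃ - β₃ ∈ A')
    (hn : (n₀ + n₁ + n₂ + n₃).re ≤ x + 1)
    (h₀ : w₀ ∈ M₀.wt n₀ ⊓ M₀.gr γ₀) (h₁ : w₁ ∈ M₁.wt n₁ ⊓ M₁.gr γ₁)
    (h₂ : w₂ ∈ M₂.wt (n₂ - h) ⊓ M₂.gr γ₂) (h₃ : w₃ ∈ M₃.wt n₃ ⊓ M₃.gr γ₃) :
    scale th zh (n₀ + n₁ + n₂ + n₃) n₀ •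
      corr I₁ I₂ hI₂.1.truncated w₀ w₁ (M₂.Y v (-1) w₂) w₃ ∈ 𝓜 := by
  obtain ⟨N₀, hN₀⟩ := M₀.adjointMode_eq_zero hv h₀
  obtain ⟨N₁, hN₁⟩ := M₁.exists_mode_eq_zero v w₁
  obtain ⟨N₃, hN₃⟩ := M₃.exists_mode_eq_zero v w₃
  rw [corr_mode_two hI₁ hI₂ v w₂ hN₀ hN₁ hN₃]
  simp only [smul_add, smul_sub, Finset.smul_sum]
  refine sub_mem (add_mem (sum_mem fun i _ => ?_) (sum_mem fun i _ => ?_)) (sum_mem fun i _ => ?_)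
  · refine hx.unit_smul_mem (M₀.adjointMode_mem hv h₀ _) h₁ h₂ h₃ hγ₁ hγ₂ hγ₃ hn _
      (i + 2 * h) (i + h) (by omega) (by push_cast; ring) (by push_cast; ring)
      ⟨0, 0, 0, 0, i, i + 2 * h, ?_⟩
    have key : ∀ (G : Type) [AddCommGroup G] (s t z₁ z₂ d : G),
        (i : ℤ) • z₂ + (i + 2 * h : ℤ) • s + (-(2 * (i + h : ℤ))) • t
        = 0 • (s - z₁) + 0 • (s - z₂) + 0 • (s - d) + 0 • (z₁ - t) + i • (z₂ - t)
          + (i + 2 * h) • (s - t) := by intros; module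
    exact key (Additive Multiplierˣ) th zh z₁ z₂ z₁₂
  · refine hx.unit_smul_mem h₀ h₁ h₂ (M₃.mode_mem hv h₃ _) hγ₁ hγ₂ (add_sub_mem hα hγ₃) hn _
      (i + 1) 0 (by omega) (by push_cast; ring) (by push_cast; ring) ⟨0, i + 1, 0, 0, 0, 0, ?_⟩
    have key : ∀ (G : Type) [AddCommGroup G] (s t z₁ z₂ d : G),
        (-1 - i : ℤ) • z₂ + (i + 1 : ℤ) • s + (-(2 * 0 : ℤ)) • t
        = 0 • (s - z₁) + (i + 1) • (s - z₂) + 0 • (s - d) + 0 • (z₁ - t) + 0 • (z₂ - t)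
          + 0 • (s - t) := by intros; module
    exact key (Additive Multiplierˣ) th zh z₁ z₂ z₁₂
  · refine smul_complex_smul_mem _ _ ?_
    refine hx.unit_smul_mem h₀ (M₁.mode_mem hv h₁ _) h₂ h₃ (add_sub_mem hα hγ₁) hγ₂ hγ₃ hn _
      (i + 1) 0 (by omega) (by push_cast; ring) (by push_cast; ring) ⟨0, 0, i + 1, 0, 0, 0, ?_⟩
    have key : ∀ (G : Type) [AddCommGroup G] (s t z₁ z₂ d : G),
        (-((i + 1 : ℕ) : ℤ)) • d + (i + 1 : ℤ) • s + (-(2 * 0 : ℤ)) • t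
        = 0 • (s - z₁) + 0 • (s - z₂) + (i + 1) • (s - d) + 0 • (z₁ - t) + 0 • (z₂ - t)
          + 0 • (s - t) := by intros; push_cast; module
    exact key (Additive Multiplierˣ) th zh z₁ z₂ z₁₂

set_option maxHeartbeats 400000 in
/-- Matrix elements with `v_{-1}` applied to the fourth argument reduce to smaller total weight. -/
theorem mode_three_mem {h : ℕ} {α : A} {v : V}
    (hI₁ : IsIntertwiningOfContragredientType M₁ M₄ M₀ I₁)
    (hI₂ : IsIntertwiningOfType M₂ M₃ M₄ I₂)
    (hx : InLattice M₀ M₁ M₂ M₃ I₁ 𝓜 A' β₁ β₂ β₃ x hI₂.1.truncated) (hh : 0 < h)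
    (hα : (α : B) ∈ A') (hv : v ∈ 𝒱.wt h ⊓ 𝒱.gr α)
    (hγ₁ : γ₁ - β₁ ∈ A') (hγ₂ : γ₂ - β₂ ∈ A') (hγ₃ : γ₃ - β₃ ∈ A')
    (hn : (n₀ + n₁ + n₂ + n₃).re ≤ x + 1)
    (h₀ : w₀ ∈ M₀.wt n₀ ⊓ M₀.gr γ₀) (h₁ : w₁ ∈ M₁.wt n₁ ⊓ M₁.gr γ₁)
    (h₂ : w₂ ∈ M₂.wt n₂ ⊓ M₂.gr γ₂) (h₃ : w₃ ∈ M₃.wt (n₃ - h) ⊓ M₃.gr γ₃) :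
    scale th zh (n₀ + n₁ + n₂ + n₃) n₀ •
      corr I₁ I₂ hI₂.1.truncated w₀ w₁ w₂ (M₃.Y v (-1) w₃) ∈ 𝓜 := by
  obtain ⟨N₁, hN₁⟩ := M₁.exists_mode_eq_zero v w₁
  obtain ⟨N₂, hN₂⟩ := M₂.exists_mode_eq_zero v w₂
  have e := corr_adjointMode hI₁ hI₂ v (-1) w₀ w₃ hN₁ hN₂
  rw [← sub_eq_iff_eq_add, ← sub_eq_iff_eq_add] at e
  rw [← e]
  simp only [smul_sub, Finset.smul_sum]
  refine sub_mem (sub_mem ?_ (sum_mem fun i _ => ?_)) (sum_mem fun i _ => ?_)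
  · rw [← one_smul Multiplierˣ (corr I₁ I₂ hI₂.1.truncated (M₀.adjointMode v (-1) w₀) w₁ w₂ w₃)]
    refine hx.unit_smul_mem (M₀.adjointMode_mem hv h₀ _) h₁ h₂ h₃ hγ₁ hγ₂ hγ₃ hn _
      (2 * h) h (by omega) (by push_cast; ring) (by push_cast; ring)
      ⟨0, 0, 0, 0, 0, 2 * h, ?_⟩
    have key : ∀ (G : Type) [AddCommGroup G] (s t z₁ z₂ d : G),
        0 + (2 * h : ℤ) • s + (-(2 * (h : ℤ))) • t
        = 0 • (s - z₁) + 0 • (s - z₂) + 0 • (s - d) + 0 • (z₁ - t) + 0 • (z₂ - t)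
          + (2 * h) • (s - t) := by intros; module
    exact key (Additive Multiplierˣ) th zh z₁ z₂ z₁₂
  · refine smul_complex_smul_mem _ _ ?_
    refine hx.unit_smul_mem h₀ h₁ (M₂.mode_mem hv h₂ _) h₃ hγ₁ (add_sub_mem hα hγ₂) hγ₃ hn _
      (i + 1) 0 (by omega) (by push_cast; ring) (by push_cast; ring) ⟨0, i + 1, 0, 0, 0, 0, ?_⟩
    have key : ∀ (G : Type) [AddCommGroup G] (s t z₁ z₂ d : G),
        (-1 - i : ℤ) • z₂ + (i + 1 : ℤ) • s + (-(2 * 0 : ℤ)) • t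
        = 0 • (s - z₁) + (i + 1) • (s - z₂) + 0 • (s - d) + 0 • (z₁ - t) + 0 • (z₂ - t)
          + 0 • (s - t) := by intros; module
    exact key (Additive Multiplierˣ) th zh z₁ z₂ z₁₂
  · refine smul_complex_smul_mem _ _ ?_
    refine hx.unit_smul_mem h₀ (M₁.mode_mem hv h₁ _) h₂ h₃ (add_sub_mem hα hγ₁) hγ₂ hγ₃ hn _
      (i + 1) 0 (by omega) (by push_cast; ring) (by push_cast; ring) ⟨i + 1, 0, 0, 0, 0, 0, ?_⟩
    have key : ∀ (G : Type) [AddCommGroup G] (s t z₁ z₂ d : G),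
        (-1 - i : ℤ) • z₁ + (i + 1 : ℤ) • s + (-(2 * 0 : ℤ)) • t
        = (i + 1) • (s - z₁) + 0 • (s - z₂) + 0 • (s - d) + 0 • (z₁ - t) + 0 • (z₂ - t)
          + 0 • (s - t) := by intros; module
    exact key (Additive Multiplierˣ) th zh z₁ z₂ z₁₂

set_option maxHeartbeats 400000 in
/-- Matrix elements with `v_{-1}` applied to the first argument reduce to smaller total weight,
since `v_{-1}` is a combination of adjoint modes, which pass to the other arguments. -/
theorem mode_zero_mem {h : ℕ} {α : A} {v : V}
    (hI₁ : IsIntertwiningOfContragredientType M₁ M₄ M₀ I₁)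
    (hI₂ : IsIntertwiningOfType M₂ M₃ M₄ I₂)
    (hx : InLattice M₀ M₁ M₂ M₃ I₁ 𝓜 A' β₁ β₂ β₃ x hI₂.1.truncated) (hh : 0 < h)
    (hα : (α : B) ∈ A') (hv : v ∈ 𝒱.wt h ⊓ 𝒱.gr α)
    (hγ₁ : γ₁ - β₁ ∈ A') (hγ₂ : γ₂ - β₂ ∈ A') (hγ₃ : γ₃ - β₃ ∈ A')
    (hn : (n₀ + n₁ + n₂ + n₃).re ≤ x + 1)
    (h₀ : w₀ ∈ M₀.wt (n₀ - h) ⊓ M₀.gr γ₀) (h₁ : w₁ ∈ M₁.wt n₁ ⊓ M₁.gr γ₁)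
    (h₂ : w₂ ∈ M₂.wt n₂ ⊓ M₂.gr γ₂) (h₃ : w₃ ∈ M₃.wt n₃ ⊓ M₃.gr γ₃) :
    scale th zh (n₀ + n₁ + n₂ + n₃) n₀ •
      corr I₁ I₂ hI₂.1.truncated (M₀.Y v (-1) w₀) w₁ w₂ w₃ ∈ 𝓜 := by
  obtain ⟨J, hJ⟩ := 𝒱.L1_pow_eq_zero hv
  have hJ' : ∀ j ≥ J + 1, (𝒱.L 1 ^ j) v = 0 := fun j hj => hJ j (by omega)
  rw [M₀.mode_eq_sum_adjointMode hv hJ' (by omega)]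
  change scale th zh (n₀ + n₁ + n₂ + n₃) n₀ • corrₗ₀ I₁ I₂ hI₂.1.truncated w₁ w₂ w₃ _ ∈ 𝓜
  rw [map_sum, Finset.smul_sum]
  refine sum_mem fun j _ => ?_
  rw [map_smul]
  refine smul_complex_smul_mem _ _ ?_
  change scale th zh (n₀ + n₁ + n₂ + n₃) n₀ • corr I₁ I₂ hI₂.1.truncated _ w₁ w₂ w₃ ∈ 𝓜
  have hj := 𝒱.L1_pow_mem hv j
  obtain ⟨N₁, hN₁⟩ := M₁.exists_mode_eq_zero ((𝒱.L 1 ^ j) v) w₁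
  obtain ⟨N₂, hN₂⟩ := M₂.exists_mode_eq_zero ((𝒱.L 1 ^ j) v) w₂
  rw [corr_adjointMode hI₁ hI₂ _ _ w₀ w₃ hN₁ hN₂]
  simp only [smul_add, Finset.smul_sum]
  refine add_mem (add_mem ?_ (sum_mem fun i _ => ?_)) (sum_mem fun i _ => ?_)
  · rw [← one_smul Multiplierˣ (corr I₁ I₂ hI₂.1.truncated w₀ w₁ w₂ _)]
    refine hx.unit_smul_mem h₀ h₁ h₂ (M₃.mode_mem hj h₃ _) hγ₁ hγ₂ (add_sub_mem hα hγ₃) hn _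
      (2 * h) h (by omega) (by push_cast; ring) (by push_cast; ring)
      ⟨0, 0, 0, 0, 0, 2 * h, ?_⟩
    have key : ∀ (G : Type) [AddCommGroup G] (s t z₁ z₂ d : G),
        0 + (2 * h : ℤ) • s + (-(2 * (h : ℤ))) • t
        = 0 • (s - z₁) + 0 • (s - z₂) + 0 • (s - d) + 0 • (z₁ - t) + 0 • (z₂ - t)
          + (2 * h) • (s - t) := by intros; module
    exact key (Additive Multiplierˣ) th zh z₁ z₂ z₁₂
  · refine smul_complex_smul_mem _ _ ?_
    refine hx.unit_smul_mem h₀ (M₁.mode_mem hj h₁ _) h₂ h₃ (add_sub_mem hα hγ₁) hγ₂ hγ₃ hn _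
      (j + i + 1) h (by omega) (by push_cast; ring) (by push_cast; ring)
      ⟨j + i + 1, 0, 0, 2 * h, 0, 0, ?_⟩
    have key : ∀ (G : Type) [AddCommGroup G] (s t z₁ z₂ d : G),
        (2 * h - j - 1 - i : ℤ) • z₁ + (j + i + 1 : ℤ) • s + (-(2 * h : ℤ)) • t
        = (j + i + 1) • (s - z₁) + 0 • (s - z₂) + 0 • (s - d) + (2 * h) • (z₁ - t) + 0 • (z₂ - t)
          + 0 • (s - t) := by intros; module
    exact key (Additive Multiplierˣ) th zh z₁ z₂ z₁₂
  · refine smul_complex_smul_mem _ _ ?_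
    refine hx.unit_smul_mem h₀ h₁ (M₂.mode_mem hj h₂ _) h₃ hγ₁ (add_sub_mem hα hγ₂) hγ₃ hn _
      (j + i + 1) h (by omega) (by push_cast; ring) (by push_cast; ring)
      ⟨0, j + i + 1, 0, 0, 2 * h, 0, ?_⟩
    have key : ∀ (G : Type) [AddCommGroup G] (s t z₁ z₂ d : G),
        (2 * h - j - 1 - i : ℤ) • z₂ + (j + i + 1 : ℤ) • s + (-(2 * h : ℤ)) • t
        = 0 • (s - z₁) + (j + i + 1) • (s - z₂) + 0 • (s - d) + 0 • (z₁ - t) + (2 * h) • (z₂ - t)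
          + 0 • (s - t) := by intros; module
    exact key (Additive Multiplierˣ) th zh z₁ z₂ z₁₂

theorem smul_map_mem_of_mem_span {W : Type*} [AddCommGroup W] [Module ℂ W] (f : W →ₗ[ℂ] TSeries)
    (s : Multiplierˣ) {S : Set W} (hS : ∀ w ∈ S, s • f w ∈ 𝓜) {w : W}
    (hw : w ∈ Submodule.span ℂ S) : s • f w ∈ 𝓜 := by
  induction hw using Submodule.span_induction with
  | mem w hw => exact hS w hw
  | zero => rw [map_zero, smul_zero]; exact 𝓜.zero_mem
  | add w w' _ _ h h' => rw [map_add, smul_add]; exact 𝓜.add_mem h h'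
  | smul c w _ h => rw [map_smul]; exact smul_complex_smul_mem s c h

set_option maxHeartbeats 400000 in
/-- The induction on the total weight: modulo matrix elements of smaller total weight, every vector
can be replaced by a combination of generators of its module modulo `C₁`. -/
theorem succ (hI₁ : IsIntertwiningOfContragredientType M₁ M₄ M₀ I₁)
    (hI₂ : IsIntertwiningOfType M₂ M₃ M₄ I₂)
    (hx : InLattice M₀ M₁ M₂ M₃ I₁ 𝓜 (A₀.map A.subtype) β₁ β₂ β₃ x hI₂.1.truncated)
    {g₀ : B → Set (ℂ × W₀)} {g₁ : B → Set (ℂ × W₁)} {g₂ : B → Set (ℂ × W₂)} {g₃ : B → Set (ℂ × W₃)}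
    (hg₁ : ∀ γ, ∀ b ∈ g₁ γ, b.2 ∈ M₁.wt b.1 ⊓ M₁.gr γ)
    (hg₂ : ∀ γ, ∀ b ∈ g₂ γ, b.2 ∈ M₂.wt b.1 ⊓ M₂.gr γ)
    (hg₃ : ∀ γ, ∀ b ∈ g₃ γ, b.2 ∈ M₃.wt b.1 ⊓ M₃.gr γ)
    (hs₀ : ∀ γ n, ∀ w ∈ M₀.wt n ⊓ M₀.gr γ,
      w ∈ Submodule.span ℂ ({y | (n, y) ∈ g₀ γ} ∪ M₀.C₁Homogeneous A₀ V₀ n γ))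
    (hs₁ : ∀ γ n, ∀ w ∈ M₁.wt n ⊓ M₁.gr γ,
      w ∈ Submodule.span ℂ ({y | (n, y) ∈ g₁ γ} ∪ M₁.C₁Homogeneous A₀ V₀ n γ))
    (hs₂ : ∀ γ n, ∀ w ∈ M₂.wt n ⊓ M₂.gr γ,
      w ∈ Submodule.span ℂ ({y | (n, y) ∈ g₂ γ} ∪ M₂.C₁Homogeneous A₀ V₀ n γ))
    (hs₃ : ∀ γ n, ∀ w ∈ M₃.wt n ⊓ M₃.gr γ,
      w ∈ Submodule.span ℂ ({y | (n, y) ∈ g₃ γ} ∪ M₃.C₁Homogeneous A₀ V₀ n γ))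
    (hgen : ∀ γ₀ γ₁ γ₂ γ₃, γ₁ - β₁ ∈ A₀.map A.subtype → γ₂ - β₂ ∈ A₀.map A.subtype →
      γ₃ - β₃ ∈ A₀.map A.subtype → ∀ b₀ ∈ g₀ γ₀, ∀ b₁ ∈ g₁ γ₁, ∀ b₂ ∈ g₂ γ₂, ∀ b₃ ∈ g₃ γ₃,
      scale th zh (b₀.1 + b₁.1 + b₂.1 + b₃.1) b₀.1 •
        corr I₁ I₂ hI₂.1.truncated b₀.2 b₁.2 b₂.2 b₃.2 ∈ 𝓜) :
    InLattice M₀ M₁ M₂ M₃ I₁ 𝓜 (A₀.map A.subtype) β₁ β₂ β₃ (x + 1) hI₂.1.truncated := by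
  intro n₀ n₁ n₂ n₃ γ₀ γ₁ γ₂ γ₃ w₀ w₁ w₂ w₃ h₀ h₁ h₂ h₃ hγ₁ hγ₂ hγ₃ hn
  have hA : ∀ α : A₀, ((α : A) : B) ∈ A₀.map A.subtype := fun α => ⟨α, α.2, rfl⟩
  have hsub : ∀ {α : A₀} {γ γ' β : B}, ((α : A) : B) + γ' = γ → γ - β ∈ A₀.map A.subtype →
      γ' - β ∈ A₀.map A.subtype := fun {α γ γ' β} e hγ => by
    rw [show γ' - β = γ - β - ((α : A) : B) by rw [← e]; abel]
    exact sub_mem hγ (hA α)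
  refine smul_map_mem_of_mem_span (corrₗ₁ I₁ I₂ hI₂.1.truncated w₀ w₂ w₃) _
    (fun w₁ hw₁ => ?_) (hs₁ γ₁ n₁ w₁ h₁)
  change scale th zh (n₀ + n₁ + n₂ + n₃) n₀ • corr I₁ I₂ hI₂.1.truncated w₀ w₁ w₂ w₃ ∈ 𝓜
  obtain hb₁ | ⟨h, α, γ', hh, hδ, u, hu, w', hw', rfl⟩ := hw₁
  swap
  · exact hx.mode_one_mem hI₁ hI₂ hh (hA α) hu.2 (hsub hδ hγ₁) hγ₂ hγ₃ hn h₀ hw' h₂ h₃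
  have h₁ := hg₁ γ₁ (n₁, w₁) hb₁
  refine smul_map_mem_of_mem_span (corrₗ₂ I₁ I₂ hI₂.1.truncated w₀ w₁ w₃) _
    (fun w₂ hw₂ => ?_) (hs₂ γ₂ n₂ w₂ h₂)
  change scale th zh (n₀ + n₁ + n₂ + n₃) n₀ • corr I₁ I₂ hI₂.1.truncated w₀ w₁ w₂ w₃ ∈ 𝓜
  obtain hb₂ | ⟨h, α, γ', hh, hδ, u, hu, w', hw', rfl⟩ := hw₂
  swap
  · exact hx.mode_two_mem hI₁ hI₂ hh (hA α) hu.2 hγ₁ (hsub hδ hγ₂) hγ₃ hn h₀ h₁ hw' h₃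
  have h₂ := hg₂ γ₂ (n₂, w₂) hb₂
  refine smul_map_mem_of_mem_span (corrₗ₃ I₁ I₂ hI₂.1.truncated w₀ w₁ w₂) _
    (fun w₃ hw₃ => ?_) (hs₃ γ₃ n₃ w₃ h₃)
  change scale th zh (n₀ + n₁ + n₂ + n₃) n₀ • corr I₁ I₂ hI₂.1.truncated w₀ w₁ w₂ w₃ ∈ 𝓜
  obtain hb₃ | ⟨h, α, γ', hh, hδ, u, hu, w', hw', rfl⟩ := hw₃
  swap
  · exact hx.mode_three_mem hI₁ hI₂ hh (hA α) hu.2 hγ₁ hγ₂ (hsub hδ hγ₃) hn h₀ h₁ h₂ hw'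
  have h₃ := hg₃ γ₃ (n₃, w₃) hb₃
  refine smul_map_mem_of_mem_span (corrₗ₀ I₁ I₂ hI₂.1.truncated w₁ w₂ w₃) _
    (fun w₀ hw₀ => ?_) (hs₀ γ₀ n₀ w₀ h₀)
  change scale th zh (n₀ + n₁ + n₂ + n₃) n₀ • corr I₁ I₂ hI₂.1.truncated w₀ w₁ w₂ w₃ ∈ 𝓜
  obtain hb₀ | ⟨h, α, γ', hh, hδ, u, hu, w', hw', rfl⟩ := hw₀
  swap
  · exact hx.mode_zero_mem hI₁ hI₂ hh (hA α) hu.2 hγ₁ hγ₂ hγ₃ hn hw' h₁ h₂ h₃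
  exact hgen γ₀ γ₁ γ₂ γ₃ hγ₁ hγ₂ hγ₃ (n₀, w₀) hb₀ (n₁, w₁) hb₁ (n₂, w₂) hb₂ (n₃, w₃) hb₃

end InLattice

/-- The rescaled matrix elements of doubly homogeneous vectors lie in a finitely generated module
over the ring `latticeRing th zh`. -/
theorem exists_lattice (hI₁ : IsIntertwiningOfContragredientType M₁ M₄ M₀ I₁)
    (hI₂ : IsIntertwiningOfType M₂ M₃ M₄ I₂) (hV₀ : IsStronglyGradedSubalgebra 𝒱 A₀ V₀)
    (hM₀ : M₀.IsLowerBounded ∧ M₀.IsC₁Cofinite V₀) (hM₁ : M₁.IsLowerBounded ∧ M₁.IsC₁Cofinite V₀)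
    (hM₂ : M₂.IsLowerBounded ∧ M₂.IsC₁Cofinite V₀) (hM₃ : M₃.IsLowerBounded ∧ M₃.IsC₁Cofinite V₀)
    (hfusion₁ : ∀ γ₁ γ₂ : B, {α : A₀ × A₀ | contragredientFusionRule M₁ M₄ M₀
      (γ₁ + ((α.1 : A) : B)) (γ₂ + ((α.2 : A) : B)) ≠ 0}.Finite)
    (hfusion₂ : ∀ γ₁ γ₂ : B, {α : A₀ × A₀ | fusionRule M₂ M₃ M₄
      (γ₁ + ((α.1 : A) : B)) (γ₂ + ((α.2 : A) : B)) ≠ 0}.Finite) (β₁ β₂ β₃ : B)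
    (th zh : Multiplierˣ) :
    ∃ 𝓜 : Submodule (latticeRing th zh) TSeries, 𝓜.FG ∧
      ∀ x, InLattice M₀ M₁ M₂ M₃ I₁ 𝓜 (A₀.map A.subtype) β₁ β₂ β₃ x hI₂.1.truncated := by
  obtain ⟨Λ, hΛ, hΛ0⟩ := exists_finite_degrees hI₁ hI₂ hfusion₁ hfusion₂ β₁ β₂ β₃
  have hzero : ∀ γ₀ γ₁ γ₂ γ₃, γ₁ - β₁ ∈ A₀.map A.subtype → γ₂ - β₂ ∈ A₀.map A.subtype →
      γ₃ - β₃ ∈ A₀.map A.subtype → (γ₀, γ₁, γ₂, γ₃) ∉ Λ → ∀ w₀ ∈ M₀.gr γ₀, ∀ w₁ ∈ M₁.gr γ₁,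
      ∀ w₂ ∈ M₂.gr γ₂, ∀ w₃ ∈ M₃.gr γ₃, corr I₁ I₂ hI₂.1.truncated w₀ w₁ w₂ w₃ = 0 := by
    rintro γ₀ γ₁ γ₂ γ₃ ⟨α₁, h₁, e₁⟩ ⟨α₂, h₂, e₂⟩ ⟨α₃, h₃, e₃⟩
    obtain rfl : γ₁ = β₁ + (α₁ : B) := by rw [show (α₁ : B) = γ₁ - β₁ from e₁]; abel
    obtain rfl : γ₂ = β₂ + (α₂ : B) := by rw [show (α₂ : B) = γ₂ - β₂ from e₂]; abel
    obtain rfl : γ₃ = β₃ + (α₃ : B) := by rw [show (α₃ : B) = γ₃ - β₃ from e₃]; abel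
    exact hΛ0 γ₀ ⟨α₁, h₁⟩ ⟨α₂, h₂⟩ ⟨α₃, h₃⟩
  choose g₀ hf₀ hg₀ hs₀ using M₀.exists_generators hV₀ hM₀.2
  choose g₁ hf₁ hg₁ hs₁ using M₁.exists_generators hV₀ hM₁.2
  choose g₂ hf₂ hg₂ hs₂ using M₂.exists_generators hV₀ hM₂.2
  choose g₃ hf₃ hg₃ hs₃ using M₃.exists_generators hV₀ hM₃.2
  choose N₀ hN₀ using hM₀.1
  choose N₁ hN₁ using hM₁.1
  choose N₂ hN₂ using hM₂.1
  choose N₃ hN₃ using hM₃.1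
  set S : Set TSeries := ⋃ γ ∈ Λ,
    (fun b : (ℂ × W₀) × (ℂ × W₁) × (ℂ × W₂) × (ℂ × W₃) =>
      scale th zh (b.1.1 + b.2.1.1 + b.2.2.1.1 + b.2.2.2.1) b.1.1 •
        corr I₁ I₂ hI₂.1.truncated b.1.2 b.2.1.2 b.2.2.1.2 b.2.2.2.2) ''
      (g₀ γ.1 ×ˢ (g₁ γ.2.1 ×ˢ (g₂ γ.2.2.1 ×ˢ g₃ γ.2.2.2))) with hS
  have hSf : S.Finite := hΛ.biUnion fun γ _ =>
    ((hf₀ _).prod ((hf₁ _).prod ((hf₂ _).prod (hf₃ _)))).image _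
  refine ⟨Submodule.span _ S, Submodule.fg_span hSf, ?_⟩
  obtain ⟨X, hX⟩ := (hΛ.image fun γ : B × B × B × B =>
    N₀ γ.1 + N₁ γ.2.1 + N₂ γ.2.2.1 + N₃ γ.2.2.2).bddBelow
  have hk : ∀ k : ℕ, InLattice M₀ M₁ M₂ M₃ I₁ (Submodule.span (latticeRing th zh) S)
      (A₀.map A.subtype) β₁ β₂ β₃ (X - 1 + k) hI₂.1.truncated := by
    intro k
    induction k with
    | zero =>
      intro n₀ n₁ n₂ n₃ γ₀ γ₁ γ₂ γ₃ w₀ w₁ w₂ w₃ h₀ h₁ h₂ h₃ hγ₁ hγ₂ hγ₃ hn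
      suffices h : corr I₁ I₂ hI₂.1.truncated w₀ w₁ w₂ w₃ = 0 by
        rw [h, smul_zero]; exact Submodule.zero_mem _
      by_cases hmem : (γ₀, γ₁, γ₂, γ₃) ∈ Λ
      swap
      · exact hzero _ _ _ _ hγ₁ hγ₂ hγ₃ hmem _ h₀.2 _ h₁.2 _ h₂.2 _ h₃.2
      have hle : X ≤ N₀ γ₀ + N₁ γ₁ + N₂ γ₂ + N₃ γ₃ := hX ⟨_, hmem, rfl⟩
      by_cases c₀ : n₀.re < N₀ γ₀
      · rw [hN₀ _ _ c₀] at h₀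
        rw [(Submodule.mem_bot ℂ).mp h₀]
        exact (corrₗ₀ I₁ I₂ hI₂.1.truncated w₁ w₂ w₃).map_zero
      by_cases c₁ : n₁.re < N₁ γ₁
      · rw [hN₁ _ _ c₁] at h₁
        rw [(Submodule.mem_bot ℂ).mp h₁]
        exact (corrₗ₁ I₁ I₂ hI₂.1.truncated w₀ w₂ w₃).map_zero
      by_cases c₂ : n₂.re < N₂ γ₂
      · rw [hN₂ _ _ c₂] at h₂
        rw [(Submodule.mem_bot ℂ).mp h₂]
        exact (corrₗ₂ I₁ I₂ hI₂.1.truncated w₀ w₁ w₃).map_zero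
      by_cases c₃ : n₃.re < N₃ γ₃
      · rw [hN₃ _ _ c₃] at h₃
        rw [(Submodule.mem_bot ℂ).mp h₃]
        exact (corrₗ₃ I₁ I₂ hI₂.1.truncated w₀ w₁ w₂).map_zero
      simp only [Complex.add_re, Nat.cast_zero] at hn
      linarith
    | succ k ih =>
      have := ih.succ hI₁ hI₂ hg₁ hg₂ hg₃ hs₀ hs₁ hs₂ hs₃ ?_
      · rwa [add_assoc, ← Nat.cast_add_one] at this
      intro γ₀ γ₁ γ₂ γ₃ hγ₁ hγ₂ hγ₃ b₀ hb₀ b₁ hb₁ b₂ hb₂ b₃ hb₃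
      by_cases hmem : (γ₀, γ₁, γ₂, γ₃) ∈ Λ
      · exact Submodule.subset_span (Set.mem_biUnion hmem
          ⟨(b₀, b₁, b₂, b₃), ⟨hb₀, hb₁, hb₂, hb₃⟩, rfl⟩)
      · rw [hzero _ _ _ _ hγ₁ hγ₂ hγ₃ hmem _ (hg₀ _ _ hb₀).2 _ (hg₁ _ _ hb₁).2 _
          (hg₂ _ _ hb₂).2 _ (hg₃ _ _ hb₃).2, smul_zero]
        exact Submodule.zero_mem _
  intro x
  obtain ⟨k, hkx⟩ := exists_nat_ge (x - (X - 1))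
  intro n₀ n₁ n₂ n₃ γ₀ γ₁ γ₂ γ₃ w₀ w₁ w₂ w₃ h₀ h₁ h₂ h₃ hγ₁ hγ₂ hγ₃ hn
  exact hk k h₀ h₁ h₂ h₃ hγ₁ hγ₂ hγ₃ (by linarith)

end Lattice

/-! ### Existence of the differential equations -/

open Multiplier

/-- In a Noetherian module every sequence satisfies a monic linear relation. -/
theorem exists_monic_relation {R M : Type*} [CommRing R] [AddCommGroup M] [Module R M]
    [IsNoetherian R M] (x : ℕ → M) :
    ∃ m, 0 < m ∧ ∃ c : Fin m → R, x m = ∑ j, c j • x j := by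
  let f : ℕ →o Submodule R M := ⟨fun n => Submodule.span R (x '' Set.Iio n), fun a b hab =>
    Submodule.span_mono (Set.image_mono (Set.Iio_subset_Iio hab))⟩
  obtain ⟨n, hn⟩ := monotone_stabilizes_iff_noetherian.mpr ‹IsNoetherian R M› f
  have h1 : x (n + 1) ∈ f (n + 1) := by
    rw [← hn (n + 1) (by omega), hn (n + 2) (by omega)]
    exact Submodule.subset_span ⟨n + 1, by simp, rfl⟩
  refine ⟨n + 1, by omega, ?_⟩
  have h2 : x '' Set.Iio (n + 1) = Set.range fun j : Fin (n + 1) => x j := by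
    ext y
    constructor
    · rintro ⟨j, hj, rfl⟩
      exact ⟨⟨j, hj⟩, rfl⟩
    · rintro ⟨j, rfl⟩
      exact ⟨j, j.2, rfl⟩
  have h3 : x (n + 1) ∈ Submodule.span R (Set.range fun j : Fin (n + 1) => x j) := h2 ▸ h1
  obtain ⟨c, hc⟩ := (Submodule.mem_span_range_iff_exists_fun R).mp h3
  exact ⟨c, hc.symm⟩

theorem exists_common_monic_relation {R X : Type*} [CommRing R] [IsNoetherianRing R]
    [AddCommGroup X] [Module R X] {N : Submodule R X} (hN : N.FG) {ι : Type*} (T : Finset ι)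
    (y : ι → ℕ → X) (hy : ∀ t ∈ T, ∀ j, y t j ∈ N) :
    ∃ m, 0 < m ∧ ∃ c : Fin m → R, ∀ t ∈ T, y t m = ∑ j : Fin m, c j • y t j := by
  have : Module.Finite R N := Module.Finite.iff_fg.mpr hN
  have : IsNoetherian R N := isNoetherian_of_isNoetherianRing_of_finite _ _
  obtain ⟨m, hm, c, hc⟩ := exists_monic_relation (R := R)
    (M := T → N) fun j t => ⟨y t j, hy t t.2 j⟩
  refine ⟨m, hm, c, fun t ht => ?_⟩
  have e := congrArg Subtype.val (congrFun hc ⟨t, ht⟩)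
  rw [Finset.sum_apply] at e
  simpa only [Pi.smul_apply, Submodule.coe_sum, Submodule.coe_smul_of_tower] using e

/-- If the rescaled derivatives of the terms of a finite sum lie in a finitely generated lattice, the
sum satisfies a linear differential equation with coefficients in the ring of the lattice. -/
theorem exists_relation_of_sum {th zh : Multiplierˣ} {𝓜 : Submodule (latticeRing th zh) TSeries}
    (h𝓜 : 𝓜.FG) {ι : Type*} (T : Finset ι) (F : ι → TSeries) (s : ι → Multiplierˣ)
    (D : Module.End ℂ TSeries) (l : Multiplierˣ)
    (h : ∀ t ∈ T, ∀ j : ℕ, s t • (l ^ j • (D ^ j) (F t)) ∈ 𝓜) :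
    ∃ m, 0 < m ∧ ∃ c : Fin m → latticeRing th zh,
      l ^ m • (D ^ m) (∑ t ∈ T, F t)
        = ∑ j : Fin m, (c j : Multiplier) • (l ^ (j : ℕ) • (D ^ (j : ℕ)) (∑ t ∈ T, F t)) := by
  obtain ⟨m, hm, c, hc⟩ := exists_common_monic_relation h𝓜 T
    (fun t j => s t • (l ^ j • (D ^ j) (F t))) h
  refine ⟨m, hm, c, ?_⟩
  have ht : ∀ t ∈ T, l ^ m • (D ^ m) (F t)
      = ∑ j : Fin m, (c j : Multiplier) • (l ^ (j : ℕ) • (D ^ (j : ℕ)) (F t)) := by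
    intro t ht
    rw [← inv_smul_smul (s t) (l ^ m • (D ^ m) (F t)), hc t ht, Finset.smul_sum]
    refine Finset.sum_congr rfl fun j _ => ?_
    change (s t)⁻¹ • ((c j : Multiplier) • (s t • (l ^ (j : ℕ) • (D ^ (j : ℕ)) (F t)))) = _
    rw [Units.smul_def, Units.smul_def (s t), ← mul_smul, ← mul_smul, mul_right_comm,
      Units.inv_mul, one_mul]
  simp only [map_sum, Finset.smul_sum]
  rw [Finset.sum_comm, Finset.sum_congr rfl ht]

section Derivatives

variable {B : Type*} [AddCommGroup B] {A : AddSubgroup B}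
  {V : Type v} [AddCommGroup V] [Module ℂ V] {𝒱 : StronglyGradedCVA A V}
  {W₀ W₁ W₂ W₃ W₄ : Type u} [AddCommGroup W₀] [Module ℂ W₀] [AddCommGroup W₁] [Module ℂ W₁]
  [AddCommGroup W₂] [Module ℂ W₂] [AddCommGroup W₃] [Module ℂ W₃] [AddCommGroup W₄] [Module ℂ W₄]
  {M₀ : StronglyGradedModule 𝒱 W₀} {M₁ : StronglyGradedModule 𝒱 W₁}
  {M₂ : StronglyGradedModule 𝒱 W₂} {M₃ : StronglyGradedModule 𝒱 W₃}
  {M₄ : StronglyGradedModule 𝒱 W₄}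
  {I₁ : ℂ → ℕ → W₁ →ₗ[ℂ] W₄ →ₗ[ℂ] Module.Dual ℂ W₀}
  {I₂ : ℂ → ℕ → W₂ →ₗ[ℂ] W₃ →ₗ[ℂ] W₄}
  {th zh : Multiplierˣ} {𝓜 : Submodule (latticeRing th zh) TSeries}
  {A' : AddSubgroup B} {β₁ β₂ β₃ : B} {γ₀ γ₁ γ₂ γ₃ : B}

theorem StronglyGradedModule.translation_mem (M : StronglyGradedModule 𝒱 W₀) {n : ℂ} {γ : B} {w : W₀}
    (hw : w ∈ M.wt n ⊓ M.gr γ) : M.Y 𝒱.ω 0 w ∈ M.wt (n + 1) ⊓ M.gr γ := by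
  have h := M.mode_mem (h := 2) ⟨𝒱.ω_mem, 𝒱.ω_gr⟩ hw 0
  rw [show n + (((2 : ℤ) : ℂ) - ((0 : ℤ) : ℂ) - 1) = n + 1 by push_cast; ring] at h
  simpa only [ZeroMemClass.coe_zero, zero_add] using h

theorem StronglyGradedModule.weightOperator_mem (M : StronglyGradedModule 𝒱 W₀) {n : ℂ} {γ : B}
    {w : W₀} (hw : w ∈ M.wt n ⊓ M.gr γ) : M.Y 𝒱.ω 1 w ∈ M.wt n ⊓ M.gr γ := by
  have h := M.mode_mem (h := 2) ⟨𝒱.ω_mem, 𝒱.ω_gr⟩ hw 1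
  rw [show n + (((2 : ℤ) : ℂ) - ((1 : ℤ) : ℂ) - 1) = n by push_cast; ring] at h
  simpa only [ZeroMemClass.coe_zero, zero_add] using h

theorem StronglyGradedModule.adjointWeightOperator_mem (M : StronglyGradedModule 𝒱 W₀) {n : ℂ}
    {γ : B} {w : W₀} (hw : w ∈ M.wt n ⊓ M.gr γ) :
    M.adjointMode 𝒱.ω 1 w ∈ M.wt n ⊓ M.gr γ := by
  have h := M.adjointMode_mem (h := 2) ⟨𝒱.ω_mem, 𝒱.ω_gr⟩ hw 1
  rw [show n + (((1 : ℤ) : ℂ) + 1 - ((2 : ℤ) : ℂ)) = n by push_cast; ring] at h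
  simpa only [ZeroMemClass.coe_zero, zero_add] using h

theorem scale_mul_pow (th zh : Multiplierˣ) (N n₀ : ℂ) :
    scale th zh N n₀ * th = scale th zh (N + 1) n₀ := by
  have h1 : ⌊(N + 1).re⌋ = ⌊N.re⌋ + 1 := by simp
  rw [scale, scale, h1, mul_right_comm, zpow_add_one]

namespace InLattice

theorem D₁_iterate_mem (hI₁ : IsIntertwiningOfContragredientType M₁ M₄ M₀ I₁)
    (hI₂ : IsIntertwiningOfType M₂ M₃ M₄ I₂)
    (hx : ∀ x, InLattice M₀ M₁ M₂ M₃ I₁ 𝓜 A' β₁ β₂ β₃ x hI₂.1.truncated)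
    (hγ₁ : γ₁ - β₁ ∈ A') (hγ₂ : γ₂ - β₂ ∈ A') (hγ₃ : γ₃ - β₃ ∈ A') (j : ℕ) :
    ∀ {n₀ n₁ n₂ n₃ : ℂ} {w₀ : W₀} {w₁ : W₁} {w₂ : W₂} {w₃ : W₃},
      w₀ ∈ M₀.wt n₀ ⊓ M₀.gr γ₀ → w₁ ∈ M₁.wt n₁ ⊓ M₁.gr γ₁ →
      w₂ ∈ M₂.wt n₂ ⊓ M₂.gr γ₂ → w₃ ∈ M₃.wt n₃ ⊓ M₃.gr γ₃ →
      scale th zh (n₀ + n₁ + n₂ + n₃) n₀ •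
        (th ^ j • TSeries.D₁^[j] (corr I₁ I₂ hI₂.1.truncated w₀ w₁ w₂ w₃)) ∈ 𝓜 := by
  induction j with
  | zero =>
    intro n₀ n₁ n₂ n₃ w₀ w₁ w₂ w₃ h₀ h₁ h₂ h₃
    rw [pow_zero, one_smul]
    exact hx _ h₀ h₁ h₂ h₃ hγ₁ hγ₂ hγ₃ le_rfl
  | succ j ih =>
    intro n₀ n₁ n₂ n₃ w₀ w₁ w₂ w₃ h₀ h₁ h₂ h₃
    have := ih h₀ (M₁.translation_mem h₁) h₂ h₃
    rw [show n₀ + (n₁ + 1) + n₂ + n₃ = n₀ + n₁ + n₂ + n₃ + 1 by ring, ← scale_mul_pow,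
      ← corr_D₁ hI₁ hI₂] at this
    rwa [Function.iterate_succ_apply, pow_succ', mul_smul, ← mul_smul (scale _ _ _ _)]

theorem D₂_iterate_mem (hI₂ : IsIntertwiningOfType M₂ M₃ M₄ I₂)
    (hx : ∀ x, InLattice M₀ M₁ M₂ M₃ I₁ 𝓜 A' β₁ β₂ β₃ x hI₂.1.truncated)
    (hγ₁ : γ₁ - β₁ ∈ A') (hγ₂ : γ₂ - β₂ ∈ A') (hγ₃ : γ₃ - β₃ ∈ A') (j : ℕ) :
    ∀ {n₀ n₁ n₂ n₃ : ℂ} {w₀ : W₀} {w₁ : W₁} {w₂ : W₂} {w₃ : W₃},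
      w₀ ∈ M₀.wt n₀ ⊓ M₀.gr γ₀ → w₁ ∈ M₁.wt n₁ ⊓ M₁.gr γ₁ →
      w₂ ∈ M₂.wt n₂ ⊓ M₂.gr γ₂ → w₃ ∈ M₃.wt n₃ ⊓ M₃.gr γ₃ →
      scale th zh (n₀ + n₁ + n₂ + n₃) n₀ •
        (th ^ j • TSeries.D₂^[j] (corr I₁ I₂ hI₂.1.truncated w₀ w₁ w₂ w₃)) ∈ 𝓜 := by
  induction j with
  | zero =>
    intro n₀ n₁ n₂ n₃ w₀ w₁ w₂ w₃ h₀ h₁ h₂ h₃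
    rw [pow_zero, one_smul]
    exact hx _ h₀ h₁ h₂ h₃ hγ₁ hγ₂ hγ₃ le_rfl
  | succ j ih =>
    intro n₀ n₁ n₂ n₃ w₀ w₁ w₂ w₃ h₀ h₁ h₂ h₃
    have := ih h₀ h₁ (M₂.translation_mem h₂) h₃
    rw [show n₀ + n₁ + (n₂ + 1) + n₃ = n₀ + n₁ + n₂ + n₃ + 1 by ring, ← scale_mul_pow,
      ← corr_D₂ hI₂] at this
    rwa [Function.iterate_succ_apply, pow_succ', mul_smul, ← mul_smul (scale _ _ _ _)]

/-- When `th = z₂`, the derivatives in `z₁` are controlled through the Euler field. -/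
theorem D₁_iterate_mem_of_eq (hI₁ : IsIntertwiningOfContragredientType M₁ M₄ M₀ I₁)
    (hI₂ : IsIntertwiningOfType M₂ M₃ M₄ I₂)
    (hx : ∀ x, InLattice M₀ M₁ M₂ M₃ I₁ 𝓜 A' β₁ β₂ β₃ x hI₂.1.truncated) (hth : th = z₂)
    (hγ₁ : γ₁ - β₁ ∈ A') (hγ₂ : γ₂ - β₂ ∈ A') (hγ₃ : γ₃ - β₃ ∈ A') (j : ℕ) :
    ∀ {n₀ n₁ n₂ n₃ : ℂ} {w₀ : W₀} {w₁ : W₁} {w₂ : W₂} {w₃ : W₃},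
      w₀ ∈ M₀.wt n₀ ⊓ M₀.gr γ₀ → w₁ ∈ M₁.wt n₁ ⊓ M₁.gr γ₁ →
      w₂ ∈ M₂.wt n₂ ⊓ M₂.gr γ₂ → w₃ ∈ M₃.wt n₃ ⊓ M₃.gr γ₃ →
      scale th zh (n₀ + n₁ + n₂ + n₃) n₀ •
        (z₁ ^ j • TSeries.D₁^[j] (corr I₁ I₂ hI₂.1.truncated w₀ w₁ w₂ w₃)) ∈ 𝓜 := by
  induction j with
  | zero =>
    intro n₀ n₁ n₂ n₃ w₀ w₁ w₂ w₃ h₀ h₁ h₂ h₃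
    rw [pow_zero, one_smul]
    exact hx _ h₀ h₁ h₂ h₃ hγ₁ hγ₂ hγ₃ le_rfl
  | succ j ih =>
    intro n₀ n₁ n₂ n₃ w₀ w₁ w₂ w₃ h₀ h₁ h₂ h₃
    have e₁ := TSeries.D₁_iterate_euler j (corr I₁ I₂ hI₂.1.truncated w₀ w₁ w₂ w₃)
    rw [eq_sub_of_add_eq (corr_euler hI₁ hI₂ w₀ w₁ w₂ w₃), corr_D₂ hI₂, TSeries.D₁_iterate_eq,
      map_sub, map_sub, map_sub, map_sub] at e₁
    simp only [← TSeries.D₁_iterate_eq, TSeries.D₁_iterate_z₂_smul] at e₁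
    rw [pow_succ, mul_smul, eq_sub_of_add_eq e₁.symm]
    simp only [smul_sub]
    refine sub_mem (sub_mem (sub_mem (sub_mem (sub_mem ?_ ?_) ?_) ?_) ?_) ?_
    · exact ih (M₀.adjointWeightOperator_mem h₀) h₁ h₂ h₃
    · exact ih h₀ (M₁.weightOperator_mem h₁) h₂ h₃
    · exact ih h₀ h₁ (M₂.weightOperator_mem h₂) h₃
    · exact ih h₀ h₁ h₂ (M₃.weightOperator_mem h₃)
    · have := ih h₀ h₁ (M₂.translation_mem h₂) h₃
      rw [show n₀ + n₁ + (n₂ + 1) + n₃ = n₀ + n₁ + n₂ + n₃ + 1 by ring, ← scale_mul_pow,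
        mul_smul, ← mul_smul th, mul_comm th, mul_smul] at this
      rwa [← hth]
    · rw [smul_comm (z₁ ^ j)]
      exact smul_complex_smul_mem _ _ (ih h₀ h₁ h₂ h₃)

/-- When `th = z₁`, the derivatives in `z₂` are controlled through the Euler field. -/
theorem D₂_iterate_mem_of_eq (hI₁ : IsIntertwiningOfContragredientType M₁ M₄ M₀ I₁)
    (hI₂ : IsIntertwiningOfType M₂ M₃ M₄ I₂)
    (hx : ∀ x, InLattice M₀ M₁ M₂ M₃ I₁ 𝓜 A' β₁ β₂ β₃ x hI₂.1.truncated) (hth : th = z₁)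
    (hγ₁ : γ₁ - β₁ ∈ A') (hγ₂ : γ₂ - β₂ ∈ A') (hγ₃ : γ₃ - β₃ ∈ A') (j : ℕ) :
    ∀ {n₀ n₁ n₂ n₃ : ℂ} {w₀ : W₀} {w₁ : W₁} {w₂ : W₂} {w₃ : W₃},
      w₀ ∈ M₀.wt n₀ ⊓ M₀.gr γ₀ → w₁ ∈ M₁.wt n₁ ⊓ M₁.gr γ₁ →
      w₂ ∈ M₂.wt n₂ ⊓ M₂.gr γ₂ → w₃ ∈ M₃.wt n₃ ⊓ M₃.gr γ₃ →
      scale th zh (n₀ + n₁ + n₂ + n₃) n₀ •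
        (z₂ ^ j • TSeries.D₂^[j] (corr I₁ I₂ hI₂.1.truncated w₀ w₁ w₂ w₃)) ∈ 𝓜 := by
  induction j with
  | zero =>
    intro n₀ n₁ n₂ n₃ w₀ w₁ w₂ w₃ h₀ h₁ h₂ h₃
    rw [pow_zero, one_smul]
    exact hx _ h₀ h₁ h₂ h₃ hγ₁ hγ₂ hγ₃ le_rfl
  | succ j ih =>
    intro n₀ n₁ n₂ n₃ w₀ w₁ w₂ w₃ h₀ h₁ h₂ h₃
    have e₁ := TSeries.D₂_iterate_euler j (corr I₁ I₂ hI₂.1.truncated w₀ w₁ w₂ w₃)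
    rw [eq_sub_of_add_eq' (corr_euler hI₁ hI₂ w₀ w₁ w₂ w₃), corr_D₁ hI₁ hI₂,
      TSeries.D₂_iterate_eq, map_sub, map_sub, map_sub, map_sub] at e₁
    simp only [← TSeries.D₂_iterate_eq, TSeries.D₂_iterate_z₁_smul] at e₁
    rw [pow_succ, mul_smul, eq_sub_of_add_eq e₁.symm]
    simp only [smul_sub]
    refine sub_mem (sub_mem (sub_mem (sub_mem (sub_mem ?_ ?_) ?_) ?_) ?_) ?_
    · exact ih (M₀.adjointWeightOperator_mem h₀) h₁ h₂ h₃
    · exact ih h₀ (M₁.weightOperator_mem h₁) h₂ h₃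
    · exact ih h₀ h₁ (M₂.weightOperator_mem h₂) h₃
    · exact ih h₀ h₁ h₂ (M₃.weightOperator_mem h₃)
    · have := ih h₀ (M₁.translation_mem h₁) h₂ h₃
      rw [show n₀ + (n₁ + 1) + n₂ + n₃ = n₀ + n₁ + n₂ + n₃ + 1 by ring, ← scale_mul_pow,
        mul_smul, ← mul_smul th, mul_comm th, mul_smul] at this
      rwa [← hth]
    · rw [smul_comm (z₂ ^ j)]
      exact smul_complex_smul_mem _ _ (ih h₀ h₁ h₂ h₃)

end InLattice

/-- A matrix element of homogeneous vectors is a finite sum of matrix elements of doubly homogeneous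
vectors. -/
theorem exists_corr_eq_sum (hT : ∀ w₂ w₃ n, ∃ N : ℕ, ∀ m : ℕ, N ≤ m → ∀ k, I₂ (n + m) k w₂ w₃ = 0)
    {w₀ : W₀} {w₁ : W₁} {w₂ : W₂} {w₃ : W₃} (h₀ : w₀ ∈ M₀.gr γ₀) (h₁ : w₁ ∈ M₁.gr γ₁)
    (h₂ : w₂ ∈ M₂.gr γ₂) (h₃ : w₃ ∈ M₃.gr γ₃) :
    ∃ (T : Finset (ℂ × ℂ × ℂ × ℂ)) (f₀ : ℂ → W₀) (f₁ : ℂ → W₁) (f₂ : ℂ → W₂) (f₃ : ℂ → W₃),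
      (∀ n, f₀ n ∈ M₀.wt n ⊓ M₀.gr γ₀) ∧ (∀ n, f₁ n ∈ M₁.wt n ⊓ M₁.gr γ₁) ∧
      (∀ n, f₂ n ∈ M₂.wt n ⊓ M₂.gr γ₂) ∧ (∀ n, f₃ n ∈ M₃.wt n ⊓ M₃.gr γ₃) ∧
      corr I₁ I₂ hT w₀ w₁ w₂ w₃
        = ∑ t ∈ T, corr I₁ I₂ hT (f₀ t.1) (f₁ t.2.1) (f₂ t.2.2.1) (f₃ t.2.2.2) := by
  rw [M₀.compatible] at h₀
  rw [M₁.compatible] at h₁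
  rw [M₂.compatible] at h₂
  rw [M₃.compatible] at h₃
  obtain ⟨f₀, hf₀, e₀⟩ := (Submodule.mem_iSup_iff_exists_finsupp _ _).mp h₀
  obtain ⟨f₁, hf₁, e₁⟩ := (Submodule.mem_iSup_iff_exists_finsupp _ _).mp h₁
  obtain ⟨f₂, hf₂, e₂⟩ := (Submodule.mem_iSup_iff_exists_finsupp _ _).mp h₂
  obtain ⟨f₃, hf₃, e₃⟩ := (Submodule.mem_iSup_iff_exists_finsupp _ _).mp h₃
  refine ⟨f₀.support ×ˢ (f₁.support ×ˢ (f₂.support ×ˢ f₃.support)), f₀, f₁, f₂, f₃, hf₀, hf₁, hf₂,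
    hf₃, ?_⟩
  simp only [Finset.sum_product]
  rw [Finsupp.sum] at e₀ e₁ e₂ e₃
  calc corr I₁ I₂ hT w₀ w₁ w₂ w₃ = ∑ a ∈ f₀.support, corr I₁ I₂ hT (f₀ a) w₁ w₂ w₃ := by
        rw [← e₀]; exact map_sum (corrₗ₀ I₁ I₂ hT w₁ w₂ w₃) _ _
    _ = _ := Finset.sum_congr rfl fun a _ => by
        rw [← e₁]; exact map_sum (corrₗ₁ I₁ I₂ hT (f₀ a) w₂ w₃) _ _
    _ = _ := Finset.sum_congr rfl fun a _ => Finset.sum_congr rfl fun b _ => by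
        rw [← e₂]; exact map_sum (corrₗ₂ I₁ I₂ hT (f₀ a) (f₁ b) w₃) _ _
    _ = _ := Finset.sum_congr rfl fun a _ => Finset.sum_congr rfl fun b _ =>
        Finset.sum_congr rfl fun c _ => by
          rw [← e₃]; exact map_sum (corrₗ₃ I₁ I₂ hT (f₀ a) (f₁ b) (f₂ c)) _ _

end Derivatives

/-! ### Systems with coefficients holomorphic along a singular locus -/

open Multiplier

namespace SingularLocus

/-- A scale-invariant coordinate that vanishes at the singular point. -/
def τ : SingularLocus → ℂ × ℂ → ℂ
  | .z₁Zero, z => z.1 / z.2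
  | .z₂Zero, z => z.2 / z.1
  | .z₁Infty, z => z.2 / z.1
  | .z₂Infty, z => z.1 / z.2
  | .diagonal, z => (z.1 - z.2) / z.2
  | .diagonalOverZ₁, z => (z.1 - z.2) / z.1
  | .diagonalOverZ₂, z => (z.1 - z.2) / z.2

/-- The function such that the system is written in terms of the operators
`(σ.speed₁)^j ∂₁^j`. -/
def speed₁ : SingularLocus → ℂ × ℂ → ℂ
  | .z₁Zero, z | .z₂Zero, z | .z₁Infty, z | .z₂Infty, z => z.1
  | .diagonal, z | .diagonalOverZ₁, z | .diagonalOverZ₂, z => z.1 - z.2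

/-- The function such that the system is written in terms of the operators
`(σ.speed₂)^j ∂₂^j`. -/
def speed₂ : SingularLocus → ℂ × ℂ → ℂ
  | .z₁Zero, z | .z₂Zero, z | .z₁Infty, z | .z₂Infty, z => z.2
  | .diagonal, z | .diagonalOverZ₁, z | .diagonalOverZ₂, z => z.1 - z.2

end SingularLocus

/-- The coefficients become holomorphic functions of `σ.τ` near `σ.τ = 0` when the system is written
in terms of the operators `(σ.speedᵢ)^j ∂ᵢ^j`. -/
def DiffSystem.IsFuchsianAlong (S : DiffSystem) (σ : SingularLocus) : Prop :=
  (∀ k, ∃ γ : ℂ → ℂ, AnalyticOnNhd ℂ γ (Metric.ball 0 1) ∧ ∀ z, IsGood z → ‖σ.τ z‖ < 1 →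
    (S.a k).eval z * σ.speed₁ z ^ ((k : ℕ) + 1) = γ (σ.τ z)) ∧
  (∀ k, ∃ γ : ℂ → ℂ, AnalyticOnNhd ℂ γ (Metric.ball 0 1) ∧ ∀ z, IsGood z → ‖σ.τ z‖ < 1 →
    (S.b k).eval z * σ.speed₂ z ^ ((k : ℕ) + 1) = γ (σ.τ z))

/-- The multiplier `c` has values that are holomorphic functions of the coordinate `τ`. -/
def HolomorphicIn (τ : ℂ × ℂ → ℂ) (c : Multiplier) : Prop :=
  ∃ γ : ℂ → ℂ, AnalyticOnNhd ℂ γ (Metric.ball 0 1) ∧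
    ∃ φ, Represents c φ ∧ ∀ z, IsGood z → ‖τ z‖ < 1 → φ z = γ (τ z)

theorem HolomorphicIn.of_mem_adjoin {τ : ℂ × ℂ → ℂ} {S : Set Multiplier}
    (hS : ∀ c ∈ S, HolomorphicIn τ c) {c : Multiplier} (hc : c ∈ Algebra.adjoin ℂ S) :
    HolomorphicIn τ c := by
  induction hc using Algebra.adjoin_induction with
  | mem c hc => exact hS c hc
  | algebraMap r => exact ⟨fun _ => r, analyticOnNhd_const, _, Represents.const r, fun _ _ _ => rfl⟩
  | add c c' _ _ h h' =>
    obtain ⟨γ, hγ, φ, hφ, e⟩ := h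
    obtain ⟨γ', hγ', φ', hφ', e'⟩ := h'
    exact ⟨_, hγ.add hγ', _, hφ.add hφ', fun z hz ht => by
      rw [e z hz ht, e' z hz ht]; rfl⟩
  | mul c c' _ _ h h' =>
    obtain ⟨γ, hγ, φ, hφ, e⟩ := h
    obtain ⟨γ', hγ', φ', hφ', e'⟩ := h'
    exact ⟨_, hγ.mul hγ', _, hφ.mul hφ', fun z hz ht => by
      rw [e z hz ht, e' z hz ht]⟩

theorem HolomorphicIn.of_fun {τ φ : ℂ × ℂ → ℂ} {c : Multiplier} (hc : Represents c φ) (γ : ℂ → ℂ)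
    (hγ : AnalyticOnNhd ℂ γ (Metric.ball 0 1))
    (h : ∀ z, IsGood z → ‖τ z‖ < 1 → φ z = γ (τ z)) : HolomorphicIn τ c :=
  ⟨γ, hγ, φ, hc, h⟩

theorem Represents.unit_div {a b : Multiplierˣ} {φ χ : ℂ × ℂ → ℂ}
    (ha : Represents (a : Multiplier) φ)
    (hb : Represents ((b⁻¹ : Multiplierˣ) : Multiplier) fun z => (χ z)⁻¹) :
    Represents ((a / b : Multiplierˣ) : Multiplier) fun z => φ z / χ z := by
  rw [div_eq_mul_inv, Units.val_mul]
  exact (ha.mul hb).congr fun z _ => (div_eq_mul_inv _ _).symm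

theorem one_sub_ne_zero_of_mem_ball {t : ℂ} (ht : t ∈ Metric.ball (0 : ℂ) 1) : 1 - t ≠ 0 := by
  intro h
  rw [← sub_eq_zero.mp h] at ht
  simp at ht

theorem one_add_ne_zero_of_mem_ball {t : ℂ} (ht : t ∈ Metric.ball (0 : ℂ) 1) : 1 + t ≠ 0 := by
  intro h
  rw [← eq_neg_of_add_eq_zero_right h |>.symm] at ht
  simp at ht

theorem analyticOnNhd_one_sub : AnalyticOnNhd ℂ (fun t : ℂ => 1 - t) (Metric.ball 0 1) :=
  analyticOnNhd_const.sub analyticOnNhd_id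

theorem analyticOnNhd_one_add : AnalyticOnNhd ℂ (fun t : ℂ => 1 + t) (Metric.ball 0 1) :=
  analyticOnNhd_const.add analyticOnNhd_id

theorem analyticOnNhd_div_one_sub : AnalyticOnNhd ℂ (fun t : ℂ => t / (1 - t)) (Metric.ball 0 1) :=
  analyticOnNhd_id.div analyticOnNhd_one_sub fun _ ht => one_sub_ne_zero_of_mem_ball ht

theorem analyticOnNhd_div_one_add : AnalyticOnNhd ℂ (fun t : ℂ => t / (1 + t)) (Metric.ball 0 1) :=
  analyticOnNhd_id.div analyticOnNhd_one_add fun _ ht => one_add_ne_zero_of_mem_ball ht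

namespace SingularLocus

/-- The multiplier whose quotient by `σ.scaleUnit` is the coordinate `σ.τ`. -/
def vanishingUnit : SingularLocus → Multiplierˣ
  | .z₁Zero | .z₂Infty => z₁
  | .z₂Zero | .z₁Infty => z₂
  | .diagonal | .diagonalOverZ₁ | .diagonalOverZ₂ => z₁₂

/-- The multiplier by which `σ.vanishingUnit` is divided to get the coordinate `σ.τ`. -/
def scaleUnit : SingularLocus → Multiplierˣ
  | .z₁Zero | .z₂Infty | .diagonal | .diagonalOverZ₂ => z₂
  | .z₂Zero | .z₁Infty | .diagonalOverZ₁ => z₁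

/-- The multiplier `σ.speed₁`. -/
def speedUnit₁ : SingularLocus → Multiplierˣ
  | .z₁Zero | .z₂Zero | .z₁Infty | .z₂Infty => z₁
  | .diagonal | .diagonalOverZ₁ | .diagonalOverZ₂ => z₁₂

/-- The multiplier `σ.speed₂`. -/
def speedUnit₂ : SingularLocus → Multiplierˣ
  | .z₁Zero | .z₂Zero | .z₁Infty | .z₂Infty => z₂
  | .diagonal | .diagonalOverZ₁ | .diagonalOverZ₂ => z₁₂

theorem represents_speedUnit₁_inv (σ : SingularLocus) :
    Represents ((σ.speedUnit₁⁻¹ : Multiplierˣ) : Multiplier) fun z => (σ.speed₁ z)⁻¹ := by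
  cases σ
  all_goals first | exact Represents.z₁_inv | exact Represents.z₁₂_inv

theorem represents_speedUnit₂_inv (σ : SingularLocus) :
    Represents ((σ.speedUnit₂⁻¹ : Multiplierˣ) : Multiplier) fun z => (σ.speed₂ z)⁻¹ := by
  cases σ
  all_goals first | exact Represents.z₂_inv | exact Represents.z₁₂_inv

theorem speed₁_ne_zero (σ : SingularLocus) {z : ℂ × ℂ} (hz : IsGood z) : σ.speed₁ z ≠ 0 := by
  cases σ
  all_goals first | exact hz.1 | exact sub_ne_zero.mpr hz.2.2

theorem speed₂_ne_zero (σ : SingularLocus) {z : ℂ × ℂ} (hz : IsGood z) : σ.speed₂ z ≠ 0 := by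
  cases σ
  all_goals first | exact hz.2.1 | exact sub_ne_zero.mpr hz.2.2

theorem holomorphicIn_ratio₁₂ : ∀ c ∈ Units.val '' ({z₂ / z₁, z₂ / z₂, z₂ / z₁₂, z₁ / z₁, z₂ / z₁,
    z₂ / z₁} : Set Multiplierˣ), HolomorphicIn (fun z => z.2 / z.1) c := by
  rintro _ ⟨_, rfl | rfl | rfl | rfl | rfl | rfl, rfl⟩
  · exact .of_fun (Represents.z₂.unit_div Represents.z₁_inv) _ analyticOnNhd_id fun _ _ _ => rfl
  · exact .of_fun (Represents.z₂.unit_div Represents.z₂_inv) _ analyticOnNhd_const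
      fun z hz _ => div_self hz.2.1
  · refine .of_fun (Represents.z₂.unit_div Represents.z₁₂_inv) _ analyticOnNhd_div_one_sub
      fun z hz _ => ?_
    have := sub_ne_zero.mpr hz.2.2
    have := hz.1
    field_simp
  · exact .of_fun (Represents.z₁.unit_div Represents.z₁_inv) _ analyticOnNhd_const
      fun z hz _ => div_self hz.1
  · exact .of_fun (Represents.z₂.unit_div Represents.z₁_inv) _ analyticOnNhd_id fun _ _ _ => rfl
  · exact .of_fun (Represents.z₂.unit_div Represents.z₁_inv) _ analyticOnNhd_id fun _ _ _ => rfl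

theorem holomorphicIn_ratio₂₁ : ∀ c ∈ Units.val '' ({z₁ / z₁, z₁ / z₂, z₁ / z₁₂, z₁ / z₂, z₂ / z₂,
    z₁ / z₂} : Set Multiplierˣ), HolomorphicIn (fun z => z.1 / z.2) c := by
  rintro _ ⟨_, rfl | rfl | rfl | rfl | rfl | rfl, rfl⟩
  · exact .of_fun (Represents.z₁.unit_div Represents.z₁_inv) _ analyticOnNhd_const
      fun z hz _ => div_self hz.1
  · exact .of_fun (Represents.z₁.unit_div Represents.z₂_inv) _ analyticOnNhd_id fun _ _ _ => rfl
  · refine .of_fun (Represents.z₁.unit_div Represents.z₁₂_inv) _ analyticOnNhd_div_one_sub.neg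
      fun z hz _ => ?_
    have h1 := sub_ne_zero.mpr hz.2.2
    have h2 := sub_ne_zero.mpr hz.2.2.symm
    have h3 := hz.2.1
    have : 1 - z.1 / z.2 ≠ 0 := by
      rw [one_sub_div h3]
      exact div_ne_zero h2 h3
    simp only [Pi.neg_apply]
    field_simp
    ring
  · exact .of_fun (Represents.z₁.unit_div Represents.z₂_inv) _ analyticOnNhd_id fun _ _ _ => rfl
  · exact .of_fun (Represents.z₂.unit_div Represents.z₂_inv) _ analyticOnNhd_const
      fun z hz _ => div_self hz.2.1
  · exact .of_fun (Represents.z₁.unit_div Represents.z₂_inv) _ analyticOnNhd_id fun _ _ _ => rfl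

theorem holomorphicIn_sub_div₂ : ∀ c ∈ Units.val '' ({z₁₂ / z₁, z₁₂ / z₂, z₁₂ / z₁₂, z₁ / z₂,
    z₂ / z₂, z₁₂ / z₂} : Set Multiplierˣ), HolomorphicIn (fun z => (z.1 - z.2) / z.2) c := by
  rintro _ ⟨_, rfl | rfl | rfl | rfl | rfl | rfl, rfl⟩
  · refine .of_fun (Represents.z₁₂.unit_div Represents.z₁_inv) _ analyticOnNhd_div_one_add
      fun z hz _ => ?_
    have := hz.1
    have := hz.2.1
    have h : 1 + (z.1 - z.2) / z.2 = z.1 / z.2 := by field_simp; ring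
    rw [h]
    field_simp
  · exact .of_fun (Represents.z₁₂.unit_div Represents.z₂_inv) _ analyticOnNhd_id fun _ _ _ => rfl
  · exact .of_fun (Represents.z₁₂.unit_div Represents.z₁₂_inv) _ analyticOnNhd_const
      fun z hz _ => div_self (sub_ne_zero.mpr hz.2.2)
  · refine .of_fun (Represents.z₁.unit_div Represents.z₂_inv) _ analyticOnNhd_one_add
      fun z hz _ => ?_
    have := hz.2.1
    field_simp
    ring
  · exact .of_fun (Represents.z₂.unit_div Represents.z₂_inv) _ analyticOnNhd_const
      fun z hz _ => div_self hz.2.1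
  · exact .of_fun (Represents.z₁₂.unit_div Represents.z₂_inv) _ analyticOnNhd_id fun _ _ _ => rfl

theorem holomorphicIn_sub_div₁ : ∀ c ∈ Units.val '' ({z₁₂ / z₁, z₁₂ / z₂, z₁₂ / z₁₂, z₁ / z₁,
    z₂ / z₁, z₁₂ / z₁} : Set Multiplierˣ), HolomorphicIn (fun z => (z.1 - z.2) / z.1) c := by
  rintro _ ⟨_, rfl | rfl | rfl | rfl | rfl | rfl, rfl⟩
  · exact .of_fun (Represents.z₁₂.unit_div Represents.z₁_inv) _ analyticOnNhd_id fun _ _ _ => rfl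
  · refine .of_fun (Represents.z₁₂.unit_div Represents.z₂_inv) _ analyticOnNhd_div_one_sub
      fun z hz _ => ?_
    have := hz.1
    have := hz.2.1
    have h : 1 - (z.1 - z.2) / z.1 = z.2 / z.1 := by field_simp; ring
    rw [h]
    field_simp
  · exact .of_fun (Represents.z₁₂.unit_div Represents.z₁₂_inv) _ analyticOnNhd_const
      fun z hz _ => div_self (sub_ne_zero.mpr hz.2.2)
  · exact .of_fun (Represents.z₁.unit_div Represents.z₁_inv) _ analyticOnNhd_const
      fun z hz _ => div_self hz.1
  · refine .of_fun (Represents.z₂.unit_div Represents.z₁_inv) _ analyticOnNhd_one_sub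
      fun z hz _ => ?_
    have := hz.1
    field_simp
    ring
  · exact .of_fun (Represents.z₁₂.unit_div Represents.z₁_inv) _ analyticOnNhd_id fun _ _ _ => rfl

theorem holomorphicIn_of_mem_latticeRing (σ : SingularLocus) {c : Multiplier}
    (hc : c ∈ latticeRing σ.vanishingUnit σ.scaleUnit) : HolomorphicIn σ.τ c := by
  refine HolomorphicIn.of_mem_adjoin ?_ hc
  cases σ
  · exact holomorphicIn_ratio₂₁
  · exact holomorphicIn_ratio₁₂
  · exact holomorphicIn_ratio₁₂
  · exact holomorphicIn_ratio₂₁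
  · exact holomorphicIn_sub_div₂
  · exact holomorphicIn_sub_div₁
  · exact holomorphicIn_sub_div₂

end SingularLocus

/-- A linear relation among the rescaled derivatives of `F`, as an equation with coefficients in `R`
that are holomorphic in `τ` after rescaling. -/
theorem exists_coefficients {τ l : ℂ × ℂ → ℂ} {L : Multiplierˣ}
    (hL : Represents ((L⁻¹ : Multiplierˣ) : Multiplier) fun z => (l z)⁻¹)
    (hl : ∀ z, IsGood z → l z ≠ 0) (D : Module.End ℂ TSeries) (F : TSeries) {m : ℕ}
    (c : Fin m → Multiplier) (hc : ∀ j, HolomorphicIn τ (c j))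
    (h : L ^ m • (D ^ m) F = ∑ j : Fin m, c j • (L ^ (j : ℕ) • (D ^ (j : ℕ)) F)) :
    ∃ a : Fin m → RFraction,
      (D ^ m) F + ∑ k : Fin m, (a k).toMultiplier • (D ^ (m - 1 - k)) F = 0 ∧
      ∀ k, ∃ γ : ℂ → ℂ, AnalyticOnNhd ℂ γ (Metric.ball 0 1) ∧ ∀ z, IsGood z → ‖τ z‖ < 1 →
        (a k).eval z * l z ^ ((k : ℕ) + 1) = γ (τ z) := by
  have key : ∀ k : Fin m, ∃ a : RFraction,
      a.toMultiplier = -(c k.rev * ((L⁻¹ : Multiplierˣ) : Multiplier) ^ ((k : ℕ) + 1)) ∧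
      ∃ γ : ℂ → ℂ, AnalyticOnNhd ℂ γ (Metric.ball 0 1) ∧ ∀ z, IsGood z → ‖τ z‖ < 1 →
        a.eval z * l z ^ ((k : ℕ) + 1) = γ (τ z) := by
    intro k
    obtain ⟨γ, hγ, φ, hφ, e⟩ := hc k.rev
    obtain ⟨a, ha, hae⟩ := (hφ.mul (hL.pow ((k : ℕ) + 1))).neg
    refine ⟨a, ha, -γ, hγ.neg, fun z hz ht => ?_⟩
    rw [hae z hz, Pi.neg_apply, ← e z hz ht]
    beta_reduce
    rw [inv_pow]
    have := pow_ne_zero ((k : ℕ) + 1) (hl z hz)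
    field_simp
  choose a ha γ hγ using key
  refine ⟨a, ?_, fun k => ⟨γ k, hγ k⟩⟩
  have h' : (D ^ m) F = ∑ j : Fin m,
      (c j * ((L⁻¹ : Multiplierˣ) : Multiplier) ^ (m - (j : ℕ))) • (D ^ (j : ℕ)) F := by
    rw [← inv_smul_smul (L ^ m) ((D ^ m) F), h, Finset.smul_sum]
    refine Finset.sum_congr rfl fun j _ => ?_
    rw [Units.smul_def, Units.smul_def, ← mul_smul, ← mul_smul, mul_comm _ (c j), mul_assoc,
      ← Units.val_mul, ← Units.val_pow_eq_pow_val]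
    congr 4
    rw [inv_pow, inv_mul_eq_iff_eq_mul, ← div_eq_mul_inv, eq_div_iff_mul_eq', ← pow_add]
    congr 1
    have := j.2
    omega
  rw [h', ← Equiv.sum_comp Fin.revPerm, ← Finset.sum_add_distrib]
  refine Finset.sum_eq_zero fun k _ => ?_
  rw [ha k, Fin.revPerm_apply, neg_smul, Fin.val_rev, show m - (m - ((k : ℕ) + 1)) = k + 1 by
    have := k.2; omega, show m - ((k : ℕ) + 1) = m - 1 - k by omega, add_neg_cancel]

section Existence

variable {B : Type*} [AddCommGroup B] {A : AddSubgroup B} {A₀ : AddSubgroup A}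
  {V : Type v} [AddCommGroup V] [Module ℂ V] {𝒱 : StronglyGradedCVA A V} {V₀ : Submodule ℂ V}
  {W₀ W₁ W₂ W₃ W₄ : Type u} [AddCommGroup W₀] [Module ℂ W₀] [AddCommGroup W₁] [Module ℂ W₁]
  [AddCommGroup W₂] [Module ℂ W₂] [AddCommGroup W₃] [Module ℂ W₃] [AddCommGroup W₄] [Module ℂ W₄]
  {M₀ : StronglyGradedModule 𝒱 W₀} {M₁ : StronglyGradedModule 𝒱 W₁}
  {M₂ : StronglyGradedModule 𝒱 W₂} {M₃ : StronglyGradedModule 𝒱 W₃}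
  {M₄ : StronglyGradedModule 𝒱 W₄}
  {I₁ : ℂ → ℕ → W₁ →ₗ[ℂ] W₄ →ₗ[ℂ] Module.Dual ℂ W₀}
  {I₂ : ℂ → ℕ → W₂ →ₗ[ℂ] W₃ →ₗ[ℂ] W₄}

/-- The matrix element is a formal solution of a system that is Fuchsian along the given singular
locus: rescaled derivatives stay in a finitely generated lattice. -/
theorem exists_fuchsian_system (hI₁ : IsIntertwiningOfContragredientType M₁ M₄ M₀ I₁)
    (hI₂ : IsIntertwiningOfType M₂ M₃ M₄ I₂) (hV₀ : IsStronglyGradedSubalgebra 𝒱 A₀ V₀)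
    (hM₀ : M₀.IsLowerBounded ∧ M₀.IsC₁Cofinite V₀) (hM₁ : M₁.IsLowerBounded ∧ M₁.IsC₁Cofinite V₀)
    (hM₂ : M₂.IsLowerBounded ∧ M₂.IsC₁Cofinite V₀) (hM₃ : M₃.IsLowerBounded ∧ M₃.IsC₁Cofinite V₀)
    (hfusion₁ : ∀ γ₁ γ₂ : B, {α : A₀ × A₀ | contragredientFusionRule M₁ M₄ M₀
      (γ₁ + ((α.1 : A) : B)) (γ₂ + ((α.2 : A) : B)) ≠ 0}.Finite)
    (hfusion₂ : ∀ γ₁ γ₂ : B, {α : A₀ × A₀ | fusionRule M₂ M₃ M₄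
      (γ₁ + ((α.1 : A) : B)) (γ₂ + ((α.2 : A) : B)) ≠ 0}.Finite) {β₀ β₁ β₂ β₃ : B}
    {w₀ : W₀} {w₁ : W₁} {w₂ : W₂} {w₃ : W₃} (h₀ : w₀ ∈ M₀.gr β₀) (h₁ : w₁ ∈ M₁.gr β₁)
    (h₂ : w₂ ∈ M₂.gr β₂) (h₃ : w₃ ∈ M₃.gr β₃) (σ : SingularLocus) :
    ∃ S : DiffSystem, S.IsFormalSolution (productSeries I₁ I₂ w₀ w₁ w₂ w₃) ∧
      S.IsFuchsianAlong σ := by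
  obtain ⟨𝓜, hfg, h𝓜⟩ := exists_lattice hI₁ hI₂ hV₀ hM₀ hM₁ hM₂ hM₃ hfusion₁ hfusion₂ β₁ β₂ β₃
    σ.vanishingUnit σ.scaleUnit
  obtain ⟨T, f₀, f₁, f₂, f₃, hf₀, hf₁, hf₂, hf₃, e⟩ :=
    exists_corr_eq_sum (I₁ := I₁) hI₂.1.truncated h₀ h₁ h₂ h₃
  have hz : ∀ β : B, β - β ∈ A₀.map A.subtype := fun β => by rw [sub_self]; exact zero_mem _
  have d₁ : ∀ t ∈ T, ∀ j : ℕ, scale σ.vanishingUnit σ.scaleUnit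
      (t.1 + t.2.1 + t.2.2.1 + t.2.2.2) t.1 • (σ.speedUnit₁ ^ j • (TSeries.D₁ₗ ^ j)
        (corr I₁ I₂ hI₂.1.truncated (f₀ t.1) (f₁ t.2.1) (f₂ t.2.2.1) (f₃ t.2.2.2))) ∈ 𝓜 := by
    intro t _ j
    rw [← TSeries.D₁_iterate_eq]
    by_cases hσ : σ.speedUnit₁ = σ.vanishingUnit
    · rw [hσ]
      exact InLattice.D₁_iterate_mem hI₁ hI₂ h𝓜 (hz _) (hz _) (hz _) j (hf₀ _) (hf₁ _) (hf₂ _)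
        (hf₃ _)
    · have hσ' : σ.vanishingUnit = z₂ ∧ σ.speedUnit₁ = z₁ := by
        cases σ
        all_goals first | exact ⟨rfl, rfl⟩ | exact absurd rfl hσ
      rw [hσ'.2]
      exact InLattice.D₁_iterate_mem_of_eq hI₁ hI₂ h𝓜 hσ'.1 (hz _) (hz _) (hz _) j (hf₀ _) (hf₁ _)
        (hf₂ _) (hf₃ _)
  have d₂ : ∀ t ∈ T, ∀ j : ℕ, scale σ.vanishingUnit σ.scaleUnit
      (t.1 + t.2.1 + t.2.2.1 + t.2.2.2) t.1 • (σ.speedUnit₂ ^ j • (TSeries.D₂ₗ ^ j)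
        (corr I₁ I₂ hI₂.1.truncated (f₀ t.1) (f₁ t.2.1) (f₂ t.2.2.1) (f₃ t.2.2.2))) ∈ 𝓜 := by
    intro t _ j
    rw [← TSeries.D₂_iterate_eq]
    by_cases hσ : σ.speedUnit₂ = σ.vanishingUnit
    · rw [hσ]
      exact InLattice.D₂_iterate_mem hI₂ h𝓜 (hz _) (hz _) (hz _) j (hf₀ _) (hf₁ _) (hf₂ _)
        (hf₃ _)
    · have hσ' : σ.vanishingUnit = z₁ ∧ σ.speedUnit₂ = z₂ := by
        cases σ
        all_goals first | exact ⟨rfl, rfl⟩ | exact absurd rfl hσ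
      rw [hσ'.2]
      exact InLattice.D₂_iterate_mem_of_eq hI₁ hI₂ h𝓜 hσ'.1 (hz _) (hz _) (hz _) j (hf₀ _) (hf₁ _)
        (hf₂ _) (hf₃ _)
  obtain ⟨m, hm, c, hc⟩ := exists_relation_of_sum hfg T _ _ _ _ d₁
  obtain ⟨n, hn, d, hd⟩ := exists_relation_of_sum hfg T _ _ _ _ d₂
  rw [← e] at hc hd
  obtain ⟨a, ha, ha'⟩ := exists_coefficients σ.represents_speedUnit₁_inv
    (fun z hz => σ.speed₁_ne_zero hz) _ _ _
    (fun j => σ.holomorphicIn_of_mem_latticeRing (c j).2) hc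
  obtain ⟨b, hb, hb'⟩ := exists_coefficients σ.represents_speedUnit₂_inv
    (fun z hz => σ.speed₂_ne_zero hz) _ _ _
    (fun j => σ.holomorphicIn_of_mem_latticeRing (d j).2) hd
  refine ⟨⟨m, n, hm, hn, a, b⟩, ⟨?_, ?_⟩, ha', hb'⟩
  · have := congrArg Subtype.val ha
    simp only [← TSeries.D₁_iterate_eq] at this
    refine Eq.trans ?_ this
    funext p k q l
    rw [TSeries.add_apply, TSeries.sum_apply]
    simp only [← RFraction.mulExpansion_eq, TSeries.D₁_iterate_coe]
    simp only [Pi.add_apply, Finset.sum_apply]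
    rfl
  · have := congrArg Subtype.val hb
    simp only [← TSeries.D₂_iterate_eq] at this
    refine Eq.trans ?_ this
    funext p k q l
    rw [TSeries.add_apply, TSeries.sum_apply]
    simp only [← RFraction.mulExpansion_eq, TSeries.D₂_iterate_coe]
    simp only [Pi.add_apply, Finset.sum_apply]
    rfl

end Existence

/-! ### Fuchsian systems of ordinary differential equations -/

/-- Finite sums of functions `exp (s ζ) ζ ^ k f (exp ζ)` on the half-plane `re ζ < ρ`, with `f`
holomorphic on the disc of radius `exp ρ`. -/
def logForms (ρ : ℝ) : Submodule ℂ (ℂ → ℂ) :=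
  Submodule.span ℂ {φ | ∃ (s : ℂ) (k : ℕ) (f : ℂ → ℂ),
    AnalyticOnNhd ℂ f (Metric.ball 0 (Real.exp ρ)) ∧
    ∀ ζ : ℂ, ζ.re < ρ → φ ζ = Complex.exp (s * ζ) * ζ ^ k * f (Complex.exp ζ)}

theorem logForms_congr {ρ : ℝ} {φ ψ : ℂ → ℂ} (hφ : φ ∈ logForms ρ)
    (h : ∀ ζ : ℂ, ζ.re < ρ → ψ ζ = φ ζ) : ψ ∈ logForms ρ := by
  have : ψ = φ + (ψ - φ) := by simp
  rw [this]
  refine Submodule.add_mem _ hφ (Submodule.subset_span ⟨0, 0, 0, analyticOnNhd_const, ?_⟩)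
  intro ζ hζ
  simp [h ζ hζ]

theorem logForms_exp_mul {ρ : ℝ} {φ : ℂ → ℂ} (hφ : φ ∈ logForms ρ) (s : ℂ) (k : ℕ) :
    (fun ζ => Complex.exp (s * ζ) * ζ ^ k * φ ζ) ∈ logForms ρ := by
  induction hφ using Submodule.span_induction with
  | mem φ h =>
    obtain ⟨s', k', f, hf, h⟩ := h
    refine Submodule.subset_span ⟨s + s', k + k', f, hf, fun ζ hζ => ?_⟩
    simp only [h ζ hζ, add_mul, Complex.exp_add, pow_add]
    ring
  | zero =>
    convert (logForms ρ).zero_mem using 1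
    ext ζ; simp
  | add φ ψ _ _ h₁ h₂ =>
    convert Submodule.add_mem _ h₁ h₂ using 1
    ext ζ; simp [mul_add]
  | smul c φ _ h =>
    convert Submodule.smul_mem _ c h using 1
    ext ζ; simp; ring

/-- Holomorphic functions on the half-plane `re ζ < ρ` whose growth on horizontal strips, towards
`re ζ = -∞`, is at most exponential. -/
def moderateGrowth (ρ : ℝ) : Subalgebra ℂ (ℂ → ℂ) where
  carrier := {φ | DifferentiableOn ℂ φ {ζ | ζ.re < ρ} ∧ ∀ M : ℝ, ∃ (N : ℕ) (C ρ' : ℝ), 0 ≤ C ∧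
    ∀ ζ : ℂ, ζ.re ≤ ρ' → |ζ.im| ≤ M → ‖φ ζ‖ ≤ C * Real.exp (-(N * ζ.re))}
  mul_mem' := by
    rintro φ ψ ⟨h₁, h₂⟩ ⟨h₃, h₄⟩
    refine ⟨h₁.mul h₃, fun M => ?_⟩
    obtain ⟨N, C, r, hC, h⟩ := h₂ M
    obtain ⟨N', C', r', hC', h'⟩ := h₄ M
    refine ⟨N + N', C * C', min r r', mul_nonneg hC hC', fun ζ hζ hM => ?_⟩
    rw [Pi.mul_apply, norm_mul]
    calc _ ≤ (C * Real.exp (-(N * ζ.re))) * (C' * Real.exp (-(N' * ζ.re))) :=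
          mul_le_mul (h ζ (hζ.trans (min_le_left _ _)) hM) (h' ζ (hζ.trans (min_le_right _ _)) hM)
            (norm_nonneg _) (by positivity)
      _ = _ := by
          rw [mul_mul_mul_comm, ← Real.exp_add]
          push_cast
          ring_nf
  add_mem' := by
    rintro φ ψ ⟨h₁, h₂⟩ ⟨h₃, h₄⟩
    refine ⟨h₁.add h₃, fun M => ?_⟩
    obtain ⟨N, C, r, hC, h⟩ := h₂ M
    obtain ⟨N', C', r', hC', h'⟩ := h₄ M
    refine ⟨N + N', C + C', min (min r r') 0, add_nonneg hC hC', fun ζ hζ hM => ?_⟩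
    have h0 : ζ.re ≤ 0 := hζ.trans (min_le_right _ _)
    have hr : ζ.re ≤ r := hζ.trans ((min_le_left _ _).trans (min_le_left _ _))
    have hr' : ζ.re ≤ r' := hζ.trans ((min_le_left _ _).trans (min_le_right _ _))
    rw [Pi.add_apply, add_mul]
    refine (norm_add_le _ _).trans (add_le_add ((h ζ hr hM).trans ?_) ((h' ζ hr' hM).trans ?_))
    · refine mul_le_mul_of_nonneg_left (Real.exp_le_exp.2 ?_) hC
      push_cast
      nlinarith [mul_nonneg (Nat.cast_nonneg (α := ℝ) N') (neg_nonneg.2 h0)]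
    · refine mul_le_mul_of_nonneg_left (Real.exp_le_exp.2 ?_) hC'
      push_cast
      nlinarith [mul_nonneg (Nat.cast_nonneg (α := ℝ) N) (neg_nonneg.2 h0)]
  algebraMap_mem' c := by
    refine ⟨differentiableOn_const _, fun M => ⟨0, ‖c‖, 0, norm_nonneg _, fun ζ _ _ => ?_⟩⟩
    simp

theorem id_mem_moderateGrowth (ρ : ℝ) : (fun ζ : ℂ => ζ) ∈ moderateGrowth ρ := by
  refine ⟨differentiableOn_id, fun M => ⟨1, 1 + |M|, 0, by positivity, fun ζ hζ hM => ?_⟩⟩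
  have h1 : ‖ζ‖ ≤ |ζ.re| + |ζ.im| := Complex.norm_le_abs_re_add_abs_im ζ
  rw [abs_of_nonpos hζ] at h1
  have h2 := Real.add_one_le_exp (-ζ.re)
  have h3 : 1 ≤ Real.exp (-ζ.re) := Real.one_le_exp (by linarith)
  have h4 := hM.trans (le_abs_self M)
  simp only [Nat.cast_one, one_mul]
  nlinarith [abs_nonneg M]

theorem exp_mem_moderateGrowth (ρ : ℝ) (s : ℂ) :
    (fun ζ : ℂ => Complex.exp (s * ζ)) ∈ moderateGrowth ρ := by
  refine ⟨(by fun_prop : Differentiable ℂ fun ζ : ℂ => Complex.exp (s * ζ)).differentiableOn,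
    fun M => ?_⟩
  obtain ⟨N, hN⟩ := exists_nat_ge |s.re|
  refine ⟨N, Real.exp (|s.im| * M), 0, (Real.exp_pos _).le, fun ζ hζ hM => ?_⟩
  rw [Complex.norm_exp, ← Real.exp_add, Real.exp_le_exp, Complex.mul_re]
  have h1 : -(s.im * ζ.im) ≤ |s.im| * M :=
    (neg_le_abs _).trans (by rw [abs_mul]; gcongr)
  have h2 : s.re * ζ.re ≤ -(N * ζ.re) := by nlinarith [neg_abs_le s.re]
  linarith

theorem translate_mem_moderateGrowth {ρ : ℝ} {φ : ℂ → ℂ} (h : φ ∈ moderateGrowth ρ) (y : ℝ) :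
    (fun ζ => φ (ζ + y * Complex.I)) ∈ moderateGrowth ρ := by
  obtain ⟨h₁, h₂⟩ := h
  refine ⟨h₁.comp (by fun_prop) fun ζ hζ => by simpa using hζ, fun M => ?_⟩
  obtain ⟨N, C, r, hC, h⟩ := h₂ (M + |y|)
  refine ⟨N, C, r, hC, fun ζ hζ hM => ?_⟩
  have := h (ζ + y * Complex.I) (by simpa using hζ)
    (by simpa using (abs_add_le ζ.im y).trans (by gcongr))
  simpa using this

open Function.Periodic in
/-- A holomorphic function on the half-plane that has period `2πi` and moderate growth is a Laurent
series in `exp ζ` with finite principal part. -/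
theorem mem_logForms_of_periodic {ρ : ℝ} {φ : ℂ → ℂ} (h : φ ∈ moderateGrowth ρ)
    (hp : ∀ ζ : ℂ, φ (ζ + 2 * Real.pi * Complex.I) = φ ζ) : φ ∈ logForms ρ := by
  obtain ⟨hd, hg⟩ := h
  obtain ⟨N, C, r, hC, hb⟩ := hg Real.pi
  set c : ℂ := 2 * Real.pi * Complex.I with hc
  have hc0 : c ≠ 0 := by simp [hc, Real.pi_ne_zero]
  have hcre (z : ℂ) : (c * z).re = -(2 * Real.pi * z.im) := by simp [hc]
  -- The reduction of `ζ` to the strip `|im ζ| ≤ π`.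
  have hb' : ∀ ζ : ℂ, ζ.re ≤ r → ‖φ ζ‖ ≤ C * Real.exp (-(N * ζ.re)) := by
    intro ζ hζ
    have hper : Function.Periodic φ c := hp
    set n : ℤ := round (ζ.im / (2 * Real.pi))
    have h1 : φ (ζ - n * c) = φ ζ := by
      simpa [zsmul_eq_mul] using hper.sub_zsmul_eq (x := ζ) n
    have h2 : (ζ - n * c).re = ζ.re := by simp [hc]
    have h3 : (ζ - n * c).im = ζ.im - n * (2 * Real.pi) := by simp [hc]
    have h4 : |(ζ - n * c).im| ≤ Real.pi := by
      have := abs_sub_round (ζ.im / (2 * Real.pi))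
      have hpi := Real.pi_pos
      have h5 : ζ.im - n * (2 * Real.pi) = (ζ.im / (2 * Real.pi) - n) * (2 * Real.pi) := by
        field_simp
      rw [h3, h5, abs_mul, abs_of_pos (by positivity : (0:ℝ) < 2 * Real.pi)]
      nlinarith
    have := hb _ (h2.le.trans hζ) h4
    rwa [h1, h2] at this
  let g : ℂ → ℂ := fun z => Complex.exp (N * (c * z)) * φ (c * z)
  have hgp : Function.Periodic g (1 : ℝ) := by
    intro z
    have h1 : φ (c * (z + (1 : ℝ))) = φ (c * z) := by
      rw [← hp (c * z)]; congr 1; push_cast; ring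
    have h2 : Complex.exp (N * (c * (z + (1 : ℝ)))) = Complex.exp (N * (c * z)) := by
      rw [Complex.exp_eq_exp_iff_exists_int]
      exact ⟨N, by push_cast; ring⟩
    simp only [g, h1, h2]
  have hgd : ∀ z : ℂ, -(2 * Real.pi * z.im) < ρ → DifferentiableAt ℂ g z := by
    intro z hz
    have hopen : IsOpen {ζ : ℂ | ζ.re < ρ} := isOpen_lt Complex.continuous_re continuous_const
    have : DifferentiableAt ℂ φ (c * z) :=
      (hd _ (by simpa [hcre] using hz)).differentiableAt (hopen.mem_nhds (by simpa [hcre] using hz))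
    have h2 : DifferentiableAt ℂ (fun z => φ (c * z)) z :=
      DifferentiableAt.comp (f := fun z => c * z) z this (by fun_prop)
    exact DifferentiableAt.mul (by fun_prop) h2
  have hgb : ∀ z : ℂ, -(2 * Real.pi * z.im) ≤ r → ‖g z‖ ≤ C := by
    intro z hz
    have := hb' (c * z) (by rwa [hcre])
    simp only [g, norm_mul, Complex.norm_exp]
    have h1 : ((N : ℂ) * (c * z)).re = N * (c * z).re := by
      rw [← Complex.ofReal_natCast, Complex.re_ofReal_mul]
    rw [h1]
    calc _ ≤ Real.exp (N * (c * z).re) * (C * Real.exp (-(N * (c * z).re))) := by gcongr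
      _ = C := by rw [Real.exp_neg]; field_simp
  have hev : ∀ t : ℝ, ∀ᶠ z : ℂ in Filter.comap Complex.im Filter.atTop, -(2 * Real.pi * z.im) < t := by
    intro t
    have h1 : ∀ᶠ y : ℝ in Filter.atTop, -(2 * Real.pi * y) < t := by
      filter_upwards [Filter.eventually_gt_atTop (-t / (2 * Real.pi))] with y hy
      rw [div_lt_iff₀ (by positivity)] at hy
      linarith
    exact h1.comap _
  have hG0 : DifferentiableAt ℂ (cuspFunction 1 g) 0 := by
    refine differentiableAt_cuspFunction_zero one_pos hgp ((hev ρ).mono hgd) ?_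
    rw [Filter.BoundedAtFilter, Asymptotics.isBigO_iff]
    exact ⟨C, ((hev r).mono fun z hz => by simpa using hgb z hz.le)⟩
  have hG : DifferentiableOn ℂ (cuspFunction 1 g) (Metric.ball 0 (Real.exp ρ)) := by
    intro q hq
    apply DifferentiableAt.differentiableWithinAt
    by_cases hq0 : q = 0
    · rw [hq0]; exact hG0
    · have h1 : Complex.exp (c * (Complex.log q / c)) = q := by
        rw [mul_div_cancel₀ _ hc0, Complex.exp_log hq0]
      have h2 : qParam (1 : ℝ) (Complex.log q / c) = q := by
        conv_rhs => rw [← h1]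
        rw [qParam, ← hc]
        simp
      rw [← h2]
      refine differentiableAt_cuspFunction one_ne_zero hgp (hgd _ ?_)
      rw [← hcre, mul_div_cancel₀ _ hc0, Complex.log_re]
      rw [mem_ball_zero_iff] at hq
      rw [← Real.log_exp ρ]
      exact Real.log_lt_log (norm_pos_iff.2 hq0) hq
  refine Submodule.subset_span ⟨-N, 0, cuspFunction 1 g,
    hG.analyticOnNhd Metric.isOpen_ball, fun ζ _ => ?_⟩
  have h1 := eq_cuspFunction one_ne_zero hgp (ζ / c)
  have h2 : qParam (1 : ℝ) (ζ / c) = Complex.exp ζ := by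
    rw [qParam]
    congr 1
    rw [← hc]
    simp [mul_div_cancel₀ _ hc0]
  rw [h2] at h1
  simp only [g, mul_div_cancel₀ _ hc0] at h1
  rw [h1, pow_zero, mul_one, ← mul_assoc, ← Complex.exp_add]
  simp

section LinearSystem

variable {ι : Type*} [Fintype ι]

/-- Gronwall's inequality for a linear system in the complex domain, along a segment. -/
theorem norm_le_of_linear_system {F : ι → ℂ → ℂ} {a : ι → ι → ℂ → ℂ} {ζ₀ ζ₁ : ℂ} {K : ℝ}
    (hF : ∀ ζ ∈ segment ℝ ζ₀ ζ₁, ∀ i, HasDerivAt (F i) (∑ j, a i j ζ * F j ζ) ζ)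
    (hK : ∀ ζ ∈ segment ℝ ζ₀ ζ₁, ∑ i, ∑ j, ‖a i j ζ‖ ≤ K) :
    ‖fun i => F i ζ₁‖ ≤ ‖fun i => F i ζ₀‖ * Real.exp (K * ‖ζ₁ - ζ₀‖) := by
  let p : ℝ → ℂ := fun t => ζ₀ + t * (ζ₁ - ζ₀)
  have hp : ∀ t ∈ Set.Icc (0 : ℝ) 1, p t ∈ segment ℝ ζ₀ ζ₁ := by
    intro t ht
    rw [segment_eq_image']
    exact ⟨t, ht, by simp [p]⟩
  have hdp : ∀ t, HasDerivAt p (ζ₁ - ζ₀) t := by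
    intro t
    have h1 : HasDerivAt (fun s : ℝ => (s : ℂ)) 1 t := Complex.ofRealCLM.hasDerivAt
    have h2 := (h1.mul_const (ζ₁ - ζ₀)).const_add ζ₀
    rw [one_mul] at h2
    exact h2
  have hd : ∀ t ∈ Set.Icc (0 : ℝ) 1, HasDerivAt (fun t => fun i => F i (p t))
      (fun i => (∑ j, a i j (p t) * F j (p t)) * (ζ₁ - ζ₀)) t := by
    intro t ht
    rw [hasDerivAt_pi]
    exact fun i => (hF (p t) (hp t ht) i).comp t (hdp t)
  have hb : ∀ t ∈ Set.Icc (0 : ℝ) 1,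
      ‖fun i => (∑ j, a i j (p t) * F j (p t)) * (ζ₁ - ζ₀)‖
        ≤ K * ‖ζ₁ - ζ₀‖ * ‖fun i => F i (p t)‖ + 0 := by
    intro t ht
    have hK' := hK (p t) (hp t ht)
    have hK0 : 0 ≤ K := le_trans (by positivity) hK'
    rw [add_zero, pi_norm_le_iff_of_nonneg (by positivity)]
    intro i
    rw [norm_mul]
    have h1 : ‖∑ j, a i j (p t) * F j (p t)‖ ≤ (∑ j, ‖a i j (p t)‖) * ‖fun i => F i (p t)‖ := by
      rw [Finset.sum_mul]
      refine norm_sum_le_of_le _ fun j _ => ?_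
      rw [norm_mul]
      gcongr
      exact norm_le_pi_norm (fun i => F i (p t)) j
    have h2 : ∑ j, ‖a i j (p t)‖ ≤ K :=
      (Finset.single_le_sum (f := fun i => ∑ j, ‖a i j (p t)‖) (fun i _ => by positivity)
        (Finset.mem_univ i)).trans hK'
    calc _ ≤ (K * ‖fun i => F i (p t)‖) * ‖ζ₁ - ζ₀‖ := by
          gcongr
          exact h1.trans (by gcongr)
      _ = _ := by ring
  have h := norm_le_gronwallBound_of_norm_deriv_right_le (δ := ‖fun i => F i ζ₀‖)
    (fun t ht => (hd t ht).continuousAt.continuousWithinAt)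
    (fun t ht => (hd t (Set.Ico_subset_Icc_self ht)).hasDerivWithinAt) (by simp [p])
    (fun t ht => hb t (Set.Ico_subset_Icc_self ht)) 1 (by simp)
  simpa [p, gronwallBound_ε0] using h

variable (ρ : ℝ) (a : ι → ι → ℂ → ℂ)

/-- The solutions on the half-plane `re ζ < ρ`, extended by zero, of the linear system with
coefficients `a i j (exp ζ)`. -/
def linearSolutions : Submodule ℂ (ι → ℂ → ℂ) where
  carrier := {F | (∀ ζ : ℂ, ζ.re < ρ → ∀ i,
      HasDerivAt (F i) (∑ j, a i j (Complex.exp ζ) * F j ζ) ζ) ∧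
    ∀ ζ : ℂ, ρ ≤ ζ.re → ∀ i, F i ζ = 0}
  add_mem' := by
    rintro F G ⟨h₁, h₂⟩ ⟨h₃, h₄⟩
    refine ⟨fun ζ hζ i => ?_, fun ζ hζ i => by simp [h₂ ζ hζ i, h₄ ζ hζ i]⟩
    simpa [mul_add, Finset.sum_add_distrib] using (h₁ ζ hζ i).add (h₃ ζ hζ i)
  zero_mem' := by
    refine ⟨fun ζ hζ i => ?_, fun ζ hζ i => rfl⟩
    simp only [Pi.zero_apply, mul_zero, Finset.sum_const_zero]
    exact hasDerivAt_const ζ (0 : ℂ)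
  smul_mem' := by
    rintro c F ⟨h₁, h₂⟩
    refine ⟨fun ζ hζ i => ?_, fun ζ hζ i => by simp [h₂ ζ hζ i]⟩
    have h := (h₁ ζ hζ i).const_mul c
    simp only [Finset.mul_sum, mul_left_comm c] at h
    exact h

variable {ρ a}

theorem exists_coeff_bound
    (ha : ∀ i j, ContinuousOn (a i j) (Metric.ball 0 (Real.exp ρ))) {r : ℝ} (hr : r < ρ) :
    ∃ K : ℝ, ∀ ζ : ℂ, ζ.re ≤ r → ∑ i, ∑ j, ‖a i j (Complex.exp ζ)‖ ≤ K := by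
  have hsub : Metric.closedBall (0 : ℂ) (Real.exp r) ⊆ Metric.ball 0 (Real.exp ρ) :=
    Metric.closedBall_subset_ball (Real.exp_lt_exp.2 hr)
  have hc : ContinuousOn (fun q => ∑ i, ∑ j, ‖a i j q‖) (Metric.closedBall 0 (Real.exp r)) :=
    continuousOn_finsetSum _ fun i _ => continuousOn_finsetSum _ fun j _ =>
      ((ha i j).mono hsub).norm
  obtain ⟨K, hK⟩ := (isCompact_closedBall (0 : ℂ) (Real.exp r)).exists_bound_of_continuousOn hc
  refine ⟨K, fun ζ hζ => (le_abs_self _).trans (hK _ ?_)⟩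
  simpa [Complex.norm_exp] using hζ

/-- A solution is determined by its value at one point. -/
theorem linearSolutions_eq_zero
    (ha : ∀ i j, ContinuousOn (a i j) (Metric.ball 0 (Real.exp ρ))) {F : ι → ℂ → ℂ}
    (hF : F ∈ linearSolutions ρ a) {ζ₀ : ℂ} (hζ₀ : ζ₀.re < ρ) (h0 : ∀ i, F i ζ₀ = 0) : F = 0 := by
  ext i ζ
  by_cases hζ : ζ.re < ρ
  · obtain ⟨K, hK⟩ := exists_coeff_bound ha (max_lt hζ₀ hζ)
    have hseg : ∀ z ∈ segment ℝ ζ₀ ζ, z.re ≤ max ζ₀.re ζ.re := fun z hz =>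
      ((convex_halfSpace_re_le (max ζ₀.re ζ.re)).segment_subset (le_max_left ζ₀.re ζ.re)
        (le_max_right ζ₀.re ζ.re)) hz
    have := norm_le_of_linear_system (a := fun i j ζ => a i j (Complex.exp ζ))
      (fun z hz => hF.1 z ((hseg z hz).trans_lt (max_lt hζ₀ hζ))) (fun z hz => hK z (hseg z hz))
    have hz : (fun i => F i ζ₀) = 0 := funext h0
    rw [hz, norm_zero, zero_mul, norm_le_zero_iff] at this
    exact congrFun this i
  · exact hF.2 ζ (not_lt.1 hζ) i

/-- The singularity is regular: by Gronwall's inequality, solutions grow at most polynomially in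
`exp (-ζ)` as `re ζ → -∞`, on strips of bounded imaginary part. -/
theorem linearSolutions_moderateGrowth
    (ha : ∀ i j, ContinuousOn (a i j) (Metric.ball 0 (Real.exp ρ))) {F : ι → ℂ → ℂ}
    (hF : F ∈ linearSolutions ρ a) (i : ι) : F i ∈ moderateGrowth ρ := by
  refine ⟨fun ζ hζ => (hF.1 ζ hζ i).differentiableAt.differentiableWithinAt, fun M => ?_⟩
  set r : ℝ := min (ρ - 1) 0
  have hr : r < ρ := (min_le_left _ _).trans_lt (by linarith)
  obtain ⟨K, hK⟩ := exists_coeff_bound ha hr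
  obtain ⟨N, hN⟩ := exists_nat_ge K
  refine ⟨N, ‖fun i => F i r‖ * Real.exp (N * |M|), r, by positivity, fun ζ hζ hM => ?_⟩
  have hseg : ∀ z ∈ segment ℝ (r : ℂ) ζ, z.re ≤ r := fun z hz =>
    ((convex_halfSpace_re_le r).segment_subset (x := (r : ℂ)) (by simp) hζ) hz
  have h1 := norm_le_of_linear_system (a := fun i j ζ => a i j (Complex.exp ζ))
    (fun z hz => hF.1 z ((hseg z hz).trans_lt hr)) (fun z hz => hK z (hseg z hz))
  refine (norm_le_pi_norm (fun i => F i ζ) i).trans (h1.trans ?_)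
  rw [mul_assoc, ← Real.exp_add]
  gcongr
  have h2 : ‖ζ - r‖ ≤ -ζ.re + |M| := by
    refine (Complex.norm_le_abs_re_add_abs_im _).trans ?_
    have hr0 : r ≤ 0 := min_le_right _ _
    have h3 : |(ζ - r).re| ≤ -ζ.re := by
      rw [Complex.sub_re, Complex.ofReal_re, abs_of_nonpos (by linarith)]
      linarith
    have h4 : |(ζ - r).im| ≤ |M| := by simpa using hM.trans (le_abs_self M)
    linarith
  calc K * ‖ζ - r‖ ≤ N * ‖ζ - r‖ := by gcongr
    _ ≤ N * (-ζ.re + |M|) := by gcongr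
    _ = _ := by ring

theorem finiteDimensional_linearSolutions
    (ha : ∀ i j, ContinuousOn (a i j) (Metric.ball 0 (Real.exp ρ))) :
    FiniteDimensional ℂ (linearSolutions ρ a) := by
  let ev : linearSolutions ρ a →ₗ[ℂ] (ι → ℂ) :=
    { toFun := fun F i => F.1 i ((ρ - 1 : ℝ) : ℂ)
      map_add' := fun F G => rfl
      map_smul' := fun c F => rfl }
  refine FiniteDimensional.of_injective ev ((injective_iff_map_eq_zero ev).2 fun F hF => ?_)
  exact Subtype.ext (linearSolutions_eq_zero ha F.2 (ζ₀ := ((ρ - 1 : ℝ) : ℂ)) (by simp)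
    fun i => congrFun hF i)

/-- The monodromy around the puncture `exp ζ = 0`. -/
def monodromy : (ℂ → ℂ) →ₗ[ℂ] (ℂ → ℂ) :=
  LinearMap.funLeft ℂ ℂ fun ζ => ζ + 2 * Real.pi * Complex.I

theorem monodromy_apply (φ : ℂ → ℂ) (ζ : ℂ) :
    monodromy φ ζ = φ (ζ + 2 * Real.pi * Complex.I) := rfl

theorem monodromy_mul (φ ψ : ℂ → ℂ) : monodromy (φ * ψ) = monodromy φ * monodromy ψ := rfl

theorem exp_add_period (ζ : ℂ) : Complex.exp (ζ + 2 * Real.pi * Complex.I) = Complex.exp ζ :=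
  Complex.exp_periodic ζ

/-- The monodromy acting on the solutions of a linear system. -/
def solutionMonodromy (ρ : ℝ) (a : ι → ι → ℂ → ℂ) :
    Module.End ℂ (linearSolutions ρ a) where
  toFun F := ⟨fun i => monodromy (F.1 i), by
    refine ⟨fun ζ hζ i => ?_, fun ζ hζ i => F.2.2 _ (by simpa using hζ) i⟩
    have h := F.2.1 (ζ + 2 * Real.pi * Complex.I) (by simpa using hζ) i
    rw [exp_add_period] at h
    exact h.comp_add_const ζ (2 * Real.pi * Complex.I)⟩
  map_add' F G := rfl
  map_smul' c F := rfl

/-- For `g` of period `2πi`, the operator `monodromy - 1` acts on `(ζ / 2πi) ^ n g` as a finite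
difference in the first factor, so its `n`-th power yields `n! g`. -/
theorem monodromy_sub_one_pow_mul {g : ℂ → ℂ} (hg : monodromy g = g) (n : ℕ) :
    ((monodromy - 1) ^ n) ((fun ζ => (ζ / (2 * Real.pi * Complex.I)) ^ n) * g)
      = (n.factorial : ℂ) • g := by
  set c : ℂ := 2 * Real.pi * Complex.I with hc
  have hc0 : c ≠ 0 := by simp [hc, Real.pi_ne_zero]
  have h : ∀ (n : ℕ) (f : ℂ → ℂ), ((monodromy - 1) ^ n) ((fun ζ => f (ζ / c)) * g)
      = (fun ζ => ((fwdDiff 1)^[n] f) (ζ / c)) * g := by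
    intro n
    induction n with
    | zero => intro f; simp
    | succ n ih =>
      intro f
      rw [pow_succ, Module.End.mul_apply]
      have : (monodromy - 1) ((fun ζ => f (ζ / c)) * g) = (fun ζ => (fwdDiff 1 f) (ζ / c)) * g := by
        rw [LinearMap.sub_apply, monodromy_mul, hg, Module.End.one_apply, ← sub_mul]
        congr 1
        ext ζ
        simp only [Pi.sub_apply, monodromy_apply, fwdDiff, ← hc, add_div, div_self hc0]
      rw [this, ih, Function.iterate_succ_apply]
  have h1 := h n (fun x => x ^ n)
  rw [fwdDiff_iter_eq_factorial] at h1
  rw [h1]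
  ext ζ
  simp

theorem moderateGrowth_monodromy {φ : ℂ → ℂ} (h : φ ∈ moderateGrowth ρ) :
    monodromy φ ∈ moderateGrowth ρ := by
  convert translate_mem_moderateGrowth h (2 * Real.pi) using 1
  ext ζ
  simp [monodromy_apply]

/-- Functions of moderate growth with unipotent monodromy are polynomials in `ζ` over those with
trivial monodromy. -/
theorem mem_logForms_of_unipotent (n : ℕ) : ∀ φ ∈ moderateGrowth ρ,
    ((monodromy - 1) ^ n) φ = 0 → φ ∈ logForms ρ := by
  induction n with
  | zero => intro φ _ h; simp at h; simp [h]
  | succ n ih =>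
    intro φ hφ h
    set g := ((monodromy - 1) ^ n) φ with hg
    have hgper : monodromy g = g := by
      rw [pow_succ', Module.End.mul_apply, ← hg, LinearMap.sub_apply, Module.End.one_apply,
        sub_eq_zero] at h
      exact h
    have hgm : g ∈ moderateGrowth ρ := by
      have : ∀ k : ℕ, ((monodromy - 1) ^ k) φ ∈ moderateGrowth ρ := by
        intro k
        induction k with
        | zero => simpa using hφ
        | succ k ihk =>
          rw [pow_succ', Module.End.mul_apply, LinearMap.sub_apply, Module.End.one_apply]
          exact sub_mem (moderateGrowth_monodromy ihk) ihk
      exact this n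
    have hgl : g ∈ logForms ρ := mem_logForms_of_periodic hgm fun ζ => congrFun hgper ζ
    set c : ℂ := 2 * Real.pi * Complex.I with hc
    set d : ℂ := (n.factorial : ℂ)⁻¹ * c⁻¹ ^ n
    have hd : d • ((fun ζ : ℂ => ζ) ^ n * g)
        = (n.factorial : ℂ)⁻¹ • ((fun ζ => (ζ / c) ^ n) * g) := by
      ext ζ
      simp [d, div_eq_mul_inv, mul_pow]
      ring
    have h1 : φ - d • ((fun ζ : ℂ => ζ) ^ n * g) ∈ logForms ρ := by
      refine ih _ (sub_mem hφ (Subalgebra.smul_mem _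
        (mul_mem (pow_mem (id_mem_moderateGrowth ρ) n) hgm) d)) ?_
      rw [map_sub, hd, map_smul, monodromy_sub_one_pow_mul hgper, ← hg, smul_smul,
        inv_mul_cancel₀ (by exact_mod_cast n.factorial_ne_zero), one_smul, sub_self]
    have h2 : d • ((fun ζ : ℂ => ζ) ^ n * g) ∈ logForms ρ := by
      refine Submodule.smul_mem _ _ ?_
      convert logForms_exp_mul hgl 0 n using 1
      ext ζ; simp
    simpa using Submodule.add_mem _ h1 h2

/-- Division by `exp (s ζ)` with `exp (2πi s) = μ` reduces a generalized eigenvector of the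
monodromy to the unipotent case. -/
theorem mem_logForms_of_generalized_eigenvector {φ : ℂ → ℂ} (hφ : φ ∈ moderateGrowth ρ) {μ : ℂ}
    (hμ : μ ≠ 0) {n : ℕ} (h : ((monodromy - algebraMap ℂ _ μ) ^ n) φ = 0) : φ ∈ logForms ρ := by
  set c : ℂ := 2 * Real.pi * Complex.I with hc
  have hc0 : c ≠ 0 := by simp [hc, Real.pi_ne_zero]
  set s : ℂ := Complex.log μ / c
  have hs : Complex.exp (s * c) = μ := by rw [div_mul_cancel₀ _ hc0, Complex.exp_log hμ]
  let e : ℂ → ℂ := fun ζ => Complex.exp (-s * ζ)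
  have he : monodromy e = μ⁻¹ • e := by
    ext ζ
    simp only [monodromy_apply, e, Pi.smul_apply, smul_eq_mul, ← hc]
    rw [mul_add, Complex.exp_add, neg_mul s c, Complex.exp_neg, hs, mul_comm]
  have hstep : ∀ (k : ℕ) (ψ : ℂ → ℂ), ((monodromy - 1) ^ k) (e * ψ)
      = μ⁻¹ ^ k • (e * ((monodromy - algebraMap ℂ _ μ) ^ k) ψ) := by
    intro k
    induction k with
    | zero => intro ψ; simp
    | succ k ih =>
      intro ψ
      have h1 : (monodromy - 1) (e * ψ) = μ⁻¹ • (e * (monodromy - algebraMap ℂ _ μ) ψ) := by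
        rw [LinearMap.sub_apply, monodromy_mul, he, Module.End.one_apply, LinearMap.sub_apply,
          Module.algebraMap_end_apply, mul_sub, smul_sub, mul_smul_comm, inv_smul_smul₀ hμ,
          smul_mul_assoc]
      rw [pow_succ, Module.End.mul_apply, h1, map_smul, ih, smul_smul, pow_succ (_ - _),
        Module.End.mul_apply, ← pow_succ']
  have h1 : e * φ ∈ logForms ρ := by
    refine mem_logForms_of_unipotent n _ (mul_mem (exp_mem_moderateGrowth ρ _) hφ) ?_
    rw [hstep, h, mul_zero, smul_zero]
  refine logForms_congr (logForms_exp_mul h1 s 0) fun ζ _ => ?_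
  simp only [pow_zero, mul_one, Pi.mul_apply, e]
  rw [← mul_assoc, ← Complex.exp_add]
  simp

/-- Fuchs' theorem: the solutions of a linear system `dF/dζ = a (exp ζ) F`, which is the system
`q dF/dq = a(q) F` in the variable `q = exp ζ`, have regular singularities. -/
theorem linear_system_mem_logForms
    (ha : ∀ i j, ContinuousOn (a i j) (Metric.ball 0 (Real.exp ρ))) {F : ι → ℂ → ℂ}
    (hF : ∀ ζ : ℂ, ζ.re < ρ → ∀ i, HasDerivAt (F i) (∑ j, a i j (Complex.exp ζ) * F j ζ) ζ)
    (i : ι) : F i ∈ logForms ρ := by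
  have hfin := finiteDimensional_linearSolutions ha
  let G : ι → ℂ → ℂ := fun i ζ => if ζ.re < ρ then F i ζ else 0
  have hopen : IsOpen {ζ : ℂ | ζ.re < ρ} := isOpen_lt Complex.continuous_re continuous_const
  have hG : G ∈ linearSolutions ρ a := by
    refine ⟨fun ζ hζ i => ?_, fun ζ hζ i => if_neg (not_lt.2 hζ)⟩
    have h1 : ∑ j, a i j (Complex.exp ζ) * G j ζ = ∑ j, a i j (Complex.exp ζ) * F j ζ := by
      simp [G, hζ]
    rw [h1]
    refine (hF ζ hζ i).congr_of_eventuallyEq ?_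
    filter_upwards [hopen.mem_nhds hζ] with z hz using if_pos hz
  have key : ∀ x : linearSolutions ρ a, x.1 i ∈ logForms ρ := by
    intro x
    have hx : x ∈ ⨆ μ, (solutionMonodromy ρ a).maxGenEigenspace μ := by
      rw [Module.End.iSup_maxGenEigenspace_eq_top]; trivial
    induction hx using Submodule.iSup_induction' with
    | zero => exact (logForms ρ).zero_mem
    | add x y _ _ h₁ h₂ => exact Submodule.add_mem _ h₁ h₂
    | mem μ x hx =>
      obtain ⟨n, hn⟩ := (Module.End.mem_maxGenEigenspace _ _ _).1 hx
      have hcomm : ∀ (k : ℕ) (x : linearSolutions ρ a),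
          (((solutionMonodromy ρ a - μ • 1) ^ k) x).1 i
            = ((monodromy - algebraMap ℂ _ μ) ^ k) (x.1 i) := by
        intro k
        induction k with
        | zero => intro x; simp
        | succ k ih =>
          intro x
          rw [pow_succ, Module.End.mul_apply, ih, pow_succ, Module.End.mul_apply]
          rfl
      have h1 : ((monodromy - algebraMap ℂ _ μ) ^ n) (x.1 i) = 0 := by
        rw [← hcomm, hn]; rfl
      by_cases hμ : μ = 0
      · have h2 : ∀ (k : ℕ) (φ : ℂ → ℂ) (ζ : ℂ), ((monodromy ^ k) φ) ζ
            = φ (ζ + k * (2 * Real.pi * Complex.I)) := by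
          intro k
          induction k with
          | zero => intro φ ζ; simp
          | succ k ih =>
            intro φ ζ
            rw [pow_succ, Module.End.mul_apply, ih, monodromy_apply]
            congr 1; push_cast; ring
        have h3 : x.1 i = 0 := by
          ext ζ
          have := congrFun h1 (ζ - n * (2 * Real.pi * Complex.I))
          rw [hμ, map_zero, sub_zero, h2, sub_add_cancel] at this
          exact this
        rw [h3]
        exact (logForms ρ).zero_mem
      · exact mem_logForms_of_generalized_eigenvector
          (linearSolutions_moderateGrowth ha x.2 i) hμ h1
  exact logForms_congr (key ⟨G, hG⟩) fun ζ hζ => (if_pos hζ).symm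

end LinearSystem

/-! ### Holomorphic functions on the covering of a punctured polydisc -/

theorem isOpen_coverDomain (r₁ r₂ : ℝ) : IsOpen (coverDomain r₁ r₂) :=
  (isOpen_lt (Complex.continuous_re.comp continuous_fst) continuous_const).inter
    (isOpen_lt (Complex.continuous_re.comp continuous_snd) continuous_const)

theorem convex_coverDomain (r₁ r₂ : ℝ) : Convex ℝ (coverDomain r₁ r₂) := by
  have : coverDomain r₁ r₂
      = {z : ℂ | z.re < Real.log r₁} ×ˢ {z : ℂ | z.re < Real.log r₂} := rfl
  rw [this]
  exact (convex_halfSpace_re_lt _).prod (convex_halfSpace_re_lt _)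

/-- Extension by zero of a function on the cover. -/
def zeroExtend {r₁ r₂ : ℝ} (f : coverDomain r₁ r₂ → ℂ) : ℂ × ℂ → ℂ :=
  Function.extend Subtype.val f 0

theorem zeroExtend_coe {r₁ r₂ : ℝ} (f : coverDomain r₁ r₂ → ℂ) (q : coverDomain r₁ r₂) :
    zeroExtend f q = f q :=
  Subtype.val_injective.extend_apply f 0 q

theorem zeroExtend_of_mem {r₁ r₂ : ℝ} (f : coverDomain r₁ r₂ → ℂ) {q : ℂ × ℂ}
    (hq : q ∈ coverDomain r₁ r₂) : zeroExtend f q = f ⟨q, hq⟩ :=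
  zeroExtend_coe f ⟨q, hq⟩

/-- The holomorphic functions on the cover of the punctured polydisc, as functions on a subtype in
order that the values outside of the cover play no role. -/
def holoSubalgebra (r₁ r₂ : ℝ) : Subalgebra ℂ (coverDomain r₁ r₂ → ℂ) where
  carrier := {f | AnalyticOnNhd ℂ (zeroExtend f) (coverDomain r₁ r₂)}
  mul_mem' {f g} hf hg := (AnalyticOnNhd.mul hf hg).congr (isOpen_coverDomain _ _) fun q hq => by
    simp [zeroExtend_of_mem _ hq]
  add_mem' {f g} hf hg := (AnalyticOnNhd.add hf hg).congr (isOpen_coverDomain _ _) fun q hq => by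
    simp [zeroExtend_of_mem _ hq]
  algebraMap_mem' c := (analyticOnNhd_const (v := c)).congr (isOpen_coverDomain _ _) fun q hq => by
    simp [zeroExtend_of_mem _ hq]

/-- The algebra of holomorphic functions on the cover of the punctured polydisc. -/
def Holo (r₁ r₂ : ℝ) : Type := holoSubalgebra r₁ r₂

namespace Holo

instance (r₁ r₂ : ℝ) : CommRing (Holo r₁ r₂) := inferInstanceAs (CommRing (holoSubalgebra r₁ r₂))

instance (r₁ r₂ : ℝ) : Algebra ℂ (Holo r₁ r₂) :=
  inferInstanceAs (Algebra ℂ (holoSubalgebra r₁ r₂))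

variable {r₁ r₂ : ℝ}

/-- A holomorphic function on the cover as a function on `ℂ × ℂ`, extended by zero. -/
def val (f : Holo r₁ r₂) : ℂ × ℂ → ℂ := zeroExtend (Subtype.val f)

theorem analyticAt (f : Holo r₁ r₂) {q : ℂ × ℂ} (hq : q ∈ coverDomain r₁ r₂) :
    AnalyticAt ℂ f.val q := f.2 q hq

/-- The element of the algebra given by a function on `ℂ × ℂ`. -/
def restrict (F : ℂ × ℂ → ℂ) (hF : AnalyticOnNhd ℂ F (coverDomain r₁ r₂)) : Holo r₁ r₂ :=
  ⟨fun q => F q, hF.congr (isOpen_coverDomain _ _) fun _ hq =>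
    (zeroExtend_of_mem (fun q : coverDomain r₁ r₂ => F q) hq).symm⟩

theorem restrict_val {F : ℂ × ℂ → ℂ} (hF : AnalyticOnNhd ℂ F (coverDomain r₁ r₂)) {q : ℂ × ℂ}
    (hq : q ∈ coverDomain r₁ r₂) : (restrict F hF).val q = F q :=
  zeroExtend_of_mem _ hq

theorem ext' {f g : Holo r₁ r₂} (h : ∀ q ∈ coverDomain r₁ r₂, f.val q = g.val q) : f = g := by
  refine Subtype.ext (funext fun q => ?_)
  have := h q q.2
  rwa [val, val, zeroExtend_coe, zeroExtend_coe] at this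

theorem eventually_mem {q : ℂ × ℂ} (hq : q ∈ coverDomain r₁ r₂) :
    ∀ᶠ q' in 𝓝 q, q' ∈ coverDomain r₁ r₂ := (isOpen_coverDomain _ _).mem_nhds hq

/-- Evaluation at a point of the cover. -/
def eval (q : coverDomain r₁ r₂) : Holo r₁ r₂ →ₐ[ℂ] ℂ :=
  (Pi.evalAlgHom ℂ (fun _ : coverDomain r₁ r₂ => ℂ) q).comp (holoSubalgebra r₁ r₂).val

theorem eval_eq_val (q : coverDomain r₁ r₂) (f : Holo r₁ r₂) : eval q f = f.val q :=
  (zeroExtend_coe _ _).symm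

theorem val_add {q : ℂ × ℂ} (hq : q ∈ coverDomain r₁ r₂) (f g : Holo r₁ r₂) :
    (f + g).val q = f.val q + g.val q := by
  simpa [eval_eq_val] using map_add (eval ⟨q, hq⟩) f g

theorem val_sub {q : ℂ × ℂ} (hq : q ∈ coverDomain r₁ r₂) (f g : Holo r₁ r₂) :
    (f - g).val q = f.val q - g.val q := by
  simpa [eval_eq_val] using map_sub (eval ⟨q, hq⟩) f g

theorem val_neg {q : ℂ × ℂ} (hq : q ∈ coverDomain r₁ r₂) (f : Holo r₁ r₂) :
    (-f).val q = -f.val q := by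
  simpa [eval_eq_val] using map_neg (eval ⟨q, hq⟩) f

theorem val_mul {q : ℂ × ℂ} (hq : q ∈ coverDomain r₁ r₂) (f g : Holo r₁ r₂) :
    (f * g).val q = f.val q * g.val q := by
  simpa [eval_eq_val] using map_mul (eval ⟨q, hq⟩) f g

theorem val_pow {q : ℂ × ℂ} (hq : q ∈ coverDomain r₁ r₂) (f : Holo r₁ r₂) (n : ℕ) :
    (f ^ n).val q = f.val q ^ n := by
  simpa [eval_eq_val] using map_pow (eval ⟨q, hq⟩) f n

theorem val_smul {q : ℂ × ℂ} (hq : q ∈ coverDomain r₁ r₂) (c : ℂ) (f : Holo r₁ r₂) :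
    (c • f).val q = c * f.val q := by
  have := map_smul (eval ⟨q, hq⟩) c f
  rwa [eval_eq_val, eval_eq_val] at this

theorem val_sum {q : ℂ × ℂ} (hq : q ∈ coverDomain r₁ r₂)
    {ι : Type*} (s : Finset ι) (f : ι → Holo r₁ r₂) :
    (∑ i ∈ s, f i).val q = ∑ i ∈ s, (f i).val q := by
  have := map_sum (eval ⟨q, hq⟩) f s
  simp only [eval_eq_val] at this
  exact this

theorem val_one {q : ℂ × ℂ} (hq : q ∈ coverDomain r₁ r₂) :
    (1 : Holo r₁ r₂).val q = 1 := by
  simpa [eval_eq_val] using map_one (eval ⟨q, hq⟩)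

theorem val_zero {q : ℂ × ℂ} (hq : q ∈ coverDomain r₁ r₂) : (0 : Holo r₁ r₂).val q = 0 := by
  simpa [eval_eq_val] using map_zero (eval ⟨q, hq⟩)

theorem analyticOnNhd_fderiv (f : Holo r₁ r₂) (w : ℂ × ℂ) :
    AnalyticOnNhd ℂ (fun q => fderiv ℂ f.val q w) (coverDomain r₁ r₂) := fun _ hq =>
  ((ContinuousLinearMap.apply ℂ ℂ w).analyticAt _).comp (f.analyticAt hq).fderiv

/-- The derivative in a constant direction. -/
def pd (w : ℂ × ℂ) : Derivation ℂ (Holo r₁ r₂) (Holo r₁ r₂) :=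
  Derivation.mk'
    { toFun := fun f => restrict (fun q => fderiv ℂ f.val q w) (f.analyticOnNhd_fderiv w)
      map_add' := fun f g => ext' fun q hq => by
        have h : (f + g).val =ᶠ[𝓝 q] f.val + g.val := by
          filter_upwards [eventually_mem hq] with q' hq' using val_add hq' f g
        rw [val_add hq, restrict_val _ hq, restrict_val _ hq, restrict_val _ hq, h.fderiv_eq,
          fderiv_add (f.analyticAt hq).differentiableAt (g.analyticAt hq).differentiableAt]
        rfl
      map_smul' := fun c f => ext' fun q hq => by
        have h : (c • f).val =ᶠ[𝓝 q] c • f.val := by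
          filter_upwards [eventually_mem hq] with q' hq' using val_smul hq' c f
        rw [RingHom.id_apply, val_smul hq, restrict_val _ hq, restrict_val _ hq, h.fderiv_eq,
          fderiv_const_smul (f.analyticAt hq).differentiableAt]
        rfl }
    fun f g => ext' fun q hq => by
      have h : (f * g).val =ᶠ[𝓝 q] f.val * g.val := by
        filter_upwards [eventually_mem hq] with q' hq' using val_mul hq' f g
      rw [smul_eq_mul, smul_eq_mul, val_add hq, val_mul hq, val_mul hq]
      simp only [LinearMap.coe_mk, AddHom.coe_mk]
      rw [restrict_val _ hq, restrict_val _ hq, restrict_val _ hq, h.fderiv_eq,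
          fderiv_mul (f.analyticAt hq).differentiableAt (g.analyticAt hq).differentiableAt]
      simp

theorem pd_val (w : ℂ × ℂ) (f : Holo r₁ r₂) {q : ℂ × ℂ} (hq : q ∈ coverDomain r₁ r₂) :
    (pd w f).val q = fderiv ℂ f.val q w :=
  restrict_val _ hq

theorem pd_comm (v w : ℂ × ℂ) (f : Holo r₁ r₂) : pd v (pd w f) = pd w (pd v f) := by
  refine ext' fun q hq => ?_
  have key : ∀ v w : ℂ × ℂ, (pd v (pd w f)).val q = fderiv ℂ (fderiv ℂ f.val) q v w := by
    intro v w
    have h : (pd w f).val =ᶠ[𝓝 q] fun q => fderiv ℂ f.val q w := by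
      filter_upwards [eventually_mem hq] with q' hq' using pd_val w f hq'
    rw [pd_val v _ hq, h.fderiv_eq,
      fderiv_clm_apply (f.analyticAt hq).fderiv.differentiableAt (differentiableAt_const _)]
    simp
  rw [key, key]
  exact ((f.analyticAt hq).contDiffAt.isSymmSndFDerivAt (n := ⊤) (by simp)) v w

/-- Post-composition with a holomorphic function of one variable. -/
def comp (g : ℂ → ℂ) (f : Holo r₁ r₂)
    (hg : ∀ q ∈ coverDomain r₁ r₂, AnalyticAt ℂ g (f.val q)) : Holo r₁ r₂ :=
  restrict (fun q => g (f.val q)) fun q hq => (hg q hq).comp (f.analyticAt hq)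

theorem comp_val {g : ℂ → ℂ} {f : Holo r₁ r₂}
    (hg : ∀ q ∈ coverDomain r₁ r₂, AnalyticAt ℂ g (f.val q)) {q : ℂ × ℂ}
    (hq : q ∈ coverDomain r₁ r₂) : (comp g f hg).val q = g (f.val q) :=
  restrict_val _ hq

theorem pd_comp (w : ℂ × ℂ) {g : ℂ → ℂ} {f : Holo r₁ r₂}
    (hg : ∀ q ∈ coverDomain r₁ r₂, AnalyticAt ℂ g (f.val q)) :
    pd w (comp g f hg) = comp (deriv g) f (fun q hq => (hg q hq).deriv) * pd w f := by
  refine ext' fun q hq => ?_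
  have h : (comp g f hg).val =ᶠ[𝓝 q] fun q => g (f.val q) := by
    filter_upwards [eventually_mem hq] with q' hq' using comp_val hg hq'
  rw [val_mul hq, pd_val _ _ hq, pd_val _ _ hq, comp_val _ hq, h.fderiv_eq]
  have := (hg q hq).differentiableAt.hasDerivAt.comp_hasFDerivAt q
    (f.analyticAt hq).differentiableAt.hasFDerivAt
  have h2 := this.fderiv
  rw [show (fun q => g (f.val q)) = g ∘ f.val from rfl, h2]
  simp

theorem isUnit_of_ne_zero {f : Holo r₁ r₂} (h : ∀ q ∈ coverDomain r₁ r₂, f.val q ≠ 0) :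
    IsUnit f := by
  have hinv : AnalyticOnNhd ℂ (fun q => (f.val q)⁻¹) (coverDomain r₁ r₂) :=
    fun q hq => (f.analyticAt hq).inv (h q hq)
  refine IsUnit.of_mul_eq_one (restrict _ hinv) (ext' fun q hq => ?_)
  rw [val_mul hq, restrict_val _ hq, val_one hq, mul_inv_cancel₀ (h q hq)]

/-- A function is determined by its Taylor coefficients at a point, in the form of iterated
directional derivatives. -/
theorem eq_zero_of_iterate_pd {f : Holo r₁ r₂} {q₀ : ℂ × ℂ} (hq₀ : q₀ ∈ coverDomain r₁ r₂)
    (h : ∀ (w : ℂ × ℂ) (k : ℕ), ((pd w)^[k] f).val q₀ = 0) : f = 0 := by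
  refine ext' fun q hq => ?_
  rw [val_zero hq]
  set w := q - q₀ with hw
  let line : ℂ → ℂ × ℂ := fun s => q₀ + s • w
  set U : Set ℂ := line ⁻¹' coverDomain r₁ r₂ with hU
  have hline : Continuous line := by fun_prop
  have hUo : IsOpen U := (isOpen_coverDomain _ _).preimage hline
  have hUc : Convex ℝ U := by
    intro s hs t ht a b ha hb hab
    have h1 := convex_coverDomain r₁ r₂ hs ht ha hb hab
    have h2 : a • line s + b • line t = line (a • s + b • t) := by
      have h3 : (a : ℂ) + b = 1 := by exact_mod_cast hab
      simp only [line, Complex.real_smul]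
      ext
      · simp
        linear_combination q₀.1 * h3
      · simp
        linear_combination q₀.2 * h3
    rwa [h2] at h1
  have h0U : (0 : ℂ) ∈ U := by simpa [hU, line] using hq₀
  have h1U : (1 : ℂ) ∈ U := by simpa [hU, line, hw] using hq
  have hda : ∀ (g : Holo r₁ r₂), ∀ s ∈ U, AnalyticAt ℂ (fun s => g.val (line s)) s := by
    intro g s hs
    have : AnalyticAt ℂ line s := by
      simp only [line]
      fun_prop
    exact AnalyticAt.comp (f := line) (g.analyticAt hs) this
  have hd : ∀ (g : Holo r₁ r₂), ∀ s ∈ U, deriv (fun s => g.val (line s)) s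
      = (pd w g).val (line s) := by
    intro g s hs
    have h1 : HasDerivAt line w s := by
      have := ((hasDerivAt_id s).smul_const w).const_add q₀
      simpa [line] using this
    have h2 := (g.analyticAt hs).differentiableAt.hasFDerivAt.comp_hasDerivAt s h1
    rw [pd_val _ _ hs]
    exact h2.deriv
  have hit : ∀ (k : ℕ) (g : Holo r₁ r₂), ∀ s ∈ U, iteratedDeriv k (fun s => g.val (line s)) s
      = ((pd w)^[k] g).val (line s) := by
    intro k
    induction k with
    | zero => intro g s hs; simp
    | succ k ih =>
      intro g s hs
      have h1 : deriv (fun s => g.val (line s)) =ᶠ[𝓝 s] fun s => (pd w g).val (line s) := by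
        filter_upwards [hUo.mem_nhds hs] with t ht using hd g t ht
      rw [iteratedDeriv_succ', h1.iteratedDeriv_eq, ih _ s hs, Function.iterate_succ_apply]
  have hz : (fun s => f.val (line s)) =ᶠ[𝓝 0] 0 := by
    have h1 := (hda f 0 h0U).hasFPowerSeriesAt
    have h2 : (fun n => iteratedDeriv n (fun s => f.val (line s)) 0 / (n.factorial : ℂ)) = 0 := by
      ext n
      rw [hit n f 0 h0U]
      simp [line, h w n]
    rw [h2] at h1
    have h3 : FormalMultilinearSeries.ofScalars ℂ (0 : ℕ → ℂ) = 0 := by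
      ext n; simp [FormalMultilinearSeries.ofScalars]
    rw [h3] at h1
    exact h1.eventually_eq_zero
  have := AnalyticOnNhd.eqOn_zero_of_preconnected_of_eventuallyEq_zero (hda f)
    hUc.isPreconnected h0U hz h1U
  simpa [line, hw] using this

end Holo

/-! ### Differential equations with commuting derivations -/

section Holonomic

variable {R : Type*} [CommRing R] [Algebra ℂ R]

/-- The operator `X (X - 1) ⋯ (X - j + 1)`. -/
def fallingIter (X : Derivation ℂ R R) : ℕ → R → R
  | 0, f => f
  | j + 1, f => X (fallingIter X j f) - (j : ℂ) • fallingIter X j f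

variable (D E : Derivation ℂ R R) (Φ : R) (m : ℕ)

/-- The ideal generated by the derivatives `E^j D^i Φ` with `j < k` and `i < m`. -/
def jetIdeal (k : ℕ) : Ideal R := Ideal.span {x | ∃ j < k, ∃ i < m, x = E^[j] (D^[i] Φ)}

variable {D E Φ m}

theorem mem_jetIdeal {k j i : ℕ} (hj : j < k) (hi : i < m) :
    E^[j] (D^[i] Φ) ∈ jetIdeal D E Φ m k := Ideal.subset_span ⟨j, hj, i, hi, rfl⟩

theorem jetIdeal_mono {k l : ℕ} (h : k ≤ l) : jetIdeal D E Φ m k ≤ jetIdeal D E Φ m l :=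
  Ideal.span_mono fun _ ⟨j, hj, i, hi, hx⟩ => ⟨j, hj.trans_le h, i, hi, hx⟩

/-- A derivation maps the ideal spanned by a set into an ideal as soon as this holds for the
generators and the ideal contains the set. -/
theorem derivation_mem_of_span {X : Derivation ℂ R R} {s : Set R} {I : Ideal R} (hs : s ⊆ I)
    (h : ∀ x ∈ s, X x ∈ I) {x : R} (hx : x ∈ Ideal.span s) : X x ∈ I := by
  induction hx using Submodule.span_induction with
  | mem x hx => exact h x hx
  | zero => simp
  | add x y _ _ hx hy => rw [map_add]; exact I.add_mem hx hy
  | smul a x hx' hx =>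
    rw [smul_eq_mul, Derivation.leibniz]
    exact I.add_mem (I.mul_mem_left _ hx) (I.mul_mem_right _ (Ideal.span_le.2 hs hx'))

theorem apply_mem_jetIdeal_succ {k : ℕ} {x : R} (hx : x ∈ jetIdeal D E Φ m k) :
    E x ∈ jetIdeal D E Φ m (k + 1) := by
  refine derivation_mem_of_span ?_ ?_ hx
  · rintro _ ⟨j, hj, i, hi, rfl⟩
    exact mem_jetIdeal (by omega) hi
  · rintro _ ⟨j, hj, i, hi, rfl⟩
    rw [← Function.iterate_succ_apply' (f := E)]
    exact mem_jetIdeal (by omega) hi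

theorem iterate_mem_jetIdeal {k : ℕ} {x : R} (hx : x ∈ jetIdeal D E Φ m k) (l : ℕ) :
    E^[l] x ∈ jetIdeal D E Φ m (k + l) := by
  induction l with
  | zero => exact hx
  | succ l ih =>
    rw [Function.iterate_succ_apply']
    exact apply_mem_jetIdeal_succ ih

/-- An equation of order `m` in `D` makes the jet ideals stable under `D`. -/
theorem apply_mem_jetIdeal (hDE : Function.Commute D E) (hD : D^[m] Φ ∈ jetIdeal D E Φ m 1)
    {k : ℕ} {x : R} (hx : x ∈ jetIdeal D E Φ m k) : D x ∈ jetIdeal D E Φ m k := by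
  refine derivation_mem_of_span Ideal.subset_span ?_ hx
  rintro _ ⟨j, hj, i, hi, rfl⟩
  have h1 : D (E^[j] (D^[i] Φ)) = E^[j] (D^[i + 1] Φ) := by
    rw [Function.iterate_succ_apply', (hDE.iterate_right j).eq]
  rw [h1]
  rcases Nat.lt_or_ge (i + 1) m with h | h
  · exact mem_jetIdeal hj h
  · obtain rfl : m = i + 1 := by omega
    exact jetIdeal_mono (by omega) (iterate_mem_jetIdeal hD j)

theorem smul_mem_ideal (I : Ideal R) (c : ℂ) {x : R} (hx : x ∈ I) : c • x ∈ I := by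
  rw [Algebra.smul_def]
  exact I.mul_mem_left _ hx

variable {α β : R}

/-- The leading term of `X (X - 1) ⋯ (X - k + 1) Φ` for `X = α E + β D`, modulo derivatives of lower
order in `E`. -/
theorem fallingIter_sub_mem_jetIdeal (hDE : Function.Commute D E)
    (hD : D^[m] Φ ∈ jetIdeal D E Φ m 1) (hm : 0 < m) (k : ℕ) :
    fallingIter (α • E + β • D) k Φ - α ^ k * E^[k] Φ ∈ jetIdeal D E Φ m k := by
  induction k with
  | zero => simp [fallingIter]
  | succ k ih =>
    set X := α • E + β • D
    set u := fallingIter X k Φ - α ^ k * E^[k] Φ with hu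
    have hfall : fallingIter X k Φ = u + α ^ k * E^[k] Φ := by simp [u]
    have hk : E^[k] Φ ∈ jetIdeal D E Φ m (k + 1) := by
      simpa using mem_jetIdeal (D := D) (E := E) (Φ := Φ) (Nat.lt_succ_self k) hm
    have h1 : ∀ {x}, x ∈ jetIdeal D E Φ m k → X x ∈ jetIdeal D E Φ m (k + 1) := by
      intro x hx
      exact Ideal.add_mem _ (Ideal.mul_mem_left _ _ (apply_mem_jetIdeal_succ hx))
        (Ideal.mul_mem_left _ _ (jetIdeal_mono (by omega) (apply_mem_jetIdeal hDE hD hx)))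
    have h2 : X (α ^ k * E^[k] Φ) - α ^ (k + 1) * E^[k + 1] Φ ∈ jetIdeal D E Φ m (k + 1) := by
      have : X (α ^ k * E^[k] Φ) - α ^ (k + 1) * E^[k + 1] Φ
          = X (α ^ k) * E^[k] Φ + α ^ k * β * D (E^[k] Φ) := by
        rw [Derivation.leibniz, Function.iterate_succ_apply' (f := E)]
        have : X (E^[k] Φ) = α * E (E^[k] Φ) + β * D (E^[k] Φ) := rfl
        rw [this, smul_eq_mul, smul_eq_mul]
        ring
      rw [this]
      exact Ideal.add_mem _ (Ideal.mul_mem_left _ _ hk)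
        (Ideal.mul_mem_left _ _ (apply_mem_jetIdeal hDE hD hk))
    have h3 : fallingIter X (k + 1) Φ - α ^ (k + 1) * E^[k + 1] Φ
        = X u + (X (α ^ k * E^[k] Φ) - α ^ (k + 1) * E^[k + 1] Φ) - (k : ℂ) • u
          - (k : ℂ) • (α ^ k * E^[k] Φ) := by
      rw [fallingIter, hfall, map_add, smul_add]
      ring
    rw [h3]
    exact Ideal.sub_mem _ (Ideal.sub_mem _ (Ideal.add_mem _ (h1 ih) h2)
      (smul_mem_ideal _ _ (jetIdeal_mono (by omega) ih)))
      (smul_mem_ideal _ _ (Ideal.mul_mem_left _ _ hk))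

/-- If `Φ` satisfies an equation of order `m` in `D` and one of order `n` in `α E + β D` with `α`
invertible, the ideal generated by finitely many derivatives is stable under `E`. -/
theorem apply_mem_jetIdeal_of_fallingIter (hDE : Function.Commute D E)
    (hD : D^[m] Φ ∈ jetIdeal D E Φ m 1) (hm : 0 < m) {n : ℕ} (hα : IsUnit α) {c : Fin n → R}
    (hX : fallingIter (α • E + β • D) n Φ
      + ∑ k, c k * fallingIter (α • E + β • D) (n - 1 - k) Φ = 0) {x : R}
    (hx : x ∈ jetIdeal D E Φ m n) : E x ∈ jetIdeal D E Φ m n := by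
  have hfall : ∀ k < n, fallingIter (α • E + β • D) k Φ ∈ jetIdeal D E Φ m n := by
    intro k hk
    have h1 := jetIdeal_mono (l := n) (by omega)
      (fallingIter_sub_mem_jetIdeal (α := α) (β := β) hDE hD hm k)
    have h2 : α ^ k * E^[k] Φ ∈ jetIdeal D E Φ m n :=
      Ideal.mul_mem_left _ _ (by simpa using mem_jetIdeal (D := D) (E := E) (Φ := Φ) hk hm)
    simpa using Ideal.add_mem _ h1 h2
  have hEn : E^[n] Φ ∈ jetIdeal D E Φ m n := by
    have h1 := fallingIter_sub_mem_jetIdeal (α := α) (β := β) hDE hD hm n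
    rw [eq_neg_of_add_eq_zero_left hX] at h1
    have h2 : ∑ k, c k * fallingIter (α • E + β • D) (n - 1 - k) Φ ∈ jetIdeal D E Φ m n :=
      Ideal.sum_mem _ fun k _ => Ideal.mul_mem_left _ _ (hfall _ (by omega))
    have h3 : α ^ n * E^[n] Φ ∈ jetIdeal D E Φ m n := by
      have := Ideal.neg_mem_iff _ |>.2 (Ideal.add_mem _ h1 h2)
      convert this using 1
      ring
    exact (Ideal.unit_mul_mem_iff_mem _ (hα.pow n)).1 h3
  refine derivation_mem_of_span Ideal.subset_span ?_ hx
  rintro _ ⟨j, hj, i, hi, rfl⟩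
  rw [← Function.iterate_succ_apply' (f := E)]
  rcases Nat.lt_or_ge (j + 1) n with h | h
  · exact mem_jetIdeal h hi
  · obtain rfl : n = j + 1 := by omega
    have h1 : E^[j + 1] (D^[i] Φ) = D^[i] (E^[j + 1] Φ) :=
      ((hDE.iterate_right (j + 1)).iterate_left i).eq Φ |>.symm
    rw [h1]
    clear h1 hi
    induction i with
    | zero => exact hEn
    | succ i ih =>
      rw [Function.iterate_succ_apply']
      exact apply_mem_jetIdeal hDE hD ih

theorem derivation_iterate_smul (c : ℂ) (x : R) (k : ℕ) : E^[k] (c • x) = c • E^[k] x := by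
  induction k with
  | zero => rfl
  | succ k ih =>
    rw [Function.iterate_succ_apply', ih, Function.iterate_succ_apply', Derivation.map_smul]

/-- The operator `D ^ m - ∑ p i D ^ i`. -/
def differentialOperator (D : Derivation ℂ R R) {m : ℕ} (p : Fin m → R) : Module.End ℂ R :=
  (D : R →ₗ[ℂ] R) ^ m - ∑ i : Fin m, (LinearMap.mulLeft ℂ (p i)) * (D : R →ₗ[ℂ] R) ^ (i : ℕ)

theorem differentialOperator_apply {p : Fin m → R} (f : R) :
    differentialOperator D p f = D^[m] f - ∑ i : Fin m, p i * D^[i] f := by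
  simp [differentialOperator, Module.End.pow_apply]

theorem iterate_mul_of_apply_eq_zero {a : R} (ha : D a = 0) (f : R) (i : ℕ) :
    D^[i] (a * f) = a * D^[i] f := by
  induction i with
  | zero => rfl
  | succ i ih =>
    rw [Function.iterate_succ_apply', Function.iterate_succ_apply', ih, Derivation.leibniz, ha]
    simp

theorem differentialOperator_mul {p : Fin m → R} {a : R} (ha : D a = 0) (f : R) :
    differentialOperator D p (a * f) = a * differentialOperator D p f := by
  simp only [differentialOperator_apply, iterate_mul_of_apply_eq_zero ha, mul_sub, Finset.mul_sum,
    mul_left_comm]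

theorem differentialOperator_comm (hDE : Function.Commute D E) {p : Fin m → R}
    (hp : ∀ i, E (p i) = 0) (f : R) :
    differentialOperator D p (E f) = E (differentialOperator D p f) := by
  have h : ∀ i : ℕ, D^[i] (E f) = E (D^[i] f) := fun i => (hDE.iterate_left i).eq f
  simp only [differentialOperator_apply, map_sub, map_sum, Derivation.leibniz, hp, h]
  simp

variable {ν : R} {L : Module.End ℂ R}

/-- A function killed by `E ^ K` is a polynomial in `ν`, where `E ν = 1`, over functions killed
by `E`. -/
theorem mem_span_of_iterate_eq_zero (hν : E ν = 1) (hL : ∀ (j : ℕ) f, L (ν ^ j * f) = ν ^ j * L f)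
    (hLE : ∀ f, L (E f) = E (L f)) (K : ℕ) : ∀ f : R, E^[K] f = 0 → L f = 0 →
      f ∈ Submodule.span ℂ {x | ∃ (j : ℕ) (g : R), E g = 0 ∧ L g = 0 ∧ x = ν ^ j * g} := by
  induction K with
  | zero => intro f hf _; rw [show f = 0 from hf]; exact Submodule.zero_mem _
  | succ K ih =>
    intro f hf hLf
    set g := E^[K] f with hg
    have hEg : E g = 0 := by rw [hg, ← Function.iterate_succ_apply' (f := E)]; exact hf
    have hLg : L g = 0 := by
      have : ∀ K, L (E^[K] f) = E^[K] (L f) := by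
        intro K
        induction K with
        | zero => rfl
        | succ K ih => rw [Function.iterate_succ_apply', hLE, ih, Function.iterate_succ_apply']
      rw [hg, this, hLf]
      exact iterate_map_zero E K
    have hpow : ∀ K : ℕ, E^[K] (ν ^ K * g) = (K.factorial : ℂ) • g := by
      intro K
      induction K with
      | zero => simp
      | succ K ihK =>
        have h1 : E (ν ^ (K + 1) * g) = ((K + 1 : ℕ) : ℂ) • (ν ^ K * g) := by
          rw [Derivation.leibniz, hEg, Derivation.leibniz_pow, hν, nsmul_eq_mul]
          simp only [Nat.add_sub_cancel, smul_eq_mul, mul_one, Algebra.smul_def, map_natCast]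
          ring
        rw [Function.iterate_succ_apply, h1, derivation_iterate_smul, ihK, smul_smul, Nat.factorial_succ, Nat.cast_mul]
    set d : ℂ := (K.factorial : ℂ)⁻¹
    have hd : d * (K.factorial : ℂ) = 1 :=
      inv_mul_cancel₀ (by exact_mod_cast K.factorial_ne_zero)
    have hsub : ∀ x y : R, E^[K] (x - y) = E^[K] x - E^[K] y := fun x y => iterate_map_sub E K x y
    have h1 := ih (f - ν ^ K * (d • g)) (by
        have h2 : E^[K] (ν ^ K * (d • g)) = g := by
          rw [mul_smul_comm, derivation_iterate_smul, hpow, smul_smul, hd, one_smul]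
        rw [hsub, h2, ← hg, sub_self])
      (by rw [map_sub, hL, map_smul, hLg, hLf]; simp)
    have h2 : ν ^ K * (d • g) ∈
        Submodule.span ℂ {x | ∃ (j : ℕ) (g : R), E g = 0 ∧ L g = 0 ∧ x = ν ^ j * g} :=
      Submodule.subset_span ⟨K, d • g, by rw [Derivation.map_smul, hEg, smul_zero],
        by rw [map_smul, hLg, smul_zero], rfl⟩
    simpa using Submodule.add_mem _ h1 h2

/-- An element of a finite-dimensional `E`-stable space of solutions of `L` is a sum of terms
`e μ ν ^ j g` with `E g = 0` and `L g = 0`, where `e μ` plays the role of `exp (μ ν)`. -/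
theorem mem_span_of_finiteDimensional {V : Submodule ℂ R} [FiniteDimensional ℂ V]
    (hVE : ∀ f ∈ V, E f ∈ V) (hVL : ∀ f ∈ V, L f = 0) (hν : E ν = 1)
    (hL : ∀ (j : ℕ) f, L (ν ^ j * f) = ν ^ j * L f) (hLE : ∀ f, L (E f) = E (L f)) {e : ℂ → R}
    (he : ∀ μ, E (e μ) = μ • e μ) (he' : ∀ μ, e μ * e (-μ) = 1)
    (heL : ∀ μ f, L (e μ * f) = e μ * L f) {f : R} (hf : f ∈ V) :
    f ∈ Submodule.span ℂ
      {x | ∃ (μ : ℂ) (j : ℕ) (g : R), E g = 0 ∧ L g = 0 ∧ x = e μ * (ν ^ j * g)} := by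
  set W := Submodule.span ℂ
      {x | ∃ (μ : ℂ) (j : ℕ) (g : R), E g = 0 ∧ L g = 0 ∧ x = e μ * (ν ^ j * g)} with hW
  let T : Module.End ℂ V := (E : R →ₗ[ℂ] R).restrict hVE
  have key : ∀ x : V, (x : R) ∈ W := by
    intro x
    have hx : x ∈ ⨆ μ, T.maxGenEigenspace μ := by
      rw [Module.End.iSup_maxGenEigenspace_eq_top]; trivial
    induction hx using Submodule.iSup_induction' with
    | zero => exact W.zero_mem
    | add x y _ _ h₁ h₂ => exact Submodule.add_mem _ h₁ h₂
    | mem μ x hx =>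
      obtain ⟨K, hK⟩ := (Module.End.mem_maxGenEigenspace _ _ _).1 hx
      have hcomm : ∀ (k : ℕ) (x : V),
          E^[k] (e (-μ) * x) = e (-μ) * (((T - μ • 1) ^ k) x : V) := by
        intro k
        induction k with
        | zero => intro x; rfl
        | succ k ih =>
          intro x
          have h1 : E (e (-μ) * x) = e (-μ) * ((T - μ • 1) x : V) := by
            have h2 : (((T - μ • 1) x : V) : R) = E x - μ • (x : R) := rfl
            rw [h2, Derivation.leibniz, he]
            simp only [smul_eq_mul, Algebra.smul_def, map_neg]
            ring
          rw [Function.iterate_succ_apply, h1, ih, pow_succ, Module.End.mul_apply]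
      have h1 := mem_span_of_iterate_eq_zero hν hL hLE K (e (-μ) * x)
        (by rw [hcomm, hK]; simp) (by rw [heL, hVL _ x.2, mul_zero])
      have h2 : (x : R) = e μ * (e (-μ) * x) := by rw [← mul_assoc, he', one_mul]
      rw [h2]
      have h3 : Submodule.span ℂ {x | ∃ (j : ℕ) (g : R), E g = 0 ∧ L g = 0 ∧ x = ν ^ j * g}
          ≤ W.comap (LinearMap.mulLeft ℂ (e μ)) := by
        rw [Submodule.span_le]
        rintro _ ⟨j, g, hg, hg', rfl⟩
        exact Submodule.subset_span ⟨μ, j, g, hg, hg', rfl⟩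
      exact h3 h1
  exact key ⟨f, hf⟩

end Holonomic

/-! ### Solutions in adapted coordinates -/

/-- Coordinates `ν = κ η + ℓ (exp η)` and `ζ = ξ + ε ν` on the cover of a punctured polydisc, where
`(ξ, η)` are the logarithms of the standard coordinates `(x, y)`. The function
`exp ζ = x y ^ d exp (ε ℓ(y))` extends to the full polydisc, with values in the unit disc. -/
structure AdaptedCoordinates (r₁ r₂ : ℝ) where
  ε : ℤ
  κ : ℤ
  d : ℕ
  d_eq : ε * κ = d
  ℓ : ℂ → ℂ
  analytic : AnalyticOnNhd ℂ ℓ (Metric.ball 0 r₂)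
  deriv_ne_zero : ∀ y ∈ Metric.ball (0 : ℂ) r₂, y ≠ 0 → κ + y * deriv ℓ y ≠ 0
  r₁_pos : 0 < r₁
  r₂_pos : 0 < r₂
  norm_lt_one : ∀ x ∈ Metric.ball (0 : ℂ) r₁, ∀ y ∈ Metric.ball (0 : ℂ) r₂,
    ‖x * y ^ d * Complex.exp (ε * ℓ y)‖ < 1

theorem exp_mem_ball {r : ℝ} (hr : 0 < r) {t : ℂ} :
    Complex.exp t ∈ Metric.ball (0 : ℂ) r ↔ t.re < Real.log r := by
  rw [mem_ball_zero_iff, Complex.norm_exp, Real.lt_log_iff_exp_lt hr]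

namespace Holo

variable {r₁ r₂ : ℝ}

/-- The logarithm of the first coordinate. -/
def xi : Holo r₁ r₂ := restrict Prod.fst fun _ _ => analyticAt_fst

/-- The logarithm of the second coordinate. -/
def eta : Holo r₁ r₂ := restrict Prod.snd fun _ _ => analyticAt_snd

theorem xi_val {q : ℂ × ℂ} (hq : q ∈ coverDomain r₁ r₂) : (xi : Holo r₁ r₂).val q = q.1 :=
  restrict_val _ hq

theorem eta_val {q : ℂ × ℂ} (hq : q ∈ coverDomain r₁ r₂) : (eta : Holo r₁ r₂).val q = q.2 :=
  restrict_val _ hq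

theorem val_algebraMap {q : ℂ × ℂ} (hq : q ∈ coverDomain r₁ r₂) (c : ℂ) :
    (algebraMap ℂ (Holo r₁ r₂) c).val q = c := by
  rw [Algebra.algebraMap_eq_smul_one, val_smul hq, val_one hq, mul_one]

theorem pd_xi (w : ℂ × ℂ) : pd w (xi : Holo r₁ r₂) = algebraMap ℂ _ w.1 := by
  refine ext' fun q hq => ?_
  have h : (xi : Holo r₁ r₂).val =ᶠ[𝓝 q] Prod.fst := by
    filter_upwards [eventually_mem hq] with q' hq' using xi_val hq'
  rw [pd_val _ _ hq, h.fderiv_eq, fderiv_fst, val_algebraMap hq]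
  rfl

theorem pd_eta (w : ℂ × ℂ) : pd w (eta : Holo r₁ r₂) = algebraMap ℂ _ w.2 := by
  refine ext' fun q hq => ?_
  have h : (eta : Holo r₁ r₂).val =ᶠ[𝓝 q] Prod.snd := by
    filter_upwards [eventually_mem hq] with q' hq' using eta_val hq'
  rw [pd_val _ _ hq, h.fderiv_eq, fderiv_snd, val_algebraMap hq]
  rfl

theorem pd_eq (w : ℂ × ℂ) (f : Holo r₁ r₂) :
    pd w f = w.1 • pd (1, 0) f + w.2 • pd (0, 1) f := by
  refine ext' fun q hq => ?_
  rw [val_add hq, val_smul hq, val_smul hq, pd_val _ _ hq, pd_val _ _ hq, pd_val _ _ hq]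
  have : w = w.1 • ((1 : ℂ), (0 : ℂ)) + w.2 • ((0 : ℂ), (1 : ℂ)) := by ext <;> simp
  conv_lhs => rw [this]
  rw [map_add, map_smul, map_smul, smul_eq_mul, smul_eq_mul]

end Holo

namespace AdaptedCoordinates

open Holo

variable {r₁ r₂ : ℝ} (C : AdaptedCoordinates r₁ r₂)

/-- The coordinate `ν` as a function of `η`. -/
def nuFun (t : ℂ) : ℂ := C.κ * t + C.ℓ (Complex.exp t)

/-- The derivative of `nuFun`. -/
def nuDeriv (t : ℂ) : ℂ := C.κ + Complex.exp t * deriv C.ℓ (Complex.exp t)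

theorem hasDerivAt_nuFun {t : ℂ} (ht : t.re < Real.log r₂) :
    HasDerivAt C.nuFun (C.nuDeriv t) t := by
  have h1 := (C.analytic _ ((exp_mem_ball C.r₂_pos).2 ht)).differentiableAt.hasDerivAt
  have h2 := h1.comp t (Complex.hasDerivAt_exp t)
  have h3 := ((hasDerivAt_id t).const_mul (C.κ : ℂ)).add h2
  rw [mul_one, mul_comm (deriv _ _)] at h3
  exact h3

theorem analyticAt_nuFun {t : ℂ} (ht : t.re < Real.log r₂) : AnalyticAt ℂ C.nuFun t :=
  (analyticAt_const.mul analyticAt_id).add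
    ((C.analytic _ ((exp_mem_ball C.r₂_pos).2 ht)).comp analyticAt_cexp)

theorem analyticAt_nuDeriv {t : ℂ} (ht : t.re < Real.log r₂) : AnalyticAt ℂ C.nuDeriv t :=
  analyticAt_const.add (analyticAt_cexp.mul
    ((C.analytic _ ((exp_mem_ball C.r₂_pos).2 ht)).deriv.comp analyticAt_cexp))

theorem nuDeriv_ne_zero {t : ℂ} (ht : t.re < Real.log r₂) : C.nuDeriv t ≠ 0 :=
  C.deriv_ne_zero _ ((exp_mem_ball C.r₂_pos).2 ht) (Complex.exp_ne_zero t)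

theorem eta_re_lt {q : ℂ × ℂ} (hq : q ∈ coverDomain r₁ r₂) :
    ((eta : Holo r₁ r₂).val q).re < Real.log r₂ := by
  rw [eta_val hq]; exact hq.2

/-- The coordinate `ν`. -/
def nu : Holo r₁ r₂ := comp C.nuFun eta fun _ hq => C.analyticAt_nuFun (eta_re_lt hq)

/-- The inverse of the derivative of `ν` with respect to `η`. -/
def nuInv : Holo r₁ r₂ := comp (fun t => (C.nuDeriv t)⁻¹) eta fun _ hq =>
  (C.analyticAt_nuDeriv (eta_re_lt hq)).inv (C.nuDeriv_ne_zero (eta_re_lt hq))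

/-- The coordinate `ζ`. -/
def zeta : Holo r₁ r₂ := xi + (C.ε : ℂ) • C.nu

/-- The derivation `∂/∂ζ` in the coordinates `(ζ, ν)`. -/
def D : Derivation ℂ (Holo r₁ r₂) (Holo r₁ r₂) := pd (1, 0)

/-- The derivation `∂/∂ν` in the coordinates `(ζ, ν)`. -/
def E : Derivation ℂ (Holo r₁ r₂) (Holo r₁ r₂) := C.nuInv • pd (0, 1) - (C.ε : ℂ) • pd (1, 0)

theorem nu_val {q : ℂ × ℂ} (hq : q ∈ coverDomain r₁ r₂) : C.nu.val q = C.nuFun q.2 := by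
  rw [nu, comp_val _ hq, eta_val hq]

theorem zeta_val {q : ℂ × ℂ} (hq : q ∈ coverDomain r₁ r₂) :
    C.zeta.val q = q.1 + C.ε * C.nuFun q.2 := by
  rw [zeta, val_add hq, xi_val hq, val_smul hq, C.nu_val hq]

theorem pd_snd_nu : C.nuInv * pd (0, 1) C.nu = 1 := by
  refine ext' fun q hq => ?_
  rw [nu, pd_comp, pd_eta, map_one, mul_one, nuInv, val_mul hq, comp_val _ hq, comp_val _ hq,
    (C.hasDerivAt_nuFun (eta_re_lt hq)).deriv, val_one hq,
    inv_mul_cancel₀ (C.nuDeriv_ne_zero (eta_re_lt hq))]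

theorem E_apply (f : Holo r₁ r₂) : C.E f = C.nuInv * pd (0, 1) f - (C.ε : ℂ) • D f := rfl

theorem D_nu : D C.nu = 0 := by
  rw [D, nu, pd_comp, pd_eta, map_zero, mul_zero]

theorem D_nuInv : D C.nuInv = 0 := by
  rw [D, nuInv, pd_comp, pd_eta, map_zero, mul_zero]

theorem E_nu : C.E C.nu = 1 := by
  rw [E_apply, D_nu, pd_snd_nu, smul_zero, sub_zero]

theorem D_zeta : D C.zeta = 1 := by
  rw [zeta, map_add, Derivation.map_smul, D_nu, smul_zero, add_zero, D, pd_xi, map_one]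

theorem E_zeta : C.E C.zeta = 0 := by
  rw [zeta, map_add, Derivation.map_smul, E_nu, E_apply, D, pd_xi, pd_xi, map_zero, map_one]
  simp

theorem D_comm_E : Function.Commute (D : Derivation ℂ (Holo r₁ r₂) (Holo r₁ r₂)) C.E := by
  intro f
  rw [E_apply, E_apply, map_sub, Derivation.leibniz, D_nuInv, Derivation.map_smul]
  simp only [D, smul_eq_mul]
  rw [pd_comm (0, 1), mul_zero, add_zero]

theorem D_comp {g : ℂ → ℂ} {f : Holo r₁ r₂}
    (hg : ∀ q ∈ coverDomain r₁ r₂, AnalyticAt ℂ g (f.val q)) :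
    D (comp g f hg) = comp (deriv g) f (fun q hq => (hg q hq).deriv) * D f := pd_comp _ hg

theorem E_comp {g : ℂ → ℂ} {f : Holo r₁ r₂}
    (hg : ∀ q ∈ coverDomain r₁ r₂, AnalyticAt ℂ g (f.val q)) :
    C.E (comp g f hg) = comp (deriv g) f (fun q hq => (hg q hq).deriv) * C.E f := by
  rw [E_apply, E_apply, D_comp hg, pd_comp _ hg, mul_sub, mul_left_comm, mul_smul_comm]

/-- The function `exp (μ ν)`. -/
def expNu (μ : ℂ) : Holo r₁ r₂ :=
  comp (fun t => Complex.exp (μ * t)) C.nu fun _ _ => by fun_prop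

theorem D_expNu (μ : ℂ) : D (C.expNu μ) = 0 := by
  rw [expNu, D_comp, D_nu, mul_zero]

theorem E_expNu (μ : ℂ) : C.E (C.expNu μ) = μ • C.expNu μ := by
  refine ext' fun q hq => ?_
  rw [expNu, E_comp, E_nu, mul_one, val_smul hq, comp_val _ hq, comp_val _ hq]
  have := ((hasDerivAt_id (C.nu.val q)).const_mul μ).cexp.deriv
  simp only [id, mul_one] at this
  rw [this, mul_comm]

theorem expNu_mul (μ : ℂ) : C.expNu μ * C.expNu (-μ) = 1 := by
  refine ext' fun q hq => ?_
  rw [expNu, expNu, val_mul hq, comp_val _ hq, comp_val _ hq, val_one hq, ← Complex.exp_add,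
    neg_mul, add_neg_cancel, Complex.exp_zero]

/-- The function `exp ζ`. -/
def tau : Holo r₁ r₂ := comp Complex.exp C.zeta fun _ _ => analyticAt_cexp

theorem tau_val {q : ℂ × ℂ} (hq : q ∈ coverDomain r₁ r₂) :
    C.tau.val q = Complex.exp (C.zeta.val q) := comp_val _ hq

/-- The extension of `exp ζ` to the polydisc. -/
def tauFun (x y : ℂ) : ℂ := x * y ^ C.d * Complex.exp (C.ε * C.ℓ y)

theorem exp_zeta {q : ℂ × ℂ} (hq : q ∈ coverDomain r₁ r₂) :
    Complex.exp (C.zeta.val q) = C.tauFun (Complex.exp q.1) (Complex.exp q.2) := by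
  have h : (C.ε : ℂ) * C.κ = C.d := by exact_mod_cast C.d_eq
  rw [C.zeta_val hq, tauFun, nuFun, ← Complex.exp_nat_mul, ← Complex.exp_add, ← Complex.exp_add]
  congr 1
  linear_combination q.2 * h

theorem tau_mem {q : ℂ × ℂ} (hq : q ∈ coverDomain r₁ r₂) :
    C.tau.val q ∈ Metric.ball (0 : ℂ) 1 := by
  rw [C.tau_val hq, C.exp_zeta hq, mem_ball_zero_iff]
  exact C.norm_lt_one _ ((exp_mem_ball C.r₁_pos).2 hq.1) _ ((exp_mem_ball C.r₂_pos).2 hq.2)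

theorem tau_ne_zero {q : ℂ × ℂ} (hq : q ∈ coverDomain r₁ r₂) : C.tau.val q ≠ 0 := by
  rw [C.tau_val hq]; exact Complex.exp_ne_zero _

theorem E_tau : C.E C.tau = 0 := by rw [tau, E_comp, E_zeta, mul_zero]

theorem D_tau : D C.tau = C.tau := by
  rw [tau, D_comp, D_zeta, mul_one]
  congr 1
  exact Complex.deriv_exp

/-- A holomorphic function of `exp ζ`. -/
def ofTau (γ : ℂ → ℂ) (hγ : AnalyticOnNhd ℂ γ (Metric.ball 0 1)) : Holo r₁ r₂ :=
  comp γ C.tau fun _ hq => hγ _ (C.tau_mem hq)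

theorem E_ofTau {γ : ℂ → ℂ} (hγ : AnalyticOnNhd ℂ γ (Metric.ball 0 1)) :
    C.E (C.ofTau γ hγ) = 0 := by
  rw [ofTau, E_comp, E_tau, mul_zero]

theorem ofTau_val {γ : ℂ → ℂ} (hγ : AnalyticOnNhd ℂ γ (Metric.ball 0 1)) {q : ℂ × ℂ}
    (hq : q ∈ coverDomain r₁ r₂) :
    (C.ofTau γ hγ).val q = γ (Complex.exp (C.zeta.val q)) := by
  rw [ofTau, comp_val _ hq, C.tau_val hq]

/-- The directional derivatives are combinations of `D` and `E`. -/
theorem pd_mem {I : Ideal (Holo r₁ r₂)} (hD : ∀ f ∈ I, D f ∈ I) (hE : ∀ f ∈ I, C.E f ∈ I)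
    (w : ℂ × ℂ) {f : Holo r₁ r₂} (hf : f ∈ I) : pd w f ∈ I := by
  have h1 : pd (0, 1) f = pd (0, 1) C.nu * (C.E f + (C.ε : ℂ) • D f) := by
    rw [E_apply, sub_add_cancel, ← mul_assoc, mul_comm (pd (0, 1) C.nu), pd_snd_nu, one_mul]
  rw [pd_eq, h1]
  exact I.add_mem (smul_mem_ideal _ _ (hD f hf)) (smul_mem_ideal _ _ (I.mul_mem_left _
    (I.add_mem (hE f hf) (smul_mem_ideal _ _ (hD f hf)))))

variable {m n : ℕ} (p : Fin m → Holo r₁ r₂) (α β : Holo r₁ r₂) (c : Fin n → Holo r₁ r₂)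

theorem fallingIter_add {R : Type*} [CommRing R] [Algebra ℂ R] (X : Derivation ℂ R R) (j : ℕ)
    (f g : R) : fallingIter X j (f + g) = fallingIter X j f + fallingIter X j g := by
  induction j with
  | zero => rfl
  | succ j ih => rw [fallingIter, ih, map_add, smul_add, fallingIter, fallingIter]; ring

theorem fallingIter_smul {R : Type*} [CommRing R] [Algebra ℂ R] (X : Derivation ℂ R R) (j : ℕ)
    (a : ℂ) (f : R) : fallingIter X j (a • f) = a • fallingIter X j f := by
  induction j with
  | zero => rfl
  | succ j ih => rw [fallingIter, ih, Derivation.map_smul, smul_comm, ← smul_sub, fallingIter]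

theorem fallingIter_comm {R : Type*} [CommRing R] [Algebra ℂ R] {X Y : Derivation ℂ R R}
    (h : ∀ f, Y (X f) = X (Y f)) (j : ℕ) (f : R) :
    fallingIter X j (Y f) = Y (fallingIter X j f) := by
  induction j with
  | zero => rfl
  | succ j ih => rw [fallingIter, ih, fallingIter, map_sub, Derivation.map_smul, h]

/-- The common solutions of an equation in `D` and an equation in `α E + β D`. -/
def solutions : Submodule ℂ (Holo r₁ r₂) where
  carrier := {f | differentialOperator D p f = 0 ∧ fallingIter (α • C.E + β • D) n f
      + ∑ k, c k * fallingIter (α • C.E + β • D) (n - 1 - k) f = 0}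
  add_mem' := by
    rintro f g ⟨h₁, h₂⟩ ⟨h₃, h₄⟩
    refine ⟨by rw [map_add, h₁, h₃, add_zero], ?_⟩
    simp only [fallingIter_add, mul_add, Finset.sum_add_distrib]
    linear_combination h₂ + h₄
  zero_mem' := by
    have h : ∀ j, fallingIter (α • C.E + β • D) j 0 = 0 := fun j => by
      have := fallingIter_smul (α • C.E + β • D) j 0 0
      rwa [zero_smul, zero_smul] at this
    refine ⟨map_zero _, ?_⟩
    simp [h]
  smul_mem' := by
    rintro a f ⟨h₁, h₂⟩
    refine ⟨by rw [map_smul, h₁, smul_zero], ?_⟩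
    simp only [fallingIter_smul, mul_smul_comm]
    rw [← Finset.smul_sum, ← smul_add, h₂, smul_zero]

variable {p α β c}

theorem E_mem_solutions (hp : ∀ i, C.E (p i) = 0) (hα : C.E α = 0) (hβ : C.E β = 0)
    (hc : ∀ k, C.E (c k) = 0) {f : Holo r₁ r₂} (hf : f ∈ C.solutions p α β c) :
    C.E f ∈ C.solutions p α β c := by
  set X : Derivation ℂ (Holo r₁ r₂) (Holo r₁ r₂) := α • C.E + β • D with hXdef
  have hX : ∀ f, C.E (X f) = X (C.E f) := by
    intro f
    have h : ∀ f, X f = α * C.E f + β * D f := fun f => rfl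
    rw [h, h, map_add, Derivation.leibniz, Derivation.leibniz, hα, hβ, C.D_comm_E f]
    simp
  refine ⟨by rw [differentialOperator_comm C.D_comm_E hp, hf.1, map_zero], ?_⟩
  have h2 : fallingIter X n f + ∑ k, c k * fallingIter X (n - 1 - k) f = 0 := hf.2
  have := congrArg C.E h2
  simp only [map_add, map_sum, Derivation.leibniz, hc, smul_eq_mul, mul_zero,
    add_zero, map_zero] at this
  simp only [← fallingIter_comm hX] at this
  exact this

/-- A solution is determined by finitely many derivatives at one point: if they vanish there, so do
all elements of the jet ideal, which is stable under differentiation, and the identity theorem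
applies. -/
theorem finiteDimensional_solutions (hm : 0 < m) (hn : 0 < n) (hα : IsUnit α) :
    FiniteDimensional ℂ (C.solutions p α β c) := by
  let q₀ : ℂ × ℂ := ((Real.log r₁ - 1 : ℝ), (Real.log r₂ - 1 : ℝ))
  have hq₀ : q₀ ∈ coverDomain r₁ r₂ := by
    constructor <;> simp [q₀]
  let ev : C.solutions p α β c →ₗ[ℂ] (Fin n × Fin m → ℂ) :=
    { toFun := fun f k => eval ⟨q₀, hq₀⟩ (C.E^[k.1] (D^[k.2] f.1))
      map_add' := fun f g => by
        ext k
        simp only [Submodule.coe_add, iterate_map_add, map_add, Pi.add_apply]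
      map_smul' := fun a f => by
        ext k
        simp only [SetLike.val_smul, derivation_iterate_smul, map_smul, Pi.smul_apply,
          RingHom.id_apply] }
  refine FiniteDimensional.of_injective ev ((injective_iff_map_eq_zero ev).2 fun f hf => ?_)
  obtain ⟨f, hf₁, hf₂⟩ := f
  set I := jetIdeal D C.E f m n
  have hD1 : D^[m] f ∈ jetIdeal D C.E f m 1 := by
    rw [differentialOperator_apply, sub_eq_zero] at hf₁
    rw [hf₁]
    exact Ideal.sum_mem _ fun i _ => Ideal.mul_mem_left _ _ (mem_jetIdeal (j := 0) one_pos i.2)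
  have hID : ∀ g ∈ I, D g ∈ I := fun g hg => apply_mem_jetIdeal C.D_comm_E hD1 hg
  have hIE : ∀ g ∈ I, C.E g ∈ I := fun g hg =>
    apply_mem_jetIdeal_of_fallingIter C.D_comm_E hD1 hm hα hf₂ hg
  have hfI : f ∈ I := mem_jetIdeal (j := 0) (i := 0) hn hm
  have hev : I ≤ RingHom.ker (eval ⟨q₀, hq₀⟩) := by
    refine Ideal.span_le.2 ?_
    rintro _ ⟨j, hj, i, hi, rfl⟩
    exact congrFun hf (⟨j, hj⟩, ⟨i, hi⟩)
  refine Subtype.ext (eq_zero_of_iterate_pd hq₀ fun w k => ?_)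
  have hk : (pd w)^[k] f ∈ I := by
    induction k with
    | zero => exact hfI
    | succ k ih =>
      rw [Function.iterate_succ_apply']
      exact C.pd_mem hID hIE w ih
  have := hev hk
  rwa [RingHom.mem_ker, eval_eq_val] at this

/-- A solution of an equation in `D` and an equation in `α E + β D`, with coefficients killed by
`E`, is a sum of terms `exp (μ ν) ν ^ j g` with `g` killed by `E` and by the first equation. -/
theorem solution_mem_span (hm : 0 < m) (hn : 0 < n) (hα : IsUnit α)
    (hEp : ∀ i, C.E (p i) = 0) (hEα : C.E α = 0) (hEβ : C.E β = 0)
    (hEc : ∀ k, C.E (c k) = 0) {f : Holo r₁ r₂} (hf : f ∈ C.solutions p α β c) :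
    f ∈ Submodule.span ℂ {x | ∃ (μ : ℂ) (j : ℕ) (g : Holo r₁ r₂), C.E g = 0 ∧
      differentialOperator D p g = 0 ∧ x = C.expNu μ * (C.nu ^ j * g)} := by
  have := C.finiteDimensional_solutions (p := p) (α := α) (β := β) (c := c) hm hn hα
  refine mem_span_of_finiteDimensional (V := C.solutions p α β c)
    (fun f hf => C.E_mem_solutions hEp hEα hEβ hEc hf) (fun f hf => hf.1) C.E_nu
    (fun j f => differentialOperator_mul ?_ f) (differentialOperator_comm C.D_comm_E hEp)
    C.E_expNu C.expNu_mul (fun μ f => differentialOperator_mul (C.D_expNu μ) f) hf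
  rw [Derivation.leibniz_pow, C.D_nu]
  simp

end AdaptedCoordinates

/-! ### Descent to functions of one variable -/

namespace AdaptedCoordinates

open Holo

variable {r₁ r₂ : ℝ} (C : AdaptedCoordinates r₁ r₂)

theorem fderiv_eq_zero_of_E_eq_zero {g : Holo r₁ r₂} (hg : C.E g = 0) {q : ℂ × ℂ}
    (hq : q ∈ coverDomain r₁ r₂) (s : ℂ) :
    fderiv ℂ g.val q (-(C.ε * (C.nuDeriv q.2 * s)), s) = 0 := by
  have h2 : pd (0, 1) g = pd (0, 1) C.nu * ((C.ε : ℂ) • D g) := by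
    rw [E_apply, sub_eq_zero] at hg
    rw [← hg, ← mul_assoc, mul_comm (pd (0, 1) C.nu), pd_snd_nu, one_mul]
  have h3 : (pd (0, 1) C.nu).val q = C.nuDeriv q.2 := by
    rw [nu, pd_comp, pd_eta, map_one, mul_one, comp_val _ hq, eta_val hq,
      (C.hasDerivAt_nuFun hq.2).deriv]
  rw [← pd_val _ _ hq, pd_eq, h2, val_add hq, val_smul hq, val_smul hq, val_mul hq, val_smul hq, h3,
    D]
  ring

/-- The point over `t` in the fibre of `ζ`. -/
def fibrePoint (ζ t : ℂ) : ℂ × ℂ := (ζ - C.ε * C.nuFun t, t)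

theorem fibrePoint_mem {ζ t : ℂ} :
    C.fibrePoint ζ t ∈ coverDomain r₁ r₂ ↔
      ζ.re < Real.log r₁ + (C.ε * C.nuFun t).re ∧ t.re < Real.log r₂ := by
  simp only [fibrePoint, coverDomain, Set.mem_ofPred_eq, Complex.sub_re]
  constructor <;> rintro ⟨h₁, h₂⟩ <;> exact ⟨by linarith, h₂⟩

theorem zeta_fibrePoint {ζ t : ℂ} (h : C.fibrePoint ζ t ∈ coverDomain r₁ r₂) :
    C.zeta.val (C.fibrePoint ζ t) = ζ := by
  rw [C.zeta_val h, fibrePoint]; ring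

theorem fibrePoint_zeta {q : ℂ × ℂ} (hq : q ∈ coverDomain r₁ r₂) :
    C.fibrePoint (C.zeta.val q) q.2 = q := by
  rw [C.zeta_val hq, fibrePoint]
  ext <;> simp

theorem hasDerivAt_fibrePoint {h : Holo r₁ r₂} {ζ t : ℂ}
    (hq : C.fibrePoint ζ t ∈ coverDomain r₁ r₂) :
    HasDerivAt (fun z => h.val (C.fibrePoint z t)) ((D h).val (C.fibrePoint ζ t)) ζ := by
  have h1 : HasDerivAt (fun z => C.fibrePoint z t) ((1 : ℂ), (0 : ℂ)) ζ :=
    ((hasDerivAt_id ζ).sub_const _).prodMk (hasDerivAt_const ζ t)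
  rw [D, pd_val _ _ hq]
  exact (h.analyticAt hq).differentiableAt.hasFDerivAt.comp_hasDerivAt ζ h1

theorem analyticAt_fibrePoint {h : Holo r₁ r₂} {ζ t : ℂ}
    (hq : C.fibrePoint ζ t ∈ coverDomain r₁ r₂) :
    AnalyticAt ℂ (fun z => h.val (C.fibrePoint z t)) ζ := by
  have h1 : AnalyticAt ℂ (fun z => C.fibrePoint z t) ζ :=
    (analyticAt_id.sub analyticAt_const).prod analyticAt_const
  exact AnalyticAt.comp (f := fun z => C.fibrePoint z t) (h.analyticAt hq) h1

/-- A function killed by `E` is constant along a segment of a fibre of `ζ`. -/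
theorem eq_of_segment_subset {g : Holo r₁ r₂} (hg : C.E g = 0) {ζ t₀ t₁ : ℂ}
    (h : ∀ t ∈ segment ℝ t₀ t₁, C.fibrePoint ζ t ∈ coverDomain r₁ r₂) :
    g.val (C.fibrePoint ζ t₁) = g.val (C.fibrePoint ζ t₀) := by
  let p : ℝ → ℂ := fun s => t₀ + s * (t₁ - t₀)
  have hp : ∀ s ∈ Set.Icc (0 : ℝ) 1, C.fibrePoint ζ (p s) ∈ coverDomain r₁ r₂ := by
    intro s hs
    refine h _ ?_
    rw [segment_eq_image']
    exact ⟨s, hs, by simp [p]⟩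
  have hdp : ∀ s, HasDerivAt p (t₁ - t₀) s := by
    intro s
    have h1 : HasDerivAt (fun s : ℝ => (s : ℂ)) 1 s := Complex.ofRealCLM.hasDerivAt
    have h2 := (h1.mul_const (t₁ - t₀)).const_add t₀
    rw [one_mul] at h2
    exact h2
  have hd : ∀ s ∈ Set.Icc (0 : ℝ) 1, HasDerivAt (fun s => g.val (C.fibrePoint ζ (p s))) 0 s := by
    intro s hs
    have hq := hp s hs
    have h1 : HasDerivAt (fun s => C.nuFun (p s)) (C.nuDeriv (p s) * (t₁ - t₀)) s :=
      (C.hasDerivAt_nuFun (t := p s) hq.2).comp s (hdp s)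
    have h2 : HasDerivAt (fun s => C.fibrePoint ζ (p s))
        (-(C.ε * (C.nuDeriv (p s) * (t₁ - t₀))), t₁ - t₀) s :=
      ((h1.const_mul (C.ε : ℂ)).const_sub ζ).prodMk (hdp s)
    have h3 := ((g.analyticAt hq).differentiableAt.hasFDerivAt.restrictScalars ℝ).comp_hasDerivAt
      s h2
    have h4 := C.fderiv_eq_zero_of_E_eq_zero hg hq (t₁ - t₀)
    simp only [ContinuousLinearMap.coe_restrictScalars'] at h3
    rw [show (C.fibrePoint ζ (p s)).2 = p s from rfl] at h4
    rw [h4] at h3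
    exact h3
  have := constant_of_has_deriv_right_zero
    (fun s hs => (hd s hs).continuousAt.continuousWithinAt)
    (fun s hs => (hd s (Set.Ico_subset_Icc_self hs)).hasDerivWithinAt) 1 (by simp)
  simpa [p] using this

/-- A function killed by `E` only depends on the coordinate `ζ`. Along a segment in the `η`-plane
this is clear if `re ζ` is sufficiently small, and the identity theorem gives the general case. -/
theorem eq_of_zeta_eq {g : Holo r₁ r₂} (hg : C.E g = 0) {q q' : ℂ × ℂ}
    (hq : q ∈ coverDomain r₁ r₂) (hq' : q' ∈ coverDomain r₁ r₂)
    (h : C.zeta.val q = C.zeta.val q') : g.val q = g.val q' := by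
  have hseg : ∀ t ∈ segment ℝ q.2 q'.2, t.re < Real.log r₂ := fun t ht =>
    (convex_halfSpace_re_lt (Real.log r₂)).segment_subset hq.2 hq'.2 ht
  set b : ℝ := min (Real.log r₁ + (C.ε * C.nuFun q.2).re) (Real.log r₁ + (C.ε * C.nuFun q'.2).re)
  have hU₁ : ∀ z : ℂ, z.re < b → C.fibrePoint z q.2 ∈ coverDomain r₁ r₂ := fun z hz =>
    C.fibrePoint_mem.2 ⟨hz.trans_le (min_le_left _ _), hq.2⟩
  have hU₂ : ∀ z : ℂ, z.re < b → C.fibrePoint z q'.2 ∈ coverDomain r₁ r₂ := fun z hz =>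
    C.fibrePoint_mem.2 ⟨hz.trans_le (min_le_right _ _), hq'.2⟩
  have hcont : ContinuousOn (fun t => (C.ε * C.nuFun t).re) (segment ℝ q.2 q'.2) := fun t ht =>
    (Complex.continuous_re.continuousAt.comp
      (continuousAt_const.mul (C.hasDerivAt_nuFun (hseg t ht)).continuousAt)).continuousWithinAt
  have hcomp : IsCompact (segment ℝ q.2 q'.2) := by
    rw [segment_eq_image']
    exact isCompact_Icc.image (by fun_prop)
  obtain ⟨B, hB⟩ := hcomp.exists_bound_of_continuousOn hcont
  have hsmall : ∀ z : ℂ, z.re < Real.log r₁ - B →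
      g.val (C.fibrePoint z q.2) = g.val (C.fibrePoint z q'.2) := by
    intro z hz
    refine (C.eq_of_segment_subset hg fun t ht => C.fibrePoint_mem.2 ⟨?_, hseg t ht⟩).symm
    have := neg_le_of_abs_le (hB t ht)
    linarith
  have hz : (C.zeta.val q).re < b := by
    refine lt_min ?_ ?_
    · exact (C.fibrePoint_mem.1 (by rwa [C.fibrePoint_zeta hq])).1
    · rw [h]
      exact (C.fibrePoint_mem.1 (by rwa [C.fibrePoint_zeta hq'])).1
  set z₀ : ℂ := ((min b (Real.log r₁ - B) - 1 : ℝ) : ℂ)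
  have hz₀ : z₀.re < min b (Real.log r₁ - B) := by
    rw [Complex.ofReal_re]
    linarith
  have hopen : IsOpen {z : ℂ | z.re < Real.log r₁ - B} :=
    isOpen_lt Complex.continuous_re continuous_const
  have key := AnalyticOnNhd.eqOn_of_preconnected_of_eventuallyEq (U := {z : ℂ | z.re < b})
    (fun z hz => C.analyticAt_fibrePoint (h := g) (hU₁ z hz))
    (fun z hz => C.analyticAt_fibrePoint (h := g) (hU₂ z hz))
    (convex_halfSpace_re_lt b).isPreconnected (z₀ := z₀) (hz₀.trans_le (min_le_left _ _))
    (by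
      filter_upwards [hopen.mem_nhds (hz₀.trans_le (min_le_right _ _))] with z hz
      exact hsmall z hz)
  have := key hz
  simp only at this
  rwa [C.fibrePoint_zeta hq, h, C.fibrePoint_zeta hq'] at this

/-- The values of `ζ` are the numbers with real part less than `zetaBound`. -/
def zetaBound : ℝ :=
  sSup {b | ∃ t : ℂ, t.re < Real.log r₂ ∧ b = Real.log r₁ + (C.ε * C.nuFun t).re}

theorem zeta_re_neg {q : ℂ × ℂ} (hq : q ∈ coverDomain r₁ r₂) : (C.zeta.val q).re < 0 := by
  have := C.tau_mem hq
  rwa [C.tau_val hq, exp_mem_ball one_pos, Real.log_one] at this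

theorem fibre_bound_nonpos {t : ℂ} (ht : t.re < Real.log r₂) :
    Real.log r₁ + (C.ε * C.nuFun t).re ≤ 0 := by
  refine le_of_forall_lt fun b hb => ?_
  have hq : C.fibrePoint (b : ℂ) t ∈ coverDomain r₁ r₂ := C.fibrePoint_mem.2 ⟨by simpa using hb, ht⟩
  simpa [C.zeta_fibrePoint hq] using C.zeta_re_neg hq

theorem bddAbove_zeta :
    BddAbove {b | ∃ t : ℂ, t.re < Real.log r₂ ∧ b = Real.log r₁ + (C.ε * C.nuFun t).re} :=
  ⟨0, by rintro _ ⟨t, ht, rfl⟩; exact C.fibre_bound_nonpos ht⟩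

theorem zeta_re_lt {q : ℂ × ℂ} (hq : q ∈ coverDomain r₁ r₂) :
    (C.zeta.val q).re < C.zetaBound := by
  have h1 := (C.fibrePoint_mem.1 (by rwa [C.fibrePoint_zeta hq])).1
  exact h1.trans_le (le_csSup C.bddAbove_zeta ⟨q.2, hq.2, rfl⟩)

theorem exists_zeta_eq {ζ : ℂ} (hζ : ζ.re < C.zetaBound) :
    ∃ q ∈ coverDomain r₁ r₂, C.zeta.val q = ζ := by
  obtain ⟨_, ⟨t, ht, rfl⟩, h⟩ := exists_lt_of_lt_csSup
    (by exact ⟨_, ((Real.log r₂ - 1 : ℝ) : ℂ), by simp, rfl⟩) hζ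
  have hq : C.fibrePoint ζ t ∈ coverDomain r₁ r₂ := C.fibrePoint_mem.2 ⟨h, ht⟩
  exact ⟨_, hq, C.zeta_fibrePoint hq⟩

open Classical in
/-- A point of the cover with given value of `ζ`. -/
def zetaLift (ζ : ℂ) : ℂ × ℂ :=
  if h : ζ.re < C.zetaBound then (C.exists_zeta_eq h).choose else 0

theorem zetaLift_mem {ζ : ℂ} (h : ζ.re < C.zetaBound) : C.zetaLift ζ ∈ coverDomain r₁ r₂ := by
  rw [zetaLift, dif_pos h]; exact (C.exists_zeta_eq h).choose_spec.1

theorem zeta_zetaLift {ζ : ℂ} (h : ζ.re < C.zetaBound) : C.zeta.val (C.zetaLift ζ) = ζ := by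
  rw [zetaLift, dif_pos h]; exact (C.exists_zeta_eq h).choose_spec.2

theorem hasDerivAt_zetaLift {h : Holo r₁ r₂} (hE : C.E h = 0) {ζ : ℂ}
    (hζ : ζ.re < C.zetaBound) :
    HasDerivAt (fun z => h.val (C.zetaLift z)) ((D h).val (C.zetaLift ζ)) ζ := by
  have hq := C.zetaLift_mem hζ
  have hf : C.fibrePoint ζ (C.zetaLift ζ).2 = C.zetaLift ζ := by
    conv_lhs => rw [← C.zeta_zetaLift hζ]
    rw [C.zeta_zetaLift hζ]
    have := C.fibrePoint_zeta hq
    rwa [C.zeta_zetaLift hζ] at this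
  have h1 := C.hasDerivAt_fibrePoint (h := h) (ζ := ζ) (t := (C.zetaLift ζ).2) (by rwa [hf])
  rw [hf] at h1
  refine h1.congr_of_eventuallyEq ?_
  have hopen : IsOpen {z : ℂ | z.re < C.zetaBound} :=
    isOpen_lt Complex.continuous_re continuous_const
  have hc : ContinuousAt (fun z => C.fibrePoint z (C.zetaLift ζ).2) ζ := by
    unfold fibrePoint; fun_prop
  filter_upwards [hopen.mem_nhds hζ,
    hc.preimage_mem_nhds ((isOpen_coverDomain r₁ r₂).mem_nhds (by rwa [hf]))] with z hz hz'
  exact C.eq_of_zeta_eq hE (C.zetaLift_mem hz) hz'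
    (by rw [C.zeta_zetaLift hz, C.zeta_fibrePoint hz'])

/-- Functions killed by `E` that satisfy a differential equation in `D` with coefficients
holomorphic in `exp ζ` are of the form described in `logForms`, by Fuchs' theorem. -/
theorem exists_logForm {m : ℕ} (hm : 0 < m) {γ : Fin m → ℂ → ℂ}
    (hγ : ∀ i, AnalyticOnNhd ℂ (γ i) (Metric.ball 0 1)) {g : Holo r₁ r₂} (hE : C.E g = 0)
    (hg : differentialOperator D (fun i => C.ofTau (γ i) (hγ i)) g = 0) :
    ∃ φ ∈ logForms C.zetaBound, ∀ q ∈ coverDomain r₁ r₂, g.val q = φ (C.zeta.val q) := by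
  have hEi : ∀ i : ℕ, C.E (D^[i] g) = 0 := by
    intro i
    rw [← (C.D_comm_E.iterate_left i).eq g, hE]
    exact iterate_map_zero D i
  let F : Fin m → ℂ → ℂ := fun i ζ => (D^[i] g).val (C.zetaLift ζ)
  let a : Fin m → Fin m → ℂ → ℂ := fun i j q =>
    if (i : ℕ) + 1 < m then (if (j : ℕ) = i + 1 then 1 else 0) else γ j q
  have hbound : C.zetaBound ≤ 0 := by
    refine csSup_le ⟨_, ((Real.log r₂ - 1 : ℝ) : ℂ), by simp, rfl⟩ fun b hb => ?_
    obtain ⟨t, ht, rfl⟩ := hb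
    exact C.fibre_bound_nonpos ht
  have hsub : Metric.ball (0 : ℂ) (Real.exp C.zetaBound) ⊆ Metric.ball 0 1 :=
    Metric.ball_subset_ball (by simpa using hbound)
  have ha : ∀ i j, ContinuousOn (a i j) (Metric.ball 0 (Real.exp C.zetaBound)) := by
    intro i j
    simp only [a]
    split_ifs
    · exact continuousOn_const
    · exact continuousOn_const
    · exact ((hγ j).continuousOn).mono hsub
  have hF : ∀ ζ : ℂ, ζ.re < C.zetaBound → ∀ i,
      HasDerivAt (F i) (∑ j, a i j (Complex.exp ζ) * F j ζ) ζ := by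
    intro ζ hζ i
    have hq := C.zetaLift_mem hζ
    have h1 := C.hasDerivAt_zetaLift (hEi i) hζ
    rw [← Function.iterate_succ_apply' (f := D)] at h1
    convert h1 using 1
    by_cases hi : (i : ℕ) + 1 < m
    · rw [Finset.sum_eq_single (⟨i + 1, hi⟩ : Fin m)]
      · simp [a, hi, F]
      · intro j _ hj
        have : (j : ℕ) ≠ i + 1 := fun h => hj (Fin.ext h)
        simp [a, hi, this]
      · simp
    · have hi' : (i : ℕ) + 1 = m := by omega
      rw [differentialOperator_apply, sub_eq_zero] at hg
      rw [Nat.succ_eq_add_one, hi', hg, val_sum hq]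
      refine Finset.sum_congr rfl fun j _ => ?_
      rw [val_mul hq, C.ofTau_val (hγ j) hq, C.zeta_zetaLift hζ]
      simp [a, hi, F]
  refine ⟨F ⟨0, hm⟩, linear_system_mem_logForms ha hF _, fun q hq => ?_⟩
  have hz := C.zeta_re_lt hq
  exact C.eq_of_zeta_eq hE hq (C.zetaLift_mem hz) (C.zeta_zetaLift hz).symm

end AdaptedCoordinates

/-! ### Regular forms -/

/-- The functions `x ^ s y ^ t (log x) ^ j (log y) ^ k f(x, y)` on the cover. -/
def regularMonomials (r₁ r₂ : ℝ) : Submonoid (ℂ × ℂ → ℂ) where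
  carrier := {Φ | ∃ (s t : ℂ) (j k : ℕ) (f : ℂ × ℂ → ℂ),
    AnalyticOnNhd ℂ f (Metric.ball 0 r₁ ×ˢ Metric.ball 0 r₂) ∧
    ∀ q ∈ coverDomain r₁ r₂, Φ q = Complex.exp (s * q.1) * Complex.exp (t * q.2) * q.1 ^ j * q.2 ^ k
      * f (Complex.exp q.1, Complex.exp q.2)}
  mul_mem' := by
    rintro Φ Ψ ⟨s, t, j, k, f, hf, h⟩ ⟨s', t', j', k', f', hf', h'⟩
    refine ⟨s + s', t + t', j + j', k + k', f * f', hf.mul hf', fun q hq => ?_⟩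
    simp only [Pi.mul_apply, h q hq, h' q hq, add_mul, Complex.exp_add, pow_add]
    ring
  one_mem' := ⟨0, 0, 0, 0, 1, analyticOnNhd_const, fun q _ => by simp⟩

/-- The algebra of finite sums of regular monomials. -/
def regularForms (r₁ r₂ : ℝ) : Subalgebra ℂ (ℂ × ℂ → ℂ) := Algebra.adjoin ℂ (regularMonomials r₁ r₂)

/-- A common bound on the powers of logarithms puts a combination of monomials in the form required
by `HasRegularForm`. -/
theorem hasRegularForm_of_mem {r₁ r₂ : ℝ} {Φ Ψ : ℂ × ℂ → ℂ} (h : Ψ ∈ regularForms r₁ r₂)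
    (hΦ : ∀ q ∈ coverDomain r₁ r₂, Φ q = Ψ q) : HasRegularForm r₁ r₂ Φ := by
  have h1 : Ψ ∈ Submodule.span ℂ (regularMonomials r₁ r₂ : Set (ℂ × ℂ → ℂ)) := by
    have h2 : Ψ ∈ Subalgebra.toSubmodule (regularForms r₁ r₂) := h
    rwa [regularForms, Algebra.adjoin_eq_span, Submonoid.closure_eq] at h2
  obtain ⟨n, c, g, rfl⟩ := Submodule.mem_span_set'.1 h1
  choose s t j k f hf hg using fun i => (g i).2
  set M := ∑ i, (j i + k i) + 1 with hM
  have hle : ∀ i, j i + k i ≤ ∑ i, (j i + k i) := fun i =>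
    Finset.single_le_sum (f := fun i => j i + k i) (fun _ _ => Nat.zero_le _) (Finset.mem_univ i)
  have hj : ∀ i, j i < M := fun i => by have := hle i; omega
  have hk : ∀ i, k i < M := fun i => by have := hle i; omega
  refine ⟨n, M, s, t, fun i a b z => if (a : ℕ) = j i ∧ (b : ℕ) = k i then c i * f i z else 0,
    fun i a b => ?_, fun q hq => ?_⟩
  · by_cases hab : (a : ℕ) = j i ∧ (b : ℕ) = k i
    · simp only [hab, and_self, if_true]
      exact analyticOnNhd_const.mul (hf i)
    · simp only [hab, if_false]
      exact analyticOnNhd_const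
  · rw [hΦ q hq, Finset.sum_apply]
    refine Finset.sum_congr rfl fun i _ => ?_
    rw [Finset.sum_eq_single (⟨j i, hj i⟩ : Fin M), Finset.sum_eq_single (⟨k i, hk i⟩ : Fin M)]
    · simp only [Pi.smul_apply, hg i q hq, smul_eq_mul, and_self, if_true]
      ring
    · intro b _ hb
      have : (b : ℕ) ≠ k i := fun h => hb (Fin.ext h)
      simp [this]
    · simp
    · intro a _ ha
      have : (a : ℕ) ≠ j i := fun h => ha (Fin.ext h)
      simp [this]
    · simp

namespace AdaptedCoordinates

variable {r₁ r₂ : ℝ} (C : AdaptedCoordinates r₁ r₂)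

theorem mem_regularForms {Φ : ℂ × ℂ → ℂ} (h : Φ ∈ regularMonomials r₁ r₂) :
    Φ ∈ regularForms r₁ r₂ := Algebra.subset_adjoin h

theorem analyticOnNhd_comp_snd {f : ℂ → ℂ} (hf : AnalyticOnNhd ℂ f (Metric.ball 0 r₂)) :
    AnalyticOnNhd ℂ (fun z : ℂ × ℂ => f z.2) (Metric.ball 0 r₁ ×ˢ Metric.ball 0 r₂) :=
  fun z hz => (hf z.2 hz.2).comp analyticAt_snd

theorem nuFun_mem_regularForms : (fun q : ℂ × ℂ => C.nuFun q.2) ∈ regularForms r₁ r₂ := by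
  have h1 : (fun q : ℂ × ℂ => q.2) ∈ regularForms r₁ r₂ :=
    mem_regularForms ⟨0, 0, 0, 1, 1, analyticOnNhd_const, fun q _ => by simp⟩
  have h2 : (fun q : ℂ × ℂ => C.ℓ (Complex.exp q.2)) ∈ regularForms r₁ r₂ :=
    mem_regularForms ⟨0, 0, 0, 0, fun z => C.ℓ z.2, analyticOnNhd_comp_snd C.analytic,
      fun q _ => by simp⟩
  exact add_mem (Subalgebra.smul_mem _ h1 (C.κ : ℂ)) h2

theorem exp_nuFun_mem_regularForms (μ : ℂ) :
    (fun q : ℂ × ℂ => Complex.exp (μ * C.nuFun q.2)) ∈ regularForms r₁ r₂ := by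
  refine mem_regularForms ⟨0, μ * C.κ, 0, 0, fun z => Complex.exp (μ * C.ℓ z.2),
    analyticOnNhd_comp_snd (f := fun y => Complex.exp (μ * C.ℓ y)) fun y hy =>
      (analyticAt_const.mul (C.analytic y hy)).cexp, fun q _ => ?_⟩
  simp only [zero_mul, Complex.exp_zero, one_mul, pow_zero, mul_one, ← Complex.exp_add]
  congr 1
  rw [nuFun]
  ring

/-- The coordinate `ζ` on all of `ℂ × ℂ`. -/
def zetaFun (q : ℂ × ℂ) : ℂ := q.1 + C.ε * C.nuFun q.2

theorem zetaFun_mem_regularForms : C.zetaFun ∈ regularForms r₁ r₂ := by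
  have h1 : (fun q : ℂ × ℂ => q.1) ∈ regularForms r₁ r₂ :=
    mem_regularForms ⟨0, 0, 1, 0, 1, analyticOnNhd_const, fun q _ => by simp⟩
  exact add_mem h1 (Subalgebra.smul_mem _ C.nuFun_mem_regularForms (C.ε : ℂ))

theorem exp_zetaFun_mem_regularForms (s : ℂ) :
    (fun q => Complex.exp (s * C.zetaFun q)) ∈ regularForms r₁ r₂ := by
  have h1 : (fun q : ℂ × ℂ => Complex.exp (s * q.1)) ∈ regularForms r₁ r₂ :=
    mem_regularForms ⟨s, 0, 0, 0, 1, analyticOnNhd_const, fun q _ => by simp⟩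
  convert mul_mem h1 (C.exp_nuFun_mem_regularForms (s * C.ε)) using 1
  ext q
  rw [Pi.mul_apply, ← Complex.exp_add, zetaFun]
  congr 1
  ring

theorem analyticAt_tauFun {z : ℂ × ℂ} (hz : z ∈ Metric.ball (0 : ℂ) r₁ ×ˢ Metric.ball (0 : ℂ) r₂) :
    AnalyticAt ℂ (fun z : ℂ × ℂ => C.tauFun z.1 z.2) z :=
  (analyticAt_fst.mul (analyticAt_snd.pow _)).mul
    (analyticAt_const.mul ((C.analytic z.2 hz.2).comp analyticAt_snd)).cexp

/-- The sharp bound for `exp ζ` also holds where one of the coordinates `x` and `y` vanishes. -/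
theorem norm_tauFun_lt {x y : ℂ} (hx : x ∈ Metric.ball (0 : ℂ) r₁) (hy : y ∈ Metric.ball (0 : ℂ) r₂) :
    ‖C.tauFun x y‖ < Real.exp C.zetaBound := by
  have key : ∀ x y : ℂ, x ∈ Metric.ball (0 : ℂ) r₁ → y ∈ Metric.ball (0 : ℂ) r₂ → x ≠ 0 → y ≠ 0 →
      ‖C.tauFun x y‖ < Real.exp C.zetaBound := by
    intro x y hx hy hx0 hy0
    have hq : (Complex.log x, Complex.log y) ∈ coverDomain r₁ r₂ := by
      refine ⟨(exp_mem_ball C.r₁_pos).1 ?_, (exp_mem_ball C.r₂_pos).1 ?_⟩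
      · rwa [Complex.exp_log hx0]
      · rwa [Complex.exp_log hy0]
    have h1 := C.exp_zeta hq
    simp only [Complex.exp_log hx0, Complex.exp_log hy0] at h1
    rw [← h1, Complex.norm_exp, Real.exp_lt_exp]
    exact C.zeta_re_lt hq
  by_cases hx0 : x = 0
  · simp [hx0, tauFun, Real.exp_pos]
  by_cases hy0 : y = 0
  · -- Compare with the limit `y → 0` at a point with larger absolute value of `x`.
    subst hy0
    rw [mem_ball_zero_iff] at hx
    set r : ℝ := (‖x‖ + r₁) / 2
    have hr0 : 0 < r := by have := norm_nonneg x; have := C.r₁_pos; simp only [r]; linarith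
    have hxr : ‖x‖ < r := by simp only [r]; linarith
    have hrr : r < r₁ := by simp only [r]; linarith
    have hr : (r : ℂ) ∈ Metric.ball (0 : ℂ) r₁ := by
      rw [mem_ball_zero_iff, Complex.norm_real, Real.norm_of_nonneg hr0.le]; exact hrr
    have hcont : ContinuousAt (fun y => ‖C.tauFun r y‖) 0 := by
      have h1 : ContinuousAt (fun y : ℂ => ((r : ℂ), y)) 0 := by fun_prop
      have h2 := (C.analyticAt_tauFun (z := ((r : ℂ), (0 : ℂ))) ⟨hr, hy⟩).continuousAt
      exact (ContinuousAt.comp (f := fun y : ℂ => ((r : ℂ), y)) h2 h1).norm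
    have hle : ‖C.tauFun r 0‖ ≤ Real.exp C.zetaBound := by
      have h1 : Filter.Tendsto (fun y => ‖C.tauFun r y‖) (𝓝[≠] (0 : ℂ)) (𝓝 ‖C.tauFun r 0‖) :=
        hcont.tendsto.mono_left nhdsWithin_le_nhds
      refine le_of_tendsto h1 ?_
      filter_upwards [self_mem_nhdsWithin,
        nhdsWithin_le_nhds (Metric.isOpen_ball.mem_nhds hy)] with y hy0 hy
      exact (key _ _ hr hy (by exact_mod_cast hr0.ne') hy0).le
    have hr' : ‖(r : ℂ)‖ = r := by rw [Complex.norm_real, Real.norm_of_nonneg hr0.le]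
    rw [tauFun, norm_mul, norm_mul] at hle ⊢
    rw [hr'] at hle
    by_cases h0 : ‖(0 : ℂ) ^ C.d‖ = 0
    · rw [h0]; simp [Real.exp_pos]
    · refine lt_of_lt_of_le ?_ hle
      have h1 : 0 < ‖(0 : ℂ) ^ C.d‖ := lt_of_le_of_ne (norm_nonneg _) (Ne.symm h0)
      have h2 : 0 < ‖Complex.exp (C.ε * C.ℓ 0)‖ := norm_pos_iff.2 (Complex.exp_ne_zero _)
      gcongr
  · exact key x y hx hy hx0 hy0

/-- Since `exp ζ` extends holomorphically to the polydisc, so do the coefficients of a function in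
`logForms`. -/
theorem logForm_comp_zeta_mem_regularForms {φ : ℂ → ℂ} (hφ : φ ∈ logForms C.zetaBound) :
    ∃ Ψ ∈ regularForms r₁ r₂, ∀ q ∈ coverDomain r₁ r₂, φ (C.zeta.val q) = Ψ q := by
  induction hφ using Submodule.span_induction with
  | mem φ h =>
    obtain ⟨s, k, f, hf, h⟩ := h
    have h1 : (fun q : ℂ × ℂ => f (C.tauFun (Complex.exp q.1) (Complex.exp q.2)))
        ∈ regularForms r₁ r₂ := by
      refine mem_regularForms ⟨0, 0, 0, 0, fun z => f (C.tauFun z.1 z.2), fun z hz => ?_,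
        fun q _ => by simp⟩
      exact AnalyticAt.comp (f := fun z : ℂ × ℂ => C.tauFun z.1 z.2)
        (hf _ (mem_ball_zero_iff.2 (C.norm_tauFun_lt hz.1 hz.2))) (C.analyticAt_tauFun hz)
    refine ⟨_, mul_mem (mul_mem (C.exp_zetaFun_mem_regularForms s)
      (pow_mem C.zetaFun_mem_regularForms k)) h1, fun q hq => ?_⟩
    rw [h _ (C.zeta_re_lt hq), C.exp_zeta hq, C.zeta_val hq]
    rfl
  | zero => exact ⟨0, zero_mem _, fun q _ => rfl⟩
  | add φ ψ _ _ h₁ h₂ =>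
    obtain ⟨Ψ₁, hΨ₁, h₁⟩ := h₁
    obtain ⟨Ψ₂, hΨ₂, h₂⟩ := h₂
    exact ⟨_, add_mem hΨ₁ hΨ₂, fun q hq => by simp [h₁ q hq, h₂ q hq]⟩
  | smul c φ _ h =>
    obtain ⟨Ψ, hΨ, h⟩ := h
    exact ⟨_, Subalgebra.smul_mem _ hΨ c, fun q hq => by simp [h q hq]⟩

/-- The solutions of an equation in `D` and an equation in `α E + β D`, with coefficients that are
holomorphic functions of `exp ζ`, have regular forms. -/
theorem hasRegularForm_of_mem_solutions {m n : ℕ} (hm : 0 < m) (hn : 0 < n) {α β : Holo r₁ r₂}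
    (hα : IsUnit α) (hEα : C.E α = 0) (hEβ : C.E β = 0) {γ : Fin m → ℂ → ℂ}
    (hγ : ∀ i, AnalyticOnNhd ℂ (γ i) (Metric.ball 0 1)) {c : Fin n → Holo r₁ r₂}
    (hEc : ∀ k, C.E (c k) = 0) {f : Holo r₁ r₂}
    (hf : f ∈ C.solutions (fun i => C.ofTau (γ i) (hγ i)) α β c) : HasRegularForm r₁ r₂ f.val := by
  have h := C.solution_mem_span hm hn hα (fun i => C.E_ofTau (hγ i)) hEα hEβ hEc hf
  have key : ∃ Ψ ∈ regularForms r₁ r₂, ∀ q ∈ coverDomain r₁ r₂, f.val q = Ψ q := by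
    clear hf
    induction h using Submodule.span_induction with
    | mem f h =>
      obtain ⟨μ, j, g, hg, hg', rfl⟩ := h
      obtain ⟨φ, hφ, h1⟩ := C.exists_logForm hm hγ hg hg'
      obtain ⟨Ψ, hΨ, h2⟩ := C.logForm_comp_zeta_mem_regularForms hφ
      refine ⟨_, mul_mem (C.exp_nuFun_mem_regularForms μ)
        (mul_mem (pow_mem C.nuFun_mem_regularForms j) hΨ), fun q hq => ?_⟩
      rw [Holo.val_mul hq, Holo.val_mul hq, Holo.val_pow hq, h1 q hq, h2 q hq, expNu,
        Holo.comp_val _ hq, C.nu_val hq]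
      rfl
    | zero => exact ⟨0, zero_mem _, fun q hq => by rw [Holo.val_zero hq]; rfl⟩
    | add f g _ _ h₁ h₂ =>
      obtain ⟨Ψ₁, hΨ₁, h₁⟩ := h₁
      obtain ⟨Ψ₂, hΨ₂, h₂⟩ := h₂
      exact ⟨_, add_mem hΨ₁ hΨ₂, fun q hq => by
        rw [Holo.val_add hq, h₁ q hq, h₂ q hq]; rfl⟩
    | smul c f _ h =>
      obtain ⟨Ψ, hΨ, h⟩ := h
      exact ⟨_, Subalgebra.smul_mem _ hΨ c, fun q hq => by
        rw [Holo.val_smul hq, h q hq]; rfl⟩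
  obtain ⟨Ψ, hΨ, h⟩ := key
  exact hasRegularForm_of_mem hΨ h

end AdaptedCoordinates

/-! ### Transport of differential equations to adapted coordinates -/

/-- The derivative in a constant direction of a function on `ℂ × ℂ`. -/
def dirDeriv (e : ℂ × ℂ) (ψ : ℂ × ℂ → ℂ) (z : ℂ × ℂ) : ℂ := fderiv ℂ ψ z e

theorem analyticAt_dirDeriv (e : ℂ × ℂ) {ψ : ℂ × ℂ → ℂ} {z : ℂ × ℂ} (h : AnalyticAt ℂ ψ z) :
    AnalyticAt ℂ (dirDeriv e ψ) z :=
  ((ContinuousLinearMap.apply ℂ ℂ e).analyticAt _).comp h.fderiv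

theorem analyticAt_iterate_dirDeriv (e : ℂ × ℂ) {ψ : ℂ × ℂ → ℂ} {z : ℂ × ℂ}
    (h : AnalyticAt ℂ ψ z) (j : ℕ) : AnalyticAt ℂ ((dirDeriv e)^[j] ψ) z := by
  induction j with
  | zero => exact h
  | succ j ih => rw [Function.iterate_succ_apply']; exact analyticAt_dirDeriv e ih

/-- The iterated derivatives along a line are iterated directional derivatives. -/
theorem iteratedDeriv_comp_line {e : ℂ × ℂ} {L : ℂ → ℂ × ℂ} (hL : ∀ s, HasDerivAt L e s) (j : ℕ) :
    ∀ {ψ : ℂ × ℂ → ℂ} {s : ℂ}, AnalyticAt ℂ ψ (L s) →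
      iteratedDeriv j (fun s => ψ (L s)) s = (dirDeriv e)^[j] ψ (L s) := by
  induction j with
  | zero => intro ψ s _; simp
  | succ j ih =>
    intro ψ s h
    have h1 : deriv (fun s => ψ (L s)) =ᶠ[𝓝 s] fun s => dirDeriv e ψ (L s) := by
      filter_upwards [(hL s).continuousAt.eventually h.eventually_analyticAt] with t ht
      exact (ht.differentiableAt.hasFDerivAt.comp_hasDerivAt t (hL t)).deriv
    rw [iteratedDeriv_succ', h1.iteratedDeriv_eq, ih (analyticAt_dirDeriv e h),
      Function.iterate_succ_apply]

namespace AdaptedCoordinates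

open Holo

variable {r₁ r₂ : ℝ} (C : AdaptedCoordinates r₁ r₂)

/-- The derivation `α E + β D`. -/
def field (α β : Holo r₁ r₂) : Derivation ℂ (Holo r₁ r₂) (Holo r₁ r₂) := α • C.E + β • D

theorem exists_vector (α β : Holo r₁ r₂) {q : ℂ × ℂ} (hq : q ∈ coverDomain r₁ r₂) :
    ∃ w : ℂ × ℂ, ∀ f : Holo r₁ r₂, (C.field α β f).val q = fderiv ℂ f.val q w := by
  refine ⟨α.val q • (C.nuInv.val q • ((0 : ℂ), (1 : ℂ)) - (C.ε : ℂ) • ((1 : ℂ), (0 : ℂ)))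
    + β.val q • ((1 : ℂ), (0 : ℂ)), fun f => ?_⟩
  have h : C.field α β f = α * (C.nuInv * pd (0, 1) f - (C.ε : ℂ) • pd (1, 0) f)
      + β * pd (1, 0) f := rfl
  rw [h, val_add hq, val_mul hq, val_sub hq, val_mul hq, val_smul hq, val_mul hq, pd_val _ _ hq,
    pd_val _ _ hq]
  simp only [map_add, map_sub, map_smul, smul_eq_mul]

/-- The chain rule for a function `χ (Z₁, Z₂)`. -/
theorem apply_val_eq {α β : Holo r₁ r₂} {q : ℂ × ℂ} (hq : q ∈ coverDomain r₁ r₂)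
    {f Z₁ Z₂ : Holo r₁ r₂} {χ : ℂ × ℂ → ℂ} (hχ : AnalyticAt ℂ χ (Z₁.val q, Z₂.val q))
    (hf : ∀ᶠ q' in 𝓝 q, f.val q' = χ (Z₁.val q', Z₂.val q')) :
    (C.field α β f).val q = fderiv ℂ χ (Z₁.val q, Z₂.val q)
      ((C.field α β Z₁).val q, (C.field α β Z₂).val q) := by
  obtain ⟨w, hw⟩ := C.exists_vector α β hq
  rw [hw, hw, hw]
  have h1 : HasFDerivAt (fun q' => (Z₁.val q', Z₂.val q'))
      ((fderiv ℂ Z₁.val q).prod (fderiv ℂ Z₂.val q)) q :=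
    (Z₁.analyticAt hq).differentiableAt.hasFDerivAt.prodMk
      (Z₂.analyticAt hq).differentiableAt.hasFDerivAt
  have h2 := HasFDerivAt.comp (f := fun q' => (Z₁.val q', Z₂.val q')) q
    hχ.differentiableAt.hasFDerivAt h1
  have h3 : f.val =ᶠ[𝓝 q] χ ∘ fun q' => (Z₁.val q', Z₂.val q') := hf
  rw [h3.fderiv_eq, h2.fderiv]
  rfl

theorem eventually_comp {Z₁ Z₂ : Holo r₁ r₂} {q : ℂ × ℂ} (hq : q ∈ coverDomain r₁ r₂)
    {p : ℂ × ℂ → Prop} (h : ∀ᶠ z in 𝓝 (Z₁.val q, Z₂.val q), p z) :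
    ∀ᶠ q' in 𝓝 q, p (Z₁.val q', Z₂.val q') := by
  have hc : ContinuousAt (fun q' => (Z₁.val q', Z₂.val q')) q :=
    (Z₁.analyticAt hq).continuousAt.prodMk (Z₂.analyticAt hq).continuousAt
  exact hc.eventually h

/-- If `X` is the pull-back of the vector field `l ∂ₑ` with `∂ₑ l = 1`, then `X (X - 1) ⋯` is the
pull-back of `l ^ j ∂ₑ ^ j`. -/
theorem fallingIter_val {α β Z₁ Z₂ : Holo r₁ r₂} {e : ℂ × ℂ} {l : ℂ × ℂ → ℂ}
    (hl : ∀ z, AnalyticAt ℂ l z) (hle : ∀ z, fderiv ℂ l z e = 1)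
    (hZ : ∀ q ∈ coverDomain r₁ r₂, ((C.field α β Z₁).val q, (C.field α β Z₂).val q)
      = l (Z₁.val q, Z₂.val q) • e) {f : Holo r₁ r₂} {ψ : ℂ × ℂ → ℂ} (j : ℕ) :
    ∀ q ∈ coverDomain r₁ r₂, AnalyticAt ℂ ψ (Z₁.val q, Z₂.val q) →
      (∀ᶠ q' in 𝓝 q, f.val q' = ψ (Z₁.val q', Z₂.val q')) →
      (fallingIter (C.field α β) j f).val q
        = l (Z₁.val q, Z₂.val q) ^ j * (dirDeriv e)^[j] ψ (Z₁.val q, Z₂.val q) := by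
  induction j with
  | zero => intro q hq _ h; simpa [fallingIter] using h.self_of_nhds
  | succ j ih =>
    intro q hq hψ hf
    set χ : ℂ × ℂ → ℂ := fun z => l z ^ j * (dirDeriv e)^[j] ψ z
    have han := analyticAt_iterate_dirDeriv e hψ j
    have hχ : AnalyticAt ℂ χ (Z₁.val q, Z₂.val q) := ((hl _).pow j).mul han
    have h1 : ∀ᶠ q' in 𝓝 q, (fallingIter (C.field α β) j f).val q'
        = χ (Z₁.val q', Z₂.val q') := by
      filter_upwards [eventually_mem hq, eventually_comp hq hψ.eventually_analyticAt,
        hf.eventually_nhds] with q' h₁ h₂ h₃ using ih q' h₁ h₂ h₃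
    rw [fallingIter, val_sub hq, val_smul hq, h1.self_of_nhds, C.apply_val_eq hq hχ h1, hZ q hq,
      map_smul]
    set z := (Z₁.val q, Z₂.val q)
    have hd : HasFDerivAt χ (l z ^ j • fderiv ℂ ((dirDeriv e)^[j] ψ) z
        + (dirDeriv e)^[j] ψ z • (j • l z ^ (j - 1)) • fderiv ℂ l z) z := by
      exact ((hl z).differentiableAt.hasFDerivAt.pow j).mul han.differentiableAt.hasFDerivAt
    rw [hd.fderiv, Function.iterate_succ_apply']
    simp only [add_apply, smul_apply, hle, smul_eq_mul,
      nsmul_eq_mul, χ]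
    have h3 : fderiv ℂ ((dirDeriv e)^[j] ψ) z e = dirDeriv e ((dirDeriv e)^[j] ψ) z := rfl
    rw [h3]
    rcases j with _ | j
    · simp
    · simp only [Nat.add_sub_cancel, pow_succ]
      ring

/-- An ordinary differential equation in the direction `e`, with coefficients that are functions of
`exp ζ` up to powers of `l`, becomes an equation in the pull-back of `l ∂ₑ`. -/
theorem fallingIter_equation {α β Z₁ Z₂ : Holo r₁ r₂} {e : ℂ × ℂ} {l : ℂ × ℂ → ℂ}
    (hl : ∀ z, AnalyticAt ℂ l z) (hle : ∀ z, fderiv ℂ l z e = 1)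
    (hZ : ∀ q ∈ coverDomain r₁ r₂, ((C.field α β Z₁).val q, (C.field α β Z₂).val q)
      = l (Z₁.val q, Z₂.val q) • e) {f : Holo r₁ r₂} {m : ℕ} {a : Fin m → ℂ × ℂ → ℂ}
    (hf : ∀ q ∈ coverDomain r₁ r₂, ∃ ψ : ℂ × ℂ → ℂ, AnalyticAt ℂ ψ (Z₁.val q, Z₂.val q) ∧
      (∀ᶠ q' in 𝓝 q, f.val q' = ψ (Z₁.val q', Z₂.val q')) ∧
      (dirDeriv e)^[m] ψ (Z₁.val q, Z₂.val q) + ∑ k, a k (Z₁.val q, Z₂.val q)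
        * (dirDeriv e)^[m - 1 - k] ψ (Z₁.val q, Z₂.val q) = 0) {γ : Fin m → ℂ → ℂ}
    (hγ : ∀ k, AnalyticOnNhd ℂ (γ k) (Metric.ball 0 1))
    (haγ : ∀ k, ∀ q ∈ coverDomain r₁ r₂, a k (Z₁.val q, Z₂.val q)
      * l (Z₁.val q, Z₂.val q) ^ ((k : ℕ) + 1) = γ k (C.tau.val q)) :
    fallingIter (C.field α β) m f
      + ∑ k, C.ofTau (γ k) (hγ k) * fallingIter (C.field α β) (m - 1 - k) f = 0 := by
  refine ext' fun q hq => ?_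
  obtain ⟨ψ, hψ, hfψ, heq⟩ := hf q hq
  have h1 := fun j => C.fallingIter_val hl hle hZ (f := f) j q hq hψ hfψ
  rw [val_add hq, val_sum hq, val_zero hq, h1]
  set z := (Z₁.val q, Z₂.val q)
  have h2 : ∀ k : Fin m, (C.ofTau (γ k) (hγ k)
      * fallingIter (C.field α β) (m - 1 - k) f).val q
      = l z ^ m * (a k z * (dirDeriv e)^[m - 1 - k] ψ z) := by
    intro k
    have hk : l z ^ m = l z ^ ((k : ℕ) + 1) * l z ^ (m - 1 - k) := by
      rw [← pow_add]; congr 1; have := k.2; omega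
    rw [val_mul hq, h1, C.ofTau_val (hγ k) hq, ← C.tau_val hq, ← haγ k q hq, hk]
    ring
  rw [Finset.sum_congr rfl fun k _ => h2 k, ← Finset.mul_sum, ← mul_add, heq, mul_zero]

/-- The coefficients of `X (X - 1) ⋯ (X - j + 1)` as a polynomial in `X = δ D`; Stirling numbers of
the first kind, up to powers of `δ`. -/
def fallingCoeff (δ : ℂ) : ℕ → ℕ → ℂ
  | 0, 0 => 1
  | 0, _ + 1 => 0
  | j + 1, 0 => -(j * fallingCoeff δ j 0)
  | j + 1, i + 1 => δ * fallingCoeff δ j i - j * fallingCoeff δ j (i + 1)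

theorem fallingCoeff_of_lt (δ : ℂ) (j : ℕ) : ∀ i, j < i → fallingCoeff δ j i = 0 := by
  induction j with
  | zero => rintro (_ | i) h <;> simp [fallingCoeff] at h ⊢
  | succ j ih =>
    rintro (_ | i) h
    · omega
    · rw [fallingCoeff, ih i (by omega), ih (i + 1) (by omega)]; simp

theorem fallingCoeff_self (δ : ℂ) (j : ℕ) : fallingCoeff δ j j = δ ^ j := by
  induction j with
  | zero => simp [fallingCoeff]
  | succ j ih => rw [fallingCoeff, ih, fallingCoeff_of_lt δ j (j + 1) (by omega), pow_succ]; ring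

theorem fallingIter_eq_sum {R : Type*} [CommRing R] [Algebra ℂ R] {X Y : Derivation ℂ R R} {δ : ℂ}
    (hX : ∀ f, X f = δ • Y f) (f : R) (j : ℕ) : ∀ M, j < M →
      fallingIter X j f = ∑ i ∈ Finset.range M, fallingCoeff δ j i • Y^[i] f := by
  induction j with
  | zero =>
    intro M hM
    obtain ⟨M, rfl⟩ : ∃ M', M = M' + 1 := ⟨M - 1, by omega⟩
    rw [Finset.sum_range_succ']
    simp [fallingCoeff, fallingIter]
  | succ j ih =>
    intro M hM
    obtain ⟨M, rfl⟩ : ∃ M', M = M' + 1 := ⟨M - 1, by omega⟩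
    have h1 : X (fallingIter X j f)
        = ∑ i ∈ Finset.range M, (δ * fallingCoeff δ j i) • Y^[i + 1] f := by
      rw [hX, ih M (by omega), map_sum, Finset.smul_sum]
      refine Finset.sum_congr rfl fun i _ => ?_
      rw [Derivation.map_smul, smul_smul, Function.iterate_succ_apply']
    rw [fallingIter, h1, ih (M + 1) (by omega), Finset.smul_sum, Finset.sum_range_succ' _ M,
      Finset.sum_range_succ' _ M, ← sub_sub, ← Finset.sum_sub_distrib]
    simp only [fallingCoeff, sub_smul, neg_smul, smul_smul, Finset.sum_sub_distrib]
    ring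

/-- A function with one equation in `δ D` and one equation in `α E + β D` has a regular form. -/
theorem hasRegularForm_of_fallingIter {m n : ℕ} (hm : 0 < m) (hn : 0 < n)
    {X : Derivation ℂ (Holo r₁ r₂) (Holo r₁ r₂)} {δ : ℂ} (hδ : δ ≠ 0)
    (hX : ∀ f, X f = δ • D f) {α β : Holo r₁ r₂} (hα : IsUnit α) (hEα : C.E α = 0)
    (hEβ : C.E β = 0) {γ : Fin m → ℂ → ℂ} (hγ : ∀ k, AnalyticOnNhd ℂ (γ k) (Metric.ball 0 1))
    {γ' : Fin n → ℂ → ℂ} (hγ' : ∀ k, AnalyticOnNhd ℂ (γ' k) (Metric.ball 0 1)) {f : Holo r₁ r₂}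
    (h₁ : fallingIter X m f + ∑ k, C.ofTau (γ k) (hγ k) * fallingIter X (m - 1 - k) f = 0)
    (h₂ : fallingIter (C.field α β) n f
      + ∑ k, C.ofTau (γ' k) (hγ' k) * fallingIter (C.field α β) (n - 1 - k) f = 0) :
    HasRegularForm r₁ r₂ f.val := by
  let p : Fin m → ℂ → ℂ := fun i t => -(δ ^ m)⁻¹ * (fallingCoeff δ m i
    + ∑ k : Fin m, γ k t * fallingCoeff δ (m - 1 - k) i)
  have hp : ∀ i, AnalyticOnNhd ℂ (p i) (Metric.ball 0 1) := fun i t ht =>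
    analyticAt_const.mul (analyticAt_const.add (Finset.analyticAt_fun_sum _ fun k _ =>
      (hγ k t ht).mul analyticAt_const))
  refine C.hasRegularForm_of_mem_solutions hm hn hα hEα hEβ hp
    (fun k => C.E_ofTau (hγ' k)) ⟨?_, h₂⟩
  rw [differentialOperator_apply, sub_eq_zero]
  refine ext' fun q hq => ?_
  have h3 := congrArg (fun g => g.val q) h₁
  simp only [val_add hq, val_sum hq, val_mul hq, val_zero hq] at h3
  have h4 : ∀ j M, j < M → (fallingIter X j f).val q
      = ∑ i ∈ Finset.range M, fallingCoeff δ j i * (D^[i] f).val q := by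
    intro j M hj
    rw [fallingIter_eq_sum hX f j M hj, val_sum hq]
    exact Finset.sum_congr rfl fun i _ => val_smul hq _ _
  rw [h4 m (m + 1) (by omega), Finset.sum_range_succ, fallingCoeff_self] at h3
  have h5 : ∀ k : Fin m, (C.ofTau (γ k) (hγ k)).val q * (fallingIter X (m - 1 - k) f).val q
      = ∑ i ∈ Finset.range m, (C.ofTau (γ k) (hγ k)).val q * (fallingCoeff δ (m - 1 - k) i
        * (D^[i] f).val q) := by
    intro k
    rw [h4 _ m (by omega), Finset.mul_sum]
  rw [Finset.sum_congr rfl fun k _ => h5 k, Finset.sum_comm] at h3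
  rw [val_sum hq, Finset.sum_congr rfl fun i _ => val_mul hq _ _]
  have h6 : ∀ i : Fin m, (C.ofTau (p i) (hp i)).val q * (D^[i] f).val q
      = -(δ ^ m)⁻¹ * (fallingCoeff δ m i * (D^[i] f).val q
        + ∑ k : Fin m, (C.ofTau (γ k) (hγ k)).val q * (fallingCoeff δ (m - 1 - k) i
          * (D^[i] f).val q)) := by
    intro i
    rw [C.ofTau_val (hp i) hq]
    simp only [p, C.ofTau_val (hγ _) hq, ← mul_assoc, ← Finset.sum_mul]
    ring
  rw [Finset.sum_congr rfl fun i _ => h6 i, ← Finset.mul_sum,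
    Fin.sum_univ_eq_sum_range (fun i => fallingCoeff δ m i * (D^[i] f).val q
        + ∑ k : Fin m, (C.ofTau (γ k) (hγ k)).val q * (fallingCoeff δ (m - 1 - k) i
          * (D^[i] f).val q)), Finset.sum_add_distrib]
  have hδm : δ ^ m ≠ 0 := pow_ne_zero _ hδ
  have h7 : (δ ^ m)⁻¹ * δ ^ m = 1 := inv_mul_cancel₀ hδm
  linear_combination (δ ^ m)⁻¹ * h3 - (D^[m] f).val q * h7

end AdaptedCoordinates

/-! ### Adapted coordinates near the singular loci -/

open Holo AdaptedCoordinates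

/-- The exponent of the leading term of the logarithm of `sphereChart c`. -/
def sphereExponent : OnePoint ℂ → ℤ
  | OnePoint.infty => -1
  | OnePoint.some c => by classical exact if c = 0 then 1 else 0

/-- A logarithm of `sphereChart c` on the cover of a punctured disc. -/
theorem exists_log_sphereChart (c : OnePoint ℂ) : ∃ (R : ℝ) (ℓ : ℂ → ℂ), 0 < R ∧
    AnalyticOnNhd ℂ ℓ (Metric.ball 0 R) ∧
    (∀ y ∈ Metric.ball (0 : ℂ) R, y ≠ 0 → sphereExponent c + y * deriv ℓ y ≠ 0) ∧
    ∀ t : ℂ, Complex.exp t ∈ Metric.ball (0 : ℂ) R →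
      Complex.exp (sphereExponent c * t + ℓ (Complex.exp t)) = sphereChart c (Complex.exp t) := by
  induction c using OnePoint.rec with
  | infty =>
    refine ⟨1, 0, one_pos, analyticOnNhd_const, fun y _ _ => ?_, fun t _ => ?_⟩
    · simp [sphereExponent, Pi.zero_def]
    · simp [sphereExponent, sphereChart, Complex.exp_neg]
  | coe c =>
    by_cases hc : c = 0
    · refine ⟨1, 0, one_pos, analyticOnNhd_const, fun y _ _ => ?_, fun t _ => ?_⟩
      · simp [sphereExponent, hc, Pi.zero_def]
      · simp [sphereExponent, sphereChart, hc]
    · have hslit : ∀ y ∈ Metric.ball (0 : ℂ) ‖c‖, 1 + y / c ∈ Complex.slitPlane := by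
        intro y hy
        rw [mem_ball_zero_iff] at hy
        refine Complex.mem_slitPlane_of_norm_lt_one ?_
        rwa [norm_div, div_lt_one (norm_pos_iff.2 hc)]
      have hd : ∀ y ∈ Metric.ball (0 : ℂ) ‖c‖,
          HasDerivAt (fun y => Complex.log c + Complex.log (1 + y / c)) ((1 / c) / (1 + y / c)) y := by
        intro y hy
        have h1 : HasDerivAt (fun y : ℂ => 1 + y / c) (1 / c) y :=
          ((hasDerivAt_id y).div_const c).const_add 1
        exact (h1.clog (hslit y hy)).const_add _
      refine ⟨‖c‖, fun y => Complex.log c + Complex.log (1 + y / c), norm_pos_iff.2 hc, ?_, ?_, ?_⟩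
      · exact DifferentiableOn.analyticOnNhd
          (fun y hy => (hd y hy).differentiableAt.differentiableWithinAt) Metric.isOpen_ball
      · intro y hy hy0
        rw [(hd y hy).deriv]
        have h0 := Complex.slitPlane_ne_zero (hslit y hy)
        simp [sphereExponent, hc, hy0, h0]
      · intro t ht
        have h0 := Complex.slitPlane_ne_zero (hslit _ ht)
        simp only [sphereExponent, hc, if_false, Int.cast_zero, zero_mul, zero_add, sphereChart]
        rw [Complex.exp_add, Complex.exp_log hc, Complex.exp_log h0]
        field_simp

/-- Adapted coordinates for which `exp ν` is the second coordinate of a singular locus. Small radii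
ensure that `exp ζ` takes values in the unit disc. -/
theorem exists_adaptedCoordinates (ε : ℤ) (c : OnePoint ℂ) (h : 0 ≤ ε * sphereExponent c) :
    ∃ ρ : ℝ, 0 < ρ ∧ ∀ r₁ r₂ : ℝ, 0 < r₁ → r₁ ≤ ρ → 0 < r₂ → r₂ ≤ ρ →
      ∃ C : AdaptedCoordinates r₁ r₂, C.ε = ε ∧ ∀ t : ℂ, t.re < Real.log r₂ →
        Complex.exp (C.nuFun t) = sphereChart c (Complex.exp t) := by
  obtain ⟨R, ℓ, hR, han, hder, hexp⟩ := exists_log_sphereChart c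
  have hcont : ContinuousAt (fun y => Complex.exp (ε * ℓ y)) 0 :=
    (continuousAt_const.mul (han 0 (Metric.mem_ball_self hR)).continuousAt).cexp
  set B : ℝ := ‖Complex.exp (ε * ℓ 0)‖ + 1 with hB
  have hB0 : 0 < B := by positivity
  have hev : ∀ᶠ y in 𝓝 (0 : ℂ), ‖Complex.exp (ε * ℓ y)‖ < B :=
    hcont.norm.eventually (gt_mem_nhds (lt_add_one _))
  obtain ⟨R', hR', hball⟩ := Metric.eventually_nhds_iff_ball.1 hev
  refine ⟨min (min R R') (min 1 B⁻¹), by positivity, fun r₁ r₂ h₁ h₁' h₂ h₂' => ?_⟩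
  have hr₂ : Metric.ball (0 : ℂ) r₂ ⊆ Metric.ball 0 R :=
    Metric.ball_subset_ball (h₂'.trans ((min_le_left _ _).trans (min_le_left _ _)))
  have hr₂' : Metric.ball (0 : ℂ) r₂ ⊆ Metric.ball 0 R' :=
    Metric.ball_subset_ball (h₂'.trans ((min_le_left _ _).trans (min_le_right _ _)))
  refine ⟨{
    ε := ε
    κ := sphereExponent c
    d := (ε * sphereExponent c).toNat
    d_eq := (Int.toNat_of_nonneg h).symm
    ℓ := ℓ
    analytic := han.mono hr₂
    deriv_ne_zero := fun y hy => hder y (hr₂ hy)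
    r₁_pos := h₁
    r₂_pos := h₂
    norm_lt_one := fun x hx y hy => ?_ }, rfl, fun t ht => ?_⟩
  · have hy1 : ‖y‖ ≤ 1 := by
      rw [mem_ball_zero_iff] at hy
      exact hy.le.trans (h₂'.trans ((min_le_right _ _).trans (min_le_left _ _)))
    have hx1 : ‖x‖ < B⁻¹ := by
      rw [mem_ball_zero_iff] at hx
      exact hx.trans_le (h₁'.trans ((min_le_right _ _).trans (min_le_right _ _)))
    have hb := hball y (hr₂' hy)
    rw [norm_mul, norm_mul, norm_pow]
    calc _ ≤ ‖x‖ * 1 * B := by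
          gcongr
          exact pow_le_one₀ (norm_nonneg _) hy1
      _ < B⁻¹ * 1 * B := by gcongr
      _ = 1 := by field_simp
  · exact hexp t (hr₂ ((exp_mem_ball h₂).2 ht))

namespace SingularLocus

/-- The scale-invariant coordinate `σ.τ` is `x` times this power of the second coordinate. -/
def weight : SingularLocus → ℤ
  | .z₁Zero | .z₂Zero | .diagonal => -1
  | .z₁Infty | .z₂Infty => 1
  | .diagonalOverZ₁ | .diagonalOverZ₂ => 0

/-- Near an isolated point `σ.τ` involves no negative power of the local coordinate `y`, so it extends
holomorphically to the polydisc. -/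
theorem weight_mul_nonneg (σ : SingularLocus) (c : OnePoint ℂ) (h : IsIsolated (σ.chart c)) :
    0 ≤ σ.weight * sphereExponent c := by
  obtain ⟨ρ, hρ, h⟩ := h
  have h0 : ((ρ / 2 : ℝ) : ℂ) ≠ 0 := by exact_mod_cast (half_pos hρ).ne'
  have hn : ‖((ρ / 2 : ℝ) : ℂ)‖ < ρ := by
    rw [Complex.norm_real, Real.norm_of_nonneg (half_pos hρ).le]; exact half_lt_self hρ
  -- In the excluded cases the locus meets another one in the point, along `x = y` or `x = -y`.
  have h1 := h _ _ h0 hn h0 hn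
  have h2 := h (-((ρ / 2 : ℝ) : ℂ)) _ (neg_ne_zero.2 h0) (by rwa [norm_neg]) h0 hn
  induction c using OnePoint.rec with
  | infty => cases σ <;> simp_all [weight, sphereExponent, chart, coordinates, sphereChart]
  | coe c =>
    by_cases hc : c = 0
    · cases σ <;> simp_all [weight, sphereExponent, chart, coordinates, sphereChart]
    · simp [sphereExponent, hc]

/-- The coordinates `(z₁, z₂)` in terms of the second coordinate `n` of the locus and `t = σ.τ`. -/
def point : SingularLocus → ℂ → ℂ → ℂ × ℂ
  | .z₁Zero, n, t => (n * t, n)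
  | .z₂Zero, n, t => (n, n * t)
  | .z₁Infty, n, t => (n * t⁻¹, n)
  | .z₂Infty, n, t => (n, n * t⁻¹)
  | .diagonal, n, t | .diagonalOverZ₂, n, t => (n * (1 + t), n)
  | .diagonalOverZ₁, n, t => (n, n * (1 - t))

theorem coordinates_eq_point (σ : SingularLocus) {x n : ℂ} (hn : n ≠ 0) :
    σ.coordinates x n = σ.point n (x * n ^ σ.weight) := by
  cases σ <;> simp [coordinates, point, weight, hn, mul_add, mul_sub] <;> field_simp

theorem isGood_point (σ : SingularLocus) {n t : ℂ} (hn : n ≠ 0) (ht : t ≠ 0) (ht' : ‖t‖ < 1) :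
    IsGood (σ.point n t) := by
  have h1 : t ≠ 1 := by rintro rfl; simp at ht'
  have h2 : 1 + t ≠ 0 := by
    intro h
    rw [eq_neg_of_add_eq_zero_right h] at ht'
    simp at ht'
  have h3 : 1 - t ≠ 0 := sub_ne_zero.2 h1.symm
  have h4 : (1 : ℂ) ≠ 1 - t := fun h => ht (by linear_combination h)
  cases σ <;> simp [IsGood, point, hn, ht, h1, h2, h3, eq_comm]
  exact h4

theorem τ_point (σ : SingularLocus) {n t : ℂ} (hn : n ≠ 0) : σ.τ (σ.point n t) = t := by
  cases σ <;> simp [τ, point] <;> field_simp <;> ring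

/-- A multiple of `σ.speed₂` by a sign, with derivative `1` in the direction of `z₂`. -/
def signedSpeed₂ : SingularLocus → ℂ × ℂ → ℂ
  | .z₁Zero, z | .z₂Zero, z | .z₁Infty, z | .z₂Infty, z => z.2
  | .diagonal, z | .diagonalOverZ₁, z | .diagonalOverZ₂, z => z.2 - z.1

/-- The sign in `signedSpeed₂`. -/
def sign : SingularLocus → ℂ
  | .z₁Zero | .z₂Zero | .z₁Infty | .z₂Infty => 1
  | .diagonal | .diagonalOverZ₁ | .diagonalOverZ₂ => -1

theorem signedSpeed₂_eq (σ : SingularLocus) (z : ℂ × ℂ) :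
    σ.signedSpeed₂ z = σ.sign * σ.speed₂ z := by
  cases σ <;> simp [signedSpeed₂, sign, speed₂]

theorem analyticAt_speed₁ (σ : SingularLocus) (z : ℂ × ℂ) : AnalyticAt ℂ σ.speed₁ z := by
  cases σ <;>
    first
    | exact analyticAt_fst
    | exact analyticAt_fst.sub analyticAt_snd

theorem analyticAt_signedSpeed₂ (σ : SingularLocus) (z : ℂ × ℂ) :
    AnalyticAt ℂ σ.signedSpeed₂ z := by
  cases σ <;>
    first
    | exact analyticAt_snd
    | exact analyticAt_snd.sub analyticAt_fst

theorem fderiv_speed₁ (σ : SingularLocus) (z : ℂ × ℂ) : fderiv ℂ σ.speed₁ z (1, 0) = 1 := by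
  have h1 : HasFDerivAt (Prod.fst : ℂ × ℂ → ℂ) (ContinuousLinearMap.fst ℂ ℂ ℂ) z := hasFDerivAt_fst
  have h2 : HasFDerivAt (fun z : ℂ × ℂ => z.1 - z.2)
      (ContinuousLinearMap.fst ℂ ℂ ℂ - ContinuousLinearMap.snd ℂ ℂ ℂ) z :=
    hasFDerivAt_fst.sub hasFDerivAt_snd
  cases σ <;>
    first
    | exact congrArg (fun L : ℂ × ℂ →L[ℂ] ℂ => L (1, 0)) h1.fderiv
    | exact (congrArg (fun L : ℂ × ℂ →L[ℂ] ℂ => L (1, 0)) h2.fderiv).trans (by simp)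

theorem fderiv_signedSpeed₂ (σ : SingularLocus) (z : ℂ × ℂ) :
    fderiv ℂ σ.signedSpeed₂ z (0, 1) = 1 := by
  have h1 : HasFDerivAt (Prod.snd : ℂ × ℂ → ℂ) (ContinuousLinearMap.snd ℂ ℂ ℂ) z := hasFDerivAt_snd
  have h2 : HasFDerivAt (fun z : ℂ × ℂ => z.2 - z.1)
      (ContinuousLinearMap.snd ℂ ℂ ℂ - ContinuousLinearMap.fst ℂ ℂ ℂ) z :=
    hasFDerivAt_snd.sub hasFDerivAt_fst
  cases σ <;>
    first
    | exact congrArg (fun L : ℂ × ℂ →L[ℂ] ℂ => L (0, 1)) h1.fderiv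
    | exact (congrArg (fun L : ℂ × ℂ →L[ℂ] ℂ => L (0, 1)) h2.fderiv).trans (by simp)

end SingularLocus

namespace AdaptedCoordinates

variable {r₁ r₂ : ℝ} (C : AdaptedCoordinates r₁ r₂)

/-- The function `exp (-ζ)`. -/
def tauInv : Holo r₁ r₂ := comp (fun t => Complex.exp (-t)) C.zeta fun _ _ => by fun_prop

theorem tauInv_val {q : ℂ × ℂ} (hq : q ∈ coverDomain r₁ r₂) :
    C.tauInv.val q = (C.tau.val q)⁻¹ := by
  rw [tauInv, comp_val _ hq, C.tau_val hq, Complex.exp_neg]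

theorem D_tauInv : D C.tauInv = -C.tauInv := by
  rw [tauInv, D_comp, D_zeta, mul_one]
  refine ext' fun q hq => ?_
  rw [← neg_one_smul ℂ, val_smul hq, comp_val _ hq, comp_val _ hq]
  have := ((hasDerivAt_id (C.zeta.val q)).neg).cexp.deriv
  simp only [id, Pi.neg_apply] at this
  rw [this, mul_comm]

theorem E_tauInv : C.E C.tauInv = 0 := by rw [tauInv, E_comp, E_zeta, mul_zero]

theorem expNu_val (μ : ℂ) {q : ℂ × ℂ} (hq : q ∈ coverDomain r₁ r₂) :
    (C.expNu μ).val q = Complex.exp (μ * C.nuFun q.2) := by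
  rw [expNu, comp_val _ hq, C.nu_val hq]

/-- The coordinates `(z₁, z₂)` as functions on the cover. -/
def point : SingularLocus → Holo r₁ r₂ × Holo r₁ r₂
  | .z₁Zero => (C.expNu 1 * C.tau, C.expNu 1)
  | .z₂Zero => (C.expNu 1, C.expNu 1 * C.tau)
  | .z₁Infty => (C.expNu 1 * C.tauInv, C.expNu 1)
  | .z₂Infty => (C.expNu 1, C.expNu 1 * C.tauInv)
  | .diagonal | .diagonalOverZ₂ => (C.expNu 1 * (1 + C.tau), C.expNu 1)
  | .diagonalOverZ₁ => (C.expNu 1, C.expNu 1 * (1 - C.tau))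

theorem point_val (σ : SingularLocus) {q : ℂ × ℂ} (hq : q ∈ coverDomain r₁ r₂) :
    ((C.point σ).1.val q, (C.point σ).2.val q)
      = σ.point (Complex.exp (C.nuFun q.2)) (C.tau.val q) := by
  cases σ <;> simp [point, SingularLocus.point, val_mul hq, val_add hq, val_sub hq, val_one hq,
    C.expNu_val 1 hq, C.tauInv_val hq]

/-- The coefficients with respect to `E` and `D` of the pull-back of `σ.speed₁ ∂₁`. -/
def coeff₁ : SingularLocus → Holo r₁ r₂ × Holo r₁ r₂
  | .z₁Zero | .diagonal | .diagonalOverZ₂ => (0, 1)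
  | .z₂Zero => (1, -1)
  | .z₁Infty => (0, -1)
  | .z₂Infty => (1, 1)
  | .diagonalOverZ₁ => (C.tau, 1 - C.tau)

/-- The coefficients with respect to `E` and `D` of the pull-back of `σ.signedSpeed₂ ∂₂`. -/
def coeff₂ : SingularLocus → Holo r₁ r₂ × Holo r₁ r₂
  | .z₂Zero | .diagonalOverZ₁ => (0, 1)
  | .z₁Zero => (1, -1)
  | .z₂Infty => (0, -1)
  | .z₁Infty => (1, 1)
  | .diagonal | .diagonalOverZ₂ => (-C.tau, 1 + C.tau)

/-- The derivation which is the pull-back of `σ.speed₁ ∂₁`. -/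
def field₁ (σ : SingularLocus) : Derivation ℂ (Holo r₁ r₂) (Holo r₁ r₂) :=
  C.field (C.coeff₁ σ).1 (C.coeff₁ σ).2

/-- The derivation which is the pull-back of `σ.signedSpeed₂ ∂₂`. -/
def field₂ (σ : SingularLocus) : Derivation ℂ (Holo r₁ r₂) (Holo r₁ r₂) :=
  C.field (C.coeff₂ σ).1 (C.coeff₂ σ).2

theorem field_apply (α β f : Holo r₁ r₂) : C.field α β f = α * C.E f + β * D f := rfl

theorem field₁_point (σ : SingularLocus) {q : ℂ × ℂ} (hq : q ∈ coverDomain r₁ r₂) :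
    ((C.field₁ σ (C.point σ).1).val q, (C.field₁ σ (C.point σ).2).val q)
      = σ.speed₁ ((C.point σ).1.val q, (C.point σ).2.val q) • ((1 : ℂ), (0 : ℂ)) := by
  have h1 : C.field₁ σ (C.point σ).2 = 0 := by
    cases σ <;> simp [field₁, field_apply, coeff₁, point, D_expNu, E_expNu, D_tau, E_tau,
      D_tauInv, E_tauInv] <;> ring
  have h2 : (C.field₁ σ (C.point σ).1).val q
      = σ.speed₁ ((C.point σ).1.val q, (C.point σ).2.val q) := by
    cases σ <;> simp [field₁, field_apply, coeff₁, point, D_expNu, E_expNu, D_tau, E_tau,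
      D_tauInv, E_tauInv, SingularLocus.speed₁, val_mul hq, val_add hq, val_sub hq, val_one hq] <;>
      ring
  rw [h1, h2, val_zero hq]
  simp

theorem field₂_point (σ : SingularLocus) {q : ℂ × ℂ} (hq : q ∈ coverDomain r₁ r₂) :
    ((C.field₂ σ (C.point σ).1).val q, (C.field₂ σ (C.point σ).2).val q)
      = σ.signedSpeed₂ ((C.point σ).1.val q, (C.point σ).2.val q) • ((0 : ℂ), (1 : ℂ)) := by
  have h1 : C.field₂ σ (C.point σ).1 = 0 := by
    cases σ <;> simp [field₂, field_apply, coeff₂, point, D_expNu, E_expNu, D_tau, E_tau,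
      D_tauInv, E_tauInv] <;> ring
  have h2 : (C.field₂ σ (C.point σ).2).val q
      = σ.signedSpeed₂ ((C.point σ).1.val q, (C.point σ).2.val q) := by
    cases σ <;> simp [field₂, field_apply, coeff₂, point, D_expNu, E_expNu, D_tau, E_tau,
      D_tauInv, E_tauInv, SingularLocus.signedSpeed₂, val_mul hq, val_add hq, val_sub hq,
      val_one hq, val_neg hq] <;> ring
  rw [h1, h2, val_zero hq]
  simp

theorem isUnit_tau : IsUnit C.tau := isUnit_of_ne_zero fun _ hq => C.tau_ne_zero hq

theorem E_coeff (σ : SingularLocus) : C.E (C.coeff₁ σ).1 = 0 ∧ C.E (C.coeff₁ σ).2 = 0 ∧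
    C.E (C.coeff₂ σ).1 = 0 ∧ C.E (C.coeff₂ σ).2 = 0 := by
  cases σ <;> simp [coeff₁, coeff₂, E_tau]

/-- One of the two equations is an equation in `D` up to sign, the other one involves `E` with an
invertible coefficient. -/
theorem exists_eq_smul_D (σ : SingularLocus) :
    (IsUnit (C.coeff₂ σ).1 ∧ ∃ δ : ℂ, δ ≠ 0 ∧ ∀ f, C.field₁ σ f = δ • D f) ∨
      (IsUnit (C.coeff₁ σ).1 ∧ ∃ δ : ℂ, δ ≠ 0 ∧ ∀ f, C.field₂ σ f = δ • D f) := by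
  have h := C.isUnit_tau
  cases σ
  · exact Or.inl ⟨isUnit_one, 1, one_ne_zero, fun f => by simp [field₁, field_apply, coeff₁]⟩
  · exact Or.inr ⟨isUnit_one, 1, one_ne_zero, fun f => by simp [field₂, field_apply, coeff₂]⟩
  · exact Or.inl ⟨isUnit_one, -1, by simp, fun f => by simp [field₁, field_apply, coeff₁]⟩
  · exact Or.inr ⟨isUnit_one, -1, by simp, fun f => by simp [field₂, field_apply, coeff₂]⟩
  · exact Or.inl ⟨h.neg, 1, one_ne_zero, fun f => by simp [field₁, field_apply, coeff₁]⟩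
  · exact Or.inr ⟨h, 1, one_ne_zero, fun f => by simp [field₂, field_apply, coeff₂]⟩
  · exact Or.inl ⟨h.neg, 1, one_ne_zero, fun f => by simp [field₁, field_apply, coeff₁]⟩

end AdaptedCoordinates

/-- A system whose coefficients are holomorphic along the locus in the sense of
`DiffSystem.IsFuchsianAlong` has a regular singularity there. -/
theorem DiffSystem.IsFuchsianAlong.isRegularAlong {S : DiffSystem} {σ : SingularLocus}
    (h : S.IsFuchsianAlong σ) : S.IsRegularAlong σ := by
  intro c hc
  obtain ⟨ρ, hρ, hC⟩ := exists_adaptedCoordinates σ.weight c (σ.weight_mul_nonneg c hc)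
  refine ⟨ρ, hρ, fun r₁ r₂ h₁ h₁' h₂ h₂' Φ hΦ => ?_⟩
  obtain ⟨C, hε, hexp⟩ := hC r₁ r₂ h₁ h₁' h₂ h₂'
  set Z₁ := (C.point σ).1 with hZ₁
  set Z₂ := (C.point σ).2 with hZ₂
  have hchart : ∀ q ∈ coverDomain r₁ r₂, σ.chart c (Complex.exp q.1, Complex.exp q.2)
      = (Z₁.val q, Z₂.val q) := by
    intro q hq
    rw [C.point_val σ hq, SingularLocus.chart, ← hexp q.2 hq.2,
      σ.coordinates_eq_point (Complex.exp_ne_zero _)]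
    congr 1
    rw [C.tau_val hq, C.zeta_val hq, Complex.exp_add, ← Complex.exp_int_mul, hε]
  have hgood : ∀ q ∈ coverDomain r₁ r₂, IsGood (Z₁.val q, Z₂.val q) ∧
      σ.τ (Z₁.val q, Z₂.val q) = C.tau.val q := by
    intro q hq
    rw [C.point_val σ hq]
    exact ⟨σ.isGood_point (Complex.exp_ne_zero _) (C.tau_ne_zero hq)
      (mem_ball_zero_iff.1 (C.tau_mem hq)), σ.τ_point (Complex.exp_ne_zero _)⟩
  have hΦ' : ∀ q ∈ coverDomain r₁ r₂, ∃ ψ : ℂ × ℂ → ℂ, AnalyticAt ℂ ψ (Z₁.val q, Z₂.val q) ∧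
      (∀ᶠ q' in 𝓝 q, Φ q' = ψ (Z₁.val q', Z₂.val q')) ∧ S.HoldsAt ψ (Z₁.val q, Z₂.val q) := by
    intro q hq
    obtain ⟨ψ, h1, h2, h3⟩ := hΦ q hq
    rw [hchart q hq] at h1 h3
    refine ⟨ψ, h1, ?_, h3.self_of_nhds⟩
    filter_upwards [h2, eventually_mem hq] with q' h4 h5
    rw [h4, hchart q' h5]
  have han : AnalyticOnNhd ℂ Φ (coverDomain r₁ r₂) := by
    intro q hq
    obtain ⟨ψ, h1, h2, -⟩ := hΦ' q hq
    have h3 : AnalyticAt ℂ (fun q' => (Z₁.val q', Z₂.val q')) q :=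
      (Z₁.analyticAt hq).prod (Z₂.analyticAt hq)
    exact (AnalyticAt.comp (f := fun q' => (Z₁.val q', Z₂.val q')) h1 h3).congr
      (h2.mono fun _ h => h.symm)
  set f : Holo r₁ r₂ := restrict Φ han with hf
  have hfΦ : ∀ q ∈ coverDomain r₁ r₂, f.val q = Φ q := fun q hq => restrict_val han hq
  have hfψ : ∀ q ∈ coverDomain r₁ r₂, ∀ ψ : ℂ × ℂ → ℂ,
      (∀ᶠ q' in 𝓝 q, Φ q' = ψ (Z₁.val q', Z₂.val q')) →
      ∀ᶠ q' in 𝓝 q, f.val q' = ψ (Z₁.val q', Z₂.val q') := by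
    intro q hq ψ h1
    filter_upwards [h1, eventually_mem hq] with q' h4 h5
    rw [hfΦ q' h5, h4]
  have hline₁ : ∀ z : ℂ × ℂ, ∀ s, HasDerivAt (fun s => (s, z.2)) ((1 : ℂ), (0 : ℂ)) s :=
    fun z s => (hasDerivAt_id s).prodMk (hasDerivAt_const s z.2)
  have hline₂ : ∀ z : ℂ × ℂ, ∀ s, HasDerivAt (fun s => (z.1, s)) ((0 : ℂ), (1 : ℂ)) s :=
    fun z s => (hasDerivAt_const s z.1).prodMk (hasDerivAt_id s)
  choose γ₁ hγ₁ haγ₁ using h.1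
  choose γ₂ hγ₂ haγ₂ using h.2
  have hγ₂' : ∀ k : Fin S.n, AnalyticOnNhd ℂ (fun t => σ.sign ^ ((k : ℕ) + 1) * γ₂ k t)
      (Metric.ball 0 1) := fun k => analyticOnNhd_const.mul (hγ₂ k)
  have heq₁ := C.fallingIter_equation (f := f) σ.analyticAt_speed₁ σ.fderiv_speed₁
    (fun q hq => C.field₁_point σ hq) (a := fun k => (S.a k).eval)
    (fun q hq => by
      obtain ⟨ψ, h1, h2, h3⟩ := hΦ' q hq
      refine ⟨ψ, h1, hfψ q hq ψ h2, ?_⟩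
      have h4 := fun j => iteratedDeriv_comp_line (hline₁ (Z₁.val q, Z₂.val q)) j (s := Z₁.val q) h1
      have h5 := h3.1
      simp only at h4
      simpa only [h4] using h5)
    hγ₁ (fun k q hq => by
      rw [haγ₁ k _ (hgood q hq).1 (by
        rw [(hgood q hq).2]; exact mem_ball_zero_iff.1 (C.tau_mem hq)), (hgood q hq).2])
  have heq₂ := C.fallingIter_equation (f := f) σ.analyticAt_signedSpeed₂ σ.fderiv_signedSpeed₂
    (fun q hq => C.field₂_point σ hq) (a := fun k => (S.b k).eval)
    (fun q hq => by
      obtain ⟨ψ, h1, h2, h3⟩ := hΦ' q hq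
      refine ⟨ψ, h1, hfψ q hq ψ h2, ?_⟩
      have h4 := fun j => iteratedDeriv_comp_line (hline₂ (Z₁.val q, Z₂.val q)) j (s := Z₂.val q) h1
      have h5 := h3.2
      simp only at h4
      simpa only [h4] using h5)
    hγ₂' (fun k q hq => by
      have := haγ₂ k _ (hgood q hq).1 (by
        rw [(hgood q hq).2]; exact mem_ball_zero_iff.1 (C.tau_mem hq))
      rw [(hgood q hq).2] at this
      rw [σ.signedSpeed₂_eq, mul_pow, ← this]
      ring)
  obtain ⟨hE₁, hE₂, hE₃, hE₄⟩ := C.E_coeff σ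
  have hreg : HasRegularForm r₁ r₂ f.val := by
    rcases C.exists_eq_smul_D σ with ⟨hu, δ, hδ, hX⟩ | ⟨hu, δ, hδ, hX⟩
    · exact C.hasRegularForm_of_fallingIter S.m_pos S.n_pos hδ hX hu hE₃ hE₄ hγ₁ hγ₂' heq₁ heq₂
    · exact C.hasRegularForm_of_fallingIter S.n_pos S.m_pos hδ hX hu hE₁ hE₂ hγ₂' hγ₁ heq₂ heq₁
  obtain ⟨r, M, s, t, g, hg, hfg⟩ := hreg
  exact ⟨r, M, s, t, g, hg, fun q hq => by rw [← hfΦ q hq, hfg q hq]⟩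

end SGVA

end

theorem theorem6p4 {B : Type*} [AddCommGroup B] (A : AddSubgroup B) (A₀ : AddSubgroup A)
    {V : Type v} [AddCommGroup V] [Module ℂ V] (𝒱 : SGVA.StronglyGradedCVA A V)
    (V₀ : Submodule ℂ V) (hV₀ : SGVA.IsStronglyGradedSubalgebra 𝒱 A₀ V₀)
    {W₀ W₁ W₂ W₃ W₄ : Type u} [AddCommGroup W₀] [Module ℂ W₀] [AddCommGroup W₁] [Module ℂ W₁]
    [AddCommGroup W₂] [Module ℂ W₂] [AddCommGroup W₃] [Module ℂ W₃] [AddCommGroup W₄] [Module ℂ W₄]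
    (M₀ : SGVA.StronglyGradedModule 𝒱 W₀) (M₁ : SGVA.StronglyGradedModule 𝒱 W₁)
    (M₂ : SGVA.StronglyGradedModule 𝒱 W₂) (M₃ : SGVA.StronglyGradedModule 𝒱 W₃)
    (M₄ : SGVA.StronglyGradedModule 𝒱 W₄)
    (hM₀ : M₀.IsRealGraded ∧ M₀.IsLowerBounded ∧ M₀.IsC₁Cofinite V₀)
    (hM₁ : M₁.IsRealGraded ∧ M₁.IsLowerBounded ∧ M₁.IsC₁Cofinite V₀)
    (hM₂ : M₂.IsRealGraded ∧ M₂.IsLowerBounded ∧ M₂.IsC₁Cofinite V₀)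
    (hM₃ : M₃.IsRealGraded ∧ M₃.IsLowerBounded ∧ M₃.IsC₁Cofinite V₀)
    (hfusion₁ : ∀ γ₁ γ₂ : B, {α : A₀ × A₀ | SGVA.contragredientFusionRule M₁ M₄ M₀
      (γ₁ + ((α.1 : A) : B)) (γ₂ + ((α.2 : A) : B)) ≠ 0}.Finite)
    (hfusion₂ : ∀ γ₁ γ₂ : B, {α : A₀ × A₀ | SGVA.fusionRule M₂ M₃ M₄
      (γ₁ + ((α.1 : A) : B)) (γ₂ + ((α.2 : A) : B)) ≠ 0}.Finite)
    (I₁ : ℂ → ℕ → W₁ →ₗ[ℂ] W₄ →ₗ[ℂ] Module.Dual ℂ W₀)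
    (hI₁ : SGVA.IsIntertwiningOfContragredientType M₁ M₄ M₀ I₁)
    (I₂ : ℂ → ℕ → W₂ →ₗ[ℂ] W₃ →ₗ[ℂ] W₄)
    (hI₂ : SGVA.IsIntertwiningOfType M₂ M₃ M₄ I₂)
    (β₀ β₁ β₂ β₃ : B) (w₀ : W₀) (hw₀ : w₀ ∈ M₀.gr β₀) (w₁ : W₁) (hw₁ : w₁ ∈ M₁.gr β₁)
    (w₂ : W₂) (hw₂ : w₂ ∈ M₂.gr β₂) (w₃ : W₃) (hw₃ : w₃ ∈ M₃.gr β₃)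
    (σ : SGVA.SingularLocus) :
    ∃ S : SGVA.DiffSystem,
      S.IsFormalSolution (SGVA.productSeries I₁ I₂ w₀ w₁ w₂ w₃) ∧ S.IsRegularAlong σ := by
  obtain ⟨S, hS, hσ⟩ := SGVA.exists_fuchsian_system hI₁ hI₂ hV₀ hM₀.2 hM₁.2 hM₂.2 hM₃.2
    hfusion₁ hfusion₂ hw₀ hw₁ hw₂ hw₃ σ
  exact ⟨S, hS, hσ.isRegularAlong⟩
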